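/- **Setting.** Let $A,S$ be real-valued on $\mathbb R$ and extend holomorphically to a simply connected open neighbourhood $\Omega$ of $\mathbb R$. Assume that $A,S,S',A',S''$ are integrable on $\mathbb R$ and that $A',S''$ are bounded on $\mathbb R$. For $\epsilon>0$ put $\omega(x,\epsilon)=-iA(x)e^{iS(x)/\epsilon}$ and $$\mathfrak D_\epsilon=\begin{bmatrix}-\frac{\epsilon}{i}\frac{d}{dx}&\omega\\-\omega^*&\frac{\epsilon}{i}\frac{d}{dx}\end{bmatrix}.$$ An eigenvalue is a $\lambda\in\mathbb C$ for which $\mathfrak D_\epsilon\mathbf u=\lambda\mathbf u$ has a nonzero solution $\mathbf u\in L^2(\mathbb R;\mathbb C^2)$. Let $g_\pm(x,\lambda)=\mp[\lambda+\frac12S'(x)\pm iA(x)]$ and $V_0=g_+g_-=-(\lambda+\frac12S')^2-A^2$. The zeros of $V_0(\cdot,\lambda)$ are the turning points. Stokes lines are level curves of $\mathrm{Re}\int i\sqrt{-V_0}\,dx$. A path is progressive if this real part is strictly monotone along it. **Geometry at $\lambda_0$.** Let $\lambda_0\in\mathbb C\setminus\mathbb R$, and let $\alpha,\beta,\gamma$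 be continuous functions of $\lambda$ near $\lambda_0$ whose values are turning points, simple at $\lambda_0$. Write $\alpha_0=\alpha(\lambda_0)$, and similarly $\beta_0,\gamma_0$. Let $C=C^-\cup C^0\cup C^+$ be a simple contour in $\Omega$ that coincides with $\mathbb R$ near $\pm\infty$. Here $C^-$ joins $-\infty$ to $\alpha_0$ and $C^+$ joins $\beta_0$ to $+\infty$, both progressive, and $C^0$ consists of two Stokes lines, one from $\alpha_0$ to $\gamma_0$ and one from $\beta_0$ to $\gamma_0$. Let $\omega_C\subset\Omega$ be an open neighbourhood of $C$ containing, for $\lambda$ near $\lambda_0$, no turning points other than $\alpha,\beta,\gamma$. For $\lambda$ near $\lambda_0$, cut $\omega_C$ along one Stokes arc from each of $\alpha(\lambda),\beta(\lambda),\gamma(\lambda)$. These arcs depend continuously on $\lambda$, and at $\lambda_0$ they meet $C$ only at $\alpha_0,\beta_0,\gamma_0$ respectively. On the cut domain take a branch of $\sqrt{-V_0}$ with a single-valued primitive of $i\sqrt{-V_0}$ that is jointly continuous in $(x,\lambda)$ and has limits at the three turning points. For a turning point $\tau$ put $z(x,\lambda,\tau)=i\int_\tau^x\sqrt{-V_0(t,\lambda)}\,dt$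 in the cut domain. Let $H=(g_- /g_+)^{1/4}$ be a holomorphic branch with $H^2=i\sqrt{-V_0}/g_+$. At $\lambda_0$ the level set $\{\mathrm{Re}\,z(\cdot,\lambda_0,\gamma_0)=0\}$ divides the cut domain into regions (connected components of its complement). Assume the following, where $z$ stands for $z(\cdot,\lambda_0,\gamma_0)$. * $\mathrm{Re}\,z$ increases towards $\alpha_0$ along $C^-$ and towards $\beta_0$ along $C^+$. * The base point $x_2$ lies in a region $\omega_{\rm up}$ whose closure contains $C^0$, and neither $C^-\setminus\{\alpha_0\}$ nor $C^+\setminus\{\beta_0\}$ meets $\omega_{\rm up}$. * The base points $x_1^\alpha,x_1^\beta$ lie in two different regions, whose closures contain respectively the Stokes line from $\alpha_0$ to $\gamma_0$ and that from $\gamma_0$ to $\beta_0$. * In the cut domain there are paths from $x_2$ to each of $\alpha_0,\beta_0,\gamma_0$ along which $\mathrm{Re}\,z$ strictly increases, and paths from $x_1^\alpha$ to $\alpha_0,\gamma_0$ and from $x_1^\beta$ to $\beta_0,\gamma_0$ along which it strictly decreases. (Thus the third Stokes line from $\gamma_0$ separates the regions of $x_1^\alpha$ and $x_1^\beta$ on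 the side of $C^0$ opposite to $\omega_{\rm up}$.) **Exact WKB solutions.** For a base point $x_0$ in the cut domain (or $x_0=\pm\infty$ along $\mathbb R$) and a turning point $\tau$, $\mathbf u^\pm(x,\lambda,\epsilon,\tau,x_0)$ is the solution of $\mathfrak D_\epsilon\mathbf u=\lambda\mathbf u$, continued holomorphically to $\Omega$, which near $x_0$ equals $$e^{\pm z(x,\lambda,\tau)/\epsilon}\begin{bmatrix}e^{iS/2\epsilon}&0\\0&e^{-iS/2\epsilon}\end{bmatrix}\begin{bmatrix}1&1\\-1&1\end{bmatrix}\begin{bmatrix}H^{-1}&H^{-1}\\iH&-iH\end{bmatrix}\begin{bmatrix}0&1\\1&0\end{bmatrix}^{\frac{1\pm1}2}\begin{bmatrix}\sum_{n\ge0}w^\pm_{2n}\\\sum_{n\ge0}w^\pm_{2n+1}\end{bmatrix}.$$ Here the series converge absolutely, $w_0^\pm=1$, $\frac{d}{dz}w^\pm_{2n+2}=\frac{dH/dz}{H}w^\pm_{2n+1}$, $(\frac d{dz}\pm\frac2\epsilon)w^\pm_{2n+1}=\frac{dH/dz}{H}w^\pm_{2n}$ for $n\ge0$, and $w_n^\pm\to0$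 at $x_0$ for $n\ge1$. Set $$\mathbf u_0^\alpha=\mathbf u^+(\cdot,\alpha,-\infty),\quad \mathbf u_0^\beta=\mathbf u^+(\cdot,\beta,+\infty),\quad \mathbf u_1^{\alpha}=\mathbf u^-(\cdot,\alpha,x_1^\alpha),\quad \mathbf u_1^{\beta}=\mathbf u^-(\cdot,\beta,x_1^\beta),$$ $$\mathbf u_1^{\gamma,\alpha}=\mathbf u^-(\cdot,\gamma,x_1^\alpha),\quad \mathbf u_1^{\gamma,\beta}=\mathbf u^-(\cdot,\gamma,x_1^\beta),\quad \mathbf u_2^\tau=\mathbf u^+(\cdot,\tau,x_2)\quad(\tau=\alpha,\beta,\gamma),$$ and let $\mathcal W[\mathbf f,\mathbf g]=\det[\mathbf f\ \mathbf g]$. **Theorem.** There exist a neighbourhood $U$ of $\lambda_0$ and $\epsilon_0>0$, $K\geq 0$ such that for all $\lambda\in U$ and $0<\epsilon<\epsilon_0$ the solutions above exist, the denominators below do not vanish, and $\lambda$ is an eigenvalue of $\mathfrak D_\epsilon$ if and only if $$m_\alpha(\epsilon)e^{2z(\gamma,\lambda,\alpha)/\epsilon}+m_\beta(\epsilon)e^{2z(\gamma,\lambda,\beta)/\epsilon}=1,$$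 where $$m_\alpha=\frac{\mathcal W[\mathbf u_0^\alpha,\mathbf u_1^\alpha]\,\mathcal W[\mathbf u_1^{\gamma,\beta},\mathbf u_2^\gamma]}{\mathcal W[\mathbf u_2^\alpha,\mathbf u_0^\alpha]\,\mathcal W[\mathbf u_1^{\gamma,\alpha},\mathbf u_1^{\gamma,\beta}]},\qquad m_\beta=\frac{\mathcal W[\mathbf u_0^\beta,\mathbf u_1^\beta]\,\mathcal W[\mathbf u_2^\gamma,\mathbf u_1^{\gamma,\alpha}]}{\mathcal W[\mathbf u_2^\beta,\mathbf u_0^\beta]\,\mathcal W[\mathbf u_1^{\gamma,\alpha},\mathbf u_1^{\gamma,\beta}]}.$$ Moreover, for all $\lambda\in U$ and $0<\epsilon<\epsilon_0$, $|m_\alpha\pm1|\le K\epsilon$ and $|m_\beta\pm1|\le K\epsilon$. For $m_\alpha$ (resp. $m_\beta$) the upper sign, i.e. $m=-1+\mathcal O(\epsilon)$, holds if $\alpha_0$ (resp. $\beta_0$) and $\gamma_0$ are zeros of the same one of $g_+(\cdot,\lambda_0),g_-(\cdot,\lambda_0)$; the lower sign, i.e. $m=1+\mathcal O(\epsilon)$,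 holds if they are zeros of different ones. -/

import Mathlib

open Filter Topology MeasureTheory Set

noncomputable section

namespace DiracWKB

/-! ### The Dirac operator and its eigenvalues -/

/-- Standing assumptions on the amplitude `A` and the phase `S`: they are real on the real line,
extend holomorphically to a simply connected open neighbourhood `Om` of the real line, and
`A, S, S', A', S''` are integrable on the real line with `A', S''` bounded there. -/
structure IsPotentialPair (A S : ℂ → ℂ) (Om : Set ℂ) : Prop where
  isOpen : IsOpen Om
  isSimplyConnected : IsSimplyConnected Om
  real_mem : ∀ x : ℝ, (x : ℂ) ∈ Om
  holo_A : DifferentiableOn ℂ A Om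
  holo_S : DifferentiableOn ℂ S Om
  real_A : ∀ x : ℝ, (A x).im = 0
  real_S : ∀ x : ℝ, (S x).im = 0
  integrable_A : Integrable (fun x : ℝ => A x)
  integrable_S : Integrable (fun x : ℝ => S x)
  integrable_dS : Integrable (fun x : ℝ => deriv S x)
  integrable_dA : Integrable (fun x : ℝ => deriv A x)
  integrable_ddS : Integrable (fun x : ℝ => deriv (deriv S) x)
  bounded : ∃ B : ℝ, ∀ x : ℝ, ‖deriv A x‖ ≤ B ∧ ‖deriv (deriv S) x‖ ≤ B

/-- The potential `ω(x, ε) = -i A(x) exp(i S(x) / ε)`. -/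
def pot (A S : ℂ → ℂ) (eps : ℝ) (x : ℂ) : ℂ :=
  -Complex.I * A x * Complex.exp (Complex.I * S x / eps)

/-- The holomorphic function `i A(x) exp(-i S(x) / ε)`, which is equal to the complex conjugate
of `ω(x, ε)` for real `x`. -/
def potConj (A S : ℂ → ℂ) (eps : ℝ) (x : ℂ) : ℂ :=
  Complex.I * A x * Complex.exp (-(Complex.I * S x) / eps)

/-- `lam` is an eigenvalue of the operator
`D_ε = [[-(ε/i) d/dx, ω], [-ω^*, (ε/i) d/dx]]` on `L²(ℝ; ℂ²)`. -/
def IsEigenvalue (A S : ℂ → ℂ) (eps : ℝ) (lam : ℂ) : Prop :=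
  ∃ u₁ u₂ : ℝ → ℂ,
    Differentiable ℝ u₁ ∧ Differentiable ℝ u₂ ∧
    MemLp u₁ 2 volume ∧ MemLp u₂ 2 volume ∧
    (∃ x, u₁ x ≠ 0 ∨ u₂ x ≠ 0) ∧
    ∀ x : ℝ,
      -((eps : ℂ) / Complex.I) * deriv u₁ x + pot A S eps x * u₂ x = lam * u₁ x ∧
      -(starRingEnd ℂ (pot A S eps x)) * u₁ x + ((eps : ℂ) / Complex.I) * deriv u₂ x = lam * u₂ x

/-- `u` is a holomorphic solution on `Om` of
`(ε/i) u' = [[-λ, ω], [ω^*, λ]] u` (the equation `D_ε u = λ u`, continued to complex `x`). -/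
def IsDiracSolution (A S : ℂ → ℂ) (Om : Set ℂ) (eps : ℝ) (lam : ℂ) (u : ℂ → Fin 2 → ℂ) : Prop :=
  ∀ x ∈ Om,
    DifferentiableAt ℂ (fun y => u y 0) x ∧ DifferentiableAt ℂ (fun y => u y 1) x ∧
    ((eps : ℂ) / Complex.I) * deriv (fun y => u y 0) x
      = -lam * u x 0 + pot A S eps x * u x 1 ∧
    ((eps : ℂ) / Complex.I) * deriv (fun y => u y 1) x
      = potConj A S eps x * u x 0 + lam * u x 1

/-- The determinant `𝓦[f, g]` of the matrix with columns `f`, `g`. -/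
def wr (f g : ℂ → Fin 2 → ℂ) (x : ℂ) : ℂ := f x 0 * g x 1 - g x 0 * f x 1

/-! ### Turning points and Stokes lines -/

/-- `g₊(x, λ) = -(λ + S'(x)/2 + i A(x))`. -/
def gPlus (A S : ℂ → ℂ) (x lam : ℂ) : ℂ := -(lam + deriv S x / 2 + Complex.I * A x)

/-- `g₋(x, λ) = λ + S'(x)/2 - i A(x)`. -/
def gMinus (A S : ℂ → ℂ) (x lam : ℂ) : ℂ := lam + deriv S x / 2 - Complex.I * A x

/-- `V₀(x, λ) = -(λ + S'(x)/2)² - A(x)² = g₊ g₋`; its zeros in `x` are the turning points. -/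
def V₀ (A S : ℂ → ℂ) (x lam : ℂ) : ℂ := -(lam + deriv S x / 2) ^ 2 - A x ^ 2

theorem V₀_eq (A S : ℂ → ℂ) (x lam : ℂ) : V₀ A S x lam = gPlus A S x lam * gMinus A S x lam := by
  unfold V₀ gPlus gMinus
  ring_nf
  rw [Complex.I_sq]
  ring

/-- Two turning points are zeros of the same one of the functions `g₊`, `g₋`. -/
def SameType (A S : ℂ → ℂ) (lam x y : ℂ) : Prop :=
  (gPlus A S x lam = 0 ∧ gPlus A S y lam = 0) ∨ (gMinus A S x lam = 0 ∧ gMinus A S y lam = 0)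

/-- Two turning points are zeros of different ones of the functions `g₊`, `g₋`. -/
def DifferentType (A S : ℂ → ℂ) (lam x y : ℂ) : Prop :=
  (gPlus A S x lam = 0 ∧ gMinus A S y lam = 0) ∨ (gMinus A S x lam = 0 ∧ gPlus A S y lam = 0)

/-- The curve `k : [0, 1] → ℂ` is a simple arc of a Stokes line starting at the point `k 0`:
along it the real part of a local branch of `i ∫ √(-V₀) dx` is constant. -/
structure IsStokesArc (A S : ℂ → ℂ) (Om : Set ℂ) (lam : ℂ) (k : ℝ → ℂ) : Prop where
  continuousOn : ContinuousOn k (Icc 0 1)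
  injOn : InjOn k (Icc 0 1)
  mapsTo : MapsTo k (Icc 0 1) Om
  level : ∀ t ∈ Ioc (0 : ℝ) 1, ∃ f : ℂ → ℂ,
    (∀ᶠ y in 𝓝 (k t), DifferentiableAt ℂ f y ∧ deriv f y ^ 2 = V₀ A S y lam) ∧
    ∀ᶠ s in 𝓝[Icc 0 1] t, (f (k s)).re = (f (k t)).re

/-- The open set `om` with branch cuts along the three arcs `kα(·, λ)`, `kβ(·, λ)`, `kγ(·, λ)`. -/
def cutDomain (om : Set ℂ) (kα kβ kγ : ℝ → ℂ → ℂ) (lam : ℂ) : Set ℂ :=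
  om \ ((fun t => kα t lam) '' Icc 0 1 ∪ (fun t => kβ t lam) '' Icc 0 1 ∪
    (fun t => kγ t lam) '' Icc 0 1)

/-- There is a path from the base point `x` to the turning point `τ` that stays in `D` before it
reaches `τ` and along which `Re z` is strictly increasing. -/
def IncreasesTo (D : Set ℂ) (z : ℂ → ℂ) (x τ : ℂ) : Prop :=
  ∃ η : ℝ → ℂ, ContinuousOn η (Icc 0 1) ∧ η 0 = x ∧ η 1 = τ ∧ (∀ t ∈ Ico (0 : ℝ) 1, η t ∈ D) ∧
    StrictMonoOn (fun t => (z (η t)).re) (Ico 0 1)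

/-- The same with `Re z` strictly decreasing. -/
def DecreasesTo (D : Set ℂ) (z : ℂ → ℂ) (x τ : ℂ) : Prop :=
  ∃ η : ℝ → ℂ, ContinuousOn η (Icc 0 1) ∧ η 0 = x ∧ η 1 = τ ∧ (∀ t ∈ Ico (0 : ℝ) 1, η t ∈ D) ∧
    StrictAntiOn (fun t => (z (η t)).re) (Ico 0 1)

/-- The Stokes region containing `x`: the connected component of `x` in the complement, within
`D`, of the level set `Re z = ℓ`. -/
def stokesRegion (D : Set ℂ) (z : ℂ → ℂ) (ℓ : ℝ) (x : ℂ) : Set ℂ :=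
  connectedComponentIn {y ∈ D | (z y).re ≠ ℓ} x

/-- The geometric data at a bifurcation point `lam₀`: an admissible contour `C = C⁻ ∪ C⁰ ∪ C⁺`
whose middle part consists of a Stokes line from `α` to `γ` and a Stokes line from `γ` to `β`;
for `lam` near `lam₀`, the turning points, branch cuts along Stokes lines, and a branch of the
phase and of `H` on the cut domain; and base points for the exact WKB solutions. -/
structure BifurcationData (A S : ℂ → ℂ) (Om : Set ℂ) (lam₀ : ℂ) where
  /-- the range of the spectral parameter -/
  U₀ : Set ℂ
  isOpen_U₀ : IsOpen U₀
  mem_U₀ : lam₀ ∈ U₀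
  /-- the turning points, as functions of the spectral parameter -/
  α : ℂ → ℂ
  β : ℂ → ℂ
  γ : ℂ → ℂ
  continuousOn_α : ContinuousOn α U₀
  continuousOn_β : ContinuousOn β U₀
  continuousOn_γ : ContinuousOn γ U₀
  V₀_α : ∀ lam ∈ U₀, V₀ A S (α lam) lam = 0
  V₀_β : ∀ lam ∈ U₀, V₀ A S (β lam) lam = 0
  V₀_γ : ∀ lam ∈ U₀, V₀ A S (γ lam) lam = 0
  simple_α : deriv (fun x => V₀ A S x lam₀) (α lam₀) ≠ 0
  simple_β : deriv (fun x => V₀ A S x lam₀) (β lam₀) ≠ 0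
  simple_γ : deriv (fun x => V₀ A S x lam₀) (γ lam₀) ≠ 0
  /-- a neighbourhood of the contour containing no other turning point -/
  om : Set ℂ
  isOpen_om : IsOpen om
  om_subset : om ⊆ Om
  eq_of_V₀ : ∀ lam ∈ U₀, ∀ x ∈ om, V₀ A S x lam = 0 → x = α lam ∨ x = β lam ∨ x = γ lam
  /-- the branch cuts, along Stokes lines emanating from the three turning points -/
  kα : ℝ → ℂ → ℂ
  kβ : ℝ → ℂ → ℂ
  kγ : ℝ → ℂ → ℂ
  continuousOn_kα : ContinuousOn (fun p : ℝ × ℂ => kα p.1 p.2) (Icc 0 1 ×ˢ U₀)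
  continuousOn_kβ : ContinuousOn (fun p : ℝ × ℂ => kβ p.1 p.2) (Icc 0 1 ×ˢ U₀)
  continuousOn_kγ : ContinuousOn (fun p : ℝ × ℂ => kγ p.1 p.2) (Icc 0 1 ×ˢ U₀)
  kα_zero : ∀ lam ∈ U₀, kα 0 lam = α lam
  kβ_zero : ∀ lam ∈ U₀, kβ 0 lam = β lam
  kγ_zero : ∀ lam ∈ U₀, kγ 0 lam = γ lam
  stokes_kα : ∀ lam ∈ U₀, IsStokesArc A S Om lam (fun t => kα t lam)
  stokes_kβ : ∀ lam ∈ U₀, IsStokesArc A S Om lam (fun t => kβ t lam)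
  stokes_kγ : ∀ lam ∈ U₀, IsStokesArc A S Om lam (fun t => kγ t lam)
  /-- the branch of `√(-V₀)` on the cut domain -/
  root : ℂ → ℂ → ℂ
  root_sq : ∀ lam ∈ U₀, ∀ x ∈ cutDomain om kα kβ kγ lam, root x lam ^ 2 = -V₀ A S x lam
  /-- a primitive of `i √(-V₀)` on the cut domain -/
  Z : ℂ → ℂ → ℂ
  continuousOn_Z : ContinuousOn (fun p : ℂ × ℂ => Z p.1 p.2)
    {p : ℂ × ℂ | p.2 ∈ U₀ ∧ p.1 ∈ cutDomain om kα kβ kγ p.2}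
  hasDerivAt_Z : ∀ lam ∈ U₀, ∀ x ∈ cutDomain om kα kβ kγ lam,
    HasDerivAt (fun y => Z y lam) (Complex.I * root x lam) x
  /-- the values of the primitive at the turning points, so that
  `z(x, λ, τ) = Z(x, λ) - Z(τ, λ)` -/
  Zα : ℂ → ℂ
  Zβ : ℂ → ℂ
  Zγ : ℂ → ℂ
  tendsto_Zα : ∀ lam ∈ U₀,
    Tendsto (fun y => Z y lam) (𝓝[cutDomain om kα kβ kγ lam] (α lam)) (𝓝 (Zα lam))
  tendsto_Zβ : ∀ lam ∈ U₀,
    Tendsto (fun y => Z y lam) (𝓝[cutDomain om kα kβ kγ lam] (β lam)) (𝓝 (Zβ lam))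
  tendsto_Zγ : ∀ lam ∈ U₀,
    Tendsto (fun y => Z y lam) (𝓝[cutDomain om kα kβ kγ lam] (γ lam)) (𝓝 (Zγ lam))
  /-- the branch of `H = (g₋ / g₊)^(1/4)` compatible with the phase: `H² = i √(-V₀) / g₊` -/
  H : ℂ → ℂ → ℂ
  differentiableOn_H : ∀ lam ∈ U₀,
    DifferentiableOn ℂ (fun x => H x lam) (cutDomain om kα kβ kγ lam)
  H_sq : ∀ lam ∈ U₀, ∀ x ∈ cutDomain om kα kβ kγ lam,
    H x lam ^ 2 * gPlus A S x lam = Complex.I * root x lam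
  /-- the admissible contour for `lam₀`, passing through `α, γ, β` at the times `a < g < b` -/
  c : ℝ → ℂ
  a : ℝ
  g : ℝ
  b : ℝ
  T : ℝ
  a_lt_g : a < g
  g_lt_b : g < b
  continuous_c : Continuous c
  injective_c : Function.Injective c
  c_real : ∀ t : ℝ, T ≤ |t| → c t = t
  c_mem : ∀ t, c t ∈ om
  c_a : c a = α lam₀
  c_g : c g = γ lam₀
  c_b : c b = β lam₀
  c_mem_cutDomain : ∀ t, t ≠ a → t ≠ g → t ≠ b → c t ∈ cutDomain om kα kβ kγ lam₀
  /-- `C⁻` is progressive, and the branch is such that `Re z` increases towards `α` on it -/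
  progressive_left : StrictMonoOn (fun t => (Z (c t) lam₀).re) (Iio a)
  /-- `C⁰` consists of two Stokes lines -/
  stokes_middle : ∀ t ∈ Ioo a b, t ≠ g → (Z (c t) lam₀).re = (Zγ lam₀).re
  /-- `C⁺` is progressive, and `Re z` increases towards `β` on it -/
  progressive_right : StrictAntiOn (fun t => (Z (c t) lam₀).re) (Ioi b)
  /-- the base points: `x₂` lies in the region bounded by the whole of `C⁰` (on the side opposite
  to the third Stokes line of `γ`), `x₁α` and `x₁β` in the two regions on the other side, bounded
  by the Stokes line from `α` to `γ` and by that from `γ` to `β`, respectively -/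
  x₁α : ℂ
  x₁β : ℂ
  x₂ : ℂ
  x₁α_region : c '' Ioo a g ⊆ closure
    (stokesRegion (cutDomain om kα kβ kγ lam₀) (fun y => Z y lam₀) (Zγ lam₀).re x₁α)
  x₁β_region : c '' Ioo g b ⊆ closure
    (stokesRegion (cutDomain om kα kβ kγ lam₀) (fun y => Z y lam₀) (Zγ lam₀).re x₁β)
  x₂_region : c '' Ioo a b ⊆ closure
    (stokesRegion (cutDomain om kα kβ kγ lam₀) (fun y => Z y lam₀) (Zγ lam₀).re x₂)
  /-- the regions containing `C⁻` and `C⁺` differ from that of `x₂`, and those of `x₁α` and `x₁β`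
  differ from each other -/
  left_not_up : ∀ t < a, c t ∉
    stokesRegion (cutDomain om kα kβ kγ lam₀) (fun y => Z y lam₀) (Zγ lam₀).re x₂
  right_not_up : ∀ t > b, c t ∉
    stokesRegion (cutDomain om kα kβ kγ lam₀) (fun y => Z y lam₀) (Zγ lam₀).re x₂
  down_ne : x₁β ∉
    stokesRegion (cutDomain om kα kβ kγ lam₀) (fun y => Z y lam₀) (Zγ lam₀).re x₁α
  /-- `Re z` is monotone along paths from the base points to the turning points at the boundary of
  their regions -/
  x₁α_to_α : DecreasesTo (cutDomain om kα kβ kγ lam₀) (fun y => Z y lam₀) x₁α (α lam₀)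
  x₁α_to_γ : DecreasesTo (cutDomain om kα kβ kγ lam₀) (fun y => Z y lam₀) x₁α (γ lam₀)
  x₁β_to_β : DecreasesTo (cutDomain om kα kβ kγ lam₀) (fun y => Z y lam₀) x₁β (β lam₀)
  x₁β_to_γ : DecreasesTo (cutDomain om kα kβ kγ lam₀) (fun y => Z y lam₀) x₁β (γ lam₀)
  x₂_to_α : IncreasesTo (cutDomain om kα kβ kγ lam₀) (fun y => Z y lam₀) x₂ (α lam₀)
  x₂_to_β : IncreasesTo (cutDomain om kα kβ kγ lam₀) (fun y => Z y lam₀) x₂ (β lam₀)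
  x₂_to_γ : IncreasesTo (cutDomain om kα kβ kγ lam₀) (fun y => Z y lam₀) x₂ (γ lam₀)

/-- The cut domain of a configuration. -/
def BifurcationData.D {A S : ℂ → ℂ} {Om : Set ℂ} {lam₀ : ℂ} (P : BifurcationData A S Om lam₀)
    (lam : ℂ) : Set ℂ :=
  cutDomain P.om P.kα P.kβ P.kγ lam

/-! ### Exact WKB solutions -/

/-- The coefficients `w n = w_n^±` (as functions of `x`), for the sign `s = ±1`, of the symbol of
an exact WKB solution on the open set `N`: `w_0 = 1`, `w_{-1} = 0`,
`dw_{2n}/dz = (dH/dz / H) w_{2n-1}`, `(d/dz ± 2/ε) w_{2n+1} = (dH/dz / H) w_{2n}`, and `w_n`,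
`n ≥ 1`, vanishes at the base point. The base point is given by the filter `l`: it is `𝓝 x₀` for
the base point `x₀`, and the image of `atBot` (`atTop`) for the base point `-∞` (`+∞`). -/
structure IsWKBSymbol (N : Set ℂ) (l : Filter ℂ) (s : ℂ) (eps : ℝ) (z H : ℂ → ℂ)
    (w : ℕ → ℂ → ℂ) : Prop where
  differentiableOn : ∀ n, DifferentiableOn ℂ (w n) N
  zero : ∀ x ∈ N, w 0 x = 1
  odd : ∀ n, ∀ x ∈ N,
    deriv (w (2 * n + 1)) x + s * (2 / eps) * deriv z x * w (2 * n + 1) x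
      = deriv H x / H x * w (2 * n) x
  even : ∀ n, ∀ x ∈ N, deriv (w (2 * n + 2)) x = deriv H x / H x * w (2 * n + 1) x
  base : ∀ n, 1 ≤ n → Tendsto (w n) l (𝓝 0)

/-- The value `e^{±z/ε} Q(x) [[0,1],[1,0]]^{(1±1)/2} (p, q)ᵀ`, where
`Q = diag(e^{iS/2ε}, e^{-iS/2ε}) [[1,1],[-1,1]] [[H⁻¹,H⁻¹],[iH,-iH]]`; the sign is `+` if
`s = 1` and `-` if `s = -1`. -/
def wkbVector (S : ℂ → ℂ) (eps : ℝ) (s : ℂ) (z H : ℂ → ℂ) (x p q : ℂ) : Fin 2 → ℂ :=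
  Complex.exp (s * z x / eps) •
    (!![Complex.exp (Complex.I * S x / (2 * eps)), 0;
        0, Complex.exp (-(Complex.I * S x) / (2 * eps))] *
      !![1, 1; -1, 1] *
      !![(H x)⁻¹, (H x)⁻¹; Complex.I * H x, -(Complex.I * H x)]).mulVec
      (if s = 1 then ![q, p] else ![p, q])

/-- `u` is the exact WKB solution `u^±`, with phase `z` and with the base point of the symbol
described by `l`: near the base point it is given by the (absolutely convergent) series for the
symbol, and it is continued to `Om` as a solution of the Dirac system. -/
def IsExactWKB (A S : ℂ → ℂ) (Om D : Set ℂ) (eps : ℝ) (lam s : ℂ) (z H : ℂ → ℂ) (l : Filter ℂ)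
    (u : ℂ → Fin 2 → ℂ) : Prop :=
  IsDiracSolution A S Om eps lam u ∧
  ∃ N : Set ℂ, IsOpen N ∧ N ⊆ D ∧ N ∈ l ∧ ∃ w : ℕ → ℂ → ℂ,
    IsWKBSymbol N l s eps z H w ∧
    ∀ x ∈ N, Summable (fun n => w (2 * n) x) ∧ Summable (fun n => w (2 * n + 1) x) ∧
      u x = wkbVector S eps s z H x (∑' n, w (2 * n) x) (∑' n, w (2 * n + 1) x)

/-- The base point `-∞` on the real line. -/
def negInfty : Filter ℂ := map (fun t : ℝ => (t : ℂ)) atBot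

/-- The base point `+∞` on the real line. -/
def posInfty : Filter ℂ := map (fun t : ℝ => (t : ℂ)) atTop

/-- The nine exact WKB solutions attached to the three turning points: in `uₖ^τ` the phase is
`z(·, λ, τ)`, the index `0` stands for the base point `-∞` (for `α`) or `+∞` (for `β`), and the
indices `1`, `2` for the base points `x₁α`, `x₁β`, `x₂`. -/
structure WKBFamily {A S : ℂ → ℂ} {Om : Set ℂ} {lam₀ : ℂ} (P : BifurcationData A S Om lam₀)
    (lam : ℂ) (eps : ℝ) where
  u₀α : ℂ → Fin 2 → ℂ
  u₁α : ℂ → Fin 2 → ℂ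
  u₂α : ℂ → Fin 2 → ℂ
  u₀β : ℂ → Fin 2 → ℂ
  u₁β : ℂ → Fin 2 → ℂ
  u₂β : ℂ → Fin 2 → ℂ
  u₁γα : ℂ → Fin 2 → ℂ
  u₁γβ : ℂ → Fin 2 → ℂ
  u₂γ : ℂ → Fin 2 → ℂ
  wkb_u₀α : IsExactWKB A S Om (P.D lam) eps lam 1 (fun x => P.Z x lam - P.Zα lam)
    (fun x => P.H x lam) negInfty u₀α
  wkb_u₁α : IsExactWKB A S Om (P.D lam) eps lam (-1) (fun x => P.Z x lam - P.Zα lam)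
    (fun x => P.H x lam) (𝓝 P.x₁α) u₁α
  wkb_u₂α : IsExactWKB A S Om (P.D lam) eps lam 1 (fun x => P.Z x lam - P.Zα lam)
    (fun x => P.H x lam) (𝓝 P.x₂) u₂α
  wkb_u₀β : IsExactWKB A S Om (P.D lam) eps lam 1 (fun x => P.Z x lam - P.Zβ lam)
    (fun x => P.H x lam) posInfty u₀β
  wkb_u₁β : IsExactWKB A S Om (P.D lam) eps lam (-1) (fun x => P.Z x lam - P.Zβ lam)
    (fun x => P.H x lam) (𝓝 P.x₁β) u₁β
  wkb_u₂β : IsExactWKB A S Om (P.D lam) eps lam 1 (fun x => P.Z x lam - P.Zβ lam)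
    (fun x => P.H x lam) (𝓝 P.x₂) u₂β
  wkb_u₁γα : IsExactWKB A S Om (P.D lam) eps lam (-1) (fun x => P.Z x lam - P.Zγ lam)
    (fun x => P.H x lam) (𝓝 P.x₁α) u₁γα
  wkb_u₁γβ : IsExactWKB A S Om (P.D lam) eps lam (-1) (fun x => P.Z x lam - P.Zγ lam)
    (fun x => P.H x lam) (𝓝 P.x₁β) u₁γβ
  wkb_u₂γ : IsExactWKB A S Om (P.D lam) eps lam 1 (fun x => P.Z x lam - P.Zγ lam)
    (fun x => P.H x lam) (𝓝 P.x₂) u₂γ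

namespace WKBFamily

variable {A S : ℂ → ℂ} {Om : Set ℂ} {lam₀ : ℂ} {P : BifurcationData A S Om lam₀}
  {lam : ℂ} {eps : ℝ}

/-- The denominator of `m_α`. -/
def denα (F : WKBFamily P lam eps) (x : ℂ) : ℂ := wr F.u₂α F.u₀α x * wr F.u₁γα F.u₁γβ x

/-- The denominator of `m_β`. -/
def denβ (F : WKBFamily P lam eps) (x : ℂ) : ℂ := wr F.u₂β F.u₀β x * wr F.u₁γα F.u₁γβ x

/-- `m_α = 𝓦[u₀^α, u₁^α] 𝓦[u₁^{γ,β}, u₂^γ] / (𝓦[u₂^α, u₀^α] 𝓦[u₁^{γ,α}, u₁^{γ,β}])`. -/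
def mα (F : WKBFamily P lam eps) (x : ℂ) : ℂ :=
  wr F.u₀α F.u₁α x * wr F.u₁γβ F.u₂γ x / F.denα x

/-- `m_β = 𝓦[u₀^β, u₁^β] 𝓦[u₂^γ, u₁^{γ,α}] / (𝓦[u₂^β, u₀^β] 𝓦[u₁^{γ,α}, u₁^{γ,β}])`. -/
def mβ (F : WKBFamily P lam eps) (x : ℂ) : ℂ :=
  wr F.u₀β F.u₁β x * wr F.u₂γ F.u₁γα x / F.denβ x

end WKBFamily

end DiracWKB

end

/-!
A gauge transformation (`redC`, `redD`) and a change of basis adapted to a branch of the phase `z`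
and of the amplitude `H` turn the Dirac system into `dp/dz = h q`, `dq/dz + (2/ε) q = h p`, where
`h = (dH/dz)/H`; the coefficients `pco`, `qco` are `p` and `q`. An exact WKB solution has
`(p, q) = (1, 0)` at its base point, and the Wronskian of a solution with it is a constant multiple
of the coefficient `p` of that solution at the base point (`IsExactWKB.wr_eq_pco`). Everything
therefore reduces to following `p` and `q` from one base point to another.

Along a path on which `Re z` increases, `p = k (1 + O(ε))` and `q = O(ε)` persist
(`BranchFamily.reach_of_inc`): the equation for `q` is damped, so that `q = O(ε)`, and then `p` varies
by `O(ε)`. For the base points `±∞` the same holds since `S''` and `A'` are integrable on the real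
line and `Re z` grows at least at the rate `|Im λ₀| / 2` there (`RayBound.norm_symbol_le`); the
solution is moreover square integrable, so that `λ` is an eigenvalue if and only if the solutions
attached to `-∞` and `+∞` are proportional (`isEigenvalue_iff`).

Some of the base points lie on different sides of a branch cut. Near a simple turning point `τ`
there is a coordinate `X` with `z - z(τ) = ± X^(3/2)` in which the cut is the negative axis
(`exists_isChart`, `exists_isSlitChart`), and moving the cut to the opposite direction gives a
branch that continues across it. The result, `BranchFamily.hasConnection`, is that passing across
the cut replaces `(z - z(τ), H)` by `(-(z - z(τ)), -o σ i H)`, where `σ = ±1` records which of `g₊`,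
`g₋` vanishes at `τ` and `o = ±1` the direction of the passage. The sign `o` is read off from `Im z`
on the Stokes line between the two regions that are connected. Since `Im z` is monotone along the
Stokes lines from `α` to `γ` and from `γ` to `β`, the three directions determine each other
(`BifurcationData.exists_reach`), and `m_α`, `m_β` equal `-σ_α σ_γ`, `-σ_β σ_γ` up to `O(ε)`; the
signs `σ` of two turning points agree exactly if they are zeros of the same one of `g₊`, `g₋`.

The quantization condition itself is the Plücker relation between the Wronskians of five vectors in
the plane (`WKBFamily.wr_eq_zero_iff`).

Two existence results are needed as well: a holomorphic linear system on a simply connected domain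
has a global solution with given initial values (`exists_isSystemSolution`), by successive
approximation, primitives being obtained from the triviality of a covering; and the series for the
symbol converges near a finite base point and on a neighbourhood of a ray
(`exists_isExactWKB_nhds`, `RayBound.exists_isExactWKB`), since each step of the recursion halves the
bound for the coefficients.
-/

open Metric
open scoped Real
open Complex (I exp log slitPlane arg I_sq slitPlane_ne_zero isOpen_slitPlane
  mem_slitPlane_iff_arg ofReal_mem_slitPlane log_im log_exp exp_add exp_sub exp_neg exp_zero
  exp_nat_mul exp_log exp_ne_zero norm_exp norm_real neg_re neg_im sub_re sub_im add_re add_im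
  mul_re mul_im re_ofReal_mul im_ofReal_mul continuous_re continuous_im ofReal_im ofReal_re
  abs_re_le_norm)

namespace DiracWKB

/-! ### Linear systems with a growing phase -/

section PhaseODE

variable {p q z h ρ : ℝ → ℂ} {a b eps M c : ℝ}

/-- The recessive component `q` of the symbol is of order `eps`: it solves
`q' + (2 / eps) z' q = h p`, and `exp (2 z / eps)` is increasing in modulus at rate `2 c / eps`. -/
theorem norm_recessive_le (heps : 0 < eps) (hc : 0 < c) (hM : 0 ≤ M) {P : ℝ} (hP : 0 ≤ P)
    (hq : ∀ t ∈ Icc a b, HasDerivAt q (h t * p t - 2 / eps * ρ t * q t) t)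
    (hz : ∀ t ∈ Icc a b, HasDerivAt z (ρ t) t)
    (hh : ∀ t ∈ Icc a b, ‖h t‖ ≤ M) (hρ : ∀ t ∈ Icc a b, c ≤ (ρ t).re)
    (hp : ∀ t ∈ Icc a b, ‖p t‖ ≤ P) :
    ∀ t ∈ Icc a b, ‖q t‖ ≤ ‖q a‖ + eps * M * P / (2 * c) := by
  have hE : (eps : ℂ) ≠ 0 := by exact_mod_cast heps.ne'
  set f : ℝ → ℂ := fun t => exp (2 * z t / eps) * q t with hf
  set e : ℝ → ℝ := fun t => Real.exp (2 * (z t).re / eps) with he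
  have hnorm : ∀ t, ‖exp (2 * z t / eps)‖ = e t := by
    intro t
    rw [norm_exp, he]
    congr 1
    rw [show (2 * z t / eps : ℂ) = ((2 / eps : ℝ) : ℂ) * z t by push_cast; ring,
      re_ofReal_mul]
    ring
  have hre : ∀ t ∈ Icc a b, HasDerivAt (fun t => (z t).re) (ρ t).re t := fun t ht =>
    (Complex.reCLM.hasFDerivAt.comp_hasDerivAt t (hz t ht))
  have hfd : ∀ t ∈ Icc a b, HasDerivAt f (exp (2 * z t / eps) * (h t * p t)) t := by
    intro t ht
    have h1 : HasDerivAt (fun t => 2 * z t / (eps : ℂ)) (2 * ρ t / eps) t :=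
      ((hz t ht).const_mul 2).div_const _
    refine (h1.cexp.mul (hq t ht)).congr_deriv ?_
    field_simp
    ring
  have hed : ∀ t ∈ Icc a b, HasDerivAt e (e t * (2 * (ρ t).re / eps)) t := by
    intro t ht
    exact (((hre t ht).const_mul 2).div_const eps).exp
  set B : ℝ → ℝ := fun t => ‖f a‖ + eps * M * P / (2 * c) * (e t - e a) with hB
  have key : ∀ t ∈ Icc a b, ‖f t‖ ≤ B t := by
    refine image_norm_le_of_norm_deriv_right_le_deriv_boundary'
      (f' := fun t => exp (2 * z t / eps) * (h t * p t))
      (B' := fun t => eps * M * P / (2 * c) * (e t * (2 * (ρ t).re / eps)))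
      (fun t ht => (hfd t ht).continuousAt.continuousWithinAt)
      (fun t ht => (hfd t (Ico_subset_Icc_self ht)).hasDerivWithinAt) ?_ ?_ ?_ ?_
    · simp [hB]
    · intro t ht
      exact (((hed t ht).sub_const _).const_mul _).const_add _
        |>.continuousAt.continuousWithinAt
    · intro t ht
      exact ((((hed t (Ico_subset_Icc_self ht)).sub_const _).const_mul _).const_add
        _).hasDerivWithinAt
    · intro t ht
      have ht' := Ico_subset_Icc_self ht
      rw [norm_mul, norm_mul, hnorm]
      have h1 : ‖h t‖ * ‖p t‖ ≤ M * P :=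
        mul_le_mul (hh t ht') (hp t ht') (norm_nonneg _) hM
      have h2 : eps * M * P / (2 * c) * (e t * (2 * (ρ t).re / eps))
          = e t * (M * P * ((ρ t).re / c)) := by
        field_simp
      rw [h2]
      have h3 : 1 ≤ (ρ t).re / c := by rw [le_div_iff₀ hc]; linarith [hρ t ht']
      have h4 : 0 ≤ M * P := mul_nonneg hM hP
      have h5 : 0 ≤ e t := (Real.exp_pos _).le
      exact mul_le_mul_of_nonneg_left (by nlinarith) h5
  have hmono : MonotoneOn (fun t => (z t).re) (Icc a b) := by
    refine monotoneOn_of_deriv_nonneg (convex_Icc a b)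
      (fun t ht => (hre t ht).continuousAt.continuousWithinAt)
      (fun t ht => (hre t (interior_subset ht)).differentiableAt.differentiableWithinAt) ?_
    intro t ht
    rw [(hre t (interior_subset ht)).deriv]
    exact hc.le.trans (hρ t (interior_subset ht))
  intro t ht
  have hk := key t ht
  have hat : e a ≤ e t := by
    have := hmono (left_mem_Icc.2 (ht.1.trans ht.2)) ht ht.1
    simp only at this
    simp only [he]
    gcongr
  have het : 0 < e t := Real.exp_pos _
  have h1 : ‖f t‖ = e t * ‖q t‖ := by rw [hf]; simp only; rw [norm_mul, hnorm]
  have h2 : ‖f a‖ = e a * ‖q a‖ := by rw [hf]; simp only; rw [norm_mul, hnorm]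
  rw [h1] at hk
  simp only [hB] at hk
  rw [h2] at hk
  have hC : 0 ≤ eps * M * P / (2 * c) := by positivity
  have h6 : e a * ‖q a‖ ≤ e t * ‖q a‖ := mul_le_mul_of_nonneg_right hat (norm_nonneg _)
  have h7 : eps * M * P / (2 * c) * (e t - e a) ≤ eps * M * P / (2 * c) * e t :=
    mul_le_mul_of_nonneg_left (by linarith [Real.exp_pos (2 * (z a).re / eps)]) hC
  have : e t * ‖q t‖ ≤ e t * (‖q a‖ + eps * M * P / (2 * c)) := by linarith
  exact le_of_mul_le_mul_left this het

/-- Propagation of `p = 1 + O(eps)`, `q = O(eps)` along an interval on which the real part of the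
phase `z` grows. -/
theorem norm_symbol_le (hab : a ≤ b) (heps : 0 < eps) (hc : 0 < c) (hM : 0 ≤ M) {L δ : ℝ}
    (hδ : 0 ≤ δ)
    (hp : ∀ t ∈ Icc a b, HasDerivAt p (h t * q t) t)
    (hq : ∀ t ∈ Icc a b, HasDerivAt q (h t * p t - 2 / eps * ρ t * q t) t)
    (hz : ∀ t ∈ Icc a b, HasDerivAt z (ρ t) t)
    (hhc : ContinuousOn h (Icc a b))
    (hh : ∀ t ∈ Icc a b, ‖h t‖ ≤ M) (hρ : ∀ t ∈ Icc a b, c ≤ (ρ t).re)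
    (hL : ∫ t in a..b, ‖h t‖ ≤ L) (hsmall : eps * M * L / c ≤ 1)
    (hpa : ‖p a - 1‖ ≤ δ) (hqa : ‖q a‖ ≤ δ) :
    ∀ t ∈ Icc a b, ‖q t‖ ≤ δ + eps * M * (1 + δ + L * δ) / c ∧
      ‖p t - 1‖ ≤ δ + L * (δ + eps * M * (1 + δ + L * δ) / c) := by
  have hL0 : 0 ≤ L := le_trans
    (intervalIntegral.integral_nonneg hab (fun t _ => norm_nonneg _)) hL
  have hpc : ContinuousOn p (Icc a b) := fun t ht => (hp t ht).continuousAt.continuousWithinAt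
  have hqc : ContinuousOn q (Icc a b) := fun t ht => (hq t ht).continuousAt.continuousWithinAt
  have hpt : ∀ Q, (∀ t ∈ Icc a b, ‖q t‖ ≤ Q) → ∀ t ∈ Icc a b, ‖p t - 1‖ ≤ δ + L * Q := by
    intro Q hQ t ht
    have hQ0 : 0 ≤ Q := (norm_nonneg _).trans (hQ a (left_mem_Icc.2 hab))
    have hsub : Icc a t ⊆ Icc a b := Icc_subset_Icc_right ht.2
    have hu : uIcc a t = Icc a t := uIcc_of_le ht.1
    have hint : IntervalIntegrable (fun s => h s * q s) volume a t :=
      ContinuousOn.intervalIntegrable (by rw [hu]; exact (hhc.mul hqc).mono hsub)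
    have hFTC : ∫ s in a..t, h s * q s = p t - p a :=
      intervalIntegral.integral_eq_sub_of_hasDerivAt
        (fun s hs => hp s (hsub (by rwa [hu] at hs))) hint
    have hhI : IntervalIntegrable (fun s => ‖h s‖) volume a t :=
      ContinuousOn.intervalIntegrable (by rw [hu]; exact hhc.norm.mono hsub)
    have hhI' : IntervalIntegrable (fun s => ‖h s‖) volume a b :=
      ContinuousOn.intervalIntegrable (by rw [uIcc_of_le hab]; exact hhc.norm)
    have h1 : ‖p t - p a‖ ≤ (∫ s in a..t, ‖h s‖) * Q := by
      rw [← hFTC, ← intervalIntegral.integral_mul_const]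
      refine (intervalIntegral.norm_integral_le_integral_norm ht.1).trans ?_
      refine intervalIntegral.integral_mono_on ht.1 hint.norm (hhI.mul_const _) ?_
      intro s hs
      rw [norm_mul]
      exact mul_le_mul_of_nonneg_left (hQ s (hsub hs)) (norm_nonneg _)
    have h2 : ∫ s in a..t, ‖h s‖ ≤ L :=
      (intervalIntegral.integral_mono_interval le_rfl ht.1 ht.2
        (Eventually.of_forall fun _ => norm_nonneg _) hhI').trans hL
    calc ‖p t - 1‖ = ‖(p a - 1) + (p t - p a)‖ := by ring_nf
      _ ≤ δ + L * Q := (norm_add_le _ _).trans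
          (add_le_add hpa (h1.trans (mul_le_mul_of_nonneg_right h2 hQ0)))
  obtain ⟨t₀, ht₀, hmax⟩ := isCompact_Icc.exists_isMaxOn ⟨a, left_mem_Icc.2 hab⟩ hpc.norm
  set P := ‖p t₀‖ with hPdef
  have hP : ∀ t ∈ Icc a b, ‖p t‖ ≤ P := fun t ht => hmax ht
  have hP0 : 0 ≤ P := norm_nonneg _
  have hQ := norm_recessive_le heps hc hM hP0 hq hz hh hρ hP
  have hQ' : ∀ t ∈ Icc a b, ‖q t‖ ≤ δ + eps * M * P / (2 * c) := fun t ht =>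
    (hQ t ht).trans (by linarith)
  -- the self-consistent bound for the maximum `P` of `‖p‖`
  have hPle : P ≤ 2 * (1 + δ + L * δ) := by
    have h1 := hpt _ hQ' t₀ ht₀
    have h2 : P ≤ ‖p t₀ - 1‖ + 1 := by
      calc P = ‖(p t₀ - 1) + 1‖ := by rw [hPdef]; ring_nf
        _ ≤ _ := by simpa using norm_add_le (p t₀ - 1) 1
    have h3 : L * (eps * M * P / (2 * c)) = (eps * M * L / c) * (P / 2) := by
      field_simp
    have h4 : (eps * M * L / c) * (P / 2) ≤ 1 * (P / 2) :=
      mul_le_mul_of_nonneg_right hsmall (by linarith)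
    nlinarith
  have hQ'' : ∀ t ∈ Icc a b, ‖q t‖ ≤ δ + eps * M * (1 + δ + L * δ) / c := by
    intro t ht
    refine (hQ' t ht).trans ?_
    have : eps * M * P / (2 * c) ≤ eps * M * (2 * (1 + δ + L * δ)) / (2 * c) := by
      gcongr
    have h2 : eps * M * (2 * (1 + δ + L * δ)) / (2 * c) = eps * M * (1 + δ + L * δ) / c := by
      field_simp
    linarith
  exact fun t ht => ⟨hQ'' t ht, hpt _ hQ'' t ht⟩

/-- The version of `norm_symbol_le` on a half-line, with the values `p = 1`, `q = 0` at
`-∞`. -/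
theorem norm_symbol_le_of_tendsto (heps : 0 < eps) (hc : 0 < c) (hM : 0 ≤ M) {L : ℝ}
    (hp : ∀ t ≤ b, HasDerivAt p (h t * q t) t)
    (hq : ∀ t ≤ b, HasDerivAt q (h t * p t - 2 / eps * ρ t * q t) t)
    (hz : ∀ t ≤ b, HasDerivAt z (ρ t) t)
    (hhc : ContinuousOn h (Iic b))
    (hh : ∀ t ≤ b, ‖h t‖ ≤ M) (hρ : ∀ t ≤ b, c ≤ (ρ t).re)
    (hL : ∀ a ≤ b, ∫ t in a..b, ‖h t‖ ≤ L) (hsmall : eps * M * L / c ≤ 1)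
    (hpa : Tendsto p atBot (𝓝 1)) (hqa : Tendsto q atBot (𝓝 0)) :
    ∀ t ≤ b, ‖q t‖ ≤ eps * M / c ∧ ‖p t - 1‖ ≤ L * (eps * M / c) := by
  intro t ht
  have hgen : ∀ δ > 0, ‖q t‖ ≤ δ + eps * M * (1 + δ + L * δ) / c ∧
      ‖p t - 1‖ ≤ δ + L * (δ + eps * M * (1 + δ + L * δ) / c) := by
    intro δ hδ
    have h1 : ∀ᶠ s in atBot, ‖p s - 1‖ ≤ δ := by
      have := (tendsto_nhds.1 hpa δ hδ)
      filter_upwards [this] with s hs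
      rw [dist_eq_norm] at hs
      exact hs.le
    have h2 : ∀ᶠ s in atBot, ‖q s‖ ≤ δ := by
      have := (tendsto_nhds.1 hqa δ hδ)
      filter_upwards [this] with s hs
      rw [dist_zero_right] at hs
      exact hs.le
    obtain ⟨a, ha1, ha2, ha3⟩ := (h1.and (h2.and (eventually_le_atBot t))).exists
    exact norm_symbol_le (ha3.trans ht) heps hc hM hδ.le (fun s hs => hp s hs.2)
      (fun s hs => hq s hs.2) (fun s hs => hz s hs.2) (hhc.mono fun s hs => hs.2)
      (fun s hs => hh s hs.2) (fun s hs => hρ s hs.2) (hL a (ha3.trans ht)) hsmall ha1 ha2 t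
      ⟨ha3, ht⟩
  have hlim : ∀ f : ℝ → ℝ, Continuous f → ∀ x, (∀ δ > 0, x ≤ f δ) → x ≤ f 0 := by
    intro f hf x hx
    refine ge_of_tendsto (hf.continuousAt.tendsto.mono_left nhdsWithin_le_nhds :
      Tendsto f (𝓝[>] 0) (𝓝 (f 0))) ?_
    exact eventually_nhdsWithin_of_forall fun δ hδ => hx δ hδ
  constructor
  · have := hlim (fun δ => δ + eps * M * (1 + δ + L * δ) / c) (by fun_prop) _
      (fun δ hδ => (hgen δ hδ).1)
    simpa using this
  · have := hlim (fun δ => δ + L * (δ + eps * M * (1 + δ + L * δ) / c)) (by fun_prop) _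
      (fun δ hδ => (hgen δ hδ).2)
    simpa using this

end PhaseODE

/-! ### Symbol coordinates -/

/-- The coefficient of the dominant exponential in the WKB form
`c = e^{z/ε} H⁻¹ (q + p)`, `d = e^{z/ε} i H (q - p)`. -/
noncomputable def pco (eps : ℝ) (z H c d : ℂ) : ℂ := exp (-z / eps) * (H * c + I * d / H) / 2

/-- The companion coefficient `q` in `c = e^{z/ε} H⁻¹ (q + p)`, `d = e^{z/ε} i H (q - p)`. -/
noncomputable def qco (eps : ℝ) (z H c d : ℂ) : ℂ := exp (-z / eps) * (H * c - I * d / H) / 2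

theorem pco_smul (eps : ℝ) (z H c d k : ℂ) : pco eps z H (k * c) (k * d) = k * pco eps z H c d := by
  unfold pco; ring

theorem qco_smul (eps : ℝ) (z H c d k : ℂ) : qco eps z H (k * c) (k * d) = k * qco eps z H c d := by
  unfold qco; ring

theorem pco_add (eps : ℝ) (z m H c d : ℂ) :
    pco eps (z + m) H c d = exp (-m / eps) * pco eps z H c d := by
  unfold pco
  rw [show -(z + m) / (eps : ℂ) = -z / eps + -m / eps by ring, exp_add]
  ring

theorem qco_add (eps : ℝ) (z m H c d : ℂ) :
    qco eps (z + m) H c d = exp (-m / eps) * qco eps z H c d := by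
  unfold qco
  rw [show -(z + m) / (eps : ℂ) = -z / eps + -m / eps by ring, exp_add]
  ring

theorem pco_neg (eps : ℝ) (z H c d : ℂ) : pco eps z (-H) c d = -pco eps z H c d := by
  unfold pco; rw [div_neg]; ring

theorem qco_neg (eps : ℝ) (z H c d : ℂ) : qco eps z (-H) c d = -qco eps z H c d := by
  unfold qco; rw [div_neg]; ring

theorem eq_of_pco_qco {eps : ℝ} {z H c d : ℂ} (hH : H ≠ 0) :
    c = exp (z / eps) * H⁻¹ * (qco eps z H c d + pco eps z H c d) ∧
      d = exp (z / eps) * (I * H) * (qco eps z H c d - pco eps z H c d) := by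
  have hE : exp (z / eps) * exp (-z / eps) = 1 := by
    rw [← exp_add, show z / (eps : ℂ) + -z / eps = 0 by ring, exp_zero]
  constructor
  · have : exp (z / eps) * H⁻¹ * (qco eps z H c d + pco eps z H c d)
        = (exp (z / eps) * exp (-z / eps)) * (H⁻¹ * H) * c := by
      unfold pco qco; ring
    rw [this, hE, inv_mul_cancel₀ hH]; ring
  · have : exp (z / eps) * (I * H) * (qco eps z H c d - pco eps z H c d)
        = (exp (z / eps) * exp (-z / eps)) * (H * H⁻¹) * -(I ^ 2) * d := by
      unfold pco qco; ring
    rw [this, hE, mul_inv_cancel₀ hH, I_sq]; ring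

theorem pco_of_wkb {eps : ℝ} {z H p q : ℂ} (hH : H ≠ 0) :
    pco eps z H (exp (z / eps) * H⁻¹ * (q + p))
      (exp (z / eps) * (I * H) * (q - p)) = p := by
  have hE : exp (-z / eps) * exp (z / eps) = 1 := by
    rw [← exp_add, show -z / (eps : ℂ) + z / eps = 0 by ring, exp_zero]
  unfold pco
  have : exp (-z / eps) * (H * (exp (z / eps) * H⁻¹ * (q + p)) +
      I * (exp (z / eps) * (I * H) * (q - p)) / H) / 2
      = (exp (-z / eps) * exp (z / eps)) * (H * H⁻¹)
        * ((q + p) + I ^ 2 * (q - p)) / 2 := by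
    rw [div_eq_mul_inv _ H]; ring
  rw [this, hE, mul_inv_cancel₀ hH, I_sq]; ring

theorem qco_of_wkb {eps : ℝ} {z H p q : ℂ} (hH : H ≠ 0) :
    qco eps z H (exp (z / eps) * H⁻¹ * (q + p))
      (exp (z / eps) * (I * H) * (q - p)) = q := by
  have hE : exp (-z / eps) * exp (z / eps) = 1 := by
    rw [← exp_add, show -z / (eps : ℂ) + z / eps = 0 by ring, exp_zero]
  unfold qco
  have : exp (-z / eps) * (H * (exp (z / eps) * H⁻¹ * (q + p)) -
      I * (exp (z / eps) * (I * H) * (q - p)) / H) / 2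
      = (exp (-z / eps) * exp (z / eps)) * (H * H⁻¹)
        * ((q + p) - I ^ 2 * (q - p)) / 2 := by
    rw [div_eq_mul_inv _ H]; ring
  rw [this, hE, mul_inv_cancel₀ hH, I_sq]; ring

section Transport

variable {𝕜 : Type*} [NontriviallyNormedField 𝕜] [NormedAlgebra 𝕜 ℂ]

/-- The symbol equations: if `ε c' = i g₊ x' d`, `ε d' = -i g₋ x' c`, where `z' = H² g₊ x'` and
`g₋ = H⁴ g₊`, then the symbol coordinates satisfy `p' = (H'/H) q` and
`q' = (H'/H) p - (2/ε) z' q`. -/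
theorem hasDerivAt_symbol {eps : ℝ} (heps : eps ≠ 0) {z H c d : 𝕜 → ℂ} {t : 𝕜} {z' H' : ℂ}
    (hH0 : H t ≠ 0) (hz : HasDerivAt z z' t) (hH : HasDerivAt H H' t)
    (hc : HasDerivAt c (I / eps * (z' / H t ^ 2) * d t) t)
    (hd : HasDerivAt d (-(I / eps) * (z' * H t ^ 2) * c t) t) :
    HasDerivAt (fun s => pco eps (z s) (H s) (c s) (d s))
        (H' / H t * qco eps (z t) (H t) (c t) (d t)) t ∧
      HasDerivAt (fun s => qco eps (z s) (H s) (c s) (d s))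
        (H' / H t * pco eps (z t) (H t) (c t) (d t)
          - 2 / eps * z' * qco eps (z t) (H t) (c t) (d t)) t := by
  have hE : (eps : ℂ) ≠ 0 := by exact_mod_cast heps
  have he : HasDerivAt (fun s => exp (-z s / eps))
      (exp (-z t / eps) * (-z' / eps)) t := (hz.neg.div_const _).cexp
  have h1 : HasDerivAt (fun s => H s * c s)
      (H' * c t + H t * (I / eps * (z' / H t ^ 2) * d t)) t := hH.mul hc
  have h2 : HasDerivAt (fun s => I * d s / H s)
      ((I * (-(I / eps) * (z' * H t ^ 2) * c t) * H t - I * d t * H')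
        / H t ^ 2) t := (hd.const_mul _).div hH hH0
  constructor
  · refine ((he.mul (h1.add h2)).div_const 2).congr_deriv ?_
    simp only [Pi.add_apply]
    unfold qco
    field_simp
    ring_nf
    rw [I_sq]
    ring
  · refine ((he.mul (h1.sub h2)).div_const 2).congr_deriv ?_
    simp only [Pi.sub_apply]
    unfold qco pco
    field_simp
    ring_nf
    rw [I_sq]
    ring

end Transport

/-! ### Primitives on simply connected domains -/

/-- The complex numbers with the discrete topology, the fibre of the covering space of germs of
primitives. -/
def DiscreteComplex : Type := ℂ

instance : TopologicalSpace DiscreteComplex := ⊥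

instance : DiscreteTopology DiscreteComplex := ⟨rfl⟩

/-- If `f` has a primitive `Fᵢ` on each member of a cover by balls, the germs of primitives of `f`
form a covering space; in the `i`-th chart the germ of `G` has the coordinate `G - Fᵢ`. -/
def primitiveCore {U : Set ℂ} {f : ℂ → ℂ} (r : U → ℝ) (hr : ∀ i, 0 < r i) (F : U → ℂ → ℂ)
    (hF : ∀ i : U, ∀ x ∈ ball (i : ℂ) (r i), HasDerivAt (F i) (f x) x) :
    FiberBundleCore U U DiscreteComplex where
  baseSet i := {x | (x : ℂ) ∈ ball (i : ℂ) (r i)}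
  isOpen_baseSet i := isOpen_ball.preimage continuous_subtype_val
  indexAt x := x
  mem_baseSet_at x := mem_ball_self (hr x)
  coordChange i j x v := (show ℂ from v) + (F i x - F j x)
  coordChange_self i x _ v := by
    change (show ℂ from v) + (F i x - F i x) = (show ℂ from v)
    ring
  continuousOn_coordChange i j := by
    rintro ⟨x, v⟩ ⟨⟨hxi, hxj⟩, -⟩
    refine ContinuousAt.continuousWithinAt ?_
    have hev : ∀ᶠ p : U × DiscreteComplex in 𝓝 (x, v),
        ((show ℂ from p.2) + (F i p.1 - F j p.1) : ℂ) = (show ℂ from v) + (F i x - F j x) := by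
      have h1 : ∀ᶠ p : U × DiscreteComplex in 𝓝 (x, v), p.2 = v :=
        have h0 : ∀ᶠ w in 𝓝 v, w = v := by rw [nhds_discrete]; exact eventually_pure.2 rfl
        ((continuous_snd : Continuous (Prod.snd : U × DiscreteComplex → _)).tendsto (x, v)).eventually h0
      obtain ⟨s, hs, hsub⟩ := isOpen_iff.1
        ((isOpen_ball (x := (i : ℂ)) (ε := r i)).inter
          (isOpen_ball (x := (j : ℂ)) (ε := r j))) x ⟨hxi, hxj⟩
      have h2 : ∀ᶠ p : U × DiscreteComplex in 𝓝 (x, v), (p.1 : ℂ) ∈ ball (x : ℂ) s :=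
        (continuous_subtype_val.comp continuous_fst).continuousAt.eventually
          (ball_mem_nhds _ hs)
      filter_upwards [h1, h2] with p hp1 hp2
      have hconst : F i p.1 - F j p.1 = F i x - F j x := by
        refine isOpen_ball.is_const_of_deriv_eq_zero (f := fun y => F i y - F j y)
          (convex_ball (x : ℂ) s).isPreconnected
          (fun y hy => ((hF i y (hsub hy).1).sub (hF j y (hsub hy).2)).differentiableAt
            |>.differentiableWithinAt) ?_ hp2 (mem_ball_self hs)
        intro y hy
        have := ((hF i y (hsub hy).1).sub (hF j y (hsub hy).2)).deriv
        rw [sub_self] at this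
        exact this
      rw [hp1, hconst]
    exact (continuousAt_const (y := (show DiscreteComplex from
      ((show ℂ from v) + (F i x - F j x) : ℂ)))).congr (hev.mono fun p hp => hp.symm)
  coordChange_comp i j k x _ v := by
    change ((show ℂ from v) + (F i x - F j x)) + (F j x - F k x)
      = (show ℂ from v) + (F i x - F k x)
    ring

/-- A holomorphic function on a simply connected open set has a primitive: the covering space of
germs of primitives has a section by the lifting theorem. -/
theorem exists_primitive_of_isSimplyConnected {U : Set ℂ} (hUo : IsOpen U)
    (hUc : IsSimplyConnected U) {f : ℂ → ℂ} (hf : DifferentiableOn ℂ f U) :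
    ∃ G : ℂ → ℂ, ∀ x ∈ U, HasDerivAt G (f x) x := by
  classical
  have := hUc.simplyConnectedSpace
  have := hUo.locallyPathConnectedSpace
  choose r hr hrU using fun i : U => isOpen_iff.1 hUo i i.2
  choose F hF using fun i : U => (hf.mono (hrU i)).isExactOn_ball
  let Z := primitiveCore r hr F hF
  have cov : IsCoveringMap Z.proj :=
    IsFiberBundle.isCoveringMap fun x => ⟨Z.localTrivAt x, Z.mem_localTrivAt_baseSet x⟩
  obtain ⟨x₀, hx₀⟩ := hUc.nonempty
  obtain ⟨s, ⟨-, hs⟩, -⟩ := cov.existsUnique_continuousMap_lifts (ContinuousMap.id U) ⟨x₀, hx₀⟩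
    (⟨⟨x₀, hx₀⟩, (show DiscreteComplex from (0 : ℂ))⟩ : Z.TotalSpace) rfl
  have hs1 : ∀ x : U, (s x).1 = x := fun x => congrFun hs x
  let v : U → ℂ := fun x => (show ℂ from (show DiscreteComplex from (s x).2))
  let G : ℂ → ℂ := fun x => if hx : x ∈ U then v ⟨x, hx⟩ + F ⟨x, hx⟩ x else 0
  refine ⟨G, fun x hx => ?_⟩
  let i : U := ⟨x, hx⟩
  have hcont : ContinuousAt (fun y : U => (Z.localTriv i (s y)).2) i := by
    have h1 : ContinuousAt (Z.localTriv i) (s i) := by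
      refine (Z.localTriv i).continuousOn_toFun.continuousAt ?_
      refine (Z.localTriv i).open_source.mem_nhds ?_
      change (s i).1 ∈ Z.baseSet i
      rw [hs1]
      exact mem_ball_self (hr i)
    exact continuousAt_snd.comp (ContinuousAt.comp (f := s) h1 s.continuous.continuousAt)
  have hval : ∀ y : U, (Z.localTriv i (s y)).2
      = (show DiscreteComplex from ((v y + (F y y - F i y) : ℂ))) := by
    intro y
    change ((show ℂ from (show DiscreteComplex from (s y).2)) + (F (s y).1 (s y).1 - F i (s y).1) : ℂ)
      = v y + (F y y - F i y)
    rw [hs1]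
  have hev : ∀ᶠ y : U in 𝓝 i, (v y + (F y y - F i y) : ℂ) = v i + (F i i - F i i) := by
    have h2 : ∀ᶠ w in 𝓝 (Z.localTriv i (s i)).2, w = (Z.localTriv i (s i)).2 := by
      rw [nhds_discrete]; exact eventually_pure.2 rfl
    filter_upwards [hcont.eventually h2] with y hy
    rw [hval, hval] at hy
    exact hy
  have hev' : ∀ᶠ y in 𝓝 x, G y = F i y + v i := by
    have h3 : ∀ᶠ y in 𝓝 x, ∃ hy : y ∈ U, (v ⟨y, hy⟩ + (F ⟨y, hy⟩ y - F i y) : ℂ) = v i := by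
      rw [nhds_subtype_eq_comap_nhdsWithin] at hev
      rw [eventually_comap] at hev
      rw [hUo.nhdsWithin_eq hx] at hev
      filter_upwards [hev, hUo.mem_nhds hx] with y hy hyU
      refine ⟨hyU, ?_⟩
      have := hy ⟨y, hyU⟩ rfl
      rw [sub_self, add_zero] at this
      exact this
    filter_upwards [h3] with y ⟨hy, hy2⟩
    have : G y = v ⟨y, hy⟩ + F ⟨y, hy⟩ y := dif_pos hy
    rw [this, ← hy2]
    ring
  exact ((hF i x (mem_ball_self (hr i))).add_const _).congr_of_eventuallyEq hev'

/-! ### Holomorphic linear systems of two equations -/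

/-- The pair `(u, v)` is a solution on `U` of `u' = a v`, `v' = b u`. -/
def IsSystemSolution (U : Set ℂ) (a b u v : ℂ → ℂ) : Prop :=
  ∀ x ∈ U, HasDerivAt u (a x * v x) x ∧ HasDerivAt v (b x * u x) x

/-- The determinant of two solutions is constant. -/
theorem IsSystemSolution.det_eq {U : Set ℂ} (hUo : IsOpen U) (hU : IsPreconnected U)
    {a b u v u' v' : ℂ → ℂ} (h : IsSystemSolution U a b u v) (h' : IsSystemSolution U a b u' v')
    {x y : ℂ} (hx : x ∈ U) (hy : y ∈ U) : u x * v' x - u' x * v x = u y * v' y - u' y * v y := by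
  have hd : ∀ w ∈ U, HasDerivAt (fun w => u w * v' w - u' w * v w) 0 w := by
    intro w hw
    refine (((h w hw).1.mul (h' w hw).2).sub ((h' w hw).1.mul (h w hw).2)).congr_deriv ?_
    ring
  exact hUo.is_const_of_deriv_eq_zero (f := fun w => u w * v' w - u' w * v w) hU
    (fun w hw => (hd w hw).differentiableAt.differentiableWithinAt)
    (fun w hw => (hd w hw).deriv) hx hy

/-- Existence on simply connected domains, by Picard iteration: the successive primitives are
summable near one point, and summability spreads to discs whose radius is bounded below on compact
sets. -/
theorem exists_isSystemSolution {U : Set ℂ} (hUo : IsOpen U) (hUc : IsSimplyConnected U)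
    {a b : ℂ → ℂ} (ha : DifferentiableOn ℂ a U) (hb : DifferentiableOn ℂ b U) {x₀ : ℂ}
    (hx₀ : x₀ ∈ U) (u₀ v₀ : ℂ) :
    ∃ u v : ℂ → ℂ, IsSystemSolution U a b u v ∧ u x₀ = u₀ ∧ v x₀ = v₀ := by
  classical
  -- one Picard step
  have hprim : ∀ f : ℂ → ℂ, DifferentiableOn ℂ f U →
      ∃ G : ℂ → ℂ, (∀ x ∈ U, HasDerivAt G (f x) x) ∧ G x₀ = 0 := by
    intro f hf
    obtain ⟨G, hG⟩ := exists_primitive_of_isSimplyConnected hUo hUc hf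
    exact ⟨fun x => G x - G x₀, fun x hx => (hG x hx).sub_const _, by simp⟩
  choose! Pr hPr hPr0 using hprim
  let W : ℕ → (ℂ → ℂ) × (ℂ → ℂ) := fun n => Nat.rec (fun _ => u₀, fun _ => v₀)
    (fun _ w => (Pr (fun x => a x * w.2 x), Pr (fun x => b x * w.1 x))) n
  have hWs : ∀ n, W (n + 1) = (Pr (fun x => a x * (W n).2 x), Pr (fun x => b x * (W n).1 x)) :=
    fun n => rfl
  have hWd : ∀ n, DifferentiableOn ℂ (W n).1 U ∧ DifferentiableOn ℂ (W n).2 U := by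
    intro n
    induction n with
    | zero => exact ⟨differentiableOn_const _, differentiableOn_const _⟩
    | succ n ih =>
      rw [hWs]
      exact ⟨fun x hx => (hPr _ (ha.mul ih.2) x hx).differentiableAt.differentiableWithinAt,
        fun x hx => (hPr _ (hb.mul ih.1) x hx).differentiableAt.differentiableWithinAt⟩
  have hW1 : ∀ n, ∀ x ∈ U, HasDerivAt (W (n + 1)).1 (a x * (W n).2 x) x := fun n x hx =>
    hPr _ (ha.mul (hWd n).2) x hx
  have hW2 : ∀ n, ∀ x ∈ U, HasDerivAt (W (n + 1)).2 (b x * (W n).1 x) x := fun n x hx =>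
    hPr _ (hb.mul (hWd n).1) x hx
  have hW0 : ∀ n, (W (n + 1)).1 x₀ = 0 ∧ (W (n + 1)).2 x₀ = 0 := fun n =>
    ⟨hPr0 _ (ha.mul (hWd n).2), hPr0 _ (hb.mul (hWd n).1)⟩
  -- summability at the centre of a small disc implies uniform summability on the disc
  have hstep : ∀ x : ℂ, ∀ s M : ℝ, 0 < s → 0 ≤ M → M * s ≤ 1 / 2 → closedBall x s ⊆ U →
      (∀ y ∈ closedBall x s, ‖a y‖ ≤ M ∧ ‖b y‖ ≤ M) →
      Summable (fun n => ‖(W n).1 x‖ + ‖(W n).2 x‖) →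
      ∃ B : ℕ → ℝ, Summable B ∧
        ∀ n, ∀ y ∈ closedBall x s, ‖(W n).1 y‖ ≤ B n ∧ ‖(W n).2 y‖ ≤ B n := by
    intro x s M hs hM hMs hsU hab hsum
    set D : ℕ → ℝ := fun n => ‖(W n).1 x‖ + ‖(W n).2 x‖ with hD
    let B : ℕ → ℝ := fun n => Nat.rec (‖u₀‖ + ‖v₀‖) (fun k w => D (k + 1) + 1 / 2 * w) n
    have hBs : ∀ n, B (n + 1) = D (n + 1) + 1 / 2 * B n := fun n => rfl
    have hD0 : ∀ n, 0 ≤ D n := fun n => add_nonneg (norm_nonneg _) (norm_nonneg _)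
    have hB0 : ∀ n, 0 ≤ B n := by
      intro n
      induction n with
      | zero => exact add_nonneg (norm_nonneg _) (norm_nonneg _)
      | succ n ih => rw [hBs]; linarith [hD0 (n + 1)]
    refine ⟨B, ?_, ?_⟩
    · have hle : ∀ N, ∑ n ∈ Finset.range N, B n ≤ 2 * (B 0 + ∑' n, D n) := by
        intro N
        have h2 : ∀ N, ∑ n ∈ Finset.range (N + 1), B n
            ≤ B 0 + ∑ n ∈ Finset.range (N + 1), D n + 1 / 2 * ∑ n ∈ Finset.range N, B n := by
          intro N
          rw [Finset.sum_range_succ', Finset.sum_range_succ' (fun n => D n)]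
          simp_rw [hBs]
          rw [Finset.sum_add_distrib, ← Finset.mul_sum]
          linarith [hD0 0]
        have h3 : ∀ N, ∑ n ∈ Finset.range N, D n ≤ ∑' n, D n := fun N =>
          hsum.sum_le_tsum _ (fun n _ => hD0 n)
        have h4 : ∑ n ∈ Finset.range N, B n ≤ ∑ n ∈ Finset.range (N + 1), B n :=
          Finset.sum_le_sum_of_subset_of_nonneg (Finset.range_mono (Nat.le_succ N))
            (fun n _ _ => hB0 n)
        linarith [h2 N, h3 (N + 1)]
      exact summable_of_sum_range_le hB0 hle
    · intro n
      induction n with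
      | zero =>
        intro y _
        exact ⟨le_add_of_nonneg_right (norm_nonneg v₀), le_add_of_nonneg_left (norm_nonneg u₀)⟩
      | succ n ih =>
        intro y hy
        have hxs : x ∈ closedBall x s := mem_closedBall_self hs.le
        have hys : ‖y - x‖ ≤ s := by rwa [mem_closedBall_iff_norm] at hy
        have hbd : ∀ (g g' : ℂ → ℂ), (∀ w ∈ closedBall x s, HasDerivAt g (g' w) w) →
            (∀ w ∈ closedBall x s, ‖g' w‖ ≤ M * B n) → ‖g y‖ ≤ ‖g x‖ + 1 / 2 * B n := by
          intro g g' hg hg'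
          have h1 := (convex_closedBall x s).norm_image_sub_le_of_norm_hasDerivWithin_le
            (fun w hw => (hg w hw).hasDerivWithinAt) hg' hxs hy
          have h2 : M * B n * ‖y - x‖ ≤ 1 / 2 * B n := by
            have := mul_le_mul_of_nonneg_left hys (mul_nonneg hM (hB0 n))
            nlinarith [hB0 n]
          calc ‖g y‖ = ‖g x + (g y - g x)‖ := by ring_nf
            _ ≤ ‖g x‖ + ‖g y - g x‖ := norm_add_le _ _
            _ ≤ _ := by linarith
        have h1 := hbd _ _ (fun w hw => hW1 n w (hsU hw)) (fun w hw => by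
          rw [norm_mul]
          exact mul_le_mul (hab w hw).1 (ih w hw).2 (norm_nonneg _) hM)
        have h2 := hbd _ _ (fun w hw => hW2 n w (hsU hw)) (fun w hw => by
          rw [norm_mul]
          exact mul_le_mul (hab w hw).2 (ih w hw).1 (norm_nonneg _) hM)
        rw [hBs]
        constructor
        · have : ‖(W (n + 1)).1 x‖ ≤ D (n + 1) := le_add_of_nonneg_right (norm_nonneg _)
          linarith
        · have : ‖(W (n + 1)).2 x‖ ≤ D (n + 1) := le_add_of_nonneg_left (norm_nonneg _)
          linarith
  have hlocal : ∀ x ∈ U, ∃ s > 0, closedBall x (2 * s) ⊆ U ∧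
      ∃ M : ℝ, 0 ≤ M ∧ M * s ≤ 1 / 2 ∧
        ∀ y ∈ closedBall x (2 * s), ‖a y‖ ≤ M ∧ ‖b y‖ ≤ M := by
    intro x hx
    have hca := (ha.continuousOn.continuousAt (hUo.mem_nhds hx)).norm
    have hcb := (hb.continuousOn.continuousAt (hUo.mem_nhds hx)).norm
    set M : ℝ := ‖a x‖ + ‖b x‖ + 1 with hM
    have h1 : ∀ᶠ y in 𝓝 x, y ∈ U ∧ ‖a y‖ < M ∧ ‖b y‖ < M := by
      filter_upwards [hUo.mem_nhds hx,
        hca.eventually_lt_const (show ‖a x‖ < M by linarith [norm_nonneg (b x)]),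
        hcb.eventually_lt_const (show ‖b x‖ < M by linarith [norm_nonneg (a x)])]
        with y h1 h2 h3 using ⟨h1, h2, h3⟩
    obtain ⟨s, hs, hsub⟩ := nhds_basis_closedBall.eventually_iff.1 h1
    have hM0 : 0 < M := by positivity
    refine ⟨min (s / 2) (1 / (2 * M)), by positivity, fun y hy => ?_, M, hM0.le, ?_, fun y hy => ?_⟩
    · exact (hsub (closedBall_subset_closedBall
        (by linarith [min_le_left (s / 2) (1 / (2 * M))]) hy)).1
    · calc M * min (s / 2) (1 / (2 * M)) ≤ M * (1 / (2 * M)) := by gcongr; exact min_le_right _ _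
        _ = 1 / 2 := by field_simp
    · have := (hsub (closedBall_subset_closedBall
        (by linarith [min_le_left (s / 2) (1 / (2 * M))]) hy)).2
      exact ⟨this.1.le, this.2.le⟩
  -- discs around nearby points
  have hspread : ∀ x ∈ U, ∃ s > 0, ∀ y ∈ closedBall x s,
      Summable (fun n => ‖(W n).1 y‖ + ‖(W n).2 y‖) → ∃ B : ℕ → ℝ, Summable B ∧
        ∀ n, ∀ w ∈ closedBall y s, ‖(W n).1 w‖ ≤ B n ∧ ‖(W n).2 w‖ ≤ B n := by
    intro x hx
    obtain ⟨s, hs, hsU, M, hM, hMs, hab⟩ := hlocal x hx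
    refine ⟨s, hs, fun y hy hsum => ?_⟩
    have hsub : closedBall y s ⊆ closedBall x (2 * s) := by
      refine closedBall_subset_closedBall' ?_
      rw [mem_closedBall] at hy
      linarith
    exact hstep y s M hs hM hMs (hsub.trans hsU) (fun w hw => hab w (hsub hw)) hsum
  have hsumof : ∀ B : ℕ → ℝ, Summable B → ∀ y, (∀ n, ‖(W n).1 y‖ ≤ B n ∧ ‖(W n).2 y‖ ≤ B n) →
      Summable (fun n => ‖(W n).1 y‖ + ‖(W n).2 y‖) := by
    intro B hB y hy
    refine Summable.of_nonneg_of_le (fun n => add_nonneg (norm_nonneg _) (norm_nonneg _))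
      (fun n => add_le_add (hy n).1 (hy n).2) (hB.add hB)
  have hTx₀ : Summable (fun n => ‖(W n).1 x₀‖ + ‖(W n).2 x₀‖) := by
    refine summable_of_ne_finset_zero (s := {0}) fun n hn => ?_
    obtain ⟨m, rfl⟩ := Nat.exists_eq_succ_of_ne_zero (by simpa using hn)
    rw [(hW0 m).1, (hW0 m).2]; simp
  have hUT : ∀ x ∈ U, ∃ s > 0, ∃ B : ℕ → ℝ, Summable B ∧
      ∀ n, ∀ y ∈ ball x s, ‖(W n).1 y‖ ≤ B n ∧ ‖(W n).2 y‖ ≤ B n := by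
    have hpre : U ⊆ {x | ∃ s > 0, ∃ B : ℕ → ℝ, Summable B ∧
      ∀ n, ∀ y ∈ ball x s, ‖(W n).1 y‖ ≤ B n ∧ ‖(W n).2 y‖ ≤ B n} := by
      refine hUc.isPathConnected.isConnected.isPreconnected.subset_of_closure_inter_subset ?_
        ⟨x₀, hx₀, ?_⟩ ?_
      · rw [isOpen_iff_mem_nhds]
        rintro x ⟨s, hs, B, hB, h⟩
        filter_upwards [ball_mem_nhds x (half_pos hs)] with y hy
        refine ⟨s / 2, half_pos hs, B, hB, fun n w hw => h n w ?_⟩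
        rw [mem_ball] at *
        linarith [dist_triangle w y x]
      · obtain ⟨s, hs, h⟩ := hspread x₀ hx₀
        obtain ⟨B, hB, hB'⟩ := h x₀ (mem_closedBall_self hs.le) hTx₀
        exact ⟨s, hs, B, hB, fun n y hy => hB' n y (ball_subset_closedBall hy)⟩
      · rintro x ⟨hxcl, hxU⟩
        obtain ⟨s, hs, h⟩ := hspread x hxU
        obtain ⟨y, ⟨t, ht, B, hB, hy⟩, hyx⟩ := mem_closure_iff.1 hxcl (s / 2) (half_pos hs)
        obtain ⟨B', hB', h'⟩ := h y (by
          rw [mem_closedBall, dist_comm]; linarith)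
          (hsumof B hB y fun n => hy n y (mem_ball_self ht))
        refine ⟨s / 2, half_pos hs, B', hB', fun n w hw => h' n w ?_⟩
        rw [mem_ball] at hw
        rw [mem_closedBall]
        linarith [dist_triangle w x y]
    exact hpre
  refine ⟨fun x => ∑' n, (W n).1 x, fun x => ∑' n, (W n).2 x, fun x hx => ?_, ?_, ?_⟩
  · obtain ⟨s, hs, B, hB, hbd⟩ := hUT x hx
    obtain ⟨s', hs', hsU⟩ := isOpen_iff.1 hUo x hx
    set N := ball x (min s s')
    have hNo : IsOpen N := isOpen_ball
    have hxN : x ∈ N := mem_ball_self (lt_min hs hs')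
    have hNU : N ⊆ U := (ball_subset_ball (min_le_right _ _)).trans hsU
    have hNs : N ⊆ ball x s := ball_subset_ball (min_le_left _ _)
    have hsum1 : ∀ y ∈ N, Summable (fun n => (W n).1 y) := fun y hy =>
      Summable.of_norm_bounded hB (fun n => (hbd n y (hNs hy)).1)
    have hsum2 : ∀ y ∈ N, Summable (fun n => (W n).2 y) := fun y hy =>
      Summable.of_norm_bounded hB (fun n => (hbd n y (hNs hy)).2)
    have key : ∀ (g g' : ℕ → ℂ → ℂ) (e : ℂ), (∀ n, DifferentiableOn ℂ (g n) U) →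
        (∀ n, ∀ y ∈ N, ‖g n y‖ ≤ B n) → (∀ n, HasDerivAt (g (n + 1)) (e * g' n x) x) →
        deriv (g 0) x = 0 →
        HasDerivAt (fun y => ∑' n, g n y) (e * ∑' n, g' n x) x := by
      intro g g' e hg hgB hgd hg0
      have h1 : DifferentiableAt ℂ (fun y => ∑' n, g n y) x :=
        (Complex.differentiableOn_tsum_of_summable_norm hB (fun n => (hg n).mono hNU) hNo
          hgB).differentiableAt (hNo.mem_nhds hxN)
      have h2 := Complex.hasSum_deriv_of_summable_norm hB (fun n => (hg n).mono hNU) hNo hgB hxN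
      refine h1.hasDerivAt.congr_deriv ?_
      rw [← h2.tsum_eq, h2.summable.tsum_eq_zero_add, hg0, zero_add, ← tsum_mul_left]
      exact tsum_congr fun n => (hgd n).deriv
    exact ⟨key (fun n => (W n).1) (fun n => (W n).2) (a x) (fun n => (hWd n).1)
        (fun n y hy => (hbd n y (hNs hy)).1) (fun n => hW1 n x hx) (deriv_const x u₀),
      key (fun n => (W n).2) (fun n => (W n).1) (b x) (fun n => (hWd n).2)
        (fun n y hy => (hbd n y (hNs hy)).2) (fun n => hW2 n x hx) (deriv_const x v₀)⟩
  · refine (tsum_eq_single 0 fun n hn => ?_).trans rfl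
    obtain ⟨m, rfl⟩ := Nat.exists_eq_succ_of_ne_zero hn
    exact (hW0 m).1
  · refine (tsum_eq_single 0 fun n hn => ?_).trans rfl
    obtain ⟨m, rfl⟩ := Nat.exists_eq_succ_of_ne_zero hn
    exact (hW0 m).2

/-- A solution on a preconnected subdomain that agrees at a point with a global solution agrees
with it everywhere; by constancy of determinants with a fundamental system. -/
theorem IsSystemSolution.eqOn {U N : Set ℂ} (hUo : IsOpen U) (hUc : IsSimplyConnected U)
    {a b : ℂ → ℂ} (ha : DifferentiableOn ℂ a U) (hb : DifferentiableOn ℂ b U)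
    (hNo : IsOpen N) (hN : IsPreconnected N) (hNU : N ⊆ U) {u v u' v' : ℂ → ℂ}
    (h : IsSystemSolution N a b u v) (h' : IsSystemSolution N a b u' v') {x₀ : ℂ} (hx₀ : x₀ ∈ N)
    (hu : u x₀ = u' x₀) (hv : v x₀ = v' x₀) {x : ℂ} (hx : x ∈ N) : u x = u' x ∧ v x = v' x := by
  obtain ⟨u₁, v₁, h₁, h₁u, h₁v⟩ := exists_isSystemSolution hUo hUc ha hb (hNU hx₀) 1 0
  obtain ⟨u₂, v₂, h₂, h₂u, h₂v⟩ := exists_isSystemSolution hUo hUc ha hb (hNU hx₀) 0 1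
  have r₁ : IsSystemSolution N a b u₁ v₁ := fun y hy => h₁ y (hNU hy)
  have r₂ : IsSystemSolution N a b u₂ v₂ := fun y hy => h₂ y (hNU hy)
  have e12 := r₁.det_eq hNo hN r₂ hx hx₀
  have e1 := h.det_eq hNo hN r₁ hx hx₀
  have e1' := h'.det_eq hNo hN r₁ hx hx₀
  have e2 := h.det_eq hNo hN r₂ hx hx₀
  have e2' := h'.det_eq hNo hN r₂ hx hx₀
  rw [h₁u, h₁v] at e1 e1'
  rw [h₂u, h₂v] at e2 e2'
  rw [h₁u, h₁v, h₂u, h₂v] at e12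
  rw [hu, hv] at e1 e2
  have d1 : (u x - u' x) * v₁ x = u₁ x * (v x - v' x) := by linear_combination e1 - e1'
  have d2 : (u x - u' x) * v₂ x = u₂ x * (v x - v' x) := by linear_combination e2 - e2'
  constructor
  · have : u x - u' x = 0 := by linear_combination (u₁ x) * d2 - (u₂ x) * d1 - (u x - u' x) * e12
    exact sub_eq_zero.1 this
  · have : v x - v' x = 0 := by linear_combination (v₁ x) * d2 - (v₂ x) * d1 - (v x - v' x) * e12
    exact sub_eq_zero.1 this

/-! ### Gauge reduction of the Dirac system -/

variable {A S : ℂ → ℂ} {Om : Set ℂ} {eps : ℝ} {lam lam₀ : ℂ}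

/-- The system `ε c' = i g₊ d`, `ε d' = -i g₋ c`, to which the Dirac system reduces after removing
the phases `exp(± i S / 2ε)` and a constant change of basis. -/
def IsReduced (A S : ℂ → ℂ) (Om : Set ℂ) (eps : ℝ) (lam : ℂ) (c d : ℂ → ℂ) : Prop :=
  IsSystemSolution Om (fun x => I / eps * gPlus A S x lam)
    (fun x => -(I / eps) * gMinus A S x lam) c d

/-- The first component of the reduced form of a vector function. -/
noncomputable def redC (S : ℂ → ℂ) (eps : ℝ) (u : ℂ → Fin 2 → ℂ) (x : ℂ) : ℂ :=
  (exp (-(I * S x) / (2 * eps)) * u x 0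
    - exp (I * S x / (2 * eps)) * u x 1) / 2

/-- The second component of the reduced form of a vector function. -/
noncomputable def redD (S : ℂ → ℂ) (eps : ℝ) (u : ℂ → Fin 2 → ℂ) (x : ℂ) : ℂ :=
  (exp (-(I * S x) / (2 * eps)) * u x 0
    + exp (I * S x / (2 * eps)) * u x 1) / 2

/-- The vector function with given reduced form. -/
noncomputable def unred (S : ℂ → ℂ) (eps : ℝ) (c d : ℂ → ℂ) (x : ℂ) : Fin 2 → ℂ :=
  ![exp (I * S x / (2 * eps)) * (c x + d x),
    exp (-(I * S x) / (2 * eps)) * (-c x + d x)]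

theorem exp_phase_mul (S : ℂ → ℂ) (eps : ℝ) (x : ℂ) :
    exp (I * S x / (2 * eps)) * exp (-(I * S x) / (2 * eps)) = 1 := by
  rw [← exp_add, ← exp_zero]
  congr 1
  ring

theorem unred_red (S : ℂ → ℂ) (eps : ℝ) (u : ℂ → Fin 2 → ℂ) :
    unred S eps (redC S eps u) (redD S eps u) = u := by
  have h := exp_phase_mul S eps
  funext x i
  fin_cases i
  · simp only [unred, redC, redD, Fin.zero_eta, Fin.isValue, Matrix.cons_val_zero]
    linear_combination (u x 0) * h x
  · simp only [unred, redC, redD, Fin.mk_one, Fin.isValue, Matrix.cons_val_one,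
      Matrix.cons_val_fin_one]
    linear_combination (u x 1) * h x

theorem wr_eq (S : ℂ → ℂ) (eps : ℝ) (u v : ℂ → Fin 2 → ℂ) (x : ℂ) :
    wr u v x = 2 * (redC S eps u x * redD S eps v x - redC S eps v x * redD S eps u x) := by
  have h := exp_phase_mul S eps x
  simp only [redC, redD, wr]
  linear_combination (-(u x 0 * v x 1) + v x 0 * u x 1) * h

theorem pot_eq (A S : ℂ → ℂ) (eps : ℝ) (x : ℂ) :
    pot A S eps x = -I * A x * exp (I * S x / (2 * eps)) ^ 2 := by
  rw [pot, ← exp_nat_mul]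
  congr 2
  push_cast
  ring

theorem potConj_eq (A S : ℂ → ℂ) (eps : ℝ) (x : ℂ) :
    potConj A S eps x = I * A x * exp (-(I * S x) / (2 * eps)) ^ 2 := by
  rw [potConj, ← exp_nat_mul]
  congr 2
  push_cast
  ring

theorem hasDerivAt_exp_phase {x : ℂ} (hS : DifferentiableAt ℂ S x) :
    HasDerivAt (fun y => exp (I * S y / (2 * eps)))
      (exp (I * S x / (2 * eps)) * (I * deriv S x / (2 * eps))) x :=
  ((hS.hasDerivAt.const_mul _).div_const _).cexp

theorem hasDerivAt_exp_neg_phase {x : ℂ} (hS : DifferentiableAt ℂ S x) :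
    HasDerivAt (fun y => exp (-(I * S y) / (2 * eps)))
      (exp (-(I * S x) / (2 * eps)) * (-(I * deriv S x) / (2 * eps))) x :=
  ((hS.hasDerivAt.const_mul _).neg.div_const _).cexp

theorem IsDiracSolution.isReduced (heps : eps ≠ 0) (hOm : IsOpen Om) (hS : DifferentiableOn ℂ S Om)
    {u : ℂ → Fin 2 → ℂ} (hu : IsDiracSolution A S Om eps lam u) :
    IsReduced A S Om eps lam (redC S eps u) (redD S eps u) := by
  intro x hx
  have hE : (eps : ℂ) ≠ 0 := by exact_mod_cast heps
  obtain ⟨h0, h1, e0, e1⟩ := hu x hx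
  have hSx := hS.differentiableAt (hOm.mem_nhds hx)
  have d0 : deriv (fun y => u y 0) x = I / eps * (-lam * u x 0 + pot A S eps x * u x 1) := by
    rw [← e0]; field_simp
  have d1 : deriv (fun y => u y 1) x = I / eps * (potConj A S eps x * u x 0 + lam * u x 1) := by
    rw [← e1]; field_simp
  have H0 := (hasDerivAt_exp_neg_phase (eps := eps) hSx).mul h0.hasDerivAt
  have H1 := (hasDerivAt_exp_phase (eps := eps) hSx).mul h1.hasDerivAt
  rw [d0, pot_eq] at H0
  rw [d1, potConj_eq] at H1
  have hm := exp_phase_mul S eps x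
  constructor
  · refine ((H0.sub H1).div_const 2).congr_deriv ?_
    simp only [redD, gPlus]
    generalize exp (I * S x / (2 * eps)) = E at hm ⊢
    generalize exp (-(I * S x) / (2 * eps)) = E' at hm ⊢
    field_simp
    linear_combination (I * A x * E * u x 1 + I * A x * E' * u x 0) * (-2) * hm
  · refine ((H0.add H1).div_const 2).congr_deriv ?_
    simp only [redC, gMinus]
    generalize exp (I * S x / (2 * eps)) = E at hm ⊢
    generalize exp (-(I * S x) / (2 * eps)) = E' at hm ⊢
    field_simp
    linear_combination (I * A x * E * u x 1 - I * A x * E' * u x 0) * (-2) * hm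

theorem IsReduced.isDiracSolution (heps : eps ≠ 0) (hOm : IsOpen Om)
    (hS : DifferentiableOn ℂ S Om) {c d : ℂ → ℂ} (h : IsReduced A S Om eps lam c d) :
    IsDiracSolution A S Om eps lam (unred S eps c d) := by
  intro x hx
  have hE : (eps : ℂ) ≠ 0 := by exact_mod_cast heps
  obtain ⟨hc, hd⟩ := h x hx
  have hSx := hS.differentiableAt (hOm.mem_nhds hx)
  have H0 := (hasDerivAt_exp_phase (eps := eps) hSx).mul (hc.add hd)
  have H1 := (hasDerivAt_exp_neg_phase (eps := eps) hSx).mul (hc.neg.add hd)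
  have G0 : HasDerivAt (fun y => unred S eps c d y 0) _ x := H0
  have G1 : HasDerivAt (fun y => unred S eps c d y 1) _ x := H1
  have hm := exp_phase_mul S eps x
  have hI := I_sq
  refine ⟨G0.differentiableAt, G1.differentiableAt, ?_, ?_⟩
  · rw [G0.deriv, pot_eq]
    simp only [unred, Fin.isValue, Matrix.cons_val_zero, Matrix.cons_val_one,
      Matrix.cons_val_fin_one, gPlus, gMinus, Pi.add_apply]
    set E := exp (I * S x / (2 * eps))
    set E' := exp (-(I * S x) / (2 * eps))
    field_simp
    linear_combination (-I * A x * E * (d x - c x)) * (-2) * hm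
  · rw [G1.deriv, potConj_eq]
    simp only [unred, Fin.isValue, Matrix.cons_val_zero, Matrix.cons_val_one,
      Matrix.cons_val_fin_one, gPlus, gMinus, Pi.add_apply, Pi.neg_apply]
    set E := exp (I * S x / (2 * eps))
    set E' := exp (-(I * S x) / (2 * eps))
    field_simp
    linear_combination (I * A x * E' * (d x + c x)) * (-2) * hm

theorem wkb_mulVec (E E' a b c d p q : ℂ) :
    (!![E, 0; 0, E'] * !![1, 1; -1, 1] * !![a, b; c, d]).mulVec ![p, q]
      = ![E * ((a + c) * p + (b + d) * q), E' * ((c - a) * p + (d - b) * q)] := by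
  funext i
  fin_cases i <;> simp [Matrix.mul_apply, Fin.sum_univ_two, Matrix.mulVec, dotProduct] <;> ring

/-- The reduced form of a WKB vector. The two signs `s = κ²`, `κ = 1` or `κ = i`, are related by
the substitution `z ↦ -z`, `H ↦ i H`. -/
theorem red_wkbVector {s κ : ℂ} (hκ : (s = 1 ∧ κ = 1) ∨ (s = -1 ∧ κ = I)) {z H : ℂ → ℂ}
    {x p q : ℂ} {u : ℂ → Fin 2 → ℂ} (hu : u x = wkbVector S eps s z H x p q) :
    redC S eps u x = κ * (exp (κ ^ 2 * z x / eps) * (κ * H x)⁻¹ * (q + p)) ∧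
      redD S eps u x
        = κ * (exp (κ ^ 2 * z x / eps) * (I * (κ * H x)) * (q - p)) := by
  have hm := exp_phase_mul S eps x
  have h11 : ¬ (-1 : ℂ) = 1 := by norm_num
  have hI : I * I⁻¹ = 1 := mul_inv_cancel₀ Complex.I_ne_zero
  have hI2 := I_sq
  rcases hκ with ⟨rfl, rfl⟩ | ⟨rfl, rfl⟩
  · simp only [redC, redD, hu, wkbVector, if_true, wkb_mulVec, Pi.smul_apply, smul_eq_mul,
      Matrix.cons_val_zero, Matrix.cons_val_one, Matrix.cons_val_fin_one, Fin.isValue, one_pow,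
      one_mul]
    generalize exp (I * S x / (2 * eps)) = E at hm ⊢
    generalize exp (-(I * S x) / (2 * eps)) = E' at hm ⊢
    constructor
    · linear_combination (exp (z x / eps) * (H x)⁻¹ * (q + p)) * hm
    · linear_combination (exp (z x / eps) * (I * H x) * (q - p)) * hm
  · simp only [redC, redD, hu, wkbVector, if_neg h11, wkb_mulVec, Pi.smul_apply, smul_eq_mul,
      Matrix.cons_val_zero, Matrix.cons_val_one, Matrix.cons_val_fin_one, Fin.isValue, hI2,
      mul_inv]
    generalize exp (I * S x / (2 * eps)) = E at hm ⊢
    generalize exp (-(I * S x) / (2 * eps)) = E' at hm ⊢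
    constructor
    · linear_combination (exp (-1 * z x / eps) * (H x)⁻¹ * (q + p)) * hm
        - (exp (-1 * z x / eps) * (H x)⁻¹ * (q + p)) * hI
    · linear_combination (exp (-1 * z x / eps) * (I * H x) * (p - q)) * hm
        - (exp (-1 * z x / eps) * (I * H x) * (q - p)) * hI2

/-- The symbol coordinates of a WKB vector, with respect to the phase `κ² z` and amplitude
`κ H`. -/
theorem pco_qco_wkbVector {s κ : ℂ} (hκ : (s = 1 ∧ κ = 1) ∨ (s = -1 ∧ κ = I))
    {z H : ℂ → ℂ} {x p q : ℂ} (hH : H x ≠ 0) {u : ℂ → Fin 2 → ℂ}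
    (hu : u x = wkbVector S eps s z H x p q) :
    pco eps (κ ^ 2 * z x) (κ * H x) (redC S eps u x) (redD S eps u x) = κ * p ∧
      qco eps (κ ^ 2 * z x) (κ * H x) (redC S eps u x) (redD S eps u x) = κ * q := by
  have hκ0 : κ ≠ 0 := by rcases hκ with ⟨-, rfl⟩ | ⟨-, rfl⟩ <;> simp
  obtain ⟨h1, h2⟩ := red_wkbVector hκ hu
  rw [h1, h2, pco_smul, qco_smul, pco_of_wkb (mul_ne_zero hκ0 hH), qco_of_wkb (mul_ne_zero hκ0 hH)]
  exact ⟨rfl, rfl⟩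

/-! ### Analyticity of the coefficients -/

theorem IsPotentialPair.differentiableOn_dS (h : IsPotentialPair A S Om) :
    DifferentiableOn ℂ (deriv S) Om := h.holo_S.deriv h.isOpen

theorem hasDerivAt_gPlus (h : IsPotentialPair A S Om) {x : ℂ} (hx : x ∈ Om) :
    HasDerivAt (fun y => gPlus A S y lam)
      (-(deriv (deriv S) x / 2 + I * deriv A x)) x := by
  have h1 := (h.differentiableOn_dS.differentiableAt (h.isOpen.mem_nhds hx)).hasDerivAt
  have h2 := (h.holo_A.differentiableAt (h.isOpen.mem_nhds hx)).hasDerivAt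
  exact (((h1.div_const 2).const_add lam).add (h2.const_mul _)).neg

theorem hasDerivAt_gMinus (h : IsPotentialPair A S Om) {x : ℂ} (hx : x ∈ Om) :
    HasDerivAt (fun y => gMinus A S y lam)
      (deriv (deriv S) x / 2 - I * deriv A x) x := by
  have h1 := (h.differentiableOn_dS.differentiableAt (h.isOpen.mem_nhds hx)).hasDerivAt
  have h2 := (h.holo_A.differentiableAt (h.isOpen.mem_nhds hx)).hasDerivAt
  exact ((h1.div_const 2).const_add lam).sub (h2.const_mul _)

theorem hasDerivAt_V₀ (h : IsPotentialPair A S Om) {x : ℂ} (hx : x ∈ Om) :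
    HasDerivAt (fun y => V₀ A S y lam)
      (-((lam + deriv S x / 2) * deriv (deriv S) x) - 2 * A x * deriv A x) x := by
  have h1 := (h.differentiableOn_dS.differentiableAt (h.isOpen.mem_nhds hx)).hasDerivAt
  have h2 := (h.holo_A.differentiableAt (h.isOpen.mem_nhds hx)).hasDerivAt
  refine ((((h1.div_const 2).const_add lam).pow 2).neg.sub (h2.pow 2)).congr_deriv ?_
  push_cast
  ring

theorem exists_isReduced (h : IsPotentialPair A S Om) {x₀ : ℂ} (hx₀ : x₀ ∈ Om) (c₀ d₀ : ℂ) :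
    ∃ c d : ℂ → ℂ, IsReduced A S Om eps lam c d ∧ c x₀ = c₀ ∧ d x₀ = d₀ :=
  exists_isSystemSolution h.isOpen h.isSimplyConnected
    (fun _ hx => ((hasDerivAt_gPlus h hx).const_mul _).differentiableAt.differentiableWithinAt)
    (fun _ hx => ((hasDerivAt_gMinus h hx).const_mul _).differentiableAt.differentiableWithinAt)
    hx₀ c₀ d₀

theorem wr_const (h : IsPotentialPair A S Om) (heps : eps ≠ 0) {u v : ℂ → Fin 2 → ℂ}
    (hu : IsDiracSolution A S Om eps lam u) (hv : IsDiracSolution A S Om eps lam v) {x y : ℂ}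
    (hx : x ∈ Om) (hy : y ∈ Om) : wr u v x = wr u v y := by
  rw [wr_eq S eps, wr_eq S eps]
  congr 1
  exact (hu.isReduced heps h.isOpen h.holo_S).det_eq h.isOpen
    h.isSimplyConnected.isPathConnected.isConnected.isPreconnected
    (hv.isReduced heps h.isOpen h.holo_S) hx hy

/-! ### Branches of the phase, and propagation along progressive paths -/

/-- At `x`, the function `z` is a branch of the phase and `H` a compatible branch of
`(g₋ / g₊)^(1/4)`. -/
structure IsBranchAt (A S : ℂ → ℂ) (Om : Set ℂ) (lam : ℂ) (z H : ℂ → ℂ) (x : ℂ) : Prop where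
  mem : x ∈ Om
  hasDerivAt : HasDerivAt z (H x ^ 2 * gPlus A S x lam) x
  diff : DifferentiableAt ℂ H x
  ne : H x ≠ 0
  gPlus_ne : gPlus A S x lam ≠ 0
  pow : H x ^ 4 * gPlus A S x lam = gMinus A S x lam

/-- Branches of the phase and of the amplitude on domains depending on the spectral parameter;
the phase is jointly continuous at `lam₀`. No continuity of `H` in `lam` is required: `H` is
determined by the phase up to a sign. -/
structure BranchFamily (A S : ℂ → ℂ) (Om : Set ℂ) (lam₀ : ℂ) where
  D : ℂ → Set ℂ
  Z : ℂ → ℂ → ℂ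
  H : ℂ → ℂ → ℂ
  mem_nhds : ∀ x ∈ D lam₀, ∀ᶠ p : ℂ × ℂ in 𝓝 (x, lam₀), p.1 ∈ D p.2
  cont : ∀ x ∈ D lam₀, ContinuousAt (fun p : ℂ × ℂ => Z p.1 p.2) (x, lam₀)
  isOpen : ∀ᶠ lam in 𝓝 lam₀, IsOpen (D lam)
  good : ∀ᶠ lam in 𝓝 lam₀, ∀ x ∈ D lam,
    IsBranchAt A S Om lam (fun y => Z y lam) (fun y => H y lam) x

/-- The logarithmic derivative of `(g₋ / g₊)^(1/4)`, a meromorphic function that does not depend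
on the branch. -/
noncomputable def logDerivH (A S : ℂ → ℂ) (x lam : ℂ) : ℂ :=
  ((deriv (deriv S) x / 2 - I * deriv A x) / gMinus A S x lam
    + (deriv (deriv S) x / 2 + I * deriv A x) / gPlus A S x lam) / 4

theorem IsBranchAt.gMinus_ne {lam : ℂ} {z H : ℂ → ℂ} {x : ℂ}
    (h : IsBranchAt A S Om lam z H x) : gMinus A S x lam ≠ 0 := by
  rw [← h.pow]
  exact mul_ne_zero (pow_ne_zero _ h.ne) h.gPlus_ne

theorem IsBranchAt.deriv_ne {lam : ℂ} {z H : ℂ → ℂ} {x : ℂ}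
    (h : IsBranchAt A S Om lam z H x) : H x ^ 2 * gPlus A S x lam ≠ 0 :=
  mul_ne_zero (pow_ne_zero _ h.ne) h.gPlus_ne

theorem IsBranchAt.sq_eq {lam : ℂ} {z H : ℂ → ℂ} {x : ℂ}
    (h : IsBranchAt A S Om lam z H x) : (H x ^ 2 * gPlus A S x lam) ^ 2 = V₀ A S x lam := by
  rw [V₀_eq]
  linear_combination (gPlus A S x lam) * h.pow

theorem IsBranchAt.deriv_H (hAS : IsPotentialPair A S Om) {D : Set ℂ} (hD : IsOpen D) {lam : ℂ}
    {z H : ℂ → ℂ} (h : ∀ x ∈ D, IsBranchAt A S Om lam z H x) {x : ℂ} (hx : x ∈ D) :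
    deriv H x / H x = logDerivH A S x lam := by
  have hb := h x hx
  have h1 : HasDerivAt (fun y => H y ^ 4 * gPlus A S y lam) _ x :=
    ((hb.diff.hasDerivAt.pow 4).mul (hasDerivAt_gPlus hAS hb.mem))
  have h2 : HasDerivAt (fun y => H y ^ 4 * gPlus A S y lam) _ x :=
    (hasDerivAt_gMinus hAS hb.mem).congr_of_eventuallyEq
      (by filter_upwards [hD.mem_nhds hx] with y hy using (h y hy).pow)
  have h3 := h1.unique h2
  have hg := hb.gMinus_ne
  have hg' := hb.gPlus_ne
  have hH := hb.ne
  rw [logDerivH, eq_div_iff (by norm_num : (4 : ℂ) ≠ 0), ← hb.pow, div_mul_eq_mul_div,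
    div_add_div _ _ (mul_ne_zero (pow_ne_zero _ hH) hg') hg', div_eq_div_iff hH
      (mul_ne_zero (mul_ne_zero (pow_ne_zero _ hH) hg') hg')]
  simp only [Pi.pow_apply] at h3
  push_cast at h3
  linear_combination (gPlus A S x lam * H x) * h3

theorem continuousAt_comp_fst {f : ℂ → ℂ} {x y : ℂ} (hf : ContinuousAt f x) :
    ContinuousAt (fun p : ℂ × ℂ => f p.1) (x, y) :=
  hf.tendsto.comp (continuous_fst.tendsto (x, y))

theorem continuousAt_gPlus (hAS : IsPotentialPair A S Om) {x lam : ℂ} (hx : x ∈ Om) :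
    ContinuousAt (fun p : ℂ × ℂ => gPlus A S p.1 p.2) (x, lam) := by
  have h1 : ContinuousAt (fun p : ℂ × ℂ => deriv S p.1) (x, lam) :=
    continuousAt_comp_fst
      (hAS.differentiableOn_dS.differentiableAt (hAS.isOpen.mem_nhds hx)).continuousAt
  have h2 : ContinuousAt (fun p : ℂ × ℂ => A p.1) (x, lam) :=
    continuousAt_comp_fst
      (hAS.holo_A.differentiableAt (hAS.isOpen.mem_nhds hx)).continuousAt
  exact ((continuousAt_snd.add (h1.div_const 2)).add (continuousAt_const.mul h2)).neg

theorem continuousAt_gMinus (hAS : IsPotentialPair A S Om) {x lam : ℂ} (hx : x ∈ Om) :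
    ContinuousAt (fun p : ℂ × ℂ => gMinus A S p.1 p.2) (x, lam) := by
  have h1 : ContinuousAt (fun p : ℂ × ℂ => deriv S p.1) (x, lam) :=
    continuousAt_comp_fst
      (hAS.differentiableOn_dS.differentiableAt (hAS.isOpen.mem_nhds hx)).continuousAt
  have h2 : ContinuousAt (fun p : ℂ × ℂ => A p.1) (x, lam) :=
    continuousAt_comp_fst
      (hAS.holo_A.differentiableAt (hAS.isOpen.mem_nhds hx)).continuousAt
  exact (continuousAt_snd.add (h1.div_const 2)).sub (continuousAt_const.mul h2)

theorem continuousAt_logDerivH (hAS : IsPotentialPair A S Om) {x lam : ℂ} (hx : x ∈ Om)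
    (h1 : gPlus A S x lam ≠ 0) (h2 : gMinus A S x lam ≠ 0) :
    ContinuousAt (fun p : ℂ × ℂ => logDerivH A S p.1 p.2) (x, lam) := by
  have e1 : ContinuousAt (fun p : ℂ × ℂ => deriv (deriv S) p.1) (x, lam) :=
    continuousAt_comp_fst
      ((hAS.differentiableOn_dS.deriv hAS.isOpen).differentiableAt
        (hAS.isOpen.mem_nhds hx)).continuousAt
  have e2 : ContinuousAt (fun p : ℂ × ℂ => deriv A p.1) (x, lam) :=
    continuousAt_comp_fst
      ((hAS.holo_A.deriv hAS.isOpen).differentiableAt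
        (hAS.isOpen.mem_nhds hx)).continuousAt
  exact ((((e1.div_const 2).sub (continuousAt_const.mul e2)).div (continuousAt_gMinus hAS hx) h2).add
    (((e1.div_const 2).add (continuousAt_const.mul e2)).div (continuousAt_gPlus hAS hx)
      h1)).div_const 4

/-- Uniformity on compact sets of continuity in a parameter. -/
theorem eventually_forall_norm_sub_le {K : Set ℂ} (hK : IsCompact K) {Φ : ℂ × ℂ → ℂ} {l : ℂ}
    (hΦ : ∀ y ∈ K, ContinuousAt Φ (y, l)) {δ : ℝ} (hδ : 0 < δ) :
    ∀ᶠ lam in 𝓝 l, ∀ y ∈ K, ‖Φ (y, lam) - Φ (y, l)‖ ≤ δ := by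
  refine hK.eventually_forall_of_forall_eventually fun y hy => ?_
  have h1 : ∀ᶠ p in 𝓝 (y, l), ‖Φ p - Φ (y, l)‖ < δ / 2 := by
    have := tendsto_nhds.1 (hΦ y hy) (δ / 2) (half_pos hδ)
    simpa only [dist_eq_norm] using this
  have h2 : ∀ᶠ p : ℂ × ℂ in 𝓝 (y, l), ‖Φ (p.1, l) - Φ (y, l)‖ < δ / 2 := by
    have hc : Tendsto (fun p : ℂ × ℂ => (p.1, l)) (𝓝 (y, l)) (𝓝 (y, l)) :=
      (continuous_fst.prodMk continuous_const).tendsto (y, l)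
    exact hc.eventually h1
  have h3 : ∀ᶠ p : ℂ × ℂ in 𝓝 (l, y), ‖Φ (p.2, p.1) - Φ (p.2, l)‖ ≤ δ := by
    have hsw : ContinuousAt (fun p : ℂ × ℂ => (p.2, p.1)) (l, y) :=
      continuousAt_snd.prodMk continuousAt_fst
    have h4 := hsw.eventually (h1.and h2)
    filter_upwards [h4] with p hp
    calc ‖Φ (p.2, p.1) - Φ (p.2, l)‖
        = ‖(Φ (p.2, p.1) - Φ (y, l)) - (Φ (p.2, l) - Φ (y, l))‖ := by ring_nf
      _ ≤ _ := (norm_sub_le _ _).trans (by linarith [hp.1, hp.2])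
  exact h3

theorem eventually_forall_mem {K : Set ℂ} (hK : IsCompact K) {D : ℂ → Set ℂ} {l : ℂ}
    (hD : ∀ y ∈ K, ∀ᶠ p : ℂ × ℂ in 𝓝 (y, l), p.1 ∈ D p.2) :
    ∀ᶠ lam in 𝓝 l, ∀ y ∈ K, y ∈ D lam := by
  refine hK.eventually_forall_of_forall_eventually fun y hy => ?_
  have hsw : ContinuousAt (fun p : ℂ × ℂ => (p.2, p.1)) (l, y) :=
    continuousAt_snd.prodMk continuousAt_fst
  have h4 := hsw.eventually (hD y hy)
  exact h4

namespace BranchFamily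

/-- The derivative of the phase. -/
noncomputable def dZ (B : BranchFamily A S Om lam₀) (x lam : ℂ) : ℂ :=
  B.H x lam ^ 2 * gPlus A S x lam

variable (B : BranchFamily A S Om lam₀)

theorem isOpen₀ : IsOpen (B.D lam₀) := B.isOpen.self_of_nhds

theorem good₀ {x : ℂ} (hx : x ∈ B.D lam₀) :
    IsBranchAt A S Om lam₀ (fun y => B.Z y lam₀) (fun y => B.H y lam₀) x :=
  B.good.self_of_nhds x hx

theorem continuousAt_Z₀ {x : ℂ} (hx : x ∈ B.D lam₀) : ContinuousAt (fun y => B.Z y lam₀) x :=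
  (B.good₀ hx).hasDerivAt.continuousAt

/-- By the Cauchy estimate the derivative of the phase inherits its joint continuity. -/
theorem continuousAt_dZ (hAS : IsPotentialPair A S Om) {x : ℂ} (hx : x ∈ B.D lam₀) :
    ContinuousAt (fun p : ℂ × ℂ => B.dZ p.1 p.2) (x, lam₀) := by
  obtain ⟨r, hr, hrD⟩ := nhds_basis_closedBall.mem_iff.1 (B.isOpen₀.mem_nhds hx)
  rw [continuousAt_iff']
  intro η hη
  have hK := isCompact_closedBall x r
  have h1 := eventually_forall_mem hK (fun y hy => B.mem_nhds y (hrD hy))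
  have h2 := eventually_forall_norm_sub_le hK (fun y hy => B.cont y (hrD hy))
    (δ := η / 2 * (r / 2) / 2) (by positivity)
  have h0 : ContinuousAt (fun y => B.dZ y lam₀) x :=
    ((B.good₀ hx).diff.continuousAt.pow 2).mul
      (hasDerivAt_gPlus hAS (B.good₀ hx).mem).continuousAt
  have h3 : ∀ᶠ y in 𝓝 x, dist (B.dZ y lam₀) (B.dZ x lam₀) < η / 2 :=
    continuousAt_iff'.1 h0 _ (half_pos hη)
  have h4 : ∀ᶠ y in 𝓝 x, y ∈ ball x (r / 2) := ball_mem_nhds _ (half_pos hr)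
  rw [nhds_prod_eq]
  filter_upwards [(h3.and h4).prod_mk ((h1.and h2).and B.good)]
  rintro ⟨y, lam⟩ ⟨⟨hy3, hy4⟩, ⟨hl1, hl2⟩, hl3⟩
  simp only at *
  have hsub : closedBall y (r / 2) ⊆ closedBall x r := by
    refine closedBall_subset_closedBall' ?_
    rw [mem_ball] at hy4
    linarith
  have hder : ∀ w ∈ closedBall y (r / 2),
      HasDerivAt (fun w => B.Z w lam - B.Z w lam₀) (B.dZ w lam - B.dZ w lam₀) w := fun w hw =>
    (hl3 w (hl1 w (hsub hw))).hasDerivAt.sub (B.good₀ (hrD (hsub hw))).hasDerivAt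
  have hC := Complex.norm_deriv_le_of_forall_mem_sphere_norm_le
    (f := fun w => B.Z w lam - B.Z w lam₀) (c := y) (R := r / 2) (C := η / 2 * (r / 2) / 2)
    (half_pos hr)
    (DifferentiableOn.diffContOnCl fun w hw => by
      rw [closure_ball y (half_pos hr).ne'] at hw
      exact (hder w hw).differentiableAt.differentiableWithinAt)
    (fun w hw => hl2 w (hsub (sphere_subset_closedBall hw)))
  rw [(hder y (mem_closedBall_self (half_pos hr).le)).deriv] at hC
  have hC' : ‖B.dZ y lam - B.dZ y lam₀‖ ≤ η / 4 := by
    refine hC.trans (le_of_eq ?_)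
    field_simp
    norm_num
  rw [dist_eq_norm] at hy3 ⊢
  calc ‖B.dZ y lam - B.dZ x lam₀‖
      = ‖(B.dZ y lam - B.dZ y lam₀) + (B.dZ y lam₀ - B.dZ x lam₀)‖ := by ring_nf
    _ < η := by linarith [norm_add_le (B.dZ y lam - B.dZ y lam₀) (B.dZ y lam₀ - B.dZ x lam₀)]

/-- The family with the phase `κ² Z` and amplitude `κ H`, for a fourth root of unity `κ`. -/
def rot (κ : ℂ) (hκ : κ ^ 4 = 1) : BranchFamily A S Om lam₀ where
  D := B.D
  Z x lam := κ ^ 2 * B.Z x lam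
  H x lam := κ * B.H x lam
  mem_nhds := B.mem_nhds
  cont x hx := continuousAt_const.mul (B.cont x hx)
  isOpen := B.isOpen
  good := by
    have hκ0 : κ ≠ 0 := by rintro rfl; norm_num at hκ
    filter_upwards [B.good] with lam h x hx
    have hb := h x hx
    exact ⟨hb.mem, (hb.hasDerivAt.const_mul (κ ^ 2)).congr_deriv (by ring), hb.diff.const_mul κ,
      mul_ne_zero hκ0 hb.ne, hb.gPlus_ne, by
        rw [mul_pow, hκ, one_mul]; exact hb.pow⟩

end BranchFamily

/-- A point together with a value of the phase and of the amplitude there. -/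
structure WState where
  pt : ℂ
  ph : ℂ
  am : ℂ

/-- In the state `s`, the symbol of the solution `(c, d)` is `k (1 + O(eps), O(eps))`. -/
def Near (K eps : ℝ) (k : ℂ) (s : WState) (c d : ℂ → ℂ) : Prop :=
  ‖pco eps s.ph s.am (c s.pt) (d s.pt) - k‖ ≤ K * eps * ‖k‖ ∧
    ‖qco eps s.ph s.am (c s.pt) (d s.pt)‖ ≤ K * eps * ‖k‖

/-- WKB asymptotics of solutions propagate from the state `s` to the state `t`, uniformly for `lam`
near `lam₀` and small `eps`. -/
def Reach (A S : ℂ → ℂ) (Om : Set ℂ) (lam₀ : ℂ) (s t : ℂ → WState) : Prop :=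
  ∀ K₀ : ℝ, 0 ≤ K₀ → ∃ K : ℝ, 0 ≤ K ∧ ∃ e : ℝ, 0 < e ∧ ∀ᶠ lam in 𝓝 lam₀, ∀ eps : ℝ, 0 < eps →
    eps < e → ∀ c d : ℂ → ℂ, IsReduced A S Om eps lam c d → ∀ k : ℂ, k ≠ 0 →
      Near K₀ eps k (s lam) c d → Near K eps k (t lam) c d

theorem Reach.trans {s t u : ℂ → WState} (h₁ : Reach A S Om lam₀ s t)
    (h₂ : Reach A S Om lam₀ t u) : Reach A S Om lam₀ s u := by
  intro K₀ hK₀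
  obtain ⟨K, hK, e, he, h⟩ := h₁ K₀ hK₀
  obtain ⟨K', hK', e', he', h'⟩ := h₂ K hK
  refine ⟨K', hK', min e e', lt_min he he', ?_⟩
  filter_upwards [h, h'] with lam hl hl' eps heps heps' c d hcd k hk hn
  exact hl' eps heps (heps'.trans_le (min_le_right _ _)) c d hcd k hk
    (hl eps heps (heps'.trans_le (min_le_left _ _)) c d hcd k hk hn)

theorem near_shift_iff {K eps : ℝ} {k m sg : ℂ} (hsg : sg = 1 ∨ sg = -1) {s : WState}
    {c d : ℂ → ℂ} :
    Near K eps k ⟨s.pt, s.ph + m, sg * s.am⟩ c d ↔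
      Near K eps (sg * exp (m / eps) * k) s c d := by
  have hm : exp (m / eps) * exp (-m / eps) = 1 := by
    rw [← exp_add, show m / (eps : ℂ) + -m / eps = 0 by ring, exp_zero]
  have hpos : 0 < ‖exp (m / eps)‖ := norm_pos_iff.2 (exp_ne_zero _)
  have hsn : ‖sg‖ = 1 := by rcases hsg with rfl | rfl <;> simp
  have hss : sg * sg = 1 := by rcases hsg with rfl | rfl <;> norm_num
  have hp : ∀ z H a b, pco eps z (sg * H) a b = sg * pco eps z H a b := by
    intro z H a b
    rcases hsg with rfl | rfl
    · simp
    · rw [neg_one_mul, pco_neg]; ring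
  have hq : ∀ z H a b, qco eps z (sg * H) a b = sg * qco eps z H a b := by
    intro z H a b
    rcases hsg with rfl | rfl
    · simp
    · rw [neg_one_mul, qco_neg]; ring
  unfold Near
  simp only [hp, hq, pco_add, qco_add]
  set P := pco eps s.ph s.am (c s.pt) (d s.pt)
  set Q := qco eps s.ph s.am (c s.pt) (d s.pt)
  have e1 : ‖P - sg * exp (m / eps) * k‖
      = ‖exp (m / eps)‖ * ‖sg * (exp (-m / eps) * P) - k‖ := by
    rw [← one_mul (‖exp (m / eps)‖ * _), ← hsn, ← norm_mul, ← norm_mul]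
    congr 1
    linear_combination (-P) * hss - (sg * sg * P) * hm
  have e2 : ‖Q‖ = ‖exp (m / eps)‖ * ‖sg * (exp (-m / eps) * Q)‖ := by
    rw [← one_mul (‖exp (m / eps)‖ * _), ← hsn, ← norm_mul, ← norm_mul]
    congr 1
    linear_combination (-Q) * hss - (sg * sg * Q) * hm
  have e3 : K * eps * ‖sg * exp (m / eps) * k‖
      = ‖exp (m / eps)‖ * (K * eps * ‖k‖) := by
    rw [norm_mul, norm_mul, hsn]; ring
  rw [e1, e2, e3, mul_le_mul_iff_right₀ hpos, mul_le_mul_iff_right₀ hpos]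

/-- The relation `Reach` is invariant under simultaneous changes of the origin of the phase and of
the sign of the amplitude. -/
theorem Reach.congr {s t s' t' : ℂ → WState} (h : Reach A S Om lam₀ s t)
    (heq : ∀ᶠ lam in 𝓝 lam₀, ∃ m sg : ℂ, (sg = 1 ∨ sg = -1) ∧
      s' lam = ⟨(s lam).pt, (s lam).ph + m, sg * (s lam).am⟩ ∧
      t' lam = ⟨(t lam).pt, (t lam).ph + m, sg * (t lam).am⟩) :
    Reach A S Om lam₀ s' t' := by
  intro K₀ hK₀
  obtain ⟨K, hK, e, he, h⟩ := h K₀ hK₀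
  refine ⟨K, hK, e, he, ?_⟩
  filter_upwards [h, heq] with lam hl ⟨m, sg, hsg, hs, ht⟩ eps heps heps' c d hcd k hk hn
  have hsg0 : sg ≠ 0 := by rcases hsg with rfl | rfl <;> norm_num
  rw [hs, near_shift_iff hsg] at hn
  rw [ht, near_shift_iff hsg]
  exact hl eps heps heps' c d hcd _
    (mul_ne_zero (mul_ne_zero hsg0 (exp_ne_zero _)) hk) hn

theorem Reach.of_eventuallyEq {s t s' t' : ℂ → WState} (h : Reach A S Om lam₀ s t)
    (hs : s' =ᶠ[𝓝 lam₀] s) (ht : t' =ᶠ[𝓝 lam₀] t) : Reach A S Om lam₀ s' t' := by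
  refine h.congr ?_
  filter_upwards [hs, ht] with lam h1 h2
  exact ⟨0, 1, Or.inl rfl, by rw [h1]; simp, by rw [h2]; simp⟩

/-- The state of the point `x` in a branch family. -/
def BranchFamily.st (B : BranchFamily A S Om lam₀) (x lam : ℂ) : WState := ⟨x, B.Z x lam, B.H x lam⟩

/-- The symbol of a solution, restricted to a curve `x` along which `z` is a branch of the phase,
and normalized by `k`. -/
theorem hasDerivAt_symbol_comp {eps : ℝ} (heps : eps ≠ 0) {lam : ℂ} {D : Set ℂ} (hD : IsOpen D)
    (hAS : IsPotentialPair A S Om) {z H c d : ℂ → ℂ}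
    (hb : ∀ x ∈ D, IsBranchAt A S Om lam z H x) (hcd : IsReduced A S Om eps lam c d) {x : ℝ → ℂ}
    {x' : ℂ} {t : ℝ} (hx : HasDerivAt x x' t) (hxD : x t ∈ D) (k : ℂ) :
    HasDerivAt (fun s => pco eps (z (x s)) (H (x s)) (c (x s)) (d (x s)) / k)
      (logDerivH A S (x t) lam * x' *
        (qco eps (z (x t)) (H (x t)) (c (x t)) (d (x t)) / k)) t ∧
    HasDerivAt (fun s => qco eps (z (x s)) (H (x s)) (c (x s)) (d (x s)) / k)
      (logDerivH A S (x t) lam * x' * (pco eps (z (x t)) (H (x t)) (c (x t)) (d (x t)) / k)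
        - 2 / eps * (H (x t) ^ 2 * gPlus A S (x t) lam * x') *
          (qco eps (z (x t)) (H (x t)) (c (x t)) (d (x t)) / k)) t := by
  have hbx := hb _ hxD
  have hH0 := hbx.ne
  have hz : HasDerivAt (fun s => z (x s)) (H (x t) ^ 2 * gPlus A S (x t) lam * x') t :=
    hbx.hasDerivAt.comp t hx
  have hH : HasDerivAt (fun s => H (x s)) (deriv H (x t) * x') t :=
    hbx.diff.hasDerivAt.comp t hx
  obtain ⟨hc, hd⟩ := hcd _ hbx.mem
  have hc' : HasDerivAt (fun s => c (x s))
      (I / eps * (H (x t) ^ 2 * gPlus A S (x t) lam * x' / H (x t) ^ 2) * d (x t)) t :=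
    (hc.comp t hx).congr_deriv (by field_simp)
  have hd' : HasDerivAt (fun s => d (x s))
      (-(I / eps) * (H (x t) ^ 2 * gPlus A S (x t) lam * x' * H (x t) ^ 2) * c (x t)) t :=
    (hd.comp t hx).congr_deriv (by simp only [← hbx.pow]; ring)
  obtain ⟨h1, h2⟩ := hasDerivAt_symbol (𝕜 := ℝ) (z := fun s => z (x s)) (H := fun s => H (x s))
    (c := fun s => c (x s)) (d := fun s => d (x s)) heps hH0 hz hH hc' hd'
  rw [← IsBranchAt.deriv_H hAS hD hb hxD]
  exact ⟨(h1.div_const k).congr_deriv (by ring), (h2.div_const k).congr_deriv (by ring)⟩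

theorem continuousAt_slice {Φ : ℂ × ℂ → ℂ} {x y : ℂ} (h : ContinuousAt Φ (x, y)) :
    ContinuousAt (fun w => Φ (w, y)) x :=
  h.tendsto.comp ((continuous_id.prodMk continuous_const).tendsto x)

/-- Propagation of WKB asymptotics along a curve, for fixed parameters, with explicit constants. -/
theorem near_of_curve (hAS : IsPotentialPair A S Om) {lam : ℂ} {D : Set ℂ} (hDo : IsOpen D)
    {z H : ℂ → ℂ} (hb : ∀ x ∈ D, IsBranchAt A S Om lam z H x) {x x' : ℝ → ℂ}
    (hx : ∀ t ∈ Icc (0 : ℝ) 1, HasDerivAt x (x' t) t) (hxD : ∀ t ∈ Icc (0 : ℝ) 1, x t ∈ D)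
    (hx'c : ContinuousOn x' (Icc 0 1)) {M c₁ K₀ eps : ℝ} (hM : 0 ≤ M) (hc₁ : 0 < c₁)
    (hK₀ : 0 ≤ K₀) (hbd : ∀ t ∈ Icc (0 : ℝ) 1, ‖logDerivH A S (x t) lam * x' t‖ ≤ M)
    (hre : ∀ t ∈ Icc (0 : ℝ) 1, c₁ ≤ (H (x t) ^ 2 * gPlus A S (x t) lam * x' t).re)
    (heps : 0 < eps) (heps1 : eps ≤ 1) (hepsM : eps * M * M / c₁ ≤ 1) {c d : ℂ → ℂ}
    (hcd : IsReduced A S Om eps lam c d) {k : ℂ} (hk : k ≠ 0)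
    (hn : Near K₀ eps k ⟨x 0, z (x 0), H (x 0)⟩ c d) :
    Near (K₀ + M * (K₀ + M * (1 + K₀ + M * K₀) / c₁) + M * (1 + K₀ + M * K₀) / c₁) eps k
      ⟨x 1, z (x 1), H (x 1)⟩ c d := by
  have hkn : 0 < ‖k‖ := norm_pos_iff.2 hk
  obtain ⟨p, hp⟩ : ∃ p : ℝ → ℂ, p = fun s => pco eps (z (x s)) (H (x s)) (c (x s)) (d (x s)) / k :=
    ⟨_, rfl⟩
  obtain ⟨q, hq⟩ : ∃ q : ℝ → ℂ, q = fun s => qco eps (z (x s)) (H (x s)) (c (x s)) (d (x s)) / k :=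
    ⟨_, rfl⟩
  have hpk : ∀ t, pco eps (z (x t)) (H (x t)) (c (x t)) (d (x t)) = p t * k := fun t => by
    rw [hp]; exact (div_mul_cancel₀ _ hk).symm
  have hqk : ∀ t, qco eps (z (x t)) (H (x t)) (c (x t)) (d (x t)) = q t * k := fun t => by
    rw [hq]; exact (div_mul_cancel₀ _ hk).symm
  have hder : ∀ t ∈ Icc (0 : ℝ) 1,
      HasDerivAt p (logDerivH A S (x t) lam * x' t * q t) t ∧
      HasDerivAt q (logDerivH A S (x t) lam * x' t * p t
        - 2 / eps * (H (x t) ^ 2 * gPlus A S (x t) lam * x' t) * q t) t := fun t ht => by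
    rw [hp, hq]
    exact hasDerivAt_symbol_comp heps.ne' hDo hAS hb hcd (hx t ht) (hxD t ht) k
  have hhc : ContinuousOn (fun t => logDerivH A S (x t) lam * x' t) (Icc 0 1) := by
    refine ContinuousOn.mul (fun t ht => ?_) hx'c
    have hbt := hb _ (hxD t ht)
    have e1 := continuousAt_logDerivH hAS hbt.mem hbt.gPlus_ne hbt.gMinus_ne
    have e2 : ContinuousAt (fun w => logDerivH A S w lam) (x t) := continuousAt_slice e1
    exact (e2.comp (hx t ht).continuousAt).continuousWithinAt
  obtain ⟨hn1, hn2⟩ := hn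
  simp only [hpk, hqk] at hn1 hn2
  rw [show p 0 * k - k = (p 0 - 1) * k by ring, norm_mul] at hn1
  rw [norm_mul] at hn2
  have hn1 := le_of_mul_le_mul_right hn1 hkn
  have hn2 := le_of_mul_le_mul_right hn2 hkn
  have hL : ∫ t in (0 : ℝ)..1, ‖logDerivH A S (x t) lam * x' t‖ ≤ M := by
    have := intervalIntegral.norm_integral_le_of_norm_le_const (a := 0) (b := 1)
      (f := fun t : ℝ => ‖logDerivH A S (x t) lam * x' t‖) (C := M) (fun t ht => by
        rw [norm_norm]
        rw [uIoc_of_le zero_le_one] at ht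
        exact hbd t (Ioc_subset_Icc_self ht))
    rw [sub_zero, abs_one, mul_one] at this
    exact (Real.le_norm_self _).trans this
  obtain ⟨hr1, hr2⟩ := norm_symbol_le (δ := K₀ * eps) zero_le_one heps hc₁ hM (by positivity)
    (fun t ht => (hder t ht).1) (fun t ht => (hder t ht).2)
    (fun t ht => (hb _ (hxD t ht)).hasDerivAt.comp t (hx t ht)) hhc hbd hre hL hepsM hn1 hn2 1
    (by simp)
  obtain ⟨X, hX⟩ : ∃ X, X = M * (1 + K₀ + M * K₀) / c₁ := ⟨_, rfl⟩
  have hX0 : 0 ≤ X := by rw [hX]; positivity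
  have hle : K₀ * eps + eps * M * (1 + K₀ * eps + M * (K₀ * eps)) / c₁ ≤ (K₀ + X) * eps := by
    have h1 : eps * M * (1 + K₀ * eps + M * (K₀ * eps)) / c₁
        ≤ eps * M * (1 + K₀ * 1 + M * (K₀ * 1)) / c₁ := by gcongr
    have e : eps * M * (1 + K₀ * 1 + M * (K₀ * 1)) / c₁ = X * eps := by
      rw [hX]; ring
    linarith
  rw [← hX]
  have h1 : 0 ≤ M * (K₀ + X) * eps := by positivity
  have h2 : 0 ≤ X * eps := by positivity
  constructor
  · simp only [hpk]
    rw [show p 1 * k - k = (p 1 - 1) * k by ring, norm_mul]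
    refine mul_le_mul_of_nonneg_right (hr2.trans ?_) hkn.le
    have h3 := mul_le_mul_of_nonneg_left hle hM
    linarith
  · simp only [hqk]
    rw [norm_mul]
    refine mul_le_mul_of_nonneg_right ((hr1.trans hle).trans ?_) hkn.le
    linarith

namespace BranchFamily

variable (B : BranchFamily A S Om lam₀)

/-- Propagation along a curve whose phase is a straight segment. -/
theorem reach_of_curve (hAS : IsPotentialPair A S Om) {x : ℝ → ℂ} {m : ℂ} (hm : 0 < m.re)
    (hD : ∀ t ∈ Icc (0 : ℝ) 1, x t ∈ B.D lam₀)
    (hx : ∀ t ∈ Icc (0 : ℝ) 1, HasDerivAt x (m / B.dZ (x t) lam₀) t) :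
    Reach A S Om lam₀ (B.st (x 0)) (B.st (x 1)) := by
  have hxc : ContinuousOn x (Icc 0 1) := fun t ht => (hx t ht).continuousAt.continuousWithinAt
  have hK : IsCompact (x '' Icc 0 1) := isCompact_Icc.image_of_continuousOn hxc
  have hKD : ∀ y ∈ x '' Icc 0 1, y ∈ B.D lam₀ := by rintro _ ⟨t, ht, rfl⟩; exact hD t ht
  have hd0 : ∀ y ∈ x '' Icc 0 1, B.dZ y lam₀ ≠ 0 := fun y hy => (B.good₀ (hKD y hy)).deriv_ne
  have hdc : ∀ y ∈ x '' Icc 0 1, ContinuousAt (fun y => m / B.dZ y lam₀) y := fun y hy =>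
    continuousAt_const.div (((B.good₀ (hKD y hy)).diff.continuousAt.pow 2).mul
      (hasDerivAt_gPlus hAS (B.good₀ (hKD y hy)).mem).continuousAt) (hd0 y hy)
  have hΦc : ∀ y ∈ x '' Icc 0 1, ContinuousAt
      (fun p : ℂ × ℂ => logDerivH A S p.1 p.2 * (m / B.dZ p.1 lam₀)) (y, lam₀) := fun y hy =>
    (continuousAt_logDerivH hAS (B.good₀ (hKD y hy)).mem (B.good₀ (hKD y hy)).gPlus_ne
      (B.good₀ (hKD y hy)).gMinus_ne).mul (continuousAt_comp_fst (hdc y hy))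
  have hΨc : ∀ y ∈ x '' Icc 0 1, ContinuousAt
      (fun p : ℂ × ℂ => B.dZ p.1 p.2 * (m / B.dZ p.1 lam₀)) (y, lam₀) := fun y hy =>
    (B.continuousAt_dZ hAS (hKD y hy)).mul (continuousAt_comp_fst (hdc y hy))
  obtain ⟨M₀, hM₀⟩ : ∃ M₀, ∀ y ∈ x '' Icc 0 1,
      ‖logDerivH A S y lam₀ * (m / B.dZ y lam₀)‖ ≤ M₀ :=
    hK.exists_bound_of_continuousOn fun y hy => (continuousAt_slice (hΦc y hy)).continuousWithinAt
  have hM₀0 : 0 ≤ M₀ := (norm_nonneg _).trans (hM₀ _ ⟨0, by simp, rfl⟩)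
  obtain ⟨M, hM⟩ : ∃ M, M = M₀ + 1 := ⟨_, rfl⟩
  obtain ⟨c₁, hc₁⟩ : ∃ c₁, c₁ = m.re / 2 := ⟨_, rfl⟩
  have hM0 : 0 < M := by linarith
  have hc₁0 : 0 < c₁ := by linarith
  intro K₀ hK₀
  refine ⟨K₀ + M * (K₀ + M * (1 + K₀ + M * K₀) / c₁) + M * (1 + K₀ + M * K₀) / c₁, by positivity,
    min 1 (c₁ / (M * M)), by positivity, ?_⟩
  filter_upwards [eventually_forall_norm_sub_le hK hΦc one_pos,
    eventually_forall_norm_sub_le hK hΨc hc₁0,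
    eventually_forall_mem hK (fun y hy => B.mem_nhds y (hKD y hy)), B.isOpen, B.good]
    with lam h1 h2 h3 h4 h5 eps heps heps' c d hcd k hk hn
  have hmem : ∀ t ∈ Icc (0 : ℝ) 1, x t ∈ x '' Icc 0 1 := fun t ht => mem_image_of_mem x ht
  refine near_of_curve hAS h4 h5 hx (fun t ht => h3 _ (hmem t ht))
    (fun t ht => ContinuousAt.comp_continuousWithinAt (g := fun y => m / B.dZ y lam₀)
      (hdc _ (hmem t ht)) (hxc t ht)) hM0.le hc₁0 hK₀ (fun t ht => ?_) (fun t ht => ?_) heps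
    (heps'.trans_le (min_le_left _ _)).le ?_ hcd hk hn
  · have e1 := h1 _ (hmem t ht)
    have e2 := hM₀ _ (hmem t ht)
    have e3 := norm_sub_norm_le (logDerivH A S (x t) lam * (m / B.dZ (x t) lam₀))
      (logDerivH A S (x t) lam₀ * (m / B.dZ (x t) lam₀))
    linarith
  · have e1 := h2 _ (hmem t ht)
    rw [mul_div_cancel₀ m (hd0 _ (hmem t ht))] at e1
    have e3 := (abs_re_le_norm _).trans e1
    rw [sub_re] at e3
    have e4 := (abs_le.1 e3).1
    have e5 : (B.dZ (x t) lam * (m / B.dZ (x t) lam₀)).re = (B.H (x t) lam ^ 2 *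
      gPlus A S (x t) lam * (m / B.dZ (x t) lam₀)).re := rfl
    linarith
  · have := (heps'.trans_le (min_le_right _ _)).le
    rw [le_div_iff₀ (by positivity)] at this
    rw [div_le_one hc₁0]
    linarith

/-- Propagation between nearby points. -/
theorem exists_nhds_reach (hAS : IsPotentialPair A S Om) {x : ℂ} (hx : x ∈ B.D lam₀) :
    ∃ V ∈ 𝓝 x, ∀ y₁ ∈ V, ∀ y₂ ∈ V, (B.Z y₁ lam₀).re < (B.Z y₂ lam₀).re →
      Reach A S Om lam₀ (B.st y₁) (B.st y₂) := by
  have hdiff : DifferentiableOn ℂ (fun y => B.Z y lam₀) (B.D lam₀) := fun y hy =>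
    (B.good₀ hy).hasDerivAt.differentiableAt.differentiableWithinAt
  have hsd : HasStrictDerivAt (fun y => B.Z y lam₀) (B.dZ x lam₀) x :=
    (hdiff.contDiffOn B.isOpen₀ (n := 1)).contDiffAt (B.isOpen₀.mem_nhds hx)
      |>.hasStrictDerivAt' (B.good₀ hx).hasDerivAt one_ne_zero
  have hne : B.dZ x lam₀ ≠ 0 := (B.good₀ hx).deriv_ne
  set e := (hsd.hasStrictFDerivAt_equiv hne).toOpenPartialHomeomorph _ with he
  have hecoe : (e : ℂ → ℂ) = fun y => B.Z y lam₀ :=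
    (hsd.hasStrictFDerivAt_equiv hne).toOpenPartialHomeomorph_coe
  have hxs : x ∈ e.source := (hsd.hasStrictFDerivAt_equiv hne).mem_toOpenPartialHomeomorph_source
  have hxt : e x ∈ e.target := e.map_source hxs
  have hlx : e.symm (e x) = x := e.left_inv hxs
  have hn : e.target ∩ e.symm ⁻¹' B.D lam₀ ∈ 𝓝 (e x) := by
    refine inter_mem (e.open_target.mem_nhds hxt) ((e.symm.continuousAt hxt).preimage_mem_nhds ?_)
    rw [hlx]
    exact B.isOpen₀.mem_nhds hx
  obtain ⟨ρ, hρ, hball⟩ := Metric.mem_nhds_iff.1 hn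
  refine ⟨e.source ∩ e ⁻¹' ball (e x) ρ, inter_mem (e.open_source.mem_nhds hxs)
    ((e.continuousAt hxs).preimage_mem_nhds (ball_mem_nhds _ hρ)), ?_⟩
  rintro y₁ ⟨hy₁, hz₁⟩ y₂ ⟨hy₂, hz₂⟩ hlt
  set m := e y₂ - e y₁ with hm
  set η : ℝ → ℂ := fun t => e.symm (e y₁ + t * m) with hη
  have hseg : ∀ t ∈ Icc (0 : ℝ) 1, e y₁ + t * m ∈ ball (e x) ρ := fun t ht => by
    have := (convex_ball (e x) ρ).add_smul_sub_mem hz₁ hz₂ ht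
    simpa [hm] using this
  have hD : ∀ t ∈ Icc (0 : ℝ) 1, η t ∈ B.D lam₀ := fun t ht => (hball (hseg t ht)).2
  have hη' : ∀ t ∈ Icc (0 : ℝ) 1, HasDerivAt η (m / B.dZ (η t) lam₀) t := fun t ht => by
    have h1 : HasDerivAt e (B.dZ (η t) lam₀) (e.symm (e y₁ + t * m)) := by
      rw [hecoe]
      exact (B.good₀ (hD t ht)).hasDerivAt
    have h2 := e.hasDerivAt_symm (hball (hseg t ht)).1 (B.good₀ (hD t ht)).deriv_ne h1
    have h3 : HasDerivAt (fun w : ℝ => e y₁ + w * m) m t := by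
      simpa using ((Complex.ofRealCLM.hasDerivAt (x := t)).mul_const m).const_add (e y₁)
    exact (h2.comp t h3).congr_deriv (by rw [div_eq_inv_mul]; rfl)
  have hmre : 0 < m.re := by
    rw [hm, hecoe, sub_re]
    linarith
  have h0 : η 0 = y₁ := by simp [hη, e.left_inv hy₁]
  have h1 : η 1 = y₂ := by simp [hη, hm, e.left_inv hy₂]
  have := B.reach_of_curve hAS hmre hD hη'
  rwa [h0, h1] at this

end BranchFamily

/-- A transitive relation that holds locally along an interval holds between its end points. -/
theorem rel_of_local {R : ℝ → ℝ → Prop} (hR : ∀ r s t, R r s → R s t → R r t) {a b : ℝ}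
    (hab : a < b)
    (h : ∀ t ∈ Icc a b, ∃ V ∈ 𝓝 t, ∀ s ∈ V ∩ Icc a b, ∀ s' ∈ V ∩ Icc a b, s < s' → R s s') :
    R a b := by
  choose! V hV hVR using h
  obtain ⟨t, ht0, hmono, ⟨m, hm⟩, ht⟩ := exists_monotone_Icc_subset_open_cover_Icc hab.le
    (c := fun i : Icc a b => {s : Icc a b | (s : ℝ) ∈ interior (V i)})
    (fun i => isOpen_interior.preimage continuous_subtype_val)
    (fun s _ => mem_iUnion.2 ⟨s, mem_interior_iff_mem_nhds.2 (hV s s.2)⟩)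
  have key : ∀ n, (t n : ℝ) = a ∨ R a (t n) := by
    intro n
    induction n with
    | zero => exact Or.inl (by rw [ht0])
    | succ n ih =>
      rcases (hmono n.le_succ).eq_or_lt with heq | hlt
      · rw [← heq]; exact ih
      · obtain ⟨i, hi⟩ := ht n
        have hstep : R (t n) (t (n + 1)) := hVR i i.2 _
          ⟨interior_subset (hi (left_mem_Icc.2 hlt.le)), (t n).2⟩ _
          ⟨interior_subset (hi (right_mem_Icc.2 hlt.le)), (t (n + 1)).2⟩ hlt
        rcases ih with h | h
        · rw [h] at hstep; exact Or.inr hstep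
        · exact Or.inr (hR _ _ _ h hstep)
  have := key m
  rw [hm m le_rfl] at this
  rcases this with h | h
  · exact absurd h hab.ne'
  · exact h

/-- There is a path in `D` from `x` to `y` along which `Re f` is strictly increasing. -/
def IncPath (D : Set ℂ) (f : ℂ → ℂ) (x y : ℂ) : Prop :=
  ∃ (a b : ℝ) (η : ℝ → ℂ), a < b ∧ ContinuousOn η (Icc a b) ∧ η a = x ∧ η b = y ∧
    (∀ t ∈ Icc a b, η t ∈ D) ∧ StrictMonoOn (fun t => (f (η t)).re) (Icc a b)

/-- The points `x` and `y` are joined by a chain of paths in `D` along which `Re f` is strictly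
increasing. -/
def Inc (D : Set ℂ) (f : ℂ → ℂ) : ℂ → ℂ → Prop := Relation.TransGen (IncPath D f)

theorem IncPath.rev {D : Set ℂ} {f g : ℂ → ℂ} {x y : ℂ} (h : IncPath D f x y)
    (hg : ∀ x ∈ D, (g x).re = -(f x).re) : IncPath D g y x := by
  obtain ⟨a, b, η, hab, hc, ha, hb, hD, hm⟩ := h
  have hmap : ∀ t ∈ Icc (-b) (-a), -t ∈ Icc a b := fun t ht => ⟨by linarith [ht.2], by linarith [ht.1]⟩
  refine ⟨-b, -a, fun t => η (-t), by linarith, hc.comp continuousOn_neg hmap, by simp [hb],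
    by simp [ha], fun t ht => hD _ (hmap t ht), ?_⟩
  intro s hs t ht hst
  have := hm (hmap t ht) (hmap s hs) (neg_lt_neg hst)
  simp only at this ⊢
  rw [hg _ (hD _ (hmap t ht)), hg _ (hD _ (hmap s hs))]
  linarith

theorem Inc.rev {D : Set ℂ} {f g : ℂ → ℂ} {x y : ℂ} (h : Inc D f x y)
    (hg : ∀ x ∈ D, (g x).re = -(f x).re) : Inc D g y x := by
  induction h with
  | single h => exact .single (h.rev hg)
  | tail _ h ih => exact .head (h.rev hg) ih

theorem BranchFamily.reach_of_inc (B : BranchFamily A S Om lam₀) (hAS : IsPotentialPair A S Om)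
    {x y : ℂ} (h : Inc (B.D lam₀) (fun y => B.Z y lam₀) x y) :
    Reach A S Om lam₀ (B.st x) (B.st y) := by
  have key : ∀ x y, IncPath (B.D lam₀) (fun y => B.Z y lam₀) x y →
      Reach A S Om lam₀ (B.st x) (B.st y) := by
    rintro _ _ ⟨a, b, η, hab, hc, rfl, rfl, hD, hm⟩
    refine rel_of_local (R := fun s t => Reach A S Om lam₀ (B.st (η s)) (B.st (η t)))
      (fun r s t h₁ h₂ => h₁.trans h₂) hab fun t ht => ?_
    obtain ⟨V, hV, hVR⟩ := B.exists_nhds_reach hAS (hD t ht)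
    obtain ⟨W, hW, hWV⟩ := mem_nhdsWithin_iff_exists_mem_nhds_inter.1 ((hc t ht) hV)
    exact ⟨W, hW, fun s hs s' hs' hlt => hVR _ (hWV hs) _ (hWV hs') (hm hs.2 hs'.2 hlt)⟩
  induction h with
  | single h => exact key _ _ h
  | tail _ h ih => exact ih.trans (key _ _ h)

/-! ### Construction of exact WKB solutions -/

/-- On `N` the equation `F' + m z' F = h f` has a solution that vanishes at the base point
described by `l` and is bounded by half the bound of `f`. -/
def SymbolStep (N : Set ℂ) (l : Filter ℂ) (z h : ℂ → ℂ) (m : ℂ) : Prop :=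
  ∀ f : ℂ → ℂ, DifferentiableOn ℂ f N → ∀ C : ℝ, (∀ x ∈ N, ‖f x‖ ≤ C) →
    ∃ F : ℂ → ℂ, (∀ x ∈ N, HasDerivAt F (h x * f x - m * deriv z x * F x) x) ∧
      (∀ x ∈ N, ‖F x‖ ≤ C / 2) ∧ Tendsto F l (𝓝 0)

/-- The coefficients of the symbol are obtained by solving the two equations of the recursion in turn;
each step halves the bound. -/
theorem exists_isWKBSymbol {N : Set ℂ} {l : Filter ℂ} {z H : ℂ → ℂ} {s : ℂ}
    (h0 : SymbolStep N l z (fun x => deriv H x / H x) 0)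
    (h1 : SymbolStep N l z (fun x => deriv H x / H x) (s * (2 / eps))) :
    ∃ w : ℕ → ℂ → ℂ, IsWKBSymbol N l s eps z H w ∧ ∀ n, ∀ x ∈ N, ‖w n x‖ ≤ (1 / 2 : ℝ) ^ n := by
  choose! G₀ hG₀ using h0
  choose! G₁ hG₁ using h1
  let w : ℕ → ℂ → ℂ := fun n => Nat.rec (fun _ => 1)
    (fun n f => if Even n then G₁ f ((1 / 2 : ℝ) ^ n) else G₀ f ((1 / 2 : ℝ) ^ n)) n
  have hw0 : w 0 = fun _ => 1 := rfl
  have hws : ∀ n, w (n + 1) = if Even n then G₁ (w n) ((1 / 2 : ℝ) ^ n)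
    else G₀ (w n) ((1 / 2 : ℝ) ^ n) := fun n => rfl
  have hgood : ∀ n, DifferentiableOn ℂ (w n) N ∧ ∀ x ∈ N, ‖w n x‖ ≤ (1 / 2 : ℝ) ^ n := by
    intro n
    induction n with
    | zero => rw [hw0]; exact ⟨differentiableOn_const 1, fun x _ => by simp⟩
    | succ n ih =>
      rw [hws]
      split_ifs
      · obtain ⟨e1, e2, -⟩ := hG₁ _ ih.1 _ ih.2
        exact ⟨fun x hx => (e1 x hx).differentiableAt.differentiableWithinAt, fun x hx =>
          (e2 x hx).trans (le_of_eq (by rw [pow_succ]; ring))⟩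
      · obtain ⟨e1, e2, -⟩ := hG₀ _ ih.1 _ ih.2
        exact ⟨fun x hx => (e1 x hx).differentiableAt.differentiableWithinAt, fun x hx =>
          (e2 x hx).trans (le_of_eq (by rw [pow_succ]; ring))⟩
  have hodd : ∀ n, w (2 * n + 1) = G₁ (w (2 * n)) ((1 / 2 : ℝ) ^ (2 * n)) := fun n => by
    rw [hws, if_pos (even_two_mul n)]
  have heven : ∀ n, w (2 * n + 2) = G₀ (w (2 * n + 1)) ((1 / 2 : ℝ) ^ (2 * n + 1)) := fun n => by
    rw [hws, if_neg (by simp)]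
  refine ⟨w, ⟨fun n => (hgood n).1, fun x _ => by rw [hw0], fun n x hx => ?_, fun n x hx => ?_,
    fun n hn => ?_⟩, fun n => (hgood n).2⟩
  · have := (hG₁ _ (hgood (2 * n)).1 _ (hgood (2 * n)).2).1 x hx
    rw [← hodd] at this
    rw [this.deriv]
    ring
  · have := (hG₀ _ (hgood (2 * n + 1)).1 _ (hgood (2 * n + 1)).2).1 x hx
    rw [← heven] at this
    rw [this.deriv]
    ring
  · obtain ⟨m, rfl⟩ := Nat.exists_eq_add_of_le' hn
    rw [hws]
    split_ifs
    · exact (hG₁ _ (hgood m).1 _ (hgood m).2).2.2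
    · exact (hG₀ _ (hgood m).1 _ (hgood m).2).2.2

/-- The symbol equations and the reduced Dirac system are equivalent: here a solution of the
latter is recovered from a solution of the former. -/
theorem isSystemSolution_of_symbol (heps : eps ≠ 0) {N : Set ℂ} {z H p q : ℂ → ℂ}
    (hb : ∀ x ∈ N, IsBranchAt A S Om lam z H x)
    (hp : ∀ x ∈ N, HasDerivAt p (deriv H x / H x * q x) x)
    (hq : ∀ x ∈ N, HasDerivAt q (deriv H x / H x * p x - 2 / eps * deriv z x * q x) x) (κ : ℂ) :
    IsSystemSolution N (fun x => I / eps * gPlus A S x lam)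
      (fun x => -(I / eps) * gMinus A S x lam)
      (fun x => κ * (exp (z x / eps) * (H x)⁻¹ * (q x + p x)))
      (fun x => κ * (exp (z x / eps) * (I * H x) * (q x - p x))) := by
  intro x hx
  have hE : (eps : ℂ) ≠ 0 := by exact_mod_cast heps
  have hbx := hb x hx
  have hH0 := hbx.ne
  have hz := hbx.hasDerivAt
  have hH := hbx.diff.hasDerivAt
  have hp' := hp x hx
  have hq' := hq x hx
  rw [hz.deriv] at hq'
  have he := (hz.div_const (eps : ℂ)).cexp
  have hI := I_sq
  constructor
  · refine (((he.mul (hH.inv hH0)).mul (hq'.add hp')).const_mul κ).congr_deriv ?_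
    simp only [Pi.mul_apply, Pi.inv_apply, Pi.add_apply]
    field_simp
    linear_combination (κ * gPlus A S x lam * H x ^ 3 * (p x - q x)) * hI
  · refine (((he.mul (hH.const_mul I)).mul (hq'.sub hp')).const_mul κ).congr_deriv ?_
    simp only [Pi.mul_apply, Pi.sub_apply]
    rw [← hbx.pow]
    field_simp
    ring

/-- If the equations for the coefficients of the symbol can be solved with geometric bounds on a
connected neighbourhood of the base point, then the exact WKB solution exists. -/
theorem exists_isExactWKB (hAS : IsPotentialPair A S Om) (heps : 0 < eps) {D N : Set ℂ}
    {z H : ℂ → ℂ} (hb : ∀ x ∈ D, IsBranchAt A S Om lam z H x) (hNo : IsOpen N)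
    (hNc : IsPreconnected N) (hND : N ⊆ D) {x₁ : ℂ} (hx₁ : x₁ ∈ N) {l : Filter ℂ} (hl : N ∈ l)
    {s κ : ℂ} (hκ : (s = 1 ∧ κ = 1) ∨ (s = -1 ∧ κ = I))
    (h0 : SymbolStep N l z (fun x => deriv H x / H x) 0)
    (h1 : SymbolStep N l z (fun x => deriv H x / H x) (s * (2 / eps))) :
    ∃ u, IsExactWKB A S Om D eps lam s z H l u := by
  obtain ⟨w, hw, hwb⟩ := exists_isWKBSymbol h0 h1
  have hκ2 : κ ^ 2 = s := by rcases hκ with ⟨rfl, rfl⟩ | ⟨rfl, rfl⟩ <;> simp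
  have hκ0 : κ ≠ 0 := by rcases hκ with ⟨-, rfl⟩ | ⟨-, rfl⟩ <;> simp
  have hκ4 : κ ^ 4 = 1 := by
    rw [show (4 : ℕ) = 2 * 2 by norm_num, pow_mul, hκ2]
    rcases hκ with ⟨rfl, rfl⟩ | ⟨rfl, rfl⟩ <;> norm_num
  have hgeo : Summable fun n : ℕ => (1 / 2 : ℝ) ^ n := summable_geometric_two
  have hinj0 : Function.Injective fun n : ℕ => 2 * n := fun a b h => by simpa using h
  have hinj1 : Function.Injective fun n : ℕ => 2 * n + 1 := fun a b h => by simpa using h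
  have hg0 : Summable fun n : ℕ => (1 / 2 : ℝ) ^ (2 * n) := hgeo.comp_injective hinj0
  have hg1 : Summable fun n : ℕ => (1 / 2 : ℝ) ^ (2 * n + 1) := hgeo.comp_injective hinj1
  have hs0 : ∀ x ∈ N, Summable fun n => w (2 * n) x := fun x hx =>
    hg0.of_norm_bounded fun n => hwb _ x hx
  have hs1 : ∀ x ∈ N, Summable fun n => w (2 * n + 1) x := fun x hx =>
    hg1.of_norm_bounded fun n => hwb _ x hx
  set p : ℂ → ℂ := fun x => ∑' n, w (2 * n) x with hp
  set q : ℂ → ℂ := fun x => ∑' n, w (2 * n + 1) x with hq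
  have hwd : ∀ n, ∀ x ∈ N, HasDerivAt (w n) (deriv (w n) x) x := fun n x hx =>
    ((hw.differentiableOn n).differentiableAt (hNo.mem_nhds hx)).hasDerivAt
  have hpd : ∀ x ∈ N, HasDerivAt p (deriv H x / H x * q x) x := by
    intro x hx
    have e1 := (Complex.differentiableOn_tsum_of_summable_norm hg0
      (fun n => hw.differentiableOn (2 * n)) hNo (fun n x hx => hwb _ x hx)).differentiableAt
      (hNo.mem_nhds hx)
    have e2 := Complex.hasSum_deriv_of_summable_norm hg0
      (fun n => hw.differentiableOn (2 * n)) hNo (fun n x hx => hwb _ x hx) hx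
    have e3 : HasSum (fun n => deriv (w (2 * n)) x) (deriv H x / H x * q x) := by
      rw [hasSum_nat_add_iff' 1 |>.symm]
      have e4 : deriv (w 0) x = 0 := by
        have : w 0 =ᶠ[𝓝 x] fun _ => 1 := by
          filter_upwards [hNo.mem_nhds hx] with y hy using hw.zero y hy
        rw [this.deriv_eq, deriv_const]
      simp only [Finset.sum_range_one, mul_zero, e4, sub_zero]
      have e5 : (fun n => deriv (w (2 * (n + 1))) x)
          = fun n => deriv H x / H x * w (2 * n + 1) x := by
        funext n
        exact hw.even n x hx
      rw [e5]
      exact (hs1 x hx).hasSum.mul_left _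
    rw [e3.unique e2]
    exact e1.hasDerivAt
  have hqd : ∀ x ∈ N, HasDerivAt q (deriv H x / H x * p x - s * (2 / eps) * deriv z x * q x) x := by
    intro x hx
    have e1 := (Complex.differentiableOn_tsum_of_summable_norm hg1
      (fun n => hw.differentiableOn (2 * n + 1)) hNo (fun n x hx => hwb _ x hx)).differentiableAt
      (hNo.mem_nhds hx)
    have e2 := Complex.hasSum_deriv_of_summable_norm hg1
      (fun n => hw.differentiableOn (2 * n + 1)) hNo (fun n x hx => hwb _ x hx) hx
    have e3 : HasSum (fun n => deriv (w (2 * n + 1)) x)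
        (deriv H x / H x * p x - s * (2 / eps) * deriv z x * q x) := by
      have e5 : (fun n => deriv (w (2 * n + 1)) x)
          = fun n => deriv H x / H x * w (2 * n) x
            - s * (2 / eps) * deriv z x * w (2 * n + 1) x := by
        funext n
        rw [← hw.odd n x hx]
        ring
      rw [e5]
      exact ((hs0 x hx).hasSum.mul_left _).sub ((hs1 x hx).hasSum.mul_left _)
    rw [e3.unique e2]
    exact e1.hasDerivAt
  -- the rotated branch `(κ² z, κ H)` reduces both signs to the sign `+`
  have hb' : ∀ x ∈ N, IsBranchAt A S Om lam (fun y => κ ^ 2 * z y) (fun y => κ * H y) x := by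
    intro x hx
    have hbx := hb x (hND hx)
    exact ⟨hbx.mem, (hbx.hasDerivAt.const_mul (κ ^ 2)).congr_deriv (by ring), hbx.diff.const_mul κ,
      mul_ne_zero hκ0 hbx.ne, hbx.gPlus_ne, by rw [mul_pow, hκ4, one_mul]; exact hbx.pow⟩
  have hlog : ∀ x ∈ N, deriv (fun y => κ * H y) x / (κ * H x) = deriv H x / H x := fun x hx => by
    rw [deriv_const_mul _ (hb x (hND hx)).diff, mul_div_mul_left _ _ hκ0]
  have hdz : ∀ x ∈ N, deriv (fun y => κ ^ 2 * z y) x = s * deriv z x := fun x hx => by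
    rw [deriv_const_mul _ (hb x (hND hx)).hasDerivAt.differentiableAt, hκ2]
  have hsys := isSystemSolution_of_symbol heps.ne' hb'
    (fun x hx => by rw [hlog x hx]; exact hpd x hx)
    (fun x hx => by rw [hlog x hx, hdz x hx]; exact (hqd x hx).congr_deriv (by ring)) κ
  obtain ⟨c, d, hcd, hc₁, hd₁⟩ := exists_isReduced (eps := eps) (lam := lam) hAS
    (hb x₁ (hND hx₁)).mem
    (κ * (exp (κ ^ 2 * z x₁ / eps) * (κ * H x₁)⁻¹ * (q x₁ + p x₁)))
    (κ * (exp (κ ^ 2 * z x₁ / eps) * (I * (κ * H x₁)) * (q x₁ - p x₁)))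
  have hNOm : N ⊆ Om := fun x hx => (hb x (hND hx)).mem
  refine ⟨unred S eps c d, hcd.isDiracSolution heps.ne' hAS.isOpen hAS.holo_S, N, hNo, hND, hl, w,
    hw, fun x hx => ⟨hs0 x hx, hs1 x hx, ?_⟩⟩
  obtain ⟨hc, hd⟩ := IsSystemSolution.eqOn hAS.isOpen hAS.isSimplyConnected
    (fun x hx => ((hasDerivAt_gPlus hAS hx).const_mul _).differentiableAt.differentiableWithinAt)
    (fun x hx => ((hasDerivAt_gMinus hAS hx).const_mul _).differentiableAt.differentiableWithinAt)
    hNo hNc hNOm (fun x hx => hcd x (hNOm hx)) hsys hx₁ hc₁ hd₁ hx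
  obtain ⟨e1, e2⟩ := red_wkbVector (S := S) (eps := eps) (x := x) (p := p x) (q := q x) (z := z)
    (H := H) (u := fun x => wkbVector S eps s z H x (p x) (q x)) hκ rfl
  have e3 : wkbVector S eps s z H x (p x) (q x)
      = unred S eps (redC S eps fun x => wkbVector S eps s z H x (p x) (q x))
        (redD S eps fun x => wkbVector S eps s z H x (p x) (q x)) x := by rw [unred_red]
  rw [show (∑' n, w (2 * n) x) = p x from rfl, show (∑' n, w (2 * n + 1) x) = q x from rfl, e3]
  simp only [unred, hc, hd, e1, e2]

/-- The equations for the coefficients of the symbol can be solved near a finite base point. -/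
theorem exists_symbolStep_nhds {D : Set ℂ} (hD : IsOpen D) {z h : ℂ → ℂ}
    (hz : DifferentiableOn ℂ z D) (hh : DifferentiableOn ℂ h D) {x₀ : ℂ} (hx₀ : x₀ ∈ D) (m : ℂ) :
    ∃ r₀ > 0, ∀ r, 0 < r → r ≤ r₀ → ball x₀ r ⊆ D ∧
      SymbolStep (ball x₀ r) (𝓝 x₀) z h m := by
  obtain ⟨r₁, hr₁, hr₁D⟩ := isOpen_iff.1 hD x₀ hx₀
  have hcz : ContinuousAt z x₀ := (hz.differentiableAt (hD.mem_nhds hx₀)).continuousAt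
  have hch : ContinuousAt h x₀ := (hh.differentiableAt (hD.mem_nhds hx₀)).continuousAt
  have hE : ContinuousAt (fun x => exp (m * (z x - z x₀))) x₀ :=
    (continuousAt_const.mul (hcz.sub continuousAt_const)).cexp
  have hE' : ContinuousAt (fun x => exp (-(m * (z x - z x₀)))) x₀ :=
    (continuousAt_const.mul (hcz.sub continuousAt_const)).neg.cexp
  have h1 : ∀ᶠ x in 𝓝 x₀, ‖exp (m * (z x - z x₀))‖ < 2 :=
    hE.norm.eventually_lt_const (by simp)
  have h2 : ∀ᶠ x in 𝓝 x₀, ‖exp (-(m * (z x - z x₀)))‖ < 2 :=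
    hE'.norm.eventually_lt_const (by simp)
  have h3 : ∀ᶠ x in 𝓝 x₀, ‖h x‖ < ‖h x₀‖ + 1 := hch.norm.eventually_lt_const (by simp)
  obtain ⟨r₂, hr₂, hr₂'⟩ := eventually_nhds_iff_ball.1 (h1.and (h2.and h3))
  obtain ⟨M, hM⟩ : ∃ M, M = ‖h x₀‖ + 1 := ⟨_, rfl⟩
  have hM0 : 0 < M := by rw [hM]; positivity
  refine ⟨min (min r₁ r₂) (1 / (8 * M)), by positivity, fun r hr hr' => ?_⟩
  have hrr₁ : r ≤ r₁ := hr'.trans ((min_le_left _ _).trans (min_le_left _ _))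
  have hrr₂ : r ≤ r₂ := hr'.trans ((min_le_left _ _).trans (min_le_right _ _))
  have hrM : 8 * M * r ≤ 1 := by
    have := hr'.trans (min_le_right _ _)
    rw [le_div_iff₀ (by positivity)] at this
    linarith
  have hsub : ball x₀ r ⊆ D := (ball_subset_ball hrr₁).trans hr₁D
  refine ⟨hsub, fun f hf C hC => ?_⟩
  have hx₀r : x₀ ∈ ball x₀ r := mem_ball_self hr
  have hC0 : 0 ≤ C := (norm_nonneg _).trans (hC x₀ hx₀r)
  have hzd : ∀ x ∈ ball x₀ r, HasDerivAt z (deriv z x) x := fun x hx =>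
    (hz.differentiableAt (hD.mem_nhds (hsub hx))).hasDerivAt
  have hEd : DifferentiableOn ℂ (fun x => exp (m * (z x - z x₀))) (ball x₀ r) :=
    fun x hx => ((((hzd x hx).sub_const (z x₀)).const_mul m).cexp).differentiableAt.differentiableWithinAt
  obtain ⟨G₀, hG₀⟩ := (hEd.mul ((hh.mono hsub).mul hf)).isExactOn_ball
  set G : ℂ → ℂ := fun x => G₀ x - G₀ x₀ with hGdef
  have hG : ∀ x ∈ ball x₀ r,
      HasDerivAt G (exp (m * (z x - z x₀)) * (h x * f x)) x := fun x hx =>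
    (hG₀ x hx).sub_const _
  have hGb : ∀ x ∈ ball x₀ r, ‖G x‖ ≤ 2 * (M * C) * r := by
    intro x hx
    have := (convex_ball x₀ r).norm_image_sub_le_of_norm_hasDerivWithin_le
      (f := G) (C := 2 * (M * C)) (fun y hy => (hG y hy).hasDerivWithinAt) (fun y hy => by
        have hy2 := hr₂' y (ball_subset_ball hrr₂ hy)
        rw [norm_mul, norm_mul, hM]
        exact mul_le_mul hy2.1.le (mul_le_mul hy2.2.2.le (hC y hy) (norm_nonneg _) (by positivity))
          (by positivity) (by norm_num)) hx₀r hx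
    have hG0 : G x₀ = 0 := sub_self _
    rw [hG0, sub_zero] at this
    refine this.trans ?_
    have : ‖x - x₀‖ ≤ r := by rw [← dist_eq_norm]; exact (mem_ball.1 hx).le
    gcongr
  refine ⟨fun x => exp (-(m * (z x - z x₀))) * G x, fun x hx => ?_, fun x hx => ?_, ?_⟩
  · have e1 := (((hzd x hx).sub_const (z x₀)).const_mul m).neg.cexp
    refine (e1.mul (hG x hx)).congr_deriv ?_
    have e2 : exp (-(m * (z x - z x₀))) * exp (m * (z x - z x₀)) = 1 := by
      rw [← exp_add]; simp
    linear_combination (h x * f x) * e2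
  · rw [norm_mul]
    have hy2 := (hr₂' x (ball_subset_ball hrr₂ hx)).2.1.le
    calc _ ≤ 2 * (2 * (M * C) * r) := mul_le_mul hy2 (hGb x hx) (norm_nonneg _) (by norm_num)
      _ = (8 * M * r) * (C / 2) := by ring
      _ ≤ 1 * (C / 2) := by gcongr
      _ = C / 2 := one_mul _
  · have hc : ContinuousAt (fun x => exp (-(m * (z x - z x₀))) * G x) x₀ :=
      hE'.mul (hG x₀ hx₀r).continuousAt
    have := hc.tendsto
    simpa [hGdef] using this

theorem exists_isExactWKB_nhds (hAS : IsPotentialPair A S Om) (heps : 0 < eps) {D : Set ℂ}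
    (hD : IsOpen D) {z H : ℂ → ℂ} (hb : ∀ x ∈ D, IsBranchAt A S Om lam z H x) {x₀ : ℂ}
    (hx₀ : x₀ ∈ D) {s κ : ℂ} (hκ : (s = 1 ∧ κ = 1) ∨ (s = -1 ∧ κ = I)) :
    ∃ u, IsExactWKB A S Om D eps lam s z H (𝓝 x₀) u := by
  have hz : DifferentiableOn ℂ z D := fun x hx =>
    (hb x hx).hasDerivAt.differentiableAt.differentiableWithinAt
  have hH : DifferentiableOn ℂ H D := fun x hx => (hb x hx).diff.differentiableWithinAt
  have hh : DifferentiableOn ℂ (fun x => deriv H x / H x) D :=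
    (hH.deriv hD).div hH fun x hx => (hb x hx).ne
  obtain ⟨r₀, hr₀, h0⟩ := exists_symbolStep_nhds hD hz hh hx₀ 0
  obtain ⟨r₁, hr₁, h1⟩ := exists_symbolStep_nhds hD hz hh hx₀ (s * (2 / eps))
  have hr : 0 < min r₀ r₁ := lt_min hr₀ hr₁
  obtain ⟨hsub, h0⟩ := h0 _ hr (min_le_left _ _)
  obtain ⟨-, h1⟩ := h1 _ hr (min_le_right _ _)
  exact exists_isExactWKB hAS heps hb isOpen_ball (convex_ball _ _).isPreconnected hsub
    (mem_ball_self hr) (ball_mem_nhds _ hr) hκ h0 h1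

/-- At a finite base point the symbol is `(1, 0)`. -/
theorem IsExactWKB.symbol_eq {D : Set ℂ} {z H : ℂ → ℂ} (hb : ∀ x ∈ D, IsBranchAt A S Om lam z H x)
    {x₀ : ℂ} {s κ : ℂ} (hκ : (s = 1 ∧ κ = 1) ∨ (s = -1 ∧ κ = I))
    {u : ℂ → Fin 2 → ℂ} (hu : IsExactWKB A S Om D eps lam s z H (𝓝 x₀) u) :
    pco eps (κ ^ 2 * z x₀) (κ * H x₀) (redC S eps u x₀) (redD S eps u x₀) = κ ∧
      qco eps (κ ^ 2 * z x₀) (κ * H x₀) (redC S eps u x₀) (redD S eps u x₀) = 0 := by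
  obtain ⟨-, N, hNo, hND, hN, w, hw, hsum⟩ := hu
  have hx₀ : x₀ ∈ N := mem_of_mem_nhds hN
  have hw0 : ∀ n, 1 ≤ n → w n x₀ = 0 := fun n hn =>
    tendsto_nhds_unique ((hw.differentiableOn n).differentiableAt hN).continuousAt.tendsto
      (hw.base n hn)
  have e0 : ∑' n, w (2 * n) x₀ = 1 := by
    rw [tsum_eq_single 0 (fun n hn => hw0 _ (by omega)), mul_zero, hw.zero x₀ hx₀]
  have e1 : ∑' n, w (2 * n + 1) x₀ = 0 := by
    rw [tsum_congr (fun n => hw0 (2 * n + 1) (by omega)), tsum_zero]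
  have h := (hsum x₀ hx₀).2.2
  rw [e0, e1] at h
  have := pco_qco_wkbVector hκ (hb x₀ (hND hx₀)).ne h
  rwa [mul_one, mul_zero] at this

/-! ### First-order equations on half-lines -/

section HalfLine

variable {w φ m g : ℝ → ℂ} {a b t : ℝ}

theorem norm_exp_le_of_deriv_re_nonneg (hφ : ∀ s ∈ Icc a t, HasDerivAt φ (m s) s)
    (hm : ∀ s ∈ Icc a t, 0 ≤ (m s).re) {s : ℝ} (hs : s ∈ Icc a t) :
    ‖exp (φ s)‖ ≤ ‖exp (φ t)‖ := by
  rw [norm_exp, norm_exp, Real.exp_le_exp]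
  have hre : ∀ s ∈ Icc a t, HasDerivAt (fun s => (φ s).re) (m s).re s := fun s hs =>
    Complex.reCLM.hasFDerivAt.comp_hasDerivAt s (hφ s hs)
  refine monotoneOn_of_deriv_nonneg (convex_Icc a t)
    (fun s hs => (hre s hs).continuousAt.continuousWithinAt)
    (fun s hs => (hre s (interior_subset hs)).differentiableAt.differentiableWithinAt)
    (fun s hs => ?_) hs (right_mem_Icc.2 (hs.1.trans hs.2)) hs.2
  rw [(hre s (interior_subset hs)).deriv]
  exact hm s (interior_subset hs)

theorem norm_le_add_integral (hat : a ≤ t) (hφ : ∀ s ∈ Icc a t, HasDerivAt φ (m s) s)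
    (hm : ∀ s ∈ Icc a t, 0 ≤ (m s).re)
    (hw : ∀ s ∈ Icc a t, HasDerivAt w (g s - m s * w s) s) (hg : ContinuousOn g (Icc a t)) :
    ‖w t‖ ≤ ‖w a‖ + ∫ s in a..t, ‖g s‖ := by
  have hE := fun s (hs : s ∈ Icc a t) => norm_exp_le_of_deriv_re_nonneg hφ hm hs
  have hEc : ContinuousOn (fun s => exp (φ s)) (Icc a t) := fun s hs =>
    (hφ s hs).continuousAt.cexp.continuousWithinAt
  have hd : ∀ s ∈ uIcc a t, HasDerivAt (fun s => exp (φ s) * w s)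
      (exp (φ s) * g s) s := fun s hs => by
    rw [uIcc_of_le hat] at hs
    exact ((hφ s hs).cexp.mul (hw s hs)).congr_deriv (by ring)
  have hint : IntervalIntegrable (fun s => exp (φ s) * g s) volume a t :=
    (hEc.mul hg).intervalIntegrable_of_Icc hat
  have h1 := intervalIntegral.integral_eq_sub_of_hasDerivAt hd hint
  have h2 : ‖∫ s in a..t, exp (φ s) * g s‖ ≤ ‖exp (φ t)‖ * ∫ s in a..t, ‖g s‖ := by
    rw [← intervalIntegral.integral_const_mul]
    refine (intervalIntegral.norm_integral_le_integral_norm hat).trans ?_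
    refine intervalIntegral.integral_mono_on hat hint.norm
      ((hg.norm.intervalIntegrable_of_Icc hat).const_mul _) fun s hs => ?_
    rw [norm_mul]
    exact mul_le_mul_of_nonneg_right (hE s hs) (norm_nonneg _)
  have hpos : 0 < ‖exp (φ t)‖ := norm_pos_iff.2 (exp_ne_zero _)
  refine le_of_mul_le_mul_left ?_ hpos
  have h3 : exp (φ t) * w t
      = exp (φ a) * w a + ∫ s in a..t, exp (φ s) * g s := by
    rw [h1]; ring
  calc ‖exp (φ t)‖ * ‖w t‖ = ‖exp (φ t) * w t‖ := (norm_mul _ _).symm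
    _ ≤ ‖exp (φ a) * w a‖ + ‖∫ s in a..t, exp (φ s) * g s‖ := by
        rw [h3]; exact norm_add_le _ _
    _ ≤ ‖exp (φ t)‖ * ‖w a‖ + ‖exp (φ t)‖ * ∫ s in a..t, ‖g s‖ := by
        rw [norm_mul]
        exact add_le_add (mul_le_mul_of_nonneg_right (hE a (left_mem_Icc.2 hat)) (norm_nonneg _)) h2
    _ = _ := by ring

theorem intervalIntegral_norm_le_Iic {f : ℝ → ℂ} (hat : a ≤ t)
    (hf : IntegrableOn f (Iic t)) : ∫ s in a..t, ‖f s‖ ≤ ∫ s in Iic t, ‖f s‖ := by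
  rw [intervalIntegral.integral_of_le hat]
  exact setIntegral_mono_set hf.norm (Eventually.of_forall fun _ => norm_nonneg _)
    (LE.le.eventuallyLE fun _ hx => hx.2)

theorem norm_le_integral_Iic (hφ : ∀ s < b, HasDerivAt φ (m s) s)
    (hm : ∀ s < b, 0 ≤ (m s).re) (hw : ∀ s < b, HasDerivAt w (g s - m s * w s) s)
    (hg : ContinuousOn g (Iio b)) (hgi : IntegrableOn g (Iio b)) (hw0 : Tendsto w atBot (𝓝 0))
    (ht : t < b) : ‖w t‖ ≤ ∫ s in Iic t, ‖g s‖ := by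
  have h1 : Tendsto (fun a => ‖w a‖ + ∫ s in Iic t, ‖g s‖) atBot (𝓝 (0 + ∫ s in Iic t, ‖g s‖)) :=
    (tendsto_zero_iff_norm_tendsto_zero.1 hw0).add_const _
  rw [zero_add] at h1
  refine ge_of_tendsto h1 ?_
  filter_upwards [eventually_le_atBot t] with a hat
  have hsub : Icc a t ⊆ Iio b := fun s hs => hs.2.trans_lt ht
  refine (norm_le_add_integral hat (fun s hs => hφ s (hsub hs)) (fun s hs => hm s (hsub hs))
    (fun s hs => hw s (hsub hs)) (hg.mono hsub)).trans ?_
  gcongr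
  exact intervalIntegral_norm_le_Iic hat (hgi.mono_set fun s hs => lt_of_le_of_lt hs ht)

theorem hasDerivAt_integral_Iic {f : ℝ → ℂ} (hf : ContinuousOn f (Iio b))
    (hfi : IntegrableOn f (Iio b)) (ht : t < b) :
    HasDerivAt (fun t => ∫ s in Iic t, f s) (f t) t := by
  have hfc : ∀ s < b, ContinuousAt f s := fun s hs => hf.continuousAt (Iio_mem_nhds hs)
  have hm : StronglyMeasurableAtFilter f (𝓝 t) volume :=
    hf.stronglyMeasurableAtFilter isOpen_Iio t ht
  have h1 : HasDerivAt (fun u => ∫ s in t..u, f s) (f t) t :=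
    intervalIntegral.integral_hasDerivAt_right (by simp) hm (hfc t ht)
  refine ((h1.const_add (∫ s in Iic t, f s))).congr_of_eventuallyEq ?_
  filter_upwards [Iio_mem_nhds ht] with u hu
  have hi : ∀ v < b, IntegrableOn f (Iic v) := fun v hv =>
    hfi.mono_set fun s hs => lt_of_le_of_lt hs hv
  rw [← intervalIntegral.integral_Iic_sub_Iic (hi t ht) (hi u hu)]
  ring

/-- The solution of `F' + φ' F = g` that vanishes at `-∞`, in the form `F = exp (-φ) Γ`. -/
theorem exists_primitive_halfLine (hφ : ∀ s < b, HasDerivAt φ (m s) s)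
    (hm : ∀ s < b, 0 ≤ (m s).re) (hg : ContinuousOn g (Iio b)) (hgi : IntegrableOn g (Iio b)) :
    ∃ Γ : ℝ → ℂ, (∀ t < b, HasDerivAt Γ (exp (φ t) * g t) t) ∧
      ∀ t < b, ‖Γ t‖ ≤ ‖exp (φ t)‖ * ∫ s in Iic t, ‖g s‖ := by
  have hEc : ContinuousOn (fun s => exp (φ s)) (Iio b) := fun s hs =>
    (hφ s hs).continuousAt.cexp.continuousWithinAt
  have hmono : ∀ s t, s ≤ t → t < b → ‖exp (φ s)‖ ≤ ‖exp (φ t)‖ :=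
    fun s t hst ht => norm_exp_le_of_deriv_re_nonneg (a := s)
      (fun r hr => hφ r (hr.2.trans_lt ht)) (fun r hr => hm r (hr.2.trans_lt ht))
      (left_mem_Icc.2 hst)
  have hi : ∀ t < b, IntegrableOn (fun s => exp (φ s) * g s) (Iic t) := fun t ht => by
    have hsub : Iic t ⊆ Iio b := fun s hs => lt_of_le_of_lt hs ht
    refine Integrable.bdd_mul (c := ‖exp (φ t)‖) (hgi.mono_set hsub)
      ((hEc.mono hsub).aestronglyMeasurable measurableSet_Iic) ?_
    filter_upwards [ae_restrict_mem measurableSet_Iic] with s hs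
    exact hmono s t hs ht
  refine ⟨fun t => ∫ s in Iic t, exp (φ s) * g s, fun t ht => ?_, fun t ht => ?_⟩
  · obtain ⟨t', ht', hb'⟩ := exists_between ht
    have hsub : Iio t' ⊆ Iio b := fun s hs => lt_trans hs hb'
    exact hasDerivAt_integral_Iic ((hEc.mul hg).mono hsub)
      ((hi t' hb').mono_set Iio_subset_Iic_self) ht'
  · have hsub : Iic t ⊆ Iio b := fun s hs => lt_of_le_of_lt hs ht
    rw [← integral_const_mul]
    refine (norm_integral_le_integral_norm _).trans ?_
    refine setIntegral_mono_on (hi t ht).norm ((hgi.mono_set hsub).norm.const_mul _)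
      measurableSet_Iic fun s hs => ?_
    rw [norm_mul]
    exact mul_le_mul_of_nonneg_right (hmono s t hs ht) (norm_nonneg _)

theorem tendsto_integral_Iic_atBot {f : ℝ → ℂ} (hf : IntegrableOn f (Iio b)) :
    Tendsto (fun t => ∫ s in Iic t, ‖f s‖) atBot (𝓝 0) := by
  have hf' : IntegrableOn (fun s => ‖f s‖) (Iic (b - 1)) :=
    (hf.mono_set (Iic_subset_Iio.2 (by linarith))).norm
  have h1 : Tendsto (fun t => ∫ s in t..(b - 1), ‖f s‖) atBot (𝓝 (∫ s in Iic (b - 1), ‖f s‖)) :=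
    intervalIntegral_tendsto_integral_Iic (b - 1) hf' tendsto_id
  have h2 := (tendsto_const_nhds (x := ∫ s in Iic (b - 1), ‖f s‖)).sub h1
  rw [sub_self] at h2
  refine h2.congr' ?_
  filter_upwards [eventually_le_atBot (b - 1)] with t ht
  rw [← intervalIntegral.integral_Iic_sub_Iic (hf'.mono_set (Iic_subset_Iic.2 ht)) hf']
  ring

end HalfLine

/-! ### Base points at infinity -/

/-- The point `e t` of the real line, where `e = ±1`; it tends to `-∞` or `+∞` as `t → -∞`. -/
def ray (e t : ℝ) : ℂ := ((e * t : ℝ) : ℂ)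

theorem hasDerivAt_ray (e t : ℝ) : HasDerivAt (ray e) e t := by
  have h := ((hasDerivAt_id t).const_mul e).ofReal_comp
  rw [mul_one] at h
  exact h

theorem dist_ray {e : ℝ} (he : e = 1 ∨ e = -1) (s t : ℝ) : dist (ray e s) (ray e t) = dist s t := by
  unfold ray
  rw [Complex.dist_eq, ← Complex.ofReal_sub, norm_real, Real.dist_eq, ← mul_sub,
    Real.norm_eq_abs, abs_mul]
  rcases he with rfl | rfl <;> simp

/-- Primitives on a union of discs centred on a ray, with given values on the ray. -/
theorem exists_primitive_iUnion_ball {e : ℝ} (he : e = 1 ∨ e = -1) {b : ℝ} {δ : ℝ → ℝ}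
    {f : ℂ → ℂ} {Γ : ℝ → ℂ} (hδ : ∀ t < b, 0 < δ t)
    (hf : ∀ t < b, DifferentiableOn ℂ f (ball (ray e t) (δ t)))
    (hΓ : ∀ t < b, ∀ s ∈ ball t (δ t), HasDerivAt Γ (f (ray e s) * e) s) :
    ∃ G : ℂ → ℂ, (∀ t < b, ∀ x ∈ ball (ray e t) (δ t), HasDerivAt G (f x) x) ∧
      ∀ t < b, G (ray e t) = Γ t := by
  classical
  have hex : ∀ t : ℝ, ∃ F : ℂ → ℂ, t < b → F (ray e t) = Γ t ∧
      ∀ x ∈ ball (ray e t) (δ t), HasDerivAt F (f x) x := by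
    intro t
    by_cases ht : t < b
    · obtain ⟨F, hF⟩ := (hf t ht).isExactOn_ball
      exact ⟨fun x => F x - F (ray e t) + Γ t, fun _ => ⟨by simp, fun x hx =>
        ((hF x hx).sub_const _).add_const _⟩⟩
    · exact ⟨0, fun h => absurd h ht⟩
  choose F hF using hex
  have hreal : ∀ t < b, ∀ s ∈ ball t (δ t), F t (ray e s) = Γ s := by
    intro t ht s hs
    have hd : ∀ u ∈ ball t (δ t), HasDerivAt (fun u => F t (ray e u) - Γ u) 0 u := by
      intro u hu
      have h1 : HasDerivAt (F t) (f (ray e u)) (ray e u) :=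
        (hF t ht).2 _ (by rw [mem_ball, dist_ray he]; exact hu)
      exact ((h1.comp u (hasDerivAt_ray e u)).sub (hΓ t ht u hu)).congr_deriv (sub_self _)
    have := (convex_ball t (δ t)).norm_image_sub_le_of_norm_hasDerivWithin_le (C := 0)
      (fun u hu => (hd u hu).hasDerivWithinAt) (fun _ _ => by simp)
      (mem_ball_self (hδ t ht)) hs
    rw [zero_mul, norm_le_zero_iff, (hF t ht).1, sub_self, sub_zero] at this
    exact sub_eq_zero.1 this
  have hagree : ∀ t < b, ∀ t' < b, ∀ x ∈ ball (ray e t) (δ t),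
      x ∈ ball (ray e t') (δ t') → F t x = F t' x := by
    intro t ht t' ht' x hx hx'
    have hre : ∀ r, dist (ray e (e * x.re)) (ray e r) ≤ dist x (ray e r) := by
      intro r
      have h1 : ray e (e * x.re) = (x.re : ℂ) := by
        unfold ray
        rcases he with rfl | rfl <;> simp
      rw [h1, Complex.dist_eq, Complex.dist_eq]
      have h2 : ((x.re : ℂ) - ray e r) = (((x - ray e r).re : ℝ) : ℂ) := by
        unfold ray
        rw [sub_re, ofReal_re, Complex.ofReal_sub]
      rw [h2, norm_real]
      exact abs_re_le_norm _
    have hs : e * x.re ∈ ball t (δ t) := by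
      rw [mem_ball, ← dist_ray he]; exact (hre t).trans_lt hx
    have hs' : e * x.re ∈ ball t' (δ t') := by
      rw [mem_ball, ← dist_ray he]; exact (hre t').trans_lt hx'
    have hconv : Convex ℝ (ball (ray e t) (δ t) ∩ ball (ray e t') (δ t')) :=
      (convex_ball _ _).inter (convex_ball _ _)
    have := hconv.norm_image_sub_le_of_norm_hasDerivWithin_le (C := 0)
      (f := fun x => F t x - F t' x) (f' := fun _ => 0)
      (fun u hu => ((((hF t ht).2 u hu.1).sub ((hF t' ht').2 u hu.2)).congr_deriv
        (sub_self _)).hasDerivWithinAt) (fun _ _ => by simp)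
      (x := ray e (e * x.re)) ⟨(hre t).trans_lt hx, (hre t').trans_lt hx'⟩ ⟨hx, hx'⟩
    rw [zero_mul, norm_le_zero_iff, hreal t ht _ hs, hreal t' ht' _ hs', sub_self, sub_zero] at this
    exact sub_eq_zero.1 this
  set G : ℂ → ℂ := fun x => if h : ∃ t < b, x ∈ ball (ray e t) (δ t) then
    F h.choose x else 0 with hG
  have hGF : ∀ t < b, ∀ x ∈ ball (ray e t) (δ t), G x = F t x := by
    intro t ht x hx
    have h : ∃ t < b, x ∈ ball (ray e t) (δ t) := ⟨t, ht, hx⟩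
    rw [hG]
    simp only [dif_pos h]
    exact hagree _ h.choose_spec.1 t ht x h.choose_spec.2 hx
  refine ⟨G, fun t ht x hx => ((hF t ht).2 x hx).congr_of_eventuallyEq ?_, fun t ht => ?_⟩
  · filter_upwards [isOpen_ball.mem_nhds hx] with y hy using hGF t ht y hy
  · rw [hGF t ht _ (mem_ball_self (hδ t ht)), (hF t ht).1]

/-- The equations for the coefficients of the symbol can be solved near a base point at infinity,
on a neighbourhood of the end of the ray that serves for both signs of the recursion. -/
theorem exists_symbolStep_ray {D : Set ℂ} (hD : IsOpen D) {z h : ℂ → ℂ}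
    (hz : DifferentiableOn ℂ z D) (hh : DifferentiableOn ℂ h D) {e : ℝ} (he : e = 1 ∨ e = -1)
    {b : ℝ} (hmem : ∀ t < b, ray e t ∈ D) {m : ℝ} (hm : 0 ≤ m)
    (hre : ∀ t < b, 0 ≤ (deriv z (ray e t) * e).re)
    (hhi : IntegrableOn (fun t => h (ray e t)) (Iio b)) :
    ∃ N ⊆ D, IsOpen N ∧ IsPreconnected N ∧ N.Nonempty ∧ N ∈ map (ray e) atBot ∧
      SymbolStep N (map (ray e) atBot) z h 0 ∧ SymbolStep N (map (ray e) atBot) z h m := by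
  have hcr : Continuous (ray e) := continuous_iff_continuousAt.2 fun t =>
    (hasDerivAt_ray e t).continuousAt
  have hen : ‖(e : ℂ)‖ = 1 := by rcases he with rfl | rfl <;> simp
  -- far out the integral of `h` along the ray is small
  obtain ⟨b', hb'b, hb'⟩ : ∃ b' < b, ∀ t < b', ∫ s in Iic t, ‖h (ray e s)‖ ≤ 1 / 16 := by
    have h1 := (tendsto_integral_Iic_atBot hhi).eventually_le_const
      (show (0 : ℝ) < 1 / 16 by norm_num)
    obtain ⟨B, hB⟩ := eventually_atBot.1 h1
    exact ⟨min B (b - 1), (min_le_right _ _).trans_lt (by linarith),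
      fun t ht => hB t (ht.le.trans (min_le_left _ _))⟩
  have hmem' : ∀ t < b', ray e t ∈ D := fun t ht => hmem t (ht.trans hb'b)
  -- radii of the discs
  have hδ : ∀ t : ℝ, ∃ δ > 0, t < b' → δ ≤ b' - t ∧ ball (ray e t) δ ⊆ D ∧
      ∀ x ∈ ball (ray e t) δ, ‖exp (m * (z x - z (ray e t)))‖ ≤ 2 ∧
        ‖exp (-(m * (z x - z (ray e t))))‖ ≤ 2 ∧ ‖h x‖ * δ ≤ 1 / 32 := by
    intro t
    by_cases ht : t < b'
    swap
    · exact ⟨1, one_pos, fun h => absurd h ht⟩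
    have h0 : ∀ᶠ x in 𝓝 (ray e t), x ∈ D := hD.mem_nhds (hmem' t ht)
    have hcz : ContinuousAt z (ray e t) :=
      (hz.differentiableAt (hD.mem_nhds (hmem' t ht))).continuousAt
    have hch : ContinuousAt h (ray e t) :=
      (hh.differentiableAt (hD.mem_nhds (hmem' t ht))).continuousAt
    have h1 : ∀ᶠ x in 𝓝 (ray e t), ‖exp (m * (z x - z (ray e t)))‖ < 2 :=
      (continuousAt_const.mul (hcz.sub continuousAt_const)).cexp.norm.eventually_lt_const (by simp)
    have h2 : ∀ᶠ x in 𝓝 (ray e t), ‖exp (-(m * (z x - z (ray e t))))‖ < 2 :=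
      (continuousAt_const.mul (hcz.sub continuousAt_const)).neg.cexp.norm.eventually_lt_const
        (by simp)
    have h3 : ∀ᶠ x in 𝓝 (ray e t), ‖h x‖ < ‖h (ray e t)‖ + 1 :=
      hch.norm.eventually_lt_const (by simp)
    obtain ⟨r, hr, hr'⟩ := eventually_nhds_iff_ball.1
      (h0.and (h1.and (h2.and h3)))
    obtain ⟨M, hM⟩ : ∃ M, M = ‖h (ray e t)‖ + 1 := ⟨_, rfl⟩
    have hM0 : 0 < M := by rw [hM]; positivity
    have hbt : 0 < b' - t := sub_pos.2 ht
    refine ⟨min (min r (b' - t)) (1 / (32 * M)), by positivity, fun _ =>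
      ⟨(min_le_left _ _).trans (min_le_right _ _), ?_, ?_⟩⟩
    · exact fun x hx => (hr' x (ball_subset_ball
        ((min_le_left _ _).trans (min_le_left _ _)) hx)).1
    · intro x hx
      obtain ⟨-, k1, k2, k3⟩ := hr' x (ball_subset_ball
        ((min_le_left _ _).trans (min_le_left _ _)) hx)
      refine ⟨k1.le, k2.le, ?_⟩
      have h4 : min (min r (b' - t)) (1 / (32 * M)) ≤ 1 / (32 * M) := min_le_right _ _
      calc _ ≤ M * (1 / (32 * M)) := by
            rw [← hM] at k3
            exact mul_le_mul k3.le h4 (by positivity) hM0.le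
        _ = 1 / 32 := by field_simp
  choose δ hδ0 hδ using hδ
  set N : Set ℂ := ⋃ t ∈ Iio b', ball (ray e t) (δ t) with hN
  have hmemN : ∀ {x}, x ∈ N ↔ ∃ t < b', x ∈ ball (ray e t) (δ t) := by
    intro x
    simp [hN]
  have hray : ∀ t < b', ray e t ∈ N := fun t ht => hmemN.2 ⟨t, ht, mem_ball_self (hδ0 t)⟩
  have hND : N ⊆ D := fun x hx => by
    obtain ⟨t, ht, hx⟩ := hmemN.1 hx
    exact (hδ t ht).2.1 hx
  have hNo : IsOpen N := isOpen_biUnion fun _ _ => isOpen_ball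
  have hNc : IsPreconnected N := by
    have hrc : IsPreconnected (ray e '' Iio b') :=
      isPreconnected_Iio.image _ hcr.continuousOn
    have heq : N = ⋃ t : Iio b', (ball (ray e t) (δ t) ∪ ray e '' Iio b') := by
      apply Subset.antisymm
      · intro x hx
        obtain ⟨t, ht, hx⟩ := hmemN.1 hx
        exact mem_iUnion.2 ⟨⟨t, ht⟩, Or.inl hx⟩
      · intro x hx
        obtain ⟨⟨t, ht⟩, hx | ⟨s, hs, rfl⟩⟩ := mem_iUnion.1 hx
        · exact hmemN.2 ⟨t, ht, hx⟩
        · exact hray s hs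
    rw [heq]
    refine isPreconnected_iUnion ⟨ray e (b' - 1), mem_iInter.2 fun t => Or.inr
      ⟨b' - 1, by simp, rfl⟩⟩ fun t => ?_
    exact IsPreconnected.union (ray e t) (mem_ball_self (hδ0 t)) ⟨t, t.2, rfl⟩
      (convex_ball _ _).isPreconnected hrc
  have hNl : N ∈ map (ray e) atBot := by
    rw [mem_map]
    filter_upwards [eventually_lt_atBot b'] with t ht using hray t ht
  have main : ∀ m' : ℝ, 0 ≤ m' → (∀ t < b', ∀ x ∈ ball (ray e t) (δ t),
      ‖exp (m' * (z x - z (ray e t)))‖ ≤ 2 ∧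
        ‖exp (-(m' * (z x - z (ray e t))))‖ ≤ 2) →
      SymbolStep N (map (ray e) atBot) z h m' := by
    intro m' hm' hexp f hf C hC
    have hzd : ∀ x ∈ N, HasDerivAt z (deriv z x) x := fun x hx =>
      (hz.differentiableAt (hD.mem_nhds (hND hx))).hasDerivAt
    have hzr : ∀ t < b', HasDerivAt (fun t => m' * z (ray e t)) (m' * (deriv z (ray e t) * e)) t :=
      fun t ht => ((hzd _ (hray t ht)).comp t (hasDerivAt_ray e t)).const_mul _
    have hC0 : 0 ≤ C := (norm_nonneg _).trans (hC _ (hray (b' - 1) (by linarith)))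
    have hhc : ContinuousOn (fun t => h (ray e t)) (Iio b') := fun t ht =>
      ((hh.differentiableAt (hD.mem_nhds (hND (hray t ht)))).continuousAt.comp
        hcr.continuousAt).continuousWithinAt
    have hfc : ContinuousOn (fun t => f (ray e t)) (Iio b') := fun t ht =>
      ((hf.differentiableAt (hNo.mem_nhds (hray t ht))).continuousAt.comp
        hcr.continuousAt).continuousWithinAt
    have hhi' : IntegrableOn (fun t => h (ray e t)) (Iio b') :=
      hhi.mono_set (Iio_subset_Iio hb'b.le)
    have hgc : ContinuousOn (fun t => h (ray e t) * f (ray e t) * e) (Iio b') :=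
      (hhc.mul hfc).mul continuousOn_const
    have hgi : IntegrableOn (fun t => h (ray e t) * f (ray e t) * e) (Iio b') := by
      refine Integrable.mul_const (Integrable.mul_bdd (c := C) hhi'
        (hfc.aestronglyMeasurable measurableSet_Iio) ?_) _
      filter_upwards [ae_restrict_mem measurableSet_Iio] with s hs
      exact hC _ (hray s hs)
    obtain ⟨Γ, hΓ, hΓb⟩ := exists_primitive_halfLine (m := fun t => m' * (deriv z (ray e t) * e))
      hzr (fun t ht => by
        rw [re_ofReal_mul]
        exact mul_nonneg hm' (hre t (lt_trans ht hb'b))) hgc hgi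
    have hΓb' : ∀ t < b', ‖Γ t‖ ≤ ‖exp (m' * z (ray e t))‖ *
        (C * ∫ s in Iic t, ‖h (ray e s)‖) := fun t ht => by
      refine (hΓb t ht).trans (mul_le_mul_of_nonneg_left ?_ (norm_nonneg _))
      have hsub : Iic t ⊆ Iio b' := fun s hs => lt_of_le_of_lt hs ht
      rw [← integral_const_mul]
      refine setIntegral_mono_on (hgi.mono_set hsub).norm ((hhi'.mono_set hsub).norm.const_mul _)
        measurableSet_Iic fun s hs => ?_
      rw [norm_mul, norm_mul, hen, mul_one, mul_comm]
      exact mul_le_mul_of_nonneg_right (hC _ (hray s (hsub hs))) (norm_nonneg _)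
    have hEd : DifferentiableOn ℂ (fun x => exp (m' * z x) * (h x * f x)) N :=
      DifferentiableOn.mul (fun x hx => ((hzd x hx).const_mul (m' : ℂ)).cexp.differentiableAt.differentiableWithinAt)
        ((hh.mono hND).mul hf)
    obtain ⟨G, hG, hGr⟩ := exists_primitive_iUnion_ball he (b := b') (δ := δ) (Γ := Γ)
      (f := fun x => exp (m' * z x) * (h x * f x)) (fun t _ => hδ0 t)
      (fun t ht => hEd.mono fun x hx => hmemN.2 ⟨t, ht, hx⟩) (fun t ht s hs => by
        have hsb : s < b' := by
          have h1 := (hδ t ht).1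
          rw [mem_ball, Real.dist_eq, abs_lt] at hs
          linarith [hs.2]
        exact (hΓ s hsb).congr_deriv (by ring))
    have hinv : ∀ x, exp (-(m' * z x)) * exp (m' * z x) = 1 := fun x => by
      rw [← exp_add]; simp
    have hΓn : ∀ t < b', ‖exp (-(m' * z (ray e t))) * Γ t‖
        ≤ C * ∫ s in Iic t, ‖h (ray e s)‖ := fun t ht => by
      rw [norm_mul]
      refine (mul_le_mul_of_nonneg_left (hΓb' t ht) (norm_nonneg _)).trans (le_of_eq ?_)
      rw [← mul_assoc, ← norm_mul, hinv, norm_one, one_mul]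
    refine ⟨fun x => exp (-(m' * z x)) * G x, fun x hx => ?_, fun x hx => ?_, ?_⟩
    · obtain ⟨t, ht, hxt⟩ := hmemN.1 hx
      have e1 := ((hzd x hx).const_mul (m' : ℂ)).neg.cexp
      exact (e1.mul (hG t ht x hxt)).congr_deriv (by linear_combination (h x * f x) * hinv x)
    · obtain ⟨t, ht, hxt⟩ := hmemN.1 hx
      have hct := mem_ball_self (x := ray e t) (hδ0 t)
      have hδt := hδ0 t
      have k1 := (convex_ball (ray e t) (δ t)).norm_image_sub_le_of_norm_hasDerivWithin_le
        (f := fun y => exp (-(m' * z (ray e t))) * G y) (C := 2 * (1 / (32 * δ t) * C))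
        (fun y hy => ((hG t ht y hy).const_mul _).hasDerivWithinAt) (fun y hy => by
          have e1 : exp (-(m' * z (ray e t))) * (exp (m' * z y) * (h y * f y))
              = exp (m' * (z y - z (ray e t))) * (h y * f y) := by
            rw [← mul_assoc, ← exp_add]
            congr 2
            ring
          rw [e1, norm_mul, norm_mul]
          refine mul_le_mul (hexp t ht y hy).1 (mul_le_mul ?_ (hC y (hmemN.2 ⟨t, ht, hy⟩))
            (norm_nonneg _) (by positivity)) (by positivity) (by norm_num)
          have e2 := ((hδ t ht).2.2 y hy).2.2
          rw [le_div_iff₀ (by positivity)]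
          linarith) hct hxt
      have k2 : ‖x - ray e t‖ ≤ δ t := by
        rw [← dist_eq_norm]; exact (mem_ball.1 hxt).le
      have k3 : ‖exp (-(m' * z (ray e t))) * G x
          - exp (-(m' * z (ray e t))) * G (ray e t)‖ ≤ C / 16 := by
        refine k1.trans ((mul_le_mul_of_nonneg_left k2 (by positivity)).trans (le_of_eq ?_))
        field_simp
        ring
      have k4 : ‖exp (-(m' * z (ray e t))) * G (ray e t)‖ ≤ C / 16 := by
        rw [hGr t ht]
        refine (hΓn t ht).trans ?_
        have := mul_le_mul_of_nonneg_left (hb' t ht) hC0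
        linarith
      have k5 : exp (-(m' * z x)) * G x = exp (-(m' * (z x - z (ray e t)))) *
          (exp (-(m' * z (ray e t))) * G x) := by
        rw [← mul_assoc, ← exp_add]
        congr 2
        ring
      have k6 : ‖exp (-(m' * z (ray e t))) * G x‖ ≤ C / 8 := by
        have := norm_add_le (exp (-(m' * z (ray e t))) * G x
          - exp (-(m' * z (ray e t))) * G (ray e t))
          (exp (-(m' * z (ray e t))) * G (ray e t))
        rw [sub_add_cancel] at this
        linarith
      simp only [k5]
      rw [norm_mul]
      have := mul_le_mul (hexp t ht x hxt).2 k6 (norm_nonneg _) (by norm_num)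
      linarith
    · rw [tendsto_map'_iff]
      have k1 := (tendsto_integral_Iic_atBot hhi).const_mul C
      rw [mul_zero] at k1
      refine squeeze_zero_norm' ?_ k1
      filter_upwards [eventually_lt_atBot b'] with t ht
      simp only [Function.comp_apply, hGr t ht]
      exact hΓn t ht
  refine ⟨N, hND, hNo, hNc, ⟨_, hray (b' - 1) (by linarith)⟩, hNl, ?_, ?_⟩
  · have := main 0 le_rfl (fun t _ x _ => by simp)
    simpa using this
  · exact main m hm fun t ht x hx =>
      ⟨((hδ t ht).2.2 x hx).1, ((hδ t ht).2.2 x hx).2.1⟩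

/-- Estimates for a branch along the end `t ≤ b` of a ray: the real part of the phase has slope at
least `c`, the logarithmic derivative of `H` is bounded by `M` and has integral at most `L`. -/
structure RayBound (A S : ℂ → ℂ) (Om : Set ℂ) (lam : ℂ) (e b c M L : ℝ) (z H : ℂ → ℂ)
    (D : Set ℂ) : Prop where
  isOpen : IsOpen D
  branch : ∀ x ∈ D, IsBranchAt A S Om lam z H x
  mem : ∀ t ≤ b, ray e t ∈ D
  slope : ∀ t ≤ b, c ≤ (H (ray e t) ^ 2 * gPlus A S (ray e t) lam * e).re
  bound : ∀ t ≤ b, ‖logDerivH A S (ray e t) lam * e‖ ≤ M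
  integrable : IntegrableOn (fun t => logDerivH A S (ray e t) lam * e) (Iic b)
  integral_le : ∫ t in Iic b, ‖logDerivH A S (ray e t) lam * e‖ ≤ L
  bound_H : ∀ t ≤ b, ‖H (ray e t)‖ ≤ 2 ∧ ‖(H (ray e t))⁻¹‖ ≤ 2

namespace RayBound

variable {lam : ℂ} {e b c M L : ℝ} {z H : ℂ → ℂ} {D : Set ℂ}

theorem integrable' (h : RayBound A S Om lam e b c M L z H D) (hAS : IsPotentialPair A S Om)
    (he : e = 1 ∨ e = -1) :
    IntegrableOn (fun t => (fun x => deriv H x / H x) (ray e t)) (Iio b) := by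
  have h1 : IntegrableOn (fun t => logDerivH A S (ray e t) lam * e * e) (Iio b) :=
    (h.integrable.mono_set Iio_subset_Iic_self).mul_const (e : ℂ)
  refine h1.congr_fun (fun t ht => ?_) measurableSet_Iio
  simp only
  rw [IsBranchAt.deriv_H hAS h.isOpen h.branch (h.mem t (le_of_lt ht)), mul_assoc]
  rcases he with rfl | rfl <;> simp

theorem deriv_slope (h : RayBound A S Om lam e b c M L z H D) (hc : 0 < c) :
    ∀ t < b, 0 ≤ (deriv z (ray e t) * e).re := fun t ht => by
  rw [(h.branch _ (h.mem t ht.le)).hasDerivAt.deriv]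
  exact hc.le.trans (h.slope t ht.le)

theorem exists_isExactWKB (h : RayBound A S Om lam e b c M L z H D)
    (hAS : IsPotentialPair A S Om) (he : e = 1 ∨ e = -1) (hc : 0 < c) {eps : ℝ} (heps : 0 < eps) :
    ∃ u, IsExactWKB A S Om D eps lam 1 z H (map (ray e) atBot) u := by
  have hz : DifferentiableOn ℂ z D := fun x hx =>
    (h.branch x hx).hasDerivAt.differentiableAt.differentiableWithinAt
  have hH : DifferentiableOn ℂ H D := fun x hx => (h.branch x hx).diff.differentiableWithinAt
  have hh : DifferentiableOn ℂ (fun x => deriv H x / H x) D :=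
    (hH.deriv h.isOpen).div hH fun x hx => (h.branch x hx).ne
  obtain ⟨N, hND, hNo, hNc, ⟨x₁, hx₁⟩, hNl, h0, h1⟩ := exists_symbolStep_ray h.isOpen hz hh he
    (fun t ht => h.mem t (le_of_lt ht)) (m := 2 / eps) (by positivity) (h.deriv_slope hc)
    (h.integrable' hAS he)
  refine DiracWKB.exists_isExactWKB hAS heps h.branch hNo hNc hND hx₁ hNl
    (Or.inl ⟨rfl, rfl⟩) h0 ?_
  rw [one_mul]
  simpa using h1

/-- At a base point at infinity the symbol tends to `(1, 0)`. -/
theorem tendsto_symbol (h : RayBound A S Om lam e b c M L z H D)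
    (hAS : IsPotentialPair A S Om) (he : e = 1 ∨ e = -1) (hc : 0 < c) {eps : ℝ} (heps : 0 < eps)
    {u : ℂ → Fin 2 → ℂ} (hu : IsExactWKB A S Om D eps lam 1 z H (map (ray e) atBot) u) :
    Tendsto (fun t => pco eps (z (ray e t)) (H (ray e t)) (redC S eps u (ray e t))
      (redD S eps u (ray e t))) atBot (𝓝 1) ∧
    Tendsto (fun t => qco eps (z (ray e t)) (H (ray e t)) (redC S eps u (ray e t))
      (redD S eps u (ray e t))) atBot (𝓝 0) := by
  obtain ⟨-, N, hNo, hND, hN, w, hw, hsum⟩ := hu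
  have hen : ‖(e : ℂ)‖ = 1 := by rcases he with rfl | rfl <;> simp
  obtain ⟨b', hb'b, hb'⟩ : ∃ b' ≤ b, ∀ t < b', ray e t ∈ N := by
    obtain ⟨B, hB⟩ := eventually_atBot.1 (mem_map.1 hN)
    exact ⟨min b B, min_le_left _ _, fun t ht => hB t (ht.le.trans (min_le_right _ _))⟩
  have hhi := (h.integrable' hAS he).mono_set (Iio_subset_Iio hb'b)
  set J : ℝ → ℝ := fun t => ∫ s in Iic t, ‖(fun x => deriv H x / H x) (ray e s)‖ with hJ
  have hJ0 : ∀ t, 0 ≤ J t := fun t => integral_nonneg fun _ => norm_nonneg _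
  have hJm : ∀ s t, s ≤ t → t < b' → J s ≤ J t := fun s t hst ht =>
    setIntegral_mono_set (hhi.mono_set (Iic_subset_Iio.2 ht)).norm
      (Eventually.of_forall fun _ => norm_nonneg _) (LE.le.eventuallyLE (Iic_subset_Iic.2 hst))
  have hcr : Continuous (ray e) := continuous_iff_continuousAt.2 fun t =>
    (hasDerivAt_ray e t).continuousAt
  have hd : ∀ n, ∀ t < b', HasDerivAt (fun t => w n (ray e t)) (deriv (w n) (ray e t) * e) t :=
    fun n t ht => ((hw.differentiableOn n).differentiableAt
      (hNo.mem_nhds (hb' t ht))).hasDerivAt.comp t (hasDerivAt_ray e t)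
  have hHc : ContinuousOn (fun t => (fun x => deriv H x / H x) (ray e t)) (Iio b') := by
    have hH : DifferentiableOn ℂ H D := fun x hx => (h.branch x hx).diff.differentiableWithinAt
    exact ((hH.deriv h.isOpen).div hH fun x hx => (h.branch x hx).ne).continuousOn.comp
      hcr.continuousOn fun t ht => hND (hb' t ht)
  have hbase : ∀ n, 1 ≤ n → Tendsto (fun t => w n (ray e t)) atBot (𝓝 0) := fun n hn =>
    tendsto_map'_iff.1 (hw.base n hn)
  have hzd : ∀ t < b', HasDerivAt (fun t => z (ray e t)) (deriv z (ray e t) * e) t := fun t ht =>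
    (h.branch _ (hND (hb' t ht))).hasDerivAt.differentiableAt.hasDerivAt.comp t (hasDerivAt_ray e t)
  have hstep : ∀ (n : ℕ) (m : ℝ), 0 ≤ m → (∀ x ∈ N, deriv (w (n + 1)) x
      = deriv H x / H x * w n x - m * deriv z x * w (n + 1) x) →
      (∀ t < b', ‖w n (ray e t)‖ ≤ J t ^ n) → ∀ t < b', ‖w (n + 1) (ray e t)‖ ≤ J t ^ (n + 1) := by
    intro n m hm heq hn t ht
    set g : ℝ → ℂ := fun t => (fun x => deriv H x / H x) (ray e t) * w n (ray e t) * e with hg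
    have hgc : ContinuousOn g (Iio b') :=
      (hHc.mul fun t ht => (hd n t ht).continuousAt.continuousWithinAt).mul continuousOn_const
    have hgn : ∀ t s, s ≤ t → t < b' →
        ‖g s‖ ≤ J t ^ n * ‖(fun x => deriv H x / H x) (ray e s)‖ := by
      intro t s hst ht
      rw [hg]
      simp only
      rw [norm_mul, norm_mul, hen, mul_one, mul_comm]
      exact mul_le_mul_of_nonneg_right ((hn s (hst.trans_lt ht)).trans
        (pow_le_pow_left₀ (hJ0 s) (hJm s t hst ht) n)) (norm_nonneg _)
    have hgi : ∀ t < b', IntegrableOn g (Iic t) := fun t ht => by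
      have hsub : Iic t ⊆ Iio b' := Iic_subset_Iio.2 ht
      refine Integrable.mono' ((hhi.mono_set hsub).norm.const_mul (J t ^ n))
        ((hgc.mono hsub).aestronglyMeasurable measurableSet_Iic) ?_
      filter_upwards [ae_restrict_mem measurableSet_Iic] with s hs using hgn t s hs ht
    obtain ⟨t', htt', ht'⟩ := exists_between ht
    have hsub : Iio t' ⊆ Iio b' := Iio_subset_Iio ht'.le
    have h1 := norm_le_integral_Iic (b := t') (w := fun t => w (n + 1) (ray e t)) (g := g)
      (φ := fun t => m * z (ray e t)) (m := fun t => m * (deriv z (ray e t) * e))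
      (fun s hs => (hzd s (hsub hs)).const_mul _)
      (fun s hs => by
        rw [re_ofReal_mul]
        exact mul_nonneg hm (h.deriv_slope hc s ((hsub hs).trans_le hb'b)))
      (fun s hs => (hd (n + 1) s (hsub hs)).congr_deriv (by
        rw [heq _ (hb' s (hsub hs)), hg]; ring)) (hgc.mono hsub)
      ((hgi t' ht').mono_set Iio_subset_Iic_self) (hbase (n + 1) (by omega)) htt'
    refine h1.trans ?_
    rw [pow_succ, hJ, ← integral_const_mul]
    exact setIntegral_mono_on (hgi t ht).norm
      ((hhi.mono_set (Iic_subset_Iio.2 ht)).norm.const_mul _) measurableSet_Iic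
      fun s hs => hgn t s hs ht
  have hbd : ∀ n, ∀ t < b', ‖w n (ray e t)‖ ≤ J t ^ n := by
    intro n
    induction n with
    | zero => intro t ht; rw [hw.zero _ (hb' t ht)]; simp
    | succ n ih =>
      rcases Nat.even_or_odd' n with ⟨k, rfl | rfl⟩
      · refine hstep _ (2 / eps) (by positivity) (fun x hx => ?_) ih
        rw [← hw.odd k x hx]
        push_cast
        ring
      · refine hstep _ 0 le_rfl (fun x hx => ?_) ih
        rw [hw.even k x hx]
        simp
  have hJt : Tendsto J atBot (𝓝 0) := tendsto_integral_Iic_atBot hhi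
  have hJ2 : Tendsto (fun t => J t * 2) atBot (𝓝 0) := by simpa using hJt.mul_const 2
  have hgeo : ∀ t, HasSum (fun n : ℕ => J t * (1 / 2 : ℝ) ^ n) (J t * 2) := fun t =>
    hasSum_geometric_two.mul_left _
  have hsmall : ∀ᶠ t in atBot, t < b' ∧ J t ≤ 1 / 2 :=
    (eventually_lt_atBot b').and (hJt.eventually_le_const (by norm_num))
  have hpow : ∀ t, J t ≤ 1 / 2 → ∀ n k : ℕ, n ≤ k → J t ^ (k + 1) ≤ J t * (1 / 2 : ℝ) ^ n := by
    intro t ht n k hnk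
    rw [pow_succ']
    refine mul_le_mul_of_nonneg_left ((pow_le_pow_left₀ (hJ0 t) ht k).trans ?_) (hJ0 t)
    exact pow_le_pow_of_le_one (by norm_num) (by norm_num) hnk
  have hpq : ∀ t < b', pco eps (z (ray e t)) (H (ray e t)) (redC S eps u (ray e t))
      (redD S eps u (ray e t)) = ∑' n, w (2 * n) (ray e t) ∧
      qco eps (z (ray e t)) (H (ray e t)) (redC S eps u (ray e t))
      (redD S eps u (ray e t)) = ∑' n, w (2 * n + 1) (ray e t) := fun t ht => by
    have := pco_qco_wkbVector (κ := 1) (Or.inl ⟨rfl, rfl⟩) (h.branch _ (hND (hb' t ht))).ne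
      (hsum _ (hb' t ht)).2.2
    simpa using this
  constructor
  · rw [← tendsto_sub_nhds_zero_iff]
    refine squeeze_zero_norm' ?_ hJ2
    filter_upwards [hsmall] with t ⟨ht, hJ'⟩
    rw [(hpq t ht).1, (hsum _ (hb' t ht)).1.tsum_eq_zero_add, mul_zero, hw.zero _ (hb' t ht),
      add_sub_cancel_left]
    exact tsum_of_norm_bounded (hgeo t) fun n =>
      (hbd _ t ht).trans (hpow t hJ' n (2 * n + 1) (by omega))
  · refine squeeze_zero_norm' ?_ hJ2
    filter_upwards [hsmall] with t ⟨ht, hJ'⟩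
    rw [(hpq t ht).2]
    exact tsum_of_norm_bounded (hgeo t) fun n =>
      (hbd _ t ht).trans (hpow t hJ' n (2 * n) (by omega))

/-- WKB asymptotics of a solution with base point at infinity, along the whole end of the ray. -/
theorem norm_symbol_le (h : RayBound A S Om lam e b c M L z H D)
    (hAS : IsPotentialPair A S Om) (he : e = 1 ∨ e = -1) (hc : 0 < c) (hM : 0 ≤ M) {eps : ℝ}
    (heps : 0 < eps) (hsmall : eps * M * L / c ≤ 1)
    {u : ℂ → Fin 2 → ℂ} (hu : IsExactWKB A S Om D eps lam 1 z H (map (ray e) atBot) u) :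
    ∀ t ≤ b, ‖qco eps (z (ray e t)) (H (ray e t)) (redC S eps u (ray e t))
      (redD S eps u (ray e t))‖ ≤ eps * M / c ∧
      ‖pco eps (z (ray e t)) (H (ray e t)) (redC S eps u (ray e t))
      (redD S eps u (ray e t)) - 1‖ ≤ L * (eps * M / c) := by
  obtain ⟨h1, h2⟩ := h.tendsto_symbol hAS he hc heps hu
  have hcd := hu.1.isReduced heps.ne' hAS.isOpen hAS.holo_S
  have hder : ∀ t ≤ b, _ := fun t ht => hasDerivAt_symbol_comp heps.ne' h.isOpen hAS h.branch hcd
    (hasDerivAt_ray e t) (h.mem t ht) 1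
  simp only [div_one] at hder
  refine norm_symbol_le_of_tendsto heps hc hM (fun t ht => (hder t ht).1)
    (fun t ht => (hder t ht).2)
    (fun t ht => (h.branch _ (h.mem t ht)).hasDerivAt.comp t (hasDerivAt_ray e t)) ?_
    h.bound h.slope ?_ hsmall h1 h2
  · refine ContinuousOn.mul (fun t ht => ?_) continuousOn_const
    have hbt := h.branch _ (h.mem t ht)
    have e2 : ContinuousAt (fun w => logDerivH A S w lam) (ray e t) :=
      continuousAt_slice (continuousAt_logDerivH hAS hbt.mem hbt.gPlus_ne hbt.gMinus_ne)
    exact (e2.comp (hasDerivAt_ray e t).continuousAt).continuousWithinAt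
  · exact fun a ha => (intervalIntegral_norm_le_Iic ha h.integrable).trans h.integral_le

/-- A WKB solution with base point at infinity is square integrable there. -/
theorem memLp (h : RayBound A S Om lam e b c M L z H D)
    (hAS : IsPotentialPair A S Om) (he : e = 1 ∨ e = -1) (hc : 0 < c) (hM : 0 ≤ M) {eps : ℝ}
    (heps : 0 < eps) (hsmall : eps * M * L / c ≤ 1)
    {u : ℂ → Fin 2 → ℂ} (hu : IsExactWKB A S Om D eps lam 1 z H (map (ray e) atBot) u)
    (i : Fin 2) : MemLp (fun t => u (ray e t) i) 2 (volume.restrict (Iic b)) := by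
  have hsym := h.norm_symbol_le hAS he hc hM heps hsmall hu
  set P := 1 + L * (eps * M / c) + eps * M / c with hP
  have hP0 : 0 ≤ P := by
    have h1 := hsym b le_rfl
    have h2 := (norm_nonneg _).trans h1.1
    have h3 := (norm_nonneg _).trans h1.2
    linarith
  have hre : ∀ t ≤ b, (z (ray e t)).re ≤ (z (ray e b)).re + c * (t - b) := by
    intro t ht
    have hd : ∀ s ≤ b, HasDerivAt (fun s => (z (ray e s)).re - c * s)
        ((H (ray e s) ^ 2 * gPlus A S (ray e s) lam * e).re - c) s := fun s hs => by
      have := Complex.reCLM.hasFDerivAt.comp_hasDerivAt s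
        ((h.branch _ (h.mem s hs)).hasDerivAt.comp s (hasDerivAt_ray e s))
      have h2 := this.sub ((hasDerivAt_id s).const_mul c)
      rw [mul_one] at h2
      exact h2
    have hint : ∀ {s}, s ∈ interior (Iic b) → s ≤ b := fun hs => interior_subset (s := Iic b) hs
    have hmono : MonotoneOn (fun s => (z (ray e s)).re - c * s) (Iic b) := by
      refine monotoneOn_of_deriv_nonneg (convex_Iic b)
        (fun s hs => (hd s hs).continuousAt.continuousWithinAt)
        (fun s hs => (hd s (hint hs)).differentiableAt.differentiableWithinAt)
        (fun s hs => ?_)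
      rw [(hd s (hint hs)).deriv, sub_nonneg]
      exact h.slope s (hint hs)
    have := hmono ht self_mem_Iic ht
    simp only at this
    linarith
  have hphase : ∀ t, ‖exp (I * S (ray e t) / (2 * eps))‖ = 1 ∧
      ‖exp (-(I * S (ray e t)) / (2 * eps))‖ = 1 := by
    intro t
    have h0 : S (ray e t) = ((S (ray e t)).re : ℂ) :=
      Complex.ext rfl (by rw [ofReal_im]; exact hAS.real_S (e * t))
    rw [h0]
    constructor
    · rw [show I * ((S (ray e t)).re : ℂ) / (2 * eps)
        = (((S (ray e t)).re / (2 * eps) : ℝ) : ℂ) * I by push_cast; ring,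
        Complex.norm_exp_ofReal_mul_I]
    · rw [show -(I * ((S (ray e t)).re : ℂ)) / (2 * eps)
        = ((-(S (ray e t)).re / (2 * eps) : ℝ) : ℂ) * I by push_cast; ring,
        Complex.norm_exp_ofReal_mul_I]
  set C := 4 * Real.exp (((z (ray e b)).re - c * b) / eps) * P with hC
  have hbd : ∀ t ≤ b, ‖u (ray e t) i‖ ≤ C * Real.exp (c / eps * t) := by
    intro t ht
    obtain ⟨hH1, hH2⟩ := h.bound_H t ht
    obtain ⟨hq, hp⟩ := hsym t ht
    obtain ⟨e1, e2⟩ := eq_of_pco_qco (eps := eps) (z := z (ray e t)) (H := H (ray e t))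
      (c := redC S eps u (ray e t)) (d := redD S eps u (ray e t)) (h.branch _ (h.mem t ht)).ne
    set p := pco eps (z (ray e t)) (H (ray e t)) (redC S eps u (ray e t)) (redD S eps u (ray e t))
    set q := qco eps (z (ray e t)) (H (ray e t)) (redC S eps u (ray e t)) (redD S eps u (ray e t))
    have hpq : ‖q‖ + ‖p‖ ≤ P := by
      have : ‖p‖ ≤ ‖p - 1‖ + 1 := by simpa using norm_add_le (p - 1) 1
      linarith
    have hexp : ‖exp (z (ray e t) / eps)‖
        ≤ Real.exp (((z (ray e b)).re - c * b) / eps) * Real.exp (c / eps * t) := by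
      rw [norm_exp, ← Real.exp_add, Real.exp_le_exp, Complex.div_ofReal_re,
        show ((z (ray e b)).re - c * b) / eps + c / eps * t
          = ((z (ray e b)).re + c * (t - b)) / eps by ring]
      exact div_le_div_of_nonneg_right (hre t ht) heps.le
    set X := Real.exp (((z (ray e b)).re - c * b) / eps) * Real.exp (c / eps * t) with hX
    have hX0 : 0 ≤ X := by positivity
    have hc1 : ‖redC S eps u (ray e t)‖ ≤ X * 2 * P := by
      rw [e1, norm_mul, norm_mul]
      exact mul_le_mul (mul_le_mul hexp hH2 (norm_nonneg _) hX0) ((norm_add_le _ _).trans hpq)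
        (norm_nonneg _) (by positivity)
    have hd1 : ‖redD S eps u (ray e t)‖ ≤ X * 2 * P := by
      rw [e2, norm_mul, norm_mul, norm_mul, Complex.norm_I, one_mul]
      exact mul_le_mul (mul_le_mul hexp hH1 (norm_nonneg _) hX0) ((norm_sub_le _ _).trans hpq)
        (norm_nonneg _) (by positivity)
    have hu' : u (ray e t) i = unred S eps (redC S eps u) (redD S eps u) (ray e t) i := by
      rw [unred_red]
    have htot : ‖u (ray e t) i‖ ≤ ‖redC S eps u (ray e t)‖ + ‖redD S eps u (ray e t)‖ := by
      rw [hu']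
      fin_cases i
      · simp only [unred, Fin.zero_eta, Fin.isValue, Matrix.cons_val_zero]
        rw [norm_mul, (hphase t).1, one_mul]
        exact norm_add_le _ _
      · simp only [unred, Fin.mk_one, Fin.isValue, Matrix.cons_val_one, Matrix.cons_val_fin_one]
        rw [norm_mul, (hphase t).2, one_mul]
        exact (norm_add_le _ _).trans (by rw [norm_neg])
    calc _ ≤ X * 2 * P + X * 2 * P := htot.trans (add_le_add hc1 hd1)
      _ = C * Real.exp (c / eps * t) := by rw [hC, hX]; ring
  have hcont : ContinuousOn (fun t => u (ray e t) i) (Iic b) := fun t ht => by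
    obtain ⟨h0, h1, -⟩ := hu.1 _ (h.branch _ (h.mem t ht)).mem
    have hi : DifferentiableAt ℂ (fun y => u y i) (ray e t) := by
      fin_cases i
      · exact h0
      · exact h1
    exact (hi.continuousAt.comp (hasDerivAt_ray e t).continuousAt).continuousWithinAt
  have hmeas := hcont.aestronglyMeasurable (μ := volume) measurableSet_Iic
  rw [memLp_two_iff_integrable_sq_norm hmeas]
  have hce : 0 < 2 * (c / eps) := by positivity
  refine Integrable.mono' ((integrableOn_exp_mul_Iic hce b).const_mul (C ^ 2))
    (hmeas.norm.pow 2) ?_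
  filter_upwards [ae_restrict_mem measurableSet_Iic] with t ht
  rw [Real.norm_of_nonneg (by positivity)]
  calc ‖u (ray e t) i‖ ^ 2 ≤ (C * Real.exp (c / eps * t)) ^ 2 :=
        pow_le_pow_left₀ (norm_nonneg _) (hbd t ht) 2
    _ = C ^ 2 * Real.exp (2 * (c / eps) * t) := by
        rw [mul_pow, ← Real.exp_nat_mul]
        push_cast
        ring_nf

end RayBound

theorem integrable_comp_ray {f : ℂ → ℂ} (hf : Integrable fun x : ℝ => f x) {e : ℝ}
    (he : e = 1 ∨ e = -1) : Integrable fun t => f (ray e t) := by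
  rcases he with rfl | rfl
  · simpa [ray] using hf
  · simpa [ray] using hf.comp_neg

theorem im_deriv_of_real {f : ℂ → ℂ} (hf : ∀ x : ℝ, (f x).im = 0) {x : ℝ}
    (hd : DifferentiableAt ℂ f x) : (deriv f x).im = 0 := by
  have h1 : HasDerivAt (fun t : ℝ => f t) (deriv f x) x := hd.hasDerivAt.comp_ofReal
  have h2 : HasDerivAt (fun t : ℝ => (f t).im) (deriv f x).im x :=
    Complex.imCLM.hasFDerivAt.comp_hasDerivAt x h1
  have h3 : (fun t : ℝ => (f t).im) = fun _ => 0 := funext hf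
  rw [h3] at h2
  exact h2.unique (hasDerivAt_const x (0 : ℝ))

/-- Uniform estimates along an end of the real line: there `A` and `S'` are small, so the phase has
slope close to `± i lam`. -/
theorem BranchFamily.exists_rayBound (B : BranchFamily A S Om lam₀) (hAS : IsPotentialPair A S Om)
    (hlam₀ : lam₀.im ≠ 0) {e : ℝ} (he : e = 1 ∨ e = -1) {b : ℝ}
    (hmem : ∀ᶠ lam in 𝓝 lam₀, ∀ t < b, ray e t ∈ B.D lam)
    (hmono : MonotoneOn (fun t => (B.Z (ray e t) lam₀).re) (Iio b)) :
    ∃ b' < b, ∃ M L : ℝ, 0 ≤ M ∧ 0 ≤ L ∧ ∀ᶠ lam in 𝓝 lam₀,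
      RayBound A S Om lam e b' (|lam₀.im| / 2) M L (fun x => B.Z x lam) (fun x => B.H x lam)
        (B.D lam) := by
  obtain ⟨y, hy⟩ : ∃ y, y = |lam₀.im| := ⟨_, rfl⟩
  have hy0 : 0 < y := by rw [hy]; exact abs_pos.2 hlam₀
  rw [← hy]
  have hen : ‖(e : ℂ)‖ = 1 := by rcases he with rfl | rfl <;> simp
  have hee : e ^ 2 = 1 := by rcases he with rfl | rfl <;> norm_num
  have hOm : ∀ t, ray e t ∈ Om := fun t => hAS.real_mem _
  have hA' : ∀ t, HasDerivAt (fun t => A (ray e t)) (deriv A (ray e t) * e) t := fun t =>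
    (hAS.holo_A.differentiableAt (hAS.isOpen.mem_nhds (hOm t))).hasDerivAt.comp t
      (hasDerivAt_ray e t)
  have hS' : ∀ t, HasDerivAt (fun t => deriv S (ray e t)) (deriv (deriv S) (ray e t) * e) t :=
    fun t => (hAS.differentiableOn_dS.differentiableAt
      (hAS.isOpen.mem_nhds (hOm t))).hasDerivAt.comp t (hasDerivAt_ray e t)
  have iA := integrable_comp_ray hAS.integrable_dA he
  have iS := integrable_comp_ray hAS.integrable_ddS he
  have tA : Tendsto (fun t => A (ray e t)) atBot (𝓝 0) :=
    tendsto_zero_of_hasDerivAt_of_integrableOn_Iic (a := 0) (fun t _ => hA' t)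
      (iA.mul_const (e : ℂ)).integrableOn (integrable_comp_ray hAS.integrable_A he).integrableOn
  obtain ⟨K, hK⟩ := hAS.bounded
  have hKr : ∀ t, ‖deriv A (ray e t)‖ ≤ K ∧ ‖deriv (deriv S) (ray e t)‖ ≤ K := fun t => hK _
  have hK0 : 0 ≤ K := (norm_nonneg _).trans (hKr 0).1
  have hAim : ∀ t, (A (ray e t)).im = 0 := fun t => hAS.real_A _
  have hSim : ∀ t, (deriv S (ray e t)).im = 0 := fun t => im_deriv_of_real hAS.real_S
    (hAS.holo_S.differentiableAt (hAS.isOpen.mem_nhds (hOm t)))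
  obtain ⟨b', hb'b, hb'⟩ : ∃ b' < b, ∀ t ≤ b', ‖A (ray e t)‖ ≤ y / 8 := by
    have h1 : ∀ᶠ t in atBot, ‖A (ray e t)‖ ≤ y / 8 :=
      (tendsto_zero_iff_norm_tendsto_zero.1 tA).eventually_le_const (by positivity)
    obtain ⟨β, hβ⟩ := eventually_atBot.1 h1
    exact ⟨min β (b - 1), (min_le_right _ _).trans_lt (by linarith),
      fun t ht => hβ t (ht.trans (min_le_left _ _))⟩
  have hare : ∀ t ≤ b', |(A (ray e t)).re| ≤ y / 8 := fun t ht =>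
    (abs_re_le_norm _).trans (hb' t ht)
  have imP : ∀ lam t, (gPlus A S (ray e t) lam).im = -(lam.im + (A (ray e t)).re) := by
    intro lam t
    have := hSim t
    unfold gPlus
    simp [this]
  have imM : ∀ lam t, (gMinus A S (ray e t) lam).im = lam.im - (A (ray e t)).re := by
    intro lam t
    have := hSim t
    unfold gMinus
    simp [this]
  have hnear : ∀ᶠ lam in 𝓝 lam₀, 3 / 4 * y ≤ |lam.im| := by
    have h1 : Tendsto (fun lam : ℂ => |lam.im|) (𝓝 lam₀) (𝓝 |lam₀.im|) :=
      (continuous_im.abs).tendsto lam₀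
    exact h1.eventually_const_le (by rw [← hy]; linarith)
  -- the phase is not stationary on the ray
  have hdz : ∀ lam, 3 / 4 * y ≤ |lam.im| → ∀ ρ : ℂ, ∀ t ≤ b', ρ ^ 2 = V₀ A S (ray e t) lam →
      y / 2 ≤ |(ρ * e).re| := by
    intro lam hl ρ t ht hρ
    have e1 : (ρ * e).re ^ 2 = ρ.re ^ 2 := by
      rw [Complex.re_mul_ofReal, mul_pow, hee, mul_one]
    have hV := hρ
    set σ := lam + deriv S (ray e t) / 2 with hσ
    have hσim : σ.im = lam.im := by
      have := hSim t
      rw [hσ]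
      simp [this]
    have hA0 : A (ray e t) = ((A (ray e t)).re : ℂ) :=
      Complex.ext rfl (by rw [ofReal_im]; exact hAim t)
    unfold V₀ at hV
    rw [← hσ, hA0] at hV
    have hVr := congrArg Complex.re hV
    have hVi := congrArg Complex.im hV
    simp only [pow_two, mul_re, mul_im, sub_re, sub_im,
      neg_re, neg_im, ofReal_re, ofReal_im] at hVr hVi
    have ha2 : (A (ray e t)).re ^ 2 ≤ (y / 8) ^ 2 := sq_le_sq' (by
      linarith [(abs_le.1 (hare t ht)).1]) (abs_le.1 (hare t ht)).2
    have hl2 : (3 / 4 * y) ^ 2 ≤ lam.im ^ 2 := by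
      rw [← sq_abs lam.im]; exact pow_le_pow_left₀ (by positivity) hl 2
    set X := ρ.re
    set Y := ρ.im
    set a := (A (ray e t)).re
    rw [hσim] at hVr hVi
    set v := lam.im
    set s := σ.re
    -- `X² - Y² = v² - s² - a²` and `X Y = - s v`
    have k1 : X * Y = -(s * v) := by linarith
    have k2 : X ^ 2 - Y ^ 2 = v ^ 2 - s ^ 2 - a ^ 2 := by linarith
    have k3 : (y / 2) ^ 2 ≤ X ^ 2 := by
      by_contra hcon
      push Not at hcon
      have k4 : X ^ 2 * Y ^ 2 = s ^ 2 * v ^ 2 := by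
        rw [← mul_pow, k1]; ring
      have k5 : Y ^ 2 = X ^ 2 - v ^ 2 + s ^ 2 + a ^ 2 := by linarith
      have k6 : X ^ 2 < v ^ 2 - a ^ 2 := by nlinarith
      have k7 : Y ^ 2 < s ^ 2 := by linarith
      have k8 : X ^ 2 ≤ v ^ 2 := by nlinarith [sq_nonneg a]
      have hs : 0 < s ^ 2 := lt_of_le_of_lt (sq_nonneg Y) k7
      have hv : 0 < v ^ 2 := by nlinarith
      nlinarith [mul_le_mul_of_nonneg_right k8 (sq_nonneg Y)]
    rw [← e1, ← sq_abs (ρ * e).re] at k3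
    exact (sq_le_sq₀ (by positivity) (abs_nonneg _)).1 k3
  -- the slope at `lam₀` is positive
  have hbr₀ : ∀ t < b, ray e t ∈ B.D lam₀ := hmem.self_of_nhds
  have hlam₀y : 3 / 4 * y ≤ |lam₀.im| := by rw [← hy]; linarith
  have hpos₀ : 0 < (B.dZ (ray e b') lam₀ * e).re := by
    have h1 := hdz lam₀ hlam₀y (B.dZ (ray e b') lam₀) b' le_rfl (B.good₀ (hbr₀ b' hb'b)).sq_eq
    have h2 : HasDerivAt (fun t => (B.Z (ray e t) lam₀).re) (B.dZ (ray e b') lam₀ * e).re b' :=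
      Complex.reCLM.hasFDerivAt.comp_hasDerivAt b'
        ((B.good₀ (hbr₀ b' hb'b)).hasDerivAt.comp b' (hasDerivAt_ray e b'))
    have h3 : 0 ≤ (B.dZ (ray e b') lam₀ * e).re := by
      rw [← h2.deriv, ← derivWithin_of_mem_nhds (Iio_mem_nhds hb'b)]
      exact hmono.derivWithin_nonneg
    rw [abs_of_nonneg h3] at h1
    linarith
  have hposlam : ∀ᶠ lam in 𝓝 lam₀, 0 < (B.dZ (ray e b') lam * e).re := by
    have h1 : Tendsto (fun lam : ℂ => (ray e b', lam)) (𝓝 lam₀) (𝓝 (ray e b', lam₀)) :=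
      (continuous_const.prodMk continuous_id).tendsto lam₀
    have h2 := ((B.continuousAt_dZ hAS (hbr₀ b' hb'b)).tendsto.comp h1).mul_const (e : ℂ)
    exact ((continuous_re.tendsto _).comp h2).eventually_const_lt hpos₀
  set G : ℝ → ℝ := fun t => (‖deriv (deriv S) (ray e t)‖ / 2 + ‖deriv A (ray e t)‖) / y with hG
  have hGi : Integrable G := ((iS.norm.div_const 2).add iA.norm).div_const y
  have hG0 : ∀ t, 0 ≤ G t := fun t => by positivity
  refine ⟨b', hb'b, (K / 2 + K) / y, ∫ t in Iic b', G t, by positivity,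
    integral_nonneg hG0, ?_⟩
  filter_upwards [hmem, hnear, hposlam, B.isOpen, B.good] with lam hm hn hp ho hg
  have hgP : ∀ t ≤ b', y / 2 ≤ ‖gPlus A S (ray e t) lam‖ := fun t ht => by
    refine le_trans ?_ (Complex.abs_im_le_norm _)
    rw [imP, abs_neg]
    have h1 := abs_sub_abs_le_abs_add lam.im (A (ray e t)).re
    linarith [hare t ht]
  have hgM : ∀ t ≤ b', y / 2 ≤ ‖gMinus A S (ray e t) lam‖ := fun t ht => by
    refine le_trans ?_ (Complex.abs_im_le_norm _)
    rw [imM]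
    have h1 := abs_sub_abs_le_abs_sub lam.im (A (ray e t)).re
    linarith [hare t ht]
  have hbr : ∀ t ≤ b', IsBranchAt A S Om lam (fun x => B.Z x lam) (fun x => B.H x lam) (ray e t) :=
    fun t ht => hg _ (hm t (ht.trans_lt hb'b))
  have hlG : ∀ t ≤ b', ‖logDerivH A S (ray e t) lam * e‖ ≤ G t := by
    intro t ht
    have hy2 : 0 < y / 2 := by positivity
    have hnum : ‖deriv (deriv S) (ray e t) / 2‖ = ‖deriv (deriv S) (ray e t)‖ / 2 := by
      rw [norm_div]; simp
    have hnum2 : ‖I * deriv A (ray e t)‖ = ‖deriv A (ray e t)‖ := by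
      rw [norm_mul, Complex.norm_I, one_mul]
    have n1 : ‖(deriv (deriv S) (ray e t) / 2 - I * deriv A (ray e t))
        / gMinus A S (ray e t) lam‖ ≤ (‖deriv (deriv S) (ray e t)‖ / 2 + ‖deriv A (ray e t)‖)
          / (y / 2) := by
      rw [norm_div]
      refine div_le_div₀ (by positivity) ?_ hy2 (hgM t ht)
      exact (norm_sub_le _ _).trans (by rw [hnum, hnum2])
    have n2 : ‖(deriv (deriv S) (ray e t) / 2 + I * deriv A (ray e t))
        / gPlus A S (ray e t) lam‖ ≤ (‖deriv (deriv S) (ray e t)‖ / 2 + ‖deriv A (ray e t)‖)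
          / (y / 2) := by
      rw [norm_div]
      refine div_le_div₀ (by positivity) ?_ hy2 (hgP t ht)
      exact (norm_add_le _ _).trans (by rw [hnum, hnum2])
    rw [norm_mul, hen, mul_one, logDerivH, norm_div]
    have h4 : ‖(4 : ℂ)‖ = 4 := by simp
    rw [h4]
    have := (norm_add_le _ _).trans (add_le_add n1 n2)
    calc _ ≤ _ := div_le_div_of_nonneg_right this (by norm_num)
      _ = G t := by rw [hG]; field_simp; ring
  have hcr : Continuous (ray e) := continuous_iff_continuousAt.2 fun t =>
    (hasDerivAt_ray e t).continuousAt
  have hlc : ContinuousOn (fun t => logDerivH A S (ray e t) lam * e) (Iic b') := by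
    refine ContinuousOn.mul (fun t ht => ?_) continuousOn_const
    have hbt := hbr t ht
    have e2 : ContinuousAt (fun w => logDerivH A S w lam) (ray e t) :=
      continuousAt_slice (continuousAt_logDerivH hAS hbt.mem hbt.gPlus_ne hbt.gMinus_ne)
    exact (e2.comp hcr.continuousAt).continuousWithinAt
  have hli : IntegrableOn (fun t => logDerivH A S (ray e t) lam * e) (Iic b') := by
    refine Integrable.mono' hGi.integrableOn (hlc.aestronglyMeasurable measurableSet_Iic) ?_
    filter_upwards [ae_restrict_mem measurableSet_Iic] with t ht using hlG t ht
  refine ⟨ho, hg, fun t ht => hm t (ht.trans_lt hb'b), fun t ht => ?_, fun t ht => ?_, hli, ?_,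
    fun t ht => ?_⟩
  · have h1 := hdz lam hn _ t ht (hbr t ht).sq_eq
    have hcont : ContinuousOn (fun t => (B.dZ (ray e t) lam * e).re) (Iic b') := fun t ht => by
      have h2 : ContinuousAt (fun x => B.dZ x lam) (ray e t) :=
        ((hbr t ht).diff.continuousAt.pow 2).mul (hasDerivAt_gPlus hAS (hOm t)).continuousAt
      exact (continuous_re.continuousAt.comp
        ((h2.comp hcr.continuousAt).mul continuousAt_const)).continuousWithinAt
    have hpt : 0 < (B.dZ (ray e t) lam * e).re := by
      by_contra hcon
      push Not at hcon
      obtain ⟨s, hs, hs0⟩ := isPreconnected_Iic.intermediate_value ht self_mem_Iic hcont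
        ⟨hcon, hp.le⟩
      have := hdz lam hn _ s hs (hbr s hs).sq_eq
      rw [show (B.H (ray e s) lam ^ 2 * gPlus A S (ray e s) lam * e).re = 0 from hs0,
        abs_zero] at this
      linarith
    rw [abs_of_pos (show 0 < (B.H (ray e t) lam ^ 2 * gPlus A S (ray e t) lam * e).re from hpt)]
      at h1
    exact h1
  · refine (hlG t ht).trans ?_
    rw [hG]
    have := hKr t
    simp only
    gcongr
    · exact this.2
    · exact this.1
  · exact setIntegral_mono_on hli.norm hGi.integrableOn measurableSet_Iic fun t ht => hlG t ht
  · have hb1 := hbr t ht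
    have hsum : gMinus A S (ray e t) lam = -gPlus A S (ray e t) lam - 2 * I * A (ray e t) := by
      unfold gMinus gPlus; ring
    have hsum' : gPlus A S (ray e t) lam = -gMinus A S (ray e t) lam - 2 * I * A (ray e t) := by
      unfold gMinus gPlus; ring
    have hA2 : ‖2 * I * A (ray e t)‖ ≤ y / 4 := by
      rw [norm_mul, norm_mul, Complex.norm_I]
      simp only [Complex.norm_ofNat, mul_one]
      linarith [hb' t ht]
    have hpow : ‖B.H (ray e t) lam‖ ^ 4 * ‖gPlus A S (ray e t) lam‖ = ‖gMinus A S (ray e t) lam‖ := by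
      rw [← norm_pow, ← norm_mul]; exact congrArg norm hb1.pow
    have n1 : ‖gMinus A S (ray e t) lam‖ ≤ 2 * ‖gPlus A S (ray e t) lam‖ := by
      have := norm_sub_le (-gPlus A S (ray e t) lam) (2 * I * A (ray e t))
      rw [← hsum, norm_neg] at this
      linarith [hgP t ht]
    have n2 : ‖gPlus A S (ray e t) lam‖ ≤ 2 * ‖gMinus A S (ray e t) lam‖ := by
      have := norm_sub_le (-gMinus A S (ray e t) lam) (2 * I * A (ray e t))
      rw [← hsum', norm_neg] at this
      linarith [hgM t ht]
    have hP0 : 0 < ‖gPlus A S (ray e t) lam‖ := norm_pos_iff.2 hb1.gPlus_ne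
    set x := ‖B.H (ray e t) lam‖ with hx
    have hx0 : 0 ≤ x := norm_nonneg _
    constructor
    · by_contra hcon
      push Not at hcon
      have : (2 : ℝ) ^ 4 ≤ x ^ 4 := pow_le_pow_left₀ (by norm_num) hcon.le 4
      have := mul_le_mul_of_nonneg_right this hP0.le
      rw [hpow] at this
      linarith
    · have hxp : 0 < x := norm_pos_iff.2 hb1.ne
      rw [norm_inv, ← hx, inv_le_comm₀ hxp (by norm_num)]
      by_contra hcon
      push Not at hcon
      have : x ^ 4 ≤ (2⁻¹ : ℝ) ^ 4 := pow_le_pow_left₀ hx0 hcon.le 4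
      have := mul_le_mul_of_nonneg_right this hP0.le
      rw [hpow] at this
      linarith

/-! ### Eigenvalues -/

theorem conj_pot (hAS : IsPotentialPair A S Om) (x : ℝ) :
    starRingEnd ℂ (pot A S eps x) = potConj A S eps x := by
  have hA : starRingEnd ℂ (A x) = A x := Complex.conj_eq_iff_im.2 (hAS.real_A x)
  have hS : starRingEnd ℂ (S x) = S x := Complex.conj_eq_iff_im.2 (hAS.real_S x)
  unfold pot potConj
  rw [map_mul, map_mul, map_neg, Complex.conj_I, hA, ← Complex.exp_conj, map_div₀, map_mul,
    Complex.conj_I, hS, Complex.conj_ofReal]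
  ring_nf

/-- Two solutions whose determinant vanishes are proportional. -/
theorem IsDiracSolution.exists_eq_smul (hAS : IsPotentialPair A S Om) (heps : eps ≠ 0)
    {u v : ℂ → Fin 2 → ℂ} (hu : IsDiracSolution A S Om eps lam u)
    (hv : IsDiracSolution A S Om eps lam v) {x₁ : ℂ} (hx₁ : x₁ ∈ Om) (hv₁ : v x₁ ≠ 0)
    (hw : wr u v x₁ = 0) : ∃ k : ℂ, ∀ x ∈ Om, u x = k • v x := by
  obtain ⟨k, hk⟩ : ∃ k : ℂ, u x₁ = k • v x₁ := by
    unfold wr at hw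
    have hv0 : v x₁ 0 ≠ 0 ∨ v x₁ 1 ≠ 0 := by
      by_contra hcon
      push Not at hcon
      apply hv₁
      funext i
      fin_cases i
      · exact hcon.1
      · exact hcon.2
    rcases hv0 with h | h
    · refine ⟨u x₁ 0 / v x₁ 0, ?_⟩
      funext i
      fin_cases i
      · simp [h]
      · simp only [Fin.mk_one, Fin.isValue, Pi.smul_apply, smul_eq_mul]
        field_simp
        linear_combination -hw
    · refine ⟨u x₁ 1 / v x₁ 1, ?_⟩
      funext i
      fin_cases i
      · simp only [Fin.zero_eta, Fin.isValue, Pi.smul_apply, smul_eq_mul]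
        field_simp
        linear_combination hw
      · simp [h]
  refine ⟨k, fun x hx => ?_⟩
  have hur := hu.isReduced heps hAS.isOpen hAS.holo_S
  have hvr := hv.isReduced heps hAS.isOpen hAS.holo_S
  have hkv : IsReduced A S Om eps lam (fun x => k * redC S eps v x)
      (fun x => k * redD S eps v x) := fun y hy =>
    ⟨((hvr y hy).1.const_mul k).congr_deriv (by ring),
      ((hvr y hy).2.const_mul k).congr_deriv (by ring)⟩
  have hred : redC S eps u x₁ = k * redC S eps v x₁ ∧ redD S eps u x₁ = k * redD S eps v x₁ := by
    unfold redC redD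
    rw [hk]
    simp only [Pi.smul_apply, smul_eq_mul]
    constructor <;> ring
  obtain ⟨h1, h2⟩ := IsSystemSolution.eqOn hAS.isOpen hAS.isSimplyConnected
    (fun x hx => ((hasDerivAt_gPlus hAS hx).const_mul _).differentiableAt.differentiableWithinAt)
    (fun x hx => ((hasDerivAt_gMinus hAS hx).const_mul _).differentiableAt.differentiableWithinAt)
    hAS.isOpen hAS.isSimplyConnected.isPathConnected.isConnected.isPreconnected Subset.rfl hur hkv
    hx₁ hred.1 hred.2 hx
  rw [← unred_red S eps u, ← unred_red S eps v]
  funext i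
  fin_cases i <;> simp [unred, h1, h2] <;> ring

/-- A square integrable eigenfunction is proportional to every solution that is square integrable
at one end: their determinant is constant and integrable there. -/
theorem eigenfunction_det_eq_zero (hAS : IsPotentialPair A S Om) (heps : eps ≠ 0) {e b : ℝ}
    (he : e = 1 ∨ e = -1) {v : ℂ → Fin 2 → ℂ} (hv : IsDiracSolution A S Om eps lam v)
    (hv2 : ∀ i, MemLp (fun t => v (ray e t) i) 2 (volume.restrict (Iic b))) {u₁ u₂ : ℝ → ℂ}
    (hd1 : Differentiable ℝ u₁) (hd2 : Differentiable ℝ u₂) (hm1 : MemLp u₁ 2 volume)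
    (hm2 : MemLp u₂ 2 volume) (heq : ∀ x : ℝ,
      -((eps : ℂ) / I) * deriv u₁ x + pot A S eps x * u₂ x = lam * u₁ x ∧
      -(starRingEnd ℂ (pot A S eps x)) * u₁ x + ((eps : ℂ) / I) * deriv u₂ x
        = lam * u₂ x) (x : ℝ) : u₁ x * v x 1 - v x 0 * u₂ x = 0 := by
  have hE : (eps : ℂ) / I ≠ 0 := div_ne_zero (by exact_mod_cast heps) Complex.I_ne_zero
  have hder : ∀ x : ℝ, HasDerivAt (fun x : ℝ => u₁ x * v x 1 - v x 0 * u₂ x) 0 x := by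
    intro x
    obtain ⟨h0, h1, e0, e1⟩ := hv x (hAS.real_mem x)
    obtain ⟨f1, f2⟩ := heq x
    rw [conj_pot hAS] at f2
    have k0 : HasDerivAt (fun x : ℝ => v x 0) (deriv (fun y => v y 0) x) x :=
      h0.hasDerivAt.comp_ofReal
    have k1 : HasDerivAt (fun x : ℝ => v x 1) (deriv (fun y => v y 1) x) x :=
      h1.hasDerivAt.comp_ofReal
    refine (((hd1 x).hasDerivAt.mul k1).sub (k0.mul (hd2 x).hasDerivAt)).congr_deriv ?_
    apply mul_left_cancel₀ hE
    linear_combination (u₁ x) * e1 - (u₂ x) * e0 - (v x 1) * f1 - (v x 0) * f2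
  have hconst : ∀ y : ℝ, u₁ y * v y 1 - v y 0 * u₂ y = u₁ x * v x 1 - v x 0 * u₂ x := fun y =>
    is_const_of_deriv_eq_zero (fun y => (hder y).differentiableAt) (fun y => (hder y).deriv) y x
  have hcomp : ∀ {f : ℝ → ℂ}, MemLp f 2 volume →
      MemLp (fun t => f (e * t)) 2 (volume.restrict (Iic b)) := by
    intro f hf
    refine MemLp.restrict _ ?_
    rcases he with rfl | rfl
    · simpa using hf
    · have := hf.comp_measurePreserving (Measure.measurePreserving_neg volume)
      simpa [Function.comp_def] using this
  have hint := ((hcomp hm1).integrable_mul (hv2 1)).sub ((hv2 0).integrable_mul (hcomp hm2))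
  have heqf : ((fun t => u₁ (e * t)) * (fun t => v (ray e t) 1)
      - (fun t => v (ray e t) 0) * fun t => u₂ (e * t))
      = fun _ => u₁ x * v x 1 - v x 0 * u₂ x := by
    funext t
    exact hconst (e * t)
  rw [heqf] at hint
  have := (integrableOn_const_iff (μ := volume) (s := Iic b)).1 hint
  rcases this with h | h
  · simpa using h
  · simp at h

/-- An eigenfunction is proportional to `u` near `-∞` and to `v` near `+∞`, since Wronskians of square
integrable solutions vanish; conversely, if `u` and `v` are proportional, they are square integrable on
the whole line. -/
theorem isEigenvalue_iff (hAS : IsPotentialPair A S Om) (heps : eps ≠ 0) {b b' : ℝ}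
    {u v : ℂ → Fin 2 → ℂ} (hu : IsDiracSolution A S Om eps lam u)
    (hv : IsDiracSolution A S Om eps lam v)
    (hu2 : ∀ i, MemLp (fun t => u (ray 1 t) i) 2 (volume.restrict (Iic b)))
    (hv2 : ∀ i, MemLp (fun t => v (ray (-1) t) i) 2 (volume.restrict (Iic b')))
    (hu0 : ∃ x : ℝ, u x ≠ 0) (hv0 : ∃ x : ℝ, v x ≠ 0) {x : ℂ} (hx : x ∈ Om) :
    IsEigenvalue A S eps lam ↔ wr u v x = 0 := by
  constructor
  · rintro ⟨u₁, u₂, hd1, hd2, hm1, hm2, ⟨x₁, hx₁⟩, heq⟩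
    have h1 := eigenfunction_det_eq_zero hAS heps (Or.inl rfl) hu hu2 hd1 hd2 hm1 hm2 heq x₁
    have h2 := eigenfunction_det_eq_zero hAS heps (Or.inr rfl) hv hv2 hd1 hd2 hm1 hm2 heq x₁
    rw [wr_const hAS heps hu hv hx (hAS.real_mem x₁)]
    unfold wr
    rcases hx₁ with h | h
    · apply mul_left_cancel₀ h
      linear_combination (-v x₁ 0) * h1 + (u x₁ 0) * h2
    · apply mul_left_cancel₀ h
      linear_combination (-v x₁ 1) * h1 + (u x₁ 1) * h2
  · intro hw
    obtain ⟨x₁, hx₁⟩ := hv0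
    obtain ⟨k, hk⟩ := hu.exists_eq_smul hAS heps hv (hAS.real_mem x₁) hx₁
      (by rw [← wr_const hAS heps hu hv hx (hAS.real_mem x₁)]; exact hw)
    have hcont : ∀ i, Continuous fun t : ℝ => u t i := fun i =>
      continuous_iff_continuousAt.2 fun t => by
        obtain ⟨h0, h1, -⟩ := hu t (hAS.real_mem t)
        have hi : DifferentiableAt ℂ (fun y => u y i) (t : ℂ) := by
          fin_cases i
          · exact h0
          · exact h1
        exact hi.continuousAt.comp Complex.continuous_ofReal.continuousAt
    have hmem : ∀ i, MemLp (fun t : ℝ => u t i) 2 volume := by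
      intro i
      have hmeas := (hcont i).aestronglyMeasurable (μ := volume)
      rw [memLp_two_iff_integrable_sq_norm hmeas, ← integrableOn_univ]
      have i1 : IntegrableOn (fun t : ℝ => ‖u t i‖ ^ 2) (Iic b) := by
        have := (memLp_two_iff_integrable_sq_norm (hu2 i).1).1 (hu2 i)
        simpa [ray, IntegrableOn] using this
      have i2 : IntegrableOn (fun t : ℝ => ‖u t i‖ ^ 2) (Icc b (-b')) :=
        ((hcont i).norm.pow 2).integrableOn_Icc
      have i3 : IntegrableOn (fun t : ℝ => ‖u t i‖ ^ 2) (Ici (-b')) := by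
        have h1 := ((memLp_two_iff_integrable_sq_norm (hv2 i).1).1 (hv2 i)).const_mul (‖k‖ ^ 2)
        have h2 : IntegrableOn ((fun t : ℝ => ‖u t i‖ ^ 2) ∘ Neg.neg) (Neg.neg ⁻¹' Ici (-b')) := by
          have hs : (Neg.neg ⁻¹' Ici (-b') : Set ℝ) = Iic b' := by ext; simp
          rw [hs]
          refine h1.congr (Eventually.of_forall fun t => ?_)
          simp only [Function.comp_apply]
          rw [hk _ (hAS.real_mem _), Pi.smul_apply, smul_eq_mul, norm_mul, mul_pow]
          simp [ray]
        exact ((Measure.measurePreserving_neg volume).integrableOn_comp_preimage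
          (MeasurableEquiv.neg ℝ).measurableEmbedding).1 h2
      refine ((i1.union i2).union i3).mono_set fun t _ => ?_
      rcases le_total t b with h | h
      · exact Or.inl (Or.inl h)
      · rcases le_total t (-b') with h' | h'
        · exact Or.inl (Or.inr ⟨h, h'⟩)
        · exact Or.inr h'
    obtain ⟨x₂, hx₂⟩ := hu0
    refine ⟨fun t => u t 0, fun t => u t 1, ?_, ?_, hmem 0, hmem 1, ⟨x₂, ?_⟩, fun t => ?_⟩
    · exact fun t => (hu t (hAS.real_mem t)).1.hasDerivAt.comp_ofReal.differentiableAt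
    · exact fun t => (hu t (hAS.real_mem t)).2.1.hasDerivAt.comp_ofReal.differentiableAt
    · by_contra hcon
      push Not at hcon
      apply hx₂
      funext i
      fin_cases i
      · exact hcon.1
      · exact hcon.2
    · obtain ⟨h0, h1, e0, e1⟩ := hu t (hAS.real_mem t)
      have k0 : deriv (fun x : ℝ => u x 0) t = deriv (fun y => u y 0) t :=
        h0.hasDerivAt.comp_ofReal.deriv
      have k1 : deriv (fun x : ℝ => u x 1) t = deriv (fun y => u y 1) t :=
        h1.hasDerivAt.comp_ofReal.deriv
      rw [k0, k1, conj_pot hAS]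
      exact ⟨by linear_combination -e0, by linear_combination e1⟩

/-! ### Straightening a simple turning point -/

/-- A zero-free holomorphic function on a disc has a holomorphic square root. -/
theorem exists_sqrt_ball {c : ℂ} {r : ℝ} {q : ℂ → ℂ} (hq : DifferentiableOn ℂ q (ball c r))
    (hq0 : ∀ x ∈ ball c r, q x ≠ 0) :
    ∃ θ : ℂ → ℂ, DifferentiableOn ℂ θ (ball c r) ∧
      ∀ x ∈ ball c r, θ x ^ 2 = q x := by
  rcases le_or_gt r 0 with hr | hr
  · refine ⟨fun _ => 0, differentiableOn_const 0, fun x hx => ?_⟩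
    rw [ball_eq_empty.2 hr] at hx
    exact absurd hx (Set.notMem_empty x)
  have hc : c ∈ ball c r := mem_ball_self hr
  obtain ⟨F, hF⟩ := ((hq.deriv isOpen_ball).div (hq.const_mul 2)
    fun x hx => mul_ne_zero two_ne_zero (hq0 x hx)).isExactOn_ball
  have hd : ∀ x ∈ ball c r, HasDerivAt (fun y => q y * exp (-(2 * F y))) 0 x := by
    intro x hx
    have h1 := (hq.differentiableAt (isOpen_ball.mem_nhds hx)).hasDerivAt
    refine (h1.mul (((hF x hx).const_mul 2).neg.cexp)).congr_deriv ?_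
    have := hq0 x hx
    simp only [Pi.div_apply]
    field_simp
    ring
  have hconst : ∀ x ∈ ball c r,
      q x * exp (-(2 * F x)) = q c * exp (-(2 * F c)) := by
    intro x hx
    have := (convex_ball c r).norm_image_sub_le_of_norm_hasDerivWithin_le (C := 0)
      (fun y hy => (hd y hy).hasDerivWithinAt) (fun _ _ => by simp) hc hx
    rw [zero_mul, norm_le_zero_iff] at this
    exact sub_eq_zero.1 this
  refine ⟨fun x => exp (log (q c * exp (-(2 * F c))) / 2) *
    exp (F x), fun x hx =>
      ((hF x hx).cexp.const_mul _).differentiableAt.differentiableWithinAt, fun x hx => ?_⟩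
  have hne : q c * exp (-(2 * F c)) ≠ 0 := mul_ne_zero (hq0 c hc) (exp_ne_zero _)
  rw [mul_pow, ← exp_nat_mul, ← exp_nat_mul]
  push_cast
  rw [mul_div_cancel₀ _ (two_ne_zero' ℂ), exp_log hne, ← hconst x hx, mul_assoc,
    ← exp_add]
  simp

/-- The average `∫₀¹ 2 s² w(τ + s² (x - τ)) ds`, a holomorphic solution `G` of
`(3/2) G + (x - τ) G' = w`. -/
noncomputable def tpAverage (w : ℂ → ℂ) (τ x : ℂ) : ℂ :=
  ∫ s in (0 : ℝ)..1, 2 * (s : ℂ) ^ 2 * w (τ + (s : ℂ) ^ 2 * (x - τ))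

theorem segment_sq_mem {c τ x : ℂ} {r : ℝ} (hτ : τ ∈ ball c r) (hx : x ∈ ball c r)
    {s : ℝ} (hs : s ∈ Icc (0 : ℝ) 1) : τ + (s : ℂ) ^ 2 * (x - τ) ∈ ball c r := by
  have := (convex_ball c r).add_smul_sub_mem hτ hx
    (t := s ^ 2) ⟨by positivity, pow_le_one₀ hs.1 hs.2⟩
  simpa using this

theorem continuousOn_average_integrand {w : ℂ → ℂ} {c τ x : ℂ} {r : ℝ}
    (hw : ContinuousOn w (ball c r)) (hτ : τ ∈ ball c r)
    (hx : x ∈ ball c r) :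
    ContinuousOn (fun s : ℝ => 2 * (s : ℂ) ^ 2 * w (τ + (s : ℂ) ^ 2 * (x - τ))) (Icc 0 1) := by
  have h1 : Continuous fun s : ℝ => 2 * (s : ℂ) ^ 2 := by fun_prop
  have h2 : Continuous fun s : ℝ => τ + (s : ℂ) ^ 2 * (x - τ) := by fun_prop
  exact h1.continuousOn.mul (hw.comp h2.continuousOn fun s hs => segment_sq_mem hτ hx hs)

/-- Integration by parts in the defining integral gives the differential equation for the average. -/
theorem hasDerivAt_tpAverage {w : ℂ → ℂ} {c τ x : ℂ} {r : ℝ}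
    (hw : DifferentiableOn ℂ w (ball c r)) (hτ : τ ∈ ball c r)
    (hx : x ∈ ball c r) :
    ∃ G', HasDerivAt (tpAverage w τ) G' x ∧ 3 / 2 * tpAverage w τ x + (x - τ) * G' = w x := by
  obtain ⟨r', hr'1, hr'2⟩ : ∃ r', max (dist τ c) (dist x c) < r' ∧ r' < r :=
    exists_between (max_lt hτ hx)
  have hτ' : τ ∈ ball c r' := (le_max_left _ _).trans_lt hr'1
  have hx' : x ∈ ball c r' := (le_max_right _ _).trans_lt hr'1
  have hsub : closedBall c r' ⊆ ball c r := closedBall_subset_ball hr'2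
  have hsub' : ball c r' ⊆ ball c r := ball_subset_ball hr'2.le
  have hwd : ∀ y ∈ ball c r, HasDerivAt w (deriv w y) y := fun y hy =>
    (hw.differentiableAt (isOpen_ball.mem_nhds hy)).hasDerivAt
  have hwc := (hw.deriv isOpen_ball).continuousOn
  obtain ⟨C, hC⟩ := (isCompact_closedBall c r').exists_bound_of_continuousOn (hwc.mono hsub)
  set F : ℂ → ℝ → ℂ := fun x s => 2 * (s : ℂ) ^ 2 * w (τ + (s : ℂ) ^ 2 * (x - τ)) with hF
  set F' : ℂ → ℝ → ℂ := fun x s =>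
    2 * (s : ℂ) ^ 2 * (deriv w (τ + (s : ℂ) ^ 2 * (x - τ)) * (s : ℂ) ^ 2) with hF'
  have hI : uIoc (0 : ℝ) 1 ⊆ Icc 0 1 := by
    rw [uIoc_of_le zero_le_one]; exact Ioc_subset_Icc_self
  have hFc : ∀ y ∈ ball c r, ContinuousOn (F y) (Icc 0 1) := fun y hy =>
    continuousOn_average_integrand hw.continuousOn hτ hy
  have hF'c : ContinuousOn (F' x) (Icc 0 1) := by
    have h1 : Continuous fun s : ℝ => 2 * (s : ℂ) ^ 2 := by fun_prop
    have h2 : Continuous fun s : ℝ => τ + (s : ℂ) ^ 2 * (x - τ) := by fun_prop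
    have h3 : Continuous fun s : ℝ => (s : ℂ) ^ 2 := by fun_prop
    exact h1.continuousOn.mul ((hwc.comp h2.continuousOn
      fun s hs => segment_sq_mem hτ hx hs).mul h3.continuousOn)
  have hd := intervalIntegral.hasDerivAt_integral_of_dominated_loc_of_deriv_le (𝕜 := ℂ)
    (μ := volume) (F := F) (F' := F') (x₀ := x) (a := 0) (b := 1) (bound := fun _ => 2 * C)
    (isOpen_ball.mem_nhds hx')
    (by
      filter_upwards [isOpen_ball.mem_nhds hx] with y hy
      exact ((hFc y hy).mono hI).aestronglyMeasurable measurableSet_uIoc)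
    ((hFc x hx).intervalIntegrable_of_Icc zero_le_one)
    ((hF'c.mono hI).aestronglyMeasurable measurableSet_uIoc)
    (Eventually.of_forall fun s hs y hy => by
      have hs' := hI hs
      have h1 := hC _ (ball_subset_closedBall (segment_sq_mem hτ' hy hs'))
      have h2 : ‖(s : ℂ) ^ 2‖ ≤ 1 := by
        rw [norm_pow, norm_real, Real.norm_of_nonneg hs'.1]
        exact pow_le_one₀ hs'.1 hs'.2
      rw [hF']
      simp only
      rw [norm_mul, norm_mul, norm_mul, Complex.norm_ofNat]
      have hC0 : 0 ≤ C := (norm_nonneg _).trans h1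
      calc 2 * ‖(s : ℂ) ^ 2‖ * (‖deriv w (τ + (s : ℂ) ^ 2 * (y - τ))‖ * ‖(s : ℂ) ^ 2‖)
          ≤ 2 * 1 * (C * 1) := by gcongr
        _ = 2 * C := by ring)
    (by simp)
    (Eventually.of_forall fun s hs y hy => by
      have hs' := hI hs
      have h1 := hwd _ (segment_sq_mem hτ (hsub' hy) hs')
      have h2 : HasDerivAt (fun y => τ + (s : ℂ) ^ 2 * (y - τ)) ((s : ℂ) ^ 2) y := by
        simpa using (((hasDerivAt_id y).sub_const τ).const_mul ((s : ℂ) ^ 2)).const_add τ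
      exact (h1.comp y h2).const_mul _)
  refine ⟨_, hd.2, ?_⟩
  have hprim : ∀ s ∈ uIcc (0 : ℝ) 1, HasDerivAt
      (fun s : ℝ => (s : ℂ) ^ 3 * w (τ + (s : ℂ) ^ 2 * (x - τ)))
      (3 / 2 * F x s + (x - τ) * F' x s) s := by
    intro s hs
    rw [uIcc_of_le zero_le_one] at hs
    have h0 : HasDerivAt (fun s : ℝ => (s : ℂ)) 1 s := Complex.ofRealCLM.hasDerivAt
    have h1 := hwd _ (segment_sq_mem hτ hx hs)
    have h2 := ((h0.pow 2).mul_const (x - τ)).const_add τ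
    have h3 := (h0.pow 3).mul (h1.comp s h2)
    refine h3.congr_deriv ?_
    simp only [hF, hF', Function.comp_apply, Pi.pow_apply]
    push_cast
    ring
  have hint : IntervalIntegrable (fun s => 3 / 2 * F x s + (x - τ) * F' x s) volume 0 1 :=
    (((hFc x hx).const_smul (3 / 2 : ℂ)).add (hF'c.const_smul (x - τ))).intervalIntegrable_of_Icc
      zero_le_one
  have h := intervalIntegral.integral_eq_sub_of_hasDerivAt hprim hint
  rw [intervalIntegral.integral_add (((hFc x hx).intervalIntegrable_of_Icc zero_le_one).const_mul _)
    (hd.1.const_mul _), intervalIntegral.integral_const_mul, intervalIntegral.integral_const_mul] at h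
  have h2 : tpAverage w τ x = ∫ s in (0 : ℝ)..1, F x s := rfl
  rw [h2, h]
  simp

theorem norm_tpAverage_sub_le {w : ℂ → ℂ} {c τ x w₀ : ℂ} {r δ : ℝ}
    (hw : ContinuousOn w (ball c r)) (hτ : τ ∈ ball c r) (hx : x ∈ ball c r)
    (hδ : ∀ y ∈ ball c r, ‖w y - w₀‖ ≤ δ) :
    ‖tpAverage w τ x - 2 / 3 * w₀‖ ≤ 2 * δ := by
  have hc := continuousOn_average_integrand hw hτ hx
  have hconst : ∫ s in (0 : ℝ)..1, 2 * (s : ℂ) ^ 2 * w₀ = 2 / 3 * w₀ := by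
    have hprim : ∀ s ∈ uIcc (0 : ℝ) 1, HasDerivAt (fun s : ℝ => 2 / 3 * (s : ℂ) ^ 3 * w₀)
        (2 * (s : ℂ) ^ 2 * w₀) s := by
      intro s _
      have h0 : HasDerivAt (fun s : ℝ => (s : ℂ)) 1 s := Complex.ofRealCLM.hasDerivAt
      refine (((h0.pow 3).const_mul (2 / 3 : ℂ)).mul_const w₀).congr_deriv ?_
      push_cast
      ring
    have hcc : Continuous fun s : ℝ => 2 * (s : ℂ) ^ 2 * w₀ := by fun_prop
    rw [intervalIntegral.integral_eq_sub_of_hasDerivAt hprim (hcc.intervalIntegrable 0 1)]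
    simp
  have hcc : Continuous fun s : ℝ => 2 * (s : ℂ) ^ 2 * w₀ := by fun_prop
  rw [tpAverage, ← hconst, ← intervalIntegral.integral_sub
    (hc.intervalIntegrable_of_Icc zero_le_one) (hcc.intervalIntegrable 0 1)]
  have := intervalIntegral.norm_integral_le_of_norm_le_const (a := 0) (b := 1) (C := 2 * δ)
    (f := fun s : ℝ => 2 * (s : ℂ) ^ 2 * w (τ + (s : ℂ) ^ 2 * (x - τ)) - 2 * (s : ℂ) ^ 2 * w₀)
    (fun s hs => by
      rw [uIoc_of_le zero_le_one] at hs
      have hs' := Ioc_subset_Icc_self hs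
      have h2 : ‖(s : ℂ) ^ 2‖ ≤ 1 := by
        rw [norm_pow, norm_real, Real.norm_of_nonneg hs'.1]
        exact pow_le_one₀ hs'.1 hs'.2
      rw [← mul_sub, norm_mul, norm_mul, Complex.norm_ofNat]
      have h3 := hδ _ (segment_sq_mem hτ hx hs')
      calc 2 * ‖(s : ℂ) ^ 2‖ * ‖w (τ + (s : ℂ) ^ 2 * (x - τ)) - w₀‖ ≤ 2 * 1 * δ := by gcongr
        _ = 2 * δ := by ring)
  simpa using this

/-- A square root of `V / (x - τ)`, close to `w₀`. -/
noncomputable def tpRoot (v₀ w₀ : ℂ) (V : ℂ → ℂ) (τ x : ℂ) : ℂ :=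
  w₀ * exp (log (dslope V τ x / v₀) / 2)

/-- The straightening coordinate `X` at the simple zero `τ` of `V`: it vanishes at `τ` and
satisfies `(9/4) X X'² = V`, so that `X^(3/2)` is a primitive of `√V`. -/
noncomputable def tpCoord (v₀ w₀ c₀ : ℂ) (V : ℂ → ℂ) (τ x : ℂ) : ℂ :=
  (x - τ) * (c₀ * exp (2 / 3 *
    log (tpAverage (tpRoot v₀ w₀ V τ) τ x / (2 / 3 * w₀))))

/-- The properties of the straightening coordinate, with a smallness condition `η` that is uniform in
`V` and `τ`: if `V / (x - τ)` is close to the constant `v₀`, then the coordinate is close to `c₀ (x - τ)`. -/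
theorem tpCoord_spec {v₀ w₀ c₀ : ℂ} (hv₀ : v₀ ≠ 0) (hw₀ : w₀ ^ 2 = v₀)
    (hc₀ : c₀ ^ 3 = (2 / 3 * w₀) ^ 2) :
    ∃ η > 0, ∀ (V : ℂ → ℂ) (c τ : ℂ) (r : ℝ), DifferentiableOn ℂ V (ball c r) →
      τ ∈ ball c r → V τ = 0 → (∀ x ∈ ball c r, ‖dslope V τ x - v₀‖ < η) →
      ∀ x ∈ ball c r,
        (dslope V τ x / v₀ ∈ slitPlane ∧ ‖tpRoot v₀ w₀ V τ x - w₀‖ ≤ 1 ∧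
          tpAverage (tpRoot v₀ w₀ V τ) τ x / (2 / 3 * w₀) ∈ slitPlane ∧
          DifferentiableAt ℂ (tpRoot v₀ w₀ V τ) x) ∧
        DifferentiableAt ℂ (tpCoord v₀ w₀ c₀ V τ) x ∧
        ‖deriv (tpCoord v₀ w₀ c₀ V τ) x - c₀‖ ≤ ‖c₀‖ / 4 ∧
        9 / 4 * tpCoord v₀ w₀ c₀ V τ x * deriv (tpCoord v₀ w₀ c₀ V τ) x ^ 2 = V x := by
  have hw0 : w₀ ≠ 0 := by rintro rfl; apply hv₀; rw [← hw₀]; norm_num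
  obtain ⟨G₀, hG₀⟩ : ∃ G₀, G₀ = 2 / 3 * w₀ := ⟨_, rfl⟩
  have hG0 : G₀ ≠ 0 := by rw [hG₀]; exact mul_ne_zero (by norm_num) hw0
  have hc0 : c₀ ≠ 0 := by
    rintro rfl
    rw [← hG₀] at hc₀
    exact hG0 (by simpa using hc₀.symm)
  rw [← hG₀] at hc₀
  -- the derivative of the coordinate as a function of the root and its average
  set Φ : ℂ × ℂ → ℂ := fun p =>
    c₀ * exp (2 / 3 * log (p.2 / G₀)) * (2 / 3 * p.1 / p.2) with hΦ
  have hΦc : ContinuousAt Φ (w₀, G₀) := by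
    have h1 : ContinuousAt (fun p : ℂ × ℂ => p.2 / G₀) (w₀, G₀) := continuousAt_snd.div_const _
    have h2 : ContinuousAt (fun p : ℂ × ℂ => log (p.2 / G₀)) (w₀, G₀) :=
      h1.clog (by simp [hG0])
    exact (continuousAt_const.mul (continuousAt_const.mul h2).cexp).mul
      ((continuousAt_const.mul continuousAt_fst).div continuousAt_snd hG0)
  have hΦ0 : Φ (w₀, G₀) = c₀ := by
    rw [hΦ]
    simp only [div_self hG0, Complex.log_one, mul_zero, exp_zero, mul_one]
    rw [← hG₀, div_self hG0, mul_one]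
  have hev : ∀ᶠ p : ℂ × ℂ in 𝓝 (w₀, G₀), ‖Φ p - c₀‖ < ‖c₀‖ / 4 ∧ p.2 / G₀ ∈ slitPlane ∧
      p.2 ≠ 0 := by
    refine Filter.Eventually.and ?_ (Filter.Eventually.and ?_ ?_)
    · have := continuousAt_iff'.1 hΦc (‖c₀‖ / 4) (by positivity)
      rw [hΦ0] at this
      simpa only [dist_eq_norm] using this
    · have h1 : ContinuousAt (fun p : ℂ × ℂ => p.2 / G₀) (w₀, G₀) := continuousAt_snd.div_const _
      exact h1.eventually_mem (isOpen_slitPlane.mem_nhds (by simp [hG0]))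
    · exact continuousAt_snd.eventually_ne hG0
  obtain ⟨δ, hδ, hδ'⟩ := eventually_nhds_iff_ball.1 hev
  have hevw : ∀ᶠ v in 𝓝 v₀, ‖w₀ * exp (log (v / v₀) / 2) - w₀‖ < min 1 (δ / 3) ∧
      v / v₀ ∈ slitPlane := by
    have h1 : ContinuousAt (fun v : ℂ => v / v₀) v₀ := continuousAt_id.div_const _
    refine Filter.Eventually.and ?_ ?_
    · have h2 : ContinuousAt (fun v => w₀ * exp (log (v / v₀) / 2)) v₀ :=
        continuousAt_const.mul ((h1.clog (by simp [hv₀])).div_const 2).cexp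
      have := continuousAt_iff'.1 h2 (min 1 (δ / 3)) (by positivity)
      simpa [dist_eq_norm, div_self hv₀] using this
    · exact h1.eventually_mem (isOpen_slitPlane.mem_nhds (by simp [hv₀]))
  obtain ⟨η, hη, hη'⟩ := eventually_nhds_iff_ball.1 hevw
  refine ⟨η, hη, fun V c τ r hV hτ hVτ hclose x hx => ?_⟩
  have hb : ∀ y ∈ ball c r, ‖tpRoot v₀ w₀ V τ y - w₀‖ < min 1 (δ / 3) ∧
      dslope V τ y / v₀ ∈ slitPlane := fun y hy =>
    hη' _ (by rw [mem_ball, dist_eq_norm]; exact hclose y hy)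
  have hds : DifferentiableOn ℂ (dslope V τ) (ball c r) :=
    (Complex.differentiableOn_dslope (isOpen_ball.mem_nhds hτ)).2 hV
  have hdsa : ∀ y ∈ ball c r, DifferentiableAt ℂ (dslope V τ) y := fun y hy =>
    hds.differentiableAt (isOpen_ball.mem_nhds hy)
  have hwda : ∀ y ∈ ball c r, DifferentiableAt ℂ (tpRoot v₀ w₀ V τ) y := fun y hy =>
    ((((hdsa y hy).div_const v₀).clog (hb y hy).2).div_const 2).cexp.const_mul w₀
  have hwd : DifferentiableOn ℂ (tpRoot v₀ w₀ V τ) (ball c r) := fun y hy =>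
    (hwda y hy).differentiableWithinAt
  obtain ⟨G', hG', hGw⟩ := hasDerivAt_tpAverage hwd hτ hx
  set G := tpAverage (tpRoot v₀ w₀ V τ) τ x with hG
  set w := tpRoot v₀ w₀ V τ x with hw
  have hGc : ‖G - G₀‖ ≤ 2 * (δ / 3) := by
    rw [hG₀]
    exact norm_tpAverage_sub_le hwd.continuousOn hτ hx fun y hy =>
      ((hb y hy).1.trans_le (min_le_right _ _)).le
  obtain ⟨k1, k2, k3⟩ := hδ' (w, G) (by
    rw [mem_ball, Prod.dist_eq, max_lt_iff]
    constructor
    · rw [dist_eq_norm]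
      have := (hb x hx).1.trans_le (min_le_right _ _)
      linarith
    · rw [dist_eq_norm]
      exact hGc.trans_lt (by linarith))
  simp only at k2 k3
  have hE : HasDerivAt (fun x => exp (2 / 3 *
      log (tpAverage (tpRoot v₀ w₀ V τ) τ x / (2 / 3 * w₀))))
      (exp (2 / 3 * log (G / G₀)) * (2 / 3 * (G' / G₀ / (G / G₀)))) x := by
    rw [← hG₀]
    exact (((hG'.div_const G₀).clog k2).const_mul (2 / 3)).cexp
  have hX : HasDerivAt (tpCoord v₀ w₀ c₀ V τ) (Φ (w, G)) x := by
    refine (((hasDerivAt_id x).sub_const τ).mul (hE.const_mul c₀)).congr_deriv ?_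
    rw [← hG₀, ← hG, hΦ]
    simp only [id_eq]
    generalize exp (2 / 3 * log (G / G₀)) = E
    field_simp
    linear_combination (2 * E) * hGw
  have hV : V x = (x - τ) * w ^ 2 := by
    have h1 : V x = (x - τ) * dslope V τ x := by
      have := sub_smul_dslope V τ x
      rw [smul_eq_mul, hVτ, sub_zero] at this
      exact this.symm
    have h2 : w ^ 2 = dslope V τ x := by
      rw [hw, tpRoot, mul_pow, hw₀, ← exp_nat_mul]
      push_cast
      rw [mul_div_cancel₀ _ (two_ne_zero' ℂ), exp_log (slitPlane_ne_zero (hb x hx).2),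
        mul_div_cancel₀ _ hv₀]
    rw [h2, h1]
  refine ⟨⟨(hb x hx).2, ((hb x hx).1.trans_le (min_le_left _ _)).le, ?_, hwda x hx⟩,
    hX.differentiableAt, ?_, ?_⟩
  · rw [← hG₀]; exact k2
  · rw [hX.deriv]; exact k1.le
  · rw [hX.deriv, hV, tpCoord, ← hG, ← hG₀, hΦ]
    simp only
    have hE3 : exp (2 / 3 * log (G / G₀)) ^ 3 = (G / G₀) ^ 2 := by
      rw [← exp_nat_mul]
      push_cast
      rw [show (3 : ℂ) * (2 / 3 * log (G / G₀)) = (2 : ℕ) * log (G / G₀) by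
        push_cast; ring, exp_nat_mul, exp_log (div_ne_zero k3 hG0)]
    generalize exp (2 / 3 * log (G / G₀)) = E at hE3 ⊢
    calc 9 / 4 * ((x - τ) * (c₀ * E)) * (c₀ * E * (2 / 3 * w / G)) ^ 2
        = (x - τ) * w ^ 2 * (c₀ ^ 3 * E ^ 3 / G ^ 2) := by ring
      _ = (x - τ) * w ^ 2 := by
        rw [hE3, hc₀]; field_simp

/-- On the disc with centre `c` and radius `r`, the function `X` is a straightening coordinate for
the turning point `t`; its range contains the disc with centre `0` and radius `ρ`. -/
structure IsChart (A S : ℂ → ℂ) (Om : Set ℂ) (lam t c : ℂ) (r ρ C : ℝ) (X : ℂ → ℂ) : Prop where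
  sub : ball c r ⊆ Om
  mem : t ∈ ball c r
  zero : X t = 0
  diff : ∀ x ∈ ball c r, DifferentiableAt ℂ X x
  deriv_ne : ∀ x ∈ ball c r, deriv X x ≠ 0
  eq : ∀ x ∈ ball c r, 9 / 4 * X x * deriv X x ^ 2 = V₀ A S x lam
  antilipschitz : ∀ x ∈ ball c r, ∀ y ∈ ball c r,
    ‖x - y‖ ≤ C * ‖X x - X y‖
  surj : ball 0 ρ ⊆ X '' ball c r

/-- A quantitative inverse function theorem. -/
theorem surjOn_ball_of_deriv_close {X : ℂ → ℂ} {c t c₀ : ℂ} {r : ℝ} (hr : 0 < r) (hc₀ : c₀ ≠ 0)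
    (ht : dist t c < r / 2) (hX : ∀ x ∈ ball c r, DifferentiableAt ℂ X x)
    (hX' : ∀ x ∈ ball c r, ‖deriv X x - c₀‖ ≤ ‖c₀‖ / 4) :
    (∀ x ∈ ball c r, ∀ y ∈ ball c r, ‖x - y‖ ≤ 4 / 3 / ‖c₀‖ * ‖X x - X y‖) ∧
      ball (X t) (‖c₀‖ * (3 / 8 * r)) ⊆ X '' ball c r := by
  have hc : 0 < ‖c₀‖ := norm_pos_iff.2 hc₀
  have hmv : ∀ x ∈ ball c r, ∀ y ∈ ball c r,
      ‖(X x - X y) - c₀ * (x - y)‖ ≤ ‖c₀‖ / 4 * ‖x - y‖ := by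
    intro x hx y hy
    have := (convex_ball c r).norm_image_sub_le_of_norm_hasDerivWithin_le
      (f := fun x => X x - c₀ * x) (C := ‖c₀‖ / 4) (fun z hz => by
        have := (hX z hz).hasDerivAt.sub ((hasDerivAt_id z).const_mul c₀)
        rw [mul_one] at this
        exact this.hasDerivWithinAt) hX' hy hx
    refine le_trans (le_of_eq ?_) this
    congr 1
    ring
  constructor
  · intro x hx y hy
    have h1 := hmv x hx y hy
    have h2 : ‖c₀ * (x - y)‖ ≤ ‖X x - X y‖ + ‖c₀‖ / 4 * ‖x - y‖ := by
      have := norm_sub_le (X x - X y) ((X x - X y) - c₀ * (x - y))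
      rw [sub_sub_cancel] at this
      linarith
    rw [norm_mul] at h2
    rw [div_mul_eq_mul_div, le_div_iff₀ hc]
    linarith
  · have happ : ApproximatesLinearOn (fun x => c₀⁻¹ * X x)
        ((ContinuousLinearEquiv.refl ℂ ℂ : ℂ ≃L[ℂ] ℂ) : ℂ →L[ℂ] ℂ) (ball c r) (1 / 4) := by
      intro x hx y hy
      have h1 := hmv x hx y hy
      have h2 : c₀⁻¹ * X x - c₀⁻¹ * X y - (x - y)
          = c₀⁻¹ * ((X x - X y) - c₀ * (x - y)) := by field_simp
      simp only [ContinuousLinearEquiv.coe_refl, ContinuousLinearMap.coe_id', id_eq]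
      rw [h2, norm_mul, norm_inv]
      calc _ ≤ ‖c₀‖⁻¹ * (‖c₀‖ / 4 * ‖x - y‖) := by gcongr
        _ = _ := by
          push_cast
          field_simp
    have hsymm : ‖((ContinuousLinearEquiv.refl ℂ ℂ : ℂ ≃L[ℂ] ℂ).symm : ℂ →L[ℂ] ℂ)‖₊ = 1 := by
      simp
    have hlt : (1 / 4 : NNReal)
        < ‖((ContinuousLinearEquiv.refl ℂ ℂ : ℂ ≃L[ℂ] ℂ).symm : ℂ →L[ℂ] ℂ)‖₊⁻¹ := by
      rw [hsymm, inv_one]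
      rw [div_lt_one (by norm_num)]
      norm_num
    have hcb : closedBall t (r / 2) ⊆ ball c r := by
      intro x hx
      have := dist_triangle x t c
      rw [mem_closedBall] at hx
      rw [mem_ball]
      linarith
    have h := happ.closedBall_subset_target (Or.inr hlt) isOpen_ball (half_pos hr).le hcb
    rw [ApproximatesLinearOn.toOpenPartialHomeomorph_target, hsymm] at h
    intro y hy
    have hy' : c₀⁻¹ * y ∈ closedBall (c₀⁻¹ * X t)
        (((1 : NNReal)⁻¹ - (1 / 4 : NNReal) : ℝ) * (r / 2)) := by
      rw [mem_closedBall, dist_eq_norm, ← mul_sub, norm_mul, norm_inv]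
      rw [mem_ball, dist_eq_norm] at hy
      rw [inv_mul_le_iff₀ hc]
      refine hy.le.trans (le_of_eq ?_)
      push_cast
      ring
    obtain ⟨x, hx, hxy⟩ := h (by simpa using hy')
    exact ⟨x, hx, mul_left_cancel₀ (inv_ne_zero hc₀) hxy⟩

/-- Straightening coordinates near a simple turning point, depending continuously on the spectral
parameter. -/
theorem exists_isChart (hAS : IsPotentialPair A S Om) {τ : ℂ → ℂ} (hτ : ContinuousAt τ lam₀)
    (hτ0 : ∀ᶠ lam in 𝓝 lam₀, V₀ A S (τ lam) lam = 0) (hOm : τ lam₀ ∈ Om)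
    (hsimple : deriv (fun x => V₀ A S x lam₀) (τ lam₀) ≠ 0) {R : ℝ} (hR : 0 < R) :
    ∃ (X : ℂ → ℂ → ℂ) (r ρ C : ℝ), 0 < r ∧ r ≤ R ∧ 0 < ρ ∧
      (∀ x ∈ ball (τ lam₀) r, x ≠ τ lam₀ →
        ContinuousAt (fun p : ℂ × ℂ => X p.1 p.2) (x, lam₀)) ∧
      ∀ᶠ lam in 𝓝 lam₀, IsChart A S Om lam (τ lam) (τ lam₀) r ρ C
        (fun x => X x lam) := by
  obtain ⟨v₀, hv₀⟩ : ∃ v₀, v₀ = deriv (fun x => V₀ A S x lam₀) (τ lam₀) := ⟨_, rfl⟩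
  rw [← hv₀] at hsimple
  obtain ⟨w₀, hw₀⟩ := IsAlgClosed.exists_pow_nat_eq v₀ (n := 2) (by norm_num)
  obtain ⟨c₀, hc₀⟩ := IsAlgClosed.exists_pow_nat_eq ((2 / 3 * w₀) ^ 2) (n := 3) (by norm_num)
  have hw0 : w₀ ≠ 0 := by rintro rfl; apply hsimple; rw [← hw₀]; norm_num
  have hc0 : c₀ ≠ 0 := by
    rintro rfl
    have : (2 / 3 * w₀) ^ 2 ≠ 0 := pow_ne_zero _ (mul_ne_zero (by norm_num) hw0)
    exact this (by rw [← hc₀]; norm_num)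
  obtain ⟨η, hη, hspec⟩ := tpCoord_spec hsimple hw₀ hc₀
  have hVc : ∀ x ∈ Om, ContinuousAt (fun p : ℂ × ℂ => V₀ A S p.1 p.2) (x, lam₀) := by
    intro x hx
    have e : (fun p : ℂ × ℂ => V₀ A S p.1 p.2)
        = fun p => gPlus A S p.1 p.2 * gMinus A S p.1 p.2 := funext fun p => V₀_eq A S p.1 p.2
    rw [e]
    exact (continuousAt_gPlus hAS hx).mul (continuousAt_gMinus hAS hx)
  have hdV : ∀ x ∈ Om, ContinuousAt
      (fun p : ℂ × ℂ => deriv (fun x => V₀ A S x p.2) p.1) (x, lam₀) := by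
    intro x hx
    have h1 : ContinuousAt (fun p : ℂ × ℂ => deriv S p.1) (x, lam₀) := continuousAt_comp_fst
      (hAS.differentiableOn_dS.differentiableAt (hAS.isOpen.mem_nhds hx)).continuousAt
    have h2 : ContinuousAt (fun p : ℂ × ℂ => A p.1) (x, lam₀) := continuousAt_comp_fst
      (hAS.holo_A.differentiableAt (hAS.isOpen.mem_nhds hx)).continuousAt
    have h3 : ContinuousAt (fun p : ℂ × ℂ => deriv (deriv S) p.1) (x, lam₀) :=
      continuousAt_comp_fst ((hAS.differentiableOn_dS.deriv hAS.isOpen).differentiableAt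
        (hAS.isOpen.mem_nhds hx)).continuousAt
    have h4 : ContinuousAt (fun p : ℂ × ℂ => deriv A p.1) (x, lam₀) :=
      continuousAt_comp_fst ((hAS.holo_A.deriv hAS.isOpen).differentiableAt
        (hAS.isOpen.mem_nhds hx)).continuousAt
    have h5 : ContinuousAt (fun p : ℂ × ℂ => -(2 * (p.2 + deriv S p.1 / 2) *
        (deriv (deriv S) p.1 / 2)) - 2 * A p.1 * deriv A p.1) (x, lam₀) :=
      (((continuousAt_const.mul (continuousAt_snd.add (h1.div_const 2))).mul
        (h3.div_const 2)).neg).sub ((continuousAt_const.mul h2).mul h4)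
    refine h5.congr ?_
    have hopen : ∀ᶠ p : ℂ × ℂ in 𝓝 (x, lam₀), p.1 ∈ Om :=
      continuousAt_fst.eventually_mem (hAS.isOpen.mem_nhds hx)
    filter_upwards [hopen] with p hp
    rw [(hasDerivAt_V₀ hAS hp).deriv]
    ring
  have hev : ∀ᶠ p : ℂ × ℂ in 𝓝 (τ lam₀, lam₀), p.1 ∈ Om ∧
      ‖deriv (fun x => V₀ A S x p.2) p.1 - v₀‖ < η / 2 := by
    refine (continuousAt_fst.eventually_mem (hAS.isOpen.mem_nhds hOm)).and ?_
    have := continuousAt_iff'.1 (hdV _ hOm) (η / 2) (half_pos hη)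
    rw [← hv₀] at this
    simpa only [dist_eq_norm] using this
  rw [nhds_prod_eq] at hev
  obtain ⟨P, hP, Q, hQ, hPQ⟩ := Filter.eventually_prod_iff.1 hev
  obtain ⟨r₀, hr₀, hr₀P⟩ := eventually_nhds_iff_ball.1 hP
  obtain ⟨r, hr⟩ : ∃ r, r = min r₀ R := ⟨_, rfl⟩
  have hr0 : 0 < r := by rw [hr]; exact lt_min hr₀ hR
  have hrP : ∀ x ∈ ball (τ lam₀) r, P x := fun x hx =>
    hr₀P x (ball_subset_ball (by rw [hr]; exact min_le_left _ _) hx)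
  have hsub : ball (τ lam₀) r ⊆ Om := fun x hx => (hPQ (hrP x hx) hQ.self_of_nhds).1
  have hVdiff : ∀ lam, DifferentiableOn ℂ (fun x => V₀ A S x lam) (ball (τ lam₀) r) :=
    fun lam x hx => (hasDerivAt_V₀ hAS (hsub hx)).differentiableAt.differentiableWithinAt
  have hτd : ∀ᶠ lam in 𝓝 lam₀, dist (τ lam) (τ lam₀) < r / 2 :=
    continuousAt_iff'.1 hτ _ (half_pos hr0)
  have hgood : ∀ᶠ lam in 𝓝 lam₀, (τ lam ∈ ball (τ lam₀) r ∧ dist (τ lam) (τ lam₀) < r / 2 ∧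
      V₀ A S (τ lam) lam = 0) ∧ ∀ x ∈ ball (τ lam₀) r,
        ‖dslope (fun x => V₀ A S x lam) (τ lam) x - v₀‖ < η := by
    filter_upwards [hτd, hτ0, hQ] with lam h1 h2 h3
    have hmem : τ lam ∈ ball (τ lam₀) r := by rw [mem_ball]; linarith
    refine ⟨⟨hmem, h1, h2⟩, fun x hx => ?_⟩
    have hder : ∀ y ∈ ball (τ lam₀) r, HasDerivAt (fun x => V₀ A S x lam)
        (deriv (fun x => V₀ A S x lam) y) y := fun y hy =>
      (hasDerivAt_V₀ hAS (hsub hy)).differentiableAt.hasDerivAt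
    by_cases hxt : x = τ lam
    · rw [hxt, dslope_same]
      exact ((hPQ (hrP _ hmem) h3).2).trans (half_lt_self hη)
    · have := (convex_ball (τ lam₀) r).norm_image_sub_le_of_norm_hasDerivWithin_le
        (f := fun x => V₀ A S x lam - v₀ * x) (C := η / 2) (fun z hz => by
          have := (hder z hz).sub ((hasDerivAt_id z).const_mul v₀)
          rw [mul_one] at this
          exact this.hasDerivWithinAt) (fun z hz => ((hPQ (hrP z hz) h3).2).le) hmem hx
      have hne : 0 < ‖x - τ lam‖ := norm_pos_iff.2 (sub_ne_zero.2 hxt)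
      rw [dslope_of_ne _ hxt, slope_def_field]
      have e : (V₀ A S x lam - V₀ A S (τ lam) lam) / (x - τ lam) - v₀
          = ((V₀ A S x lam - v₀ * x) - (V₀ A S (τ lam) lam - v₀ * τ lam)) / (x - τ lam) := by
        have := sub_ne_zero.2 hxt
        field_simp
        ring
      rw [e, norm_div, div_lt_iff₀ hne]
      have h4 : η / 2 * ‖x - τ lam‖ < η * ‖x - τ lam‖ := by
        apply mul_lt_mul_of_pos_right (half_lt_self hη) hne
      exact this.trans_lt h4
  obtain ⟨X, hX⟩ : ∃ X : ℂ → ℂ → ℂ, X = fun x lam =>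
    tpCoord v₀ w₀ c₀ (fun x => V₀ A S x lam) (τ lam) x := ⟨_, rfl⟩
  refine ⟨X, r, ‖c₀‖ * (3 / 8 * r), 4 / 3 / ‖c₀‖, hr0, by rw [hr]; exact min_le_right _ _,
    by have := norm_pos_iff.2 hc0; positivity, fun x hx hxτ => ?_, ?_⟩
  · -- joint continuity, by dominated convergence for the average
    have hroot : ∀ y ∈ ball (τ lam₀) r, y ≠ τ lam₀ → ContinuousAt (fun p : ℂ × ℂ =>
        tpRoot v₀ w₀ (fun x => V₀ A S x p.2) (τ p.2) p.1) (y, lam₀) := by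
      intro y hy hyτ
      have hτs : ContinuousAt (fun p : ℂ × ℂ => τ p.2) (y, lam₀) :=
        hτ.tendsto.comp (continuous_snd.tendsto (y, lam₀))
      have h1 : ContinuousAt (fun p : ℂ × ℂ =>
          dslope (fun x => V₀ A S x p.2) (τ p.2) p.1) (y, lam₀) := by
        have h2 : ContinuousAt (fun p : ℂ × ℂ => V₀ A S p.1 p.2 / (p.1 - τ p.2)) (y, lam₀) :=
          (hVc y (hsub hy)).div (continuousAt_fst.sub hτs) (sub_ne_zero.2 hyτ)
        refine h2.congr ?_
        have h3 : ∀ᶠ p : ℂ × ℂ in 𝓝 (y, lam₀), p.1 - τ p.2 ≠ 0 :=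
          (continuousAt_fst.sub hτs).eventually_ne (sub_ne_zero.2 hyτ)
        have h4 : ∀ᶠ p : ℂ × ℂ in 𝓝 (y, lam₀), V₀ A S (τ p.2) p.2 = 0 :=
          (continuous_snd.tendsto (y, lam₀)).eventually hτ0
        filter_upwards [h3, h4] with p h3 h4
        rw [dslope_of_ne _ (sub_ne_zero.1 h3), slope_def_field, h4, sub_zero]
      have hs := (hspec _ _ _ _ (hVdiff lam₀) hgood.self_of_nhds.1.1 hgood.self_of_nhds.1.2.2
        hgood.self_of_nhds.2 y hy).1.1
      exact continuousAt_const.mul (((h1.div_const v₀).clog hs).div_const 2).cexp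
    have hmemx : ∀ᶠ p : ℂ × ℂ in 𝓝 (x, lam₀), p.1 ∈ ball (τ lam₀) r :=
      continuousAt_fst.eventually_mem (isOpen_ball.mem_nhds hx)
    have hgood' : ∀ᶠ p : ℂ × ℂ in 𝓝 (x, lam₀), _ :=
      (continuous_snd.tendsto (x, lam₀)).eventually hgood
    have hτx : ContinuousAt (fun p : ℂ × ℂ => τ p.2) (x, lam₀) :=
      hτ.tendsto.comp (continuous_snd.tendsto (x, lam₀))
    have hI : uIoc (0 : ℝ) 1 ⊆ Icc 0 1 := by
      rw [uIoc_of_le zero_le_one]; exact Ioc_subset_Icc_self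
    have hG : ContinuousAt (fun p : ℂ × ℂ =>
        tpAverage (tpRoot v₀ w₀ (fun x => V₀ A S x p.2) (τ p.2)) (τ p.2) p.1) (x, lam₀) := by
      refine intervalIntegral.continuousAt_of_dominated_interval
        (bound := fun _ => 2 * (1 + ‖w₀‖)) ?_ ?_ (by simp) ?_
      · filter_upwards [hmemx, hgood'] with p hp hg
        have hc : ContinuousOn (tpRoot v₀ w₀ (fun x => V₀ A S x p.2) (τ p.2))
            (ball (τ lam₀) r) := fun y hy =>
          (hspec _ _ _ _ (hVdiff p.2) hg.1.1 hg.1.2.2 hg.2 y hy).1.2.2.2.continuousAt.continuousWithinAt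
        exact ((continuousOn_average_integrand hc hg.1.1 hp).mono hI).aestronglyMeasurable
          measurableSet_uIoc
      · filter_upwards [hmemx, hgood'] with p hp hg
        refine Eventually.of_forall fun s hs => ?_
        have hs' := hI hs
        have h1 := (hspec _ _ _ _ (hVdiff p.2) hg.1.1 hg.1.2.2 hg.2 _
          (segment_sq_mem hg.1.1 hp hs')).1.2.1
        have h2 : ‖(s : ℂ) ^ 2‖ ≤ 1 := by
          rw [norm_pow, norm_real, Real.norm_of_nonneg hs'.1]
          exact pow_le_one₀ hs'.1 hs'.2
        rw [norm_mul, norm_mul, Complex.norm_ofNat]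
        have h3 := norm_add_le (tpRoot v₀ w₀ (fun x => V₀ A S x p.2) (τ p.2)
          (τ p.2 + (s : ℂ) ^ 2 * (p.1 - τ p.2)) - w₀) w₀
        rw [sub_add_cancel] at h3
        calc _ ≤ 2 * 1 * (1 + ‖w₀‖) := by
              refine mul_le_mul ?_ (h3.trans (by linarith)) (norm_nonneg _) (by norm_num)
              linarith
          _ = _ := by ring
      · refine Eventually.of_forall fun s hs => ?_
        have hs' := hI hs
        have hs0 : (s : ℂ) ^ 2 ≠ 0 := by
          rw [uIoc_of_le zero_le_one] at hs
          exact pow_ne_zero _ (Complex.ofReal_ne_zero.2 hs.1.ne')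
        have hy := segment_sq_mem hgood.self_of_nhds.1.1 hx hs'
        have h1 := hroot _ hy (by
          rw [Ne, add_eq_left]
          exact mul_ne_zero hs0 (sub_ne_zero.2 hxτ))
        have h2 : ContinuousAt (fun p : ℂ × ℂ => (τ p.2 + (s : ℂ) ^ 2 * (p.1 - τ p.2), p.2))
            (x, lam₀) :=
          (hτx.add (continuousAt_const.mul (continuousAt_fst.sub hτx))).prodMk continuousAt_snd
        have h3 : ContinuousAt (fun p : ℂ × ℂ => tpRoot v₀ w₀ (fun x => V₀ A S x p.2) (τ p.2)
            (τ p.2 + (s : ℂ) ^ 2 * (p.1 - τ p.2))) (x, lam₀) :=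
          ContinuousAt.comp (g := fun p : ℂ × ℂ =>
            tpRoot v₀ w₀ (fun x => V₀ A S x p.2) (τ p.2) p.1)
            (f := fun p : ℂ × ℂ => (τ p.2 + (s : ℂ) ^ 2 * (p.1 - τ p.2), p.2)) h1 h2
        exact continuousAt_const.mul h3
    have hs := (hspec _ _ _ _ (hVdiff lam₀) hgood.self_of_nhds.1.1 hgood.self_of_nhds.1.2.2
      hgood.self_of_nhds.2 x hx).1.2.2.1
    rw [hX]
    exact (continuousAt_fst.sub hτx).mul (continuousAt_const.mul
      (continuousAt_const.mul ((hG.div_const _).clog hs)).cexp)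
  · filter_upwards [hgood] with lam hg
    have hsp := hspec _ _ _ _ (hVdiff lam) hg.1.1 hg.1.2.2 hg.2
    obtain ⟨h1, h2⟩ := surjOn_ball_of_deriv_close hr0 hc0 hg.1.2.1 (fun x hx => (hsp x hx).2.1)
      (fun x hx => (hsp x hx).2.2.1)
    have h0 : tpCoord v₀ w₀ c₀ (fun x => V₀ A S x lam) (τ lam) (τ lam) = 0 := by
      unfold tpCoord; rw [sub_self, zero_mul]
    rw [h0] at h2
    rw [hX]
    refine ⟨hsub, hg.1.1, h0, fun x hx => (hsp x hx).2.1, fun x hx h => ?_,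
      fun x hx => (hsp x hx).2.2.2, h1, h2⟩
    have h3 := (hsp x hx).2.2.1
    rw [h, zero_sub, norm_neg] at h3
    have := norm_pos_iff.2 hc0
    linarith

/-! ### Stokes lines near a simple turning point -/

/-- A Stokes arc cannot pass through a simple turning point except at its start: the square of a
holomorphic function has no simple zeros. -/
theorem IsStokesArc.ne_of_simple {lam t₀ : ℂ} {k : ℝ → ℂ} (h : IsStokesArc A S Om lam k)
    (h0 : V₀ A S t₀ lam = 0) (hs : deriv (fun x => V₀ A S x lam) t₀ ≠ 0) {t : ℝ}
    (ht : t ∈ Ioc (0 : ℝ) 1) : k t ≠ t₀ := by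
  rintro rfl
  obtain ⟨f, hf, -⟩ := h.level t ht
  have hd : DifferentiableAt ℂ (deriv f) (k t) := by
    obtain ⟨N, hN, hNo, hmem⟩ := _root_.eventually_nhds_iff.1 hf
    exact (DifferentiableOn.deriv (fun y hy => (hN y hy).1.differentiableWithinAt) hNo).differentiableAt
      (hNo.mem_nhds hmem)
  have he : (fun x => V₀ A S x lam) =ᶠ[𝓝 (k t)] fun y => deriv f y ^ 2 := by
    filter_upwards [hf] with y hy using hy.2.symm
  have h1 := he.deriv_eq
  have h2 : deriv f (k t) = 0 := by
    have := hf.self_of_nhds.2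
    rw [h0] at this
    exact pow_eq_zero_iff (two_ne_zero) |>.1 this
  apply hs
  rw [h1]
  refine (hd.hasDerivAt.pow 2).deriv.trans ?_
  rw [h2]
  simp

/-- If `G² = w³` then `|w|³ + Re w³ = 2 (Re G)²`. -/
theorem norm_cube_add_re {G w : ℂ} (h : G ^ 2 = w ^ 3) :
    ‖w‖ ^ 3 + (w ^ 3).re = 2 * G.re ^ 2 := by
  rw [← norm_pow, ← h, norm_pow, Complex.sq_norm, Complex.normSq_apply, sq, mul_re]
  ring

/-- Along a Stokes arc the function `|X|³ + Re X³ = 2 (Re X^{3/2})²` is locally constant away from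
the turning point. -/
theorem IsStokesArc.level_cube {lam t₀ c : ℂ} {r ρ C : ℝ} {X : ℂ → ℂ} {k : ℝ → ℂ}
    (h : IsStokesArc A S Om lam k) (hX : IsChart A S Om lam t₀ c r ρ C X) {t : ℝ}
    (ht : t ∈ Ioc (0 : ℝ) 1) (hb : k t ∈ ball c r) (hne : X (k t) ≠ 0) :
    ∀ᶠ s in 𝓝[Icc 0 1] t, ‖X (k s)‖ ^ 3 + (X (k s) ^ 3).re = ‖X (k t)‖ ^ 3 + (X (k t) ^ 3).re := by
  obtain ⟨f, hf, hlev⟩ := h.level t ht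
  obtain ⟨e, κ, hκ, he4, hslit⟩ : ∃ e κ : ℂ, κ ^ 2 = e ∧ e ^ 4 = 1 ∧ e * X (k t) ∈ slitPlane := by
    by_cases hs : X (k t) ∈ slitPlane
    · exact ⟨1, 1, by norm_num, by norm_num, by rwa [one_mul]⟩
    · refine ⟨-1, I, by rw [I_sq], by norm_num, ?_⟩
      rw [Complex.mem_slitPlane_iff] at hs ⊢
      push Not at hs
      left
      rw [neg_one_mul, neg_re]
      rcases hs.1.lt_or_eq with h1 | h1
      · linarith
      · exact absurd (Complex.ext h1 hs.2) hne
  have he0 : e ≠ 0 := by rintro rfl; norm_num at he4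
  have hXt := hX.diff _ hb
  have hslit' : ∀ᶠ y in 𝓝 (k t), e * X y ∈ slitPlane :=
    (continuousAt_const.mul hXt.continuousAt).eventually_mem (isOpen_slitPlane.mem_nhds hslit)
  obtain ⟨δ, hδ, hball⟩ := eventually_nhds_iff_ball.1
    ((hf.and hslit').and (isOpen_ball.mem_nhds hb))
  obtain ⟨G, hG⟩ : ∃ G : ℂ → ℂ, G = fun y => κ * exp (3 / 2 * log (e * X y)) :=
    ⟨_, rfl⟩
  have hexp : ∀ y ∈ ball (k t) δ, exp (3 / 2 * log (e * X y)) ^ 2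
      = (e * X y) ^ 3 := by
    intro y hy
    have h0 := slitPlane_ne_zero (hball y hy).1.2
    rw [← exp_nat_mul]
    rw [show ((2 : ℕ) : ℂ) * (3 / 2 * log (e * X y))
      = ((3 : ℕ) : ℂ) * log (e * X y) by push_cast; ring, exp_nat_mul,
      exp_log h0]
  have hG2 : ∀ y ∈ ball (k t) δ, G y ^ 2 = X y ^ 3 := by
    intro y hy
    rw [hG]
    simp only [mul_pow, hκ, hexp y hy]
    linear_combination (X y ^ 3) * he4
  have hGd : ∀ y ∈ ball (k t) δ, HasDerivAt G
      (G y * (3 / 2 * (deriv X y / X y))) y := by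
    intro y hy
    have h0 := slitPlane_ne_zero (hball y hy).1.2
    have h1 := (hX.diff y (hball y hy).2).hasDerivAt
    have h2 := ((((h1.const_mul e).clog (hball y hy).1.2).const_mul (3 / 2)).cexp).const_mul κ
    rw [hG]
    refine h2.congr_deriv ?_
    rw [mul_div_mul_left _ _ he0]
    ring
  have hfd : DifferentiableOn ℂ f (ball (k t) δ) := fun y hy =>
    (hball y hy).1.1.1.differentiableWithinAt
  have hGd' : DifferentiableOn ℂ G (ball (k t) δ) := fun y hy =>
    (hGd y hy).differentiableAt.differentiableWithinAt
  have hXne : ∀ y ∈ ball (k t) δ, X y ≠ 0 := fun y hy =>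
    right_ne_zero_of_mul (slitPlane_ne_zero (hball y hy).1.2)
  have hsq : ∀ y ∈ ball (k t) δ, deriv G y ^ 2 = V₀ A S y lam := by
    intro y hy
    rw [(hGd y hy).deriv, mul_pow, hG2 y hy, ← hX.eq y (hball y hy).2]
    have := hXne y hy
    field_simp
    ring
  have hGne : ∀ {y : ℂ}, y ∈ ball (k t) δ → deriv G y ≠ 0 := by
    intro y hy
    have h1 := hXne y hy
    have h2 : G y ≠ 0 := fun h0 => by
      have := hG2 y hy
      rw [h0, zero_pow two_ne_zero] at this
      exact pow_ne_zero 3 h1 this.symm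
    rw [(hGd y hy).deriv]
    exact mul_ne_zero h2 (mul_ne_zero (by norm_num) (div_ne_zero (hX.deriv_ne y (hball y hy).2) h1))
  have hconst : ∃ s : ℝ, s ≠ 0 ∧ ∃ m : ℝ, ∀ y ∈ ball (k t) δ, (f y).re = s * (G y).re + m := by
    have key : ∀ s : ℝ, (∀ y ∈ ball (k t) δ, deriv f y = (s : ℂ) * deriv G y) →
        ∃ m : ℝ, ∀ y ∈ ball (k t) δ, (f y).re = s * (G y).re + m := by
      intro s hs
      refine ⟨(f (k t) - (s : ℂ) * G (k t)).re, fun y hy => ?_⟩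
      have := (convex_ball (k t) δ).norm_image_sub_le_of_norm_hasDerivWithin_le (C := 0)
        (f := fun y => f y - (s : ℂ) * G y) (f' := fun _ => 0)
        (fun y hy => ((((hball y hy).1.1.1.hasDerivAt).sub
          (((hGd y hy).differentiableAt.hasDerivAt).const_mul (s : ℂ))).congr_deriv
            (by rw [hs y hy, sub_self])).hasDerivWithinAt) (fun _ _ => by simp)
        (mem_ball_self hδ) hy
      rw [zero_mul, norm_le_zero_iff, sub_eq_zero] at this
      rw [← this]
      simp
    rcases (convex_ball (k t) δ).isPreconnected.eq_or_eq_neg_of_sq_eq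
      (hfd.deriv isOpen_ball).continuousOn (hGd'.deriv isOpen_ball).continuousOn
      (fun y hy => by
        simp only [Pi.pow_apply]
        rw [(hball y hy).1.1.2, hsq y hy]) (fun hy => hGne hy) with h1 | h1
    · exact ⟨1, one_ne_zero, key 1 fun y hy => by rw [h1 hy]; simp⟩
    · exact ⟨-1, by norm_num, key (-1) fun y hy => by rw [h1 hy]; simp⟩
  obtain ⟨s, hs, m, hm⟩ := hconst
  have hkc : ∀ᶠ t' in 𝓝[Icc 0 1] t, k t' ∈ ball (k t) δ :=
    (h.continuousOn t ⟨ht.1.le, ht.2⟩).eventually_mem (ball_mem_nhds _ hδ)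
  filter_upwards [hkc, hlev] with t' h1 h2
  rw [norm_cube_add_re (hG2 _ h1), norm_cube_add_re (hG2 _ (mem_ball_self hδ))]
  rw [hm _ h1, hm _ (mem_ball_self hδ)] at h2
  rw [mul_left_cancel₀ hs (add_right_cancel h2)]

theorem IsChart.eq_of_eq_zero {lam t₀ c : ℂ} {r ρ C : ℝ} {X : ℂ → ℂ}
    (hX : IsChart A S Om lam t₀ c r ρ C X) {x : ℂ} (hx : x ∈ ball c r) (h : X x = 0) :
    x = t₀ := by
  have := hX.antilipschitz x hx t₀ hX.mem
  rw [h, hX.zero, sub_self, norm_zero, mul_zero, norm_le_zero_iff, sub_eq_zero] at this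
  exact this

theorem IsChart.injOn {lam t₀ c : ℂ} {r ρ C : ℝ} {X : ℂ → ℂ}
    (hX : IsChart A S Om lam t₀ c r ρ C X) : InjOn X (ball c r) := by
  intro x hx y hy h
  have := hX.antilipschitz x hx y hy
  rw [h, sub_self, norm_zero, mul_zero, norm_le_zero_iff, sub_eq_zero] at this
  exact this

/-- In the straightening coordinate a Stokes arc starting at the turning point lies on the three
rays `X³ ≤ 0`. -/
theorem IsStokesArc.cube_nonpos {lam t₀ c : ℂ} {r ρ C : ℝ} {X : ℂ → ℂ} {k : ℝ → ℂ}
    (h : IsStokesArc A S Om lam k) (hX : IsChart A S Om lam t₀ c r ρ C X) (h0 : k 0 = t₀) {t₁ : ℝ}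
    (ht₁ : t₁ ≤ 1) (hk : ∀ t ∈ Icc 0 t₁, k t ∈ ball c r) {t : ℝ} (ht : t ∈ Ioc 0 t₁) :
    X (k t) ≠ 0 ∧ ‖X (k t)‖ ^ 3 + (X (k t) ^ 3).re = 0 := by
  have hne : ∀ s ∈ Ioc 0 t₁, X (k s) ≠ 0 := by
    intro s hs hXs
    have h1 := hX.eq_of_eq_zero (hk s ⟨hs.1.le, hs.2⟩) hXs
    rw [← h0] at h1
    exact hs.1.ne' (h.injOn ⟨hs.1.le, hs.2.trans ht₁⟩ ⟨le_rfl, zero_le_one⟩ h1)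
  refine ⟨hne t ht, ?_⟩
  obtain ⟨φ, hφ⟩ : ∃ φ : ℝ → ℝ, φ = fun s => ‖X (k s)‖ ^ 3 + (X (k s) ^ 3).re := ⟨_, rfl⟩
  have hsub : Icc 0 t₁ ⊆ Icc (0 : ℝ) 1 := Icc_subset_Icc_right ht₁
  have hφc : ContinuousOn φ (Icc 0 t₁) := by
    have h1 : ContinuousOn (fun s => X (k s)) (Icc 0 t₁) := fun s hs =>
      (hX.diff _ (hk s hs)).continuousAt.comp_continuousWithinAt
        ((h.continuousOn s (hsub hs)).mono hsub)
    rw [hφ]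
    exact (h1.norm.pow 3).add (continuous_re.comp_continuousOn (h1.pow 3))
  have hconst : ∀ s ∈ Ioo 0 t, φ s = φ t := by
    intro s hs
    refine rel_of_local (R := fun a b => φ a = φ b) (fun _ _ _ h1 h2 => h1.trans h2) hs.2
      fun u hu => ?_
    have hu' : u ∈ Ioc 0 t₁ := ⟨hs.1.trans_le hu.1, hu.2.trans ht.2⟩
    have h1 := h.level_cube hX ⟨hu'.1, hu'.2.trans ht₁⟩ (hk u ⟨hu'.1.le, hu'.2⟩) (hne u hu')
    obtain ⟨V, hV, hV'⟩ := mem_nhdsWithin_iff_exists_mem_nhds_inter.1 h1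
    refine ⟨V, hV, fun s₁ hs₁ s₂ hs₂ _ => ?_⟩
    have e : ∀ s' ∈ V ∩ Icc s t, φ s' = φ u := fun s' hs' => by
      have := hV' ⟨hs'.1, hs.1.le.trans hs'.2.1, hs'.2.2.trans (ht.2.trans ht₁)⟩
      rw [hφ]
      exact this
    rw [e s₁ hs₁, e s₂ hs₂]
  have hlim : Tendsto φ (𝓝[Ioo 0 t] 0) (𝓝 (φ 0)) :=
    (hφc 0 ⟨le_rfl, ht.1.le.trans ht.2⟩).mono_left
      (nhdsWithin_mono _ fun s hs => ⟨hs.1.le, hs.2.le.trans ht.2⟩)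
  have hlim' : Tendsto φ (𝓝[Ioo 0 t] 0) (𝓝 (φ t)) :=
    tendsto_const_nhds.congr' (by
      filter_upwards [self_mem_nhdsWithin] with s hs using (hconst s hs).symm)
  have : (𝓝[Ioo 0 t] (0 : ℝ)).NeBot := left_nhdsWithin_Ioo_neBot ht.1
  have := tendsto_nhds_unique hlim' hlim
  rw [hφ] at this
  simp only [h0, hX.zero] at this
  rw [this]
  simp

theorem cube_eq_of_norm_add_re {w : ℂ} (h : ‖w‖ ^ 3 + (w ^ 3).re = 0) :
    w ^ 3 = -((‖w‖ : ℂ)) ^ 3 := by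
  have h1 : (w ^ 3).re = -‖w ^ 3‖ := by rw [norm_pow]; linarith
  have h2 : (w ^ 3).im = 0 := by
    have := Complex.sq_norm (w ^ 3)
    rw [Complex.normSq_apply, h1] at this
    have h3 : (w ^ 3).im * (w ^ 3).im = 0 := by nlinarith
    exact mul_self_eq_zero.1 h3
  refine Complex.ext ?_ ?_
  · rw [h1, norm_pow, ← Complex.ofReal_pow, neg_re, ofReal_re]
  · rw [h2, ← Complex.ofReal_pow, neg_im, ofReal_im, neg_zero]

/-- On the three rays `w³ ≤ 0`, the negative axis is singled out by the sign of the real part. -/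
theorem eq_neg_norm_or_re_pos {w : ℂ} (hw : w ≠ 0) (h : ‖w‖ ^ 3 + (w ^ 3).re = 0) :
    w = -(‖w‖ : ℂ) ∨ 0 < w.re := by
  have h1 := cube_eq_of_norm_add_re h
  have h2 : (w + ‖w‖) * (w ^ 2 - w * ‖w‖ + (‖w‖ : ℂ) ^ 2) = 0 := by linear_combination h1
  rcases mul_eq_zero.1 h2 with h3 | h3
  · exact Or.inl (eq_neg_of_add_eq_zero_left h3)
  · right
    have h4 : (‖w‖ : ℂ) ^ 2 = w * (starRingEnd ℂ) w := by
      rw [Complex.mul_conj, Complex.normSq_eq_norm_sq]; push_cast; ring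
    rw [h4] at h3
    have h5 : w * (w + (starRingEnd ℂ) w - ‖w‖) = 0 := by linear_combination h3
    have h6 := (mul_eq_zero.1 h5).resolve_left hw
    have h7 := congrArg Complex.re h6
    simp only [sub_re, add_re, Complex.conj_re, ofReal_re,
      Complex.zero_re] at h7
    have := norm_pos_iff.2 hw
    linarith

/-- Multiplication by a cube root of unity permutes the straightening coordinates. -/
theorem IsChart.rot {lam t₀ c : ℂ} {r ρ C : ℝ} {X : ℂ → ℂ}
    (hX : IsChart A S Om lam t₀ c r ρ C X) {κ : ℂ} (hκ : κ ^ 3 = 1) :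
    IsChart A S Om lam t₀ c r ρ C (fun x => κ * X x) := by
  have hn : ‖κ‖ = 1 := by
    have := congrArg norm hκ
    rw [norm_pow, norm_one] at this
    exact (pow_eq_one_iff_of_nonneg (norm_nonneg _) (by norm_num)).1 this
  have h0 : κ ≠ 0 := by rintro rfl; norm_num at hκ
  have hd : ∀ x ∈ ball c r, deriv (fun x => κ * X x) x = κ * deriv X x := fun x hx =>
    ((hX.diff x hx).hasDerivAt.const_mul κ).deriv
  refine ⟨hX.sub, hX.mem, by simp [hX.zero], fun x hx => (hX.diff x hx).const_mul κ,
    fun x hx => ?_, fun x hx => ?_, fun x hx y hy => ?_, fun w hw => ?_⟩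
  · rw [hd x hx]; exact mul_ne_zero h0 (hX.deriv_ne x hx)
  · rw [hd x hx, ← hX.eq x hx]
    linear_combination (9 / 4 * X x * deriv X x ^ 2) * hκ
  · rw [← mul_sub, norm_mul, hn, one_mul]; exact hX.antilipschitz x hx y hy
  · obtain ⟨x, hx, hxw⟩ := hX.surj (show κ⁻¹ * w ∈ ball 0 ρ by
      rw [mem_ball_zero_iff] at hw ⊢
      rwa [norm_mul, norm_inv, hn, inv_one, one_mul])
    exact ⟨x, hx, by simp only [hxw]; field_simp⟩

/-- A curve depending on a parameter stays in an open set, locally uniformly in the parameter. -/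
theorem eventually_forall_curve_mem {k : ℝ → ℂ → ℂ} {U₀ : Set ℂ} (hU : U₀ ∈ 𝓝 lam₀)
    (hk : ContinuousOn (fun p : ℝ × ℂ => k p.1 p.2) (Icc 0 1 ×ˢ U₀)) {T : Set ℝ}
    (hT : IsCompact T) (hT1 : T ⊆ Icc 0 1) {O : Set ℂ} (hO : IsOpen O)
    (hTO : ∀ t ∈ T, k t lam₀ ∈ O) : ∀ᶠ lam in 𝓝 lam₀, ∀ t ∈ T, k t lam ∈ O := by
  obtain ⟨k', hk'⟩ : ∃ k' : ℂ × ℝ → ℂ, k' = fun p => k (projIcc 0 1 zero_le_one p.2) p.1 := ⟨_, rfl⟩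
  have hc : ∀ t, ContinuousAt k' (lam₀, t) := by
    intro t
    have h1 : ContinuousAt (fun p : ℂ × ℝ =>
        (((projIcc (0 : ℝ) 1 zero_le_one p.2 : ℝ), p.1) : ℝ × ℂ)) (lam₀, t) :=
      ((continuous_subtype_val.comp (continuous_projIcc.comp continuous_snd)).prodMk
        continuous_fst).continuousAt
    have h2 : ∀ᶠ p : ℂ × ℝ in 𝓝 (lam₀, t),
        (((projIcc (0 : ℝ) 1 zero_le_one p.2 : ℝ), p.1) : ℝ × ℂ) ∈ Icc (0 : ℝ) 1 ×ˢ U₀ := by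
      filter_upwards [continuousAt_fst.eventually_mem hU] with p hp
      exact ⟨Subtype.coe_prop _, hp⟩
    have h3 := hk (((projIcc (0 : ℝ) 1 zero_le_one t : ℝ), lam₀))
      ⟨Subtype.coe_prop _, mem_of_mem_nhds hU⟩
    rw [hk']
    exact h3.tendsto.comp (tendsto_nhdsWithin_iff.2 ⟨h1, h2⟩)
  have hkk : ∀ t ∈ T, ∀ lam, k' (lam, t) = k t lam := fun t ht lam => by
    rw [hk']; simp only [projIcc_of_mem zero_le_one (hT1 ht)]
  have := hT.eventually_forall_of_forall_eventually (x₀ := lam₀)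
    (P := fun lam t => k' (lam, t) ∈ O) fun t ht =>
      (hc t).eventually_mem (hO.mem_nhds (by rw [hkk t ht]; exact hTO t ht))
  filter_upwards [this] with lam hl t ht
  rw [← hkk t ht]
  exact hl t ht

/-- A curve depending on a parameter stays away from a point that it avoids, locally uniformly in
the parameter. -/
theorem eventually_forall_le_dist {k : ℝ → ℂ → ℂ} {U₀ : Set ℂ} (hU : U₀ ∈ 𝓝 lam₀)
    (hk : ContinuousOn (fun p : ℝ × ℂ => k p.1 p.2) (Icc 0 1 ×ˢ U₀)) {T : Set ℝ}
    (hT : IsCompact T) (hT1 : T ⊆ Icc 0 1) {y : ℂ} (hy : ∀ t ∈ T, k t lam₀ ≠ y) :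
    ∃ δ : ℝ, 0 < δ ∧ ∀ᶠ lam in 𝓝 lam₀, ∀ t ∈ T, δ ≤ dist (k t lam) y := by
  have hk₀ : ContinuousOn (fun t => k t lam₀) T :=
    hk.comp (f := fun t => ((t, lam₀) : ℝ × ℂ)) (by fun_prop) fun t ht =>
      ⟨hT1 ht, mem_of_mem_nhds hU⟩
  have hcl : IsClosed ((fun t => k t lam₀) '' T) := (hT.image_of_continuousOn hk₀).isClosed
  have hyn : y ∈ ((fun t => k t lam₀) '' T)ᶜ := by
    rintro ⟨t, ht, hty⟩
    exact hy t ht hty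
  obtain ⟨δ, hδ, hball⟩ := isOpen_iff.1 hcl.isOpen_compl y hyn
  refine ⟨δ / 2, half_pos hδ, ?_⟩
  filter_upwards [eventually_forall_curve_mem hU hk hT hT1
    (O := (closedBall y (δ / 2))ᶜ) isClosed_closedBall.isOpen_compl fun t ht h =>
      hball (closedBall_subset_ball (half_lt_self hδ) h) ⟨t, ht, rfl⟩] with lam hl t ht
  have := hl t ht
  rw [mem_compl_iff, mem_closedBall, not_le] at this
  exact this.le

theorem IsStokesArc.eq_neg_norm {lam t₀ c : ℂ} {r ρ C : ℝ} {X : ℂ → ℂ} {k : ℝ → ℂ}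
    (h : IsStokesArc A S Om lam k) (hX : IsChart A S Om lam t₀ c r ρ C X) (h0 : k 0 = t₀) {t₁ : ℝ}
    (ht₁ : t₁ ≤ 1) (hk : ∀ t ∈ Icc 0 t₁, k t ∈ ball c r) (hneg : (X (k t₁)).re < 0) {t : ℝ}
    (ht : t ∈ Ioc 0 t₁) : X (k t) = -(‖X (k t)‖ : ℂ) := by
  have hc := fun s (hs : s ∈ Ioc 0 t₁) => h.cube_nonpos hX h0 ht₁ hk hs
  refine (eq_neg_norm_or_re_pos (hc t ht).1 (hc t ht).2).resolve_right fun hpos => ?_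
  have hcont : ContinuousOn (fun s => (X (k s)).re) (Icc t t₁) := fun s hs =>
    continuous_re.continuousAt.comp_continuousWithinAt
      ((hX.diff _ (hk s ⟨ht.1.le.trans hs.1, hs.2⟩)).continuousAt.comp_continuousWithinAt
        ((h.continuousOn s ⟨ht.1.le.trans hs.1, hs.2.trans ht₁⟩).mono
          (Icc_subset_Icc ht.1.le ht₁)))
  obtain ⟨s, hs, hs0⟩ := intermediate_value_Icc' ht.2 hcont ⟨hneg.le, hpos.le⟩
  have hs' := hc s ⟨ht.1.trans_le hs.1, hs.2⟩
  rcases eq_neg_norm_or_re_pos hs'.1 hs'.2 with h1 | h1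
  · have h2 := congrArg Complex.re h1
    simp only at hs0
    rw [hs0, neg_re, ofReal_re, eq_comm, neg_eq_zero] at h2
    exact hs'.1 (norm_eq_zero.1 h2)
  · exact h1.ne' hs0

/-- A straightening coordinate at the turning point `τ`, depending on the spectral parameter,
adapted to the cut domains `D`: for `lam` near `lam₀` the cut lies on the negative axis of the
coordinate, and for `lam₀` it covers the negative axis near `0`. -/
structure IsSlitChart (A S : ℂ → ℂ) (Om : Set ℂ) (lam₀ : ℂ) (τ : ℂ → ℂ) (D : ℂ → Set ℂ)
    (r ρ C : ℝ) (X : ℂ → ℂ → ℂ) : Prop where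
  ρ_pos : 0 < ρ
  cont : ∀ x ∈ ball (τ lam₀) r, x ≠ τ lam₀ →
    ContinuousAt (fun p : ℂ × ℂ => X p.1 p.2) (x, lam₀)
  chart : ∀ᶠ lam in 𝓝 lam₀, IsChart A S Om lam (τ lam) (τ lam₀) r ρ C (fun x => X x lam)
  mem : ∀ᶠ lam in 𝓝 lam₀, ∀ x ∈ ball (τ lam₀) r, X x lam ∈ ball 0 ρ →
    X x lam ∈ slitPlane → x ∈ D lam
  slit : ∀ x ∈ ball (τ lam₀) r, X x lam₀ ∈ ball 0 ρ → x ∈ D lam₀ →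
    X x lam₀ ∈ slitPlane

/-- In one of the three straightening coordinates that differ by cube roots of unity, the Stokes arc `k`
is the negative axis near the turning point. The part `t ≥ t₁` of the arc stays away from the turning
point, so that it does not meet a small disc. -/
theorem exists_isSlitChart (hAS : IsPotentialPair A S Om) {τ : ℂ → ℂ} {D : ℂ → Set ℂ}
    {k : ℝ → ℂ → ℂ} (hτ : ContinuousAt τ lam₀)
    (hτ0 : ∀ᶠ lam in 𝓝 lam₀, V₀ A S (τ lam) lam = 0) (hOm : τ lam₀ ∈ Om)
    (hsimple : deriv (fun x => V₀ A S x lam₀) (τ lam₀) ≠ 0) {R : ℝ} (hR : 0 < R)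
    {U₀ : Set ℂ} (hU : U₀ ∈ 𝓝 lam₀)
    (hk : ContinuousOn (fun p : ℝ × ℂ => k p.1 p.2) (Icc 0 1 ×ˢ U₀))
    (hk0 : ∀ lam ∈ U₀, k 0 lam = τ lam)
    (harc : ∀ lam ∈ U₀, IsStokesArc A S Om lam (fun t => k t lam))
    (hD : ∀ᶠ lam in 𝓝 lam₀, ∀ x ∈ ball (τ lam₀) R,
      x ∈ D lam ↔ x ∉ (fun t => k t lam) '' Icc 0 1) :
    ∃ (X : ℂ → ℂ → ℂ) (r ρ C : ℝ), r ≤ R ∧ IsSlitChart A S Om lam₀ τ D r ρ C X := by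
  obtain ⟨X₀, r, ρ, C, hr, hrR, hρ, hX₀c, hX₀⟩ := exists_isChart hAS hτ hτ0 hOm hsimple hR
  have hlam₀ : lam₀ ∈ U₀ := mem_of_mem_nhds hU
  obtain ⟨δ, hδ, hkδ⟩ := continuousOn_iff.1 hk (0, lam₀)
    ⟨⟨le_rfl, zero_le_one⟩, hlam₀⟩ r hr
  obtain ⟨t₁, ht₁⟩ : ∃ t₁, t₁ = min (δ / 2) 1 := ⟨_, rfl⟩
  have ht0 : 0 < t₁ := by rw [ht₁]; exact lt_min (half_pos hδ) one_pos
  have ht1 : t₁ ≤ 1 := by rw [ht₁]; exact min_le_right _ _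
  have hkball : ∀ lam ∈ U₀, dist lam lam₀ < δ → ∀ t ∈ Icc 0 t₁, k t lam ∈ ball (τ lam₀) r := by
    intro lam hl hld t ht
    have := hkδ (t, lam) ⟨⟨ht.1, ht.2.trans ht1⟩, hl⟩ (by
      rw [Prod.dist_eq]
      refine max_lt ?_ hld
      rw [Real.dist_eq, sub_zero, abs_of_nonneg ht.1]
      have := min_le_left (δ / 2) 1
      rw [← ht₁] at this
      linarith [ht.2])
    rwa [hk0 lam₀ hlam₀] at this
  have hkb₀ := hkball lam₀ hlam₀ (by rw [dist_self]; exact hδ)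
  have hav : ∀ t ∈ Ioc (0 : ℝ) 1, k t lam₀ ≠ τ lam₀ := fun t ht =>
    (harc lam₀ hlam₀).ne_of_simple hτ0.self_of_nhds hsimple ht
  obtain ⟨δ₂, hδ₂, hfar⟩ := eventually_forall_le_dist hU hk (isCompact_Icc (a := t₁) (b := 1))
    (Icc_subset_Icc_left ht0.le) fun t ht => hav t ⟨ht0.trans_le ht.1, ht.2⟩
  obtain ⟨X₁, hX₁⟩ : ∃ X₁, X₁ = X₀ (k t₁ lam₀) lam₀ := ⟨_, rfl⟩
  obtain ⟨hX₁0, hX₁c⟩ := (harc lam₀ hlam₀).cube_nonpos hX₀.self_of_nhds (hk0 lam₀ hlam₀) ht1 hkb₀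
    ⟨ht0, le_rfl⟩
  rw [← hX₁] at hX₁0 hX₁c
  -- the rotation that maps the ray containing the cut to the negative axis
  obtain ⟨κ, hκ⟩ : ∃ κ, κ = -(‖X₁‖ : ℂ) / X₁ := ⟨_, rfl⟩
  have hκ3 : κ ^ 3 = 1 := by
    have h1 := cube_eq_of_norm_add_re hX₁c
    rw [hκ, div_pow, h1, div_eq_one_iff_eq]
    · ring
    · rw [← h1]; exact pow_ne_zero 3 hX₁0
  have hκX : κ * X₁ = -(‖X₁‖ : ℂ) := by rw [hκ]; field_simp
  have hX := hX₀.mono fun lam h => h.rot hκ3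
  have hXc : ∀ x ∈ ball (τ lam₀) r, x ≠ τ lam₀ →
      ContinuousAt (fun p : ℂ × ℂ => κ * X₀ p.1 p.2) (x, lam₀) := fun x hx hne =>
    continuousAt_const.mul (hX₀c x hx hne)
  have hn1 : 0 < ‖X₁‖ := norm_pos_iff.2 hX₁0
  obtain ⟨ρ', hρ'⟩ : ∃ ρ', ρ' = min ρ (min (δ₂ / (2 * (|C| + 1))) ‖X₁‖) := ⟨_, rfl⟩
  have hC1 : 0 < |C| + 1 := by positivity
  have hρ0 : 0 < ρ' := by rw [hρ']; exact lt_min hρ (lt_min (by positivity) hn1)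
  have hρ1 : ρ' ≤ ρ := by rw [hρ']; exact min_le_left _ _
  have hρ2 : ρ' ≤ δ₂ / (2 * (|C| + 1)) := by
    rw [hρ']; exact (min_le_right _ _).trans (min_le_left _ _)
  have hρ3 : ρ' ≤ ‖X₁‖ := by rw [hρ']; exact (min_le_right _ _).trans (min_le_right _ _)
  refine ⟨fun x lam => κ * X₀ x lam, r, ρ', C, hrR, hρ0, hXc, hX.mono fun lam h =>
    { h with surj := (ball_subset_ball hρ1).trans h.surj }, ?_, ?_⟩
  · have hneg : ∀ᶠ lam in 𝓝 lam₀, (κ * X₀ (k t₁ lam) lam).re < 0 := by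
      have h1 : ContinuousAt (fun lam => k t₁ lam) lam₀ := by
        have h2 : ContinuousOn (fun lam => k t₁ lam) U₀ :=
          hk.comp (f := fun lam => ((t₁, lam) : ℝ × ℂ)) (by fun_prop) fun lam hl =>
            ⟨⟨ht0.le, ht1⟩, hl⟩
        exact h2.continuousAt hU
      have h2 : ContinuousAt (fun lam => κ * X₀ (k t₁ lam) lam) lam₀ :=
        ContinuousAt.comp (f := fun lam => (k t₁ lam, lam))
          (hXc _ (hkb₀ t₁ ⟨ht0.le, le_rfl⟩) (hav t₁ ⟨ht0, ht1⟩)) (h1.prodMk continuousAt_id)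
      refine (continuous_re.continuousAt.comp h2).eventually_lt_const ?_
      simp only [Function.comp_apply]
      rw [← hX₁, hκX, neg_re, ofReal_re]
      linarith
    have hτn : ∀ᶠ lam in 𝓝 lam₀, dist (τ lam) (τ lam₀) < δ₂ / 2 :=
      continuousAt_iff'.1 hτ _ (half_pos hδ₂)
    filter_upwards [hneg, hτn, hX, hfar, hD, hU, ball_mem_nhds lam₀ hδ]
      with lam h1 h2 h3 h4 h5 h6 h7 x hx hxρ hxs
    rw [h5 x (ball_subset_ball hrR hx)]
    rintro ⟨t, ht, rfl⟩
    simp only at hx hxρ hxs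
    -- points with `t ≥ t₁` are excluded by their distance, those with `t < t₁` lie on the negative axis
    rcases le_or_gt t₁ t with htt | htt
    · have h8 := h3.antilipschitz _ hx _ h3.mem
      rw [h3.zero, sub_zero, ← dist_eq_norm] at h8
      rw [mem_ball_zero_iff] at hxρ
      have h9 : C * ‖κ * X₀ (k t lam) lam‖ ≤ (|C| + 1) * ρ' :=
        mul_le_mul ((le_abs_self C).trans (by linarith)) hxρ.le (norm_nonneg _) hC1.le
      have h10 : (|C| + 1) * ρ' ≤ δ₂ / 2 := by
        calc _ ≤ (|C| + 1) * (δ₂ / (2 * (|C| + 1))) := by gcongr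
          _ = _ := by field_simp
      have h11 := h4 t ⟨htt, ht.2⟩
      have h12 := dist_triangle (k t lam) (τ lam) (τ lam₀)
      linarith
    · rcases ht.1.eq_or_lt with h0 | h0
      · rw [← h0, hk0 lam h6] at hxs
        rw [h3.zero] at hxs
        exact slitPlane_ne_zero hxs rfl
      · have := (harc lam h6).eq_neg_norm h3 (hk0 lam h6) ht1 (hkball lam h6 h7) h1 ⟨h0, htt.le⟩
        rw [this, ← Complex.ofReal_neg] at hxs
        rw [ofReal_mem_slitPlane] at hxs
        linarith [norm_nonneg (κ * X₀ (k t lam) lam)]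
  · intro x hx hxρ hxD
    by_contra hns
    rw [hD.self_of_nhds x (ball_subset_ball hrR hx)] at hxD
    apply hxD
    have h3 := hX.self_of_nhds
    rw [Complex.mem_slitPlane_iff] at hns
    push Not at hns
    rw [mem_ball_zero_iff] at hxρ
    -- the arc takes all values between `0` and `-‖X₁‖` in the coordinate, by the intermediate value theorem
    have hcont : ContinuousOn (fun s => (κ * X₀ (k s lam₀) lam₀).re) (Icc 0 t₁) := fun s hs =>
      continuous_re.continuousAt.comp_continuousWithinAt
        ((h3.diff _ (hkb₀ s hs)).continuousAt.comp_continuousWithinAt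
          (f := fun s => k s lam₀) (((harc lam₀ hlam₀).continuousOn s ⟨hs.1, hs.2.trans ht1⟩).mono
            (Icc_subset_Icc_right ht1)))
    have hz := h3.zero
    obtain ⟨s, hs, hsx⟩ := intermediate_value_Icc' ht0.le hcont
      (show (κ * X₀ x lam₀).re ∈ Icc _ _ from by
        simp only [hk0 lam₀ hlam₀, hz, ← hX₁, hκX]
        rw [neg_re, ofReal_re, Complex.zero_re]
        exact ⟨by linarith [neg_le_of_abs_le (abs_re_le_norm (κ * X₀ x lam₀))], hns.1⟩)
    refine ⟨s, ⟨hs.1, hs.2.trans ht1⟩, h3.injOn (hkb₀ s hs) hx ?_⟩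
    refine Complex.ext hsx ?_
    rw [hns.2]
    rcases hs.1.eq_or_lt with h0 | h0
    · simp only [← h0, hk0 lam₀ hlam₀, hz, Complex.zero_im]
    · have := (harc lam₀ hlam₀).eq_neg_norm h3 (hk0 lam₀ hlam₀) ht1 hkb₀ (by
        rw [← hX₁, hκX, neg_re, ofReal_re]; linarith) ⟨h0, hs.2⟩
      rw [this, ← Complex.ofReal_neg, ofReal_im]

/-! ### Branches near a simple turning point -/

/-- Two branches of the phase on a connected domain agree up to the sign and the origin. -/
theorem exists_sign_of_isBranchAt {lam : ℂ} {D : Set ℂ} (hDo : IsOpen D) (hDc : IsPreconnected D)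
    {z H z₁ H₁ : ℂ → ℂ} (h : ∀ x ∈ D, IsBranchAt A S Om lam z H x)
    (h₁ : ∀ x ∈ D, IsBranchAt A S Om lam z₁ H₁ x) :
    ∃ ς m : ℂ, (ς = 1 ∨ ς = -1) ∧
      ∀ x ∈ D, H x ^ 2 = ς * H₁ x ^ 2 ∧ z x = ς * z₁ x + m := by
  have hsq : EqOn ((fun x => H x ^ 2) ^ 2) ((fun x => H₁ x ^ 2) ^ 2) D := by
    intro x hx
    have h1 := (h x hx).pow
    have h2 := (h₁ x hx).pow
    have h3 := mul_right_cancel₀ (h x hx).gPlus_ne (h1.trans h2.symm)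
    simp only [Pi.pow_apply]
    linear_combination h3
  have hH : ContinuousOn (fun x => H x ^ 2) D := fun x hx =>
    ((h x hx).diff.continuousAt.pow 2).continuousWithinAt
  have hH₁ : ContinuousOn (fun x => H₁ x ^ 2) D := fun x hx =>
    ((h₁ x hx).diff.continuousAt.pow 2).continuousWithinAt
  have hsign : ∃ ς : ℂ, (ς = 1 ∨ ς = -1) ∧ ∀ x ∈ D, H x ^ 2 = ς * H₁ x ^ 2 := by
    rcases hDc.eq_or_eq_neg_of_sq_eq hH hH₁ hsq
      (fun hx => pow_ne_zero 2 (h₁ _ hx).ne) with h3 | h3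
    · exact ⟨1, Or.inl rfl, fun x hx => by rw [one_mul]; exact h3 hx⟩
    · exact ⟨-1, Or.inr rfl, fun x hx => by rw [neg_one_mul]; exact h3 hx⟩
  obtain ⟨ς, hς, hςH⟩ := hsign
  rcases D.eq_empty_or_nonempty with rfl | ⟨p, hp⟩
  · exact ⟨ς, 0, hς, fun x hx => absurd hx (notMem_empty x)⟩
  refine ⟨ς, z p - ς * z₁ p, hς, fun x hx => ⟨hςH x hx, ?_⟩⟩
  have hd : ∀ y ∈ D, HasDerivAt (fun y => z y - ς * z₁ y) 0 y := fun y hy =>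
    ((h y hy).hasDerivAt.sub ((h₁ y hy).hasDerivAt.const_mul ς)).congr_deriv
      (by rw [hςH y hy]; ring)
  have := hDo.is_const_of_deriv_eq_zero hDc
    (fun y hy => (hd y hy).differentiableAt.differentiableWithinAt)
    (fun y hy => (hd y hy).deriv) hx hp
  linear_combination this

theorem exists_sign_of_sq_eq {D : Set ℂ} (hDc : IsPreconnected D) {H H₁ : ℂ → ℂ}
    (hH : ContinuousOn H D) (hH₁ : ContinuousOn H₁ D) (h₀ : ∀ x ∈ D, H₁ x ≠ 0)
    (h : ∀ x ∈ D, H x ^ 2 = H₁ x ^ 2) : ∃ sg : ℂ, (sg = 1 ∨ sg = -1) ∧ ∀ x ∈ D, H x = sg * H₁ x := by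
  rcases hDc.eq_or_eq_neg_of_sq_eq hH hH₁ (fun x hx => h x hx) (fun hx => h₀ _ hx) with h3 | h3
  · exact ⟨1, Or.inl rfl, fun x hx => by rw [one_mul]; exact h3 hx⟩
  · exact ⟨-1, Or.inr rfl, fun x hx => by rw [neg_one_mul]; exact h3 hx⟩

/-- A branch `L` of `log X` gives the branch `X^{3/2} = exp (3 L / 2)` of the phase, with the
amplitude `X^{σ/4} θ`, where `θ` is holomorphic at the turning point; here `σ = 1` if the turning
point is a zero of `g₋` and `σ = -1` if it is a zero of `g₊`. -/
theorem IsChart.exists_amplitude (hAS : IsPotentialPair A S Om) {lam t c : ℂ} {r ρ C : ℝ}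
    {X : ℂ → ℂ} (hX : IsChart A S Om lam t c r ρ C X) {σ : ℂ}
    (hσ : (σ = 1 ∧ ∀ x ∈ ball c r, gPlus A S x lam ≠ 0) ∨
      (σ = -1 ∧ ∀ x ∈ ball c r, gMinus A S x lam ≠ 0)) :
    ∃ θ : ℂ → ℂ, ∀ (L : ℂ → ℂ), ∀ x ∈ ball c r, HasDerivAt L (deriv X x / X x) x →
      exp (L x) = X x →
      IsBranchAt A S Om lam (fun y => exp (3 / 2 * L y))
        (fun y => exp (σ / 4 * L y) * θ y) x := by
  have hXd : DifferentiableOn ℂ X (ball c r) := fun x hx =>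
    (hX.diff x hx).differentiableWithinAt
  have hXd' : DifferentiableOn ℂ (fun x => 3 / 2 * deriv X x) (ball c r) :=
    (hXd.deriv isOpen_ball).const_mul _
  have hgp : DifferentiableOn ℂ (fun x => gPlus A S x lam) (ball c r) := fun x hx =>
    (hasDerivAt_gPlus hAS (hX.sub hx)).differentiableAt.differentiableWithinAt
  have hgm : DifferentiableOn ℂ (fun x => gMinus A S x lam) (ball c r) := fun x hx =>
    (hasDerivAt_gMinus hAS (hX.sub hx)).differentiableAt.differentiableWithinAt
  have hX0 : ∀ x ∈ ball c r, 3 / 2 * deriv X x ≠ 0 := fun x hx =>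
    mul_ne_zero (by norm_num) (hX.deriv_ne x hx)
  -- in both cases the amplitude is determined by `H² g₊ = z'`
  have key : ∀ θ : ℂ → ℂ, DifferentiableOn ℂ θ (ball c r) →
      (∀ (L : ℂ → ℂ), ∀ x ∈ ball c r, exp (L x) = X x →
        θ x ≠ 0 ∧ (exp (σ / 4 * L x) * θ x) ^ 2 * gPlus A S x lam
          = exp (3 / 2 * L x) * (3 / 2 * (deriv X x / X x))) →
      ∀ (L : ℂ → ℂ), ∀ x ∈ ball c r, HasDerivAt L (deriv X x / X x) x →
      exp (L x) = X x →
      IsBranchAt A S Om lam (fun y => exp (3 / 2 * L y))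
        (fun y => exp (σ / 4 * L y) * θ y) x := by
    intro θ hθ hkey L x hx hL hexp
    obtain ⟨h1, h2⟩ := hkey L x hx hexp
    have hXne : X x ≠ 0 := by rw [← hexp]; exact exp_ne_zero _
    have hV := hX.eq x hx
    have hV0 : V₀ A S x lam ≠ 0 := by
      rw [← hV]
      exact mul_ne_zero (mul_ne_zero (by norm_num) hXne) (pow_ne_zero 2 (hX.deriv_ne x hx))
    rw [V₀_eq] at hV0
    have hgp0 := left_ne_zero_of_mul hV0
    refine ⟨hX.sub hx, ?_, ?_, mul_ne_zero (exp_ne_zero _) h1, hgp0, ?_⟩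
    · rw [h2]
      exact (hL.const_mul _).cexp
    · exact ((hL.const_mul _).cexp.differentiableAt).mul
        (hθ.differentiableAt (isOpen_ball.mem_nhds hx))
    · have h3 : exp (3 / 2 * L x) ^ 2 = X x ^ 3 := by
        rw [← hexp, ← exp_nat_mul, ← exp_nat_mul]
        congr 1
        push_cast
        ring
      have h4 : ((exp (σ / 4 * L x) * θ x) ^ 2 * gPlus A S x lam) ^ 2
          = gPlus A S x lam * gMinus A S x lam := by
        rw [h2, mul_pow, h3, ← V₀_eq, ← hV]
        field_simp
        ring
      apply mul_left_cancel₀ hgp0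
      linear_combination h4
  rcases hσ with ⟨rfl, hg⟩ | ⟨rfl, hg⟩
  · obtain ⟨θ, hθ, hθ2⟩ := exists_sqrt_ball (hXd'.div hgp hg)
      (fun x hx => div_ne_zero (hX0 x hx) (hg x hx))
    refine ⟨θ, key θ hθ fun L x hx hexp => ?_⟩
    have h2 := hθ2 x hx
    simp only [Pi.div_apply] at h2
    refine ⟨fun h0 => ?_, ?_⟩
    · rw [h0, zero_pow two_ne_zero, eq_comm] at h2
      exact div_ne_zero (hX0 x hx) (hg x hx) h2
    · have hgx := hg x hx
      have e : exp (3 / 2 * L x) = exp (1 / 4 * L x) ^ 2 * X x := by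
        rw [← hexp, ← exp_nat_mul, ← exp_add]
        congr 1
        push_cast
        ring
      have hXne : X x ≠ 0 := by rw [← hexp]; exact exp_ne_zero _
      rw [mul_pow, h2, e]
      field_simp
  · obtain ⟨θ, hθ, hθ2⟩ := exists_sqrt_ball (hgm.div hXd' hX0)
      (fun x hx => div_ne_zero (hg x hx) (hX0 x hx))
    refine ⟨θ, key θ hθ fun L x hx hexp => ?_⟩
    have h2 := hθ2 x hx
    simp only [Pi.div_apply] at h2
    refine ⟨fun h0 => ?_, ?_⟩
    · rw [h0, zero_pow two_ne_zero, eq_comm] at h2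
      exact div_ne_zero (hg x hx) (hX0 x hx) h2
    · have hXne : X x ≠ 0 := by rw [← hexp]; exact exp_ne_zero _
      have hV := hX.eq x hx
      rw [V₀_eq] at hV
      have e : exp (3 / 2 * L x) = exp (-1 / 4 * L x) ^ 2 * X x ^ 2 := by
        rw [← hexp, ← exp_nat_mul, ← exp_nat_mul, ← exp_add]
        congr 1
        push_cast
        ring
      have hd := hX.deriv_ne x hx
      rw [mul_pow, h2, e]
      field_simp
      linear_combination (-4) * hV

theorem IsChart.exists_inv {lam t c : ℂ} {r ρ C : ℝ} {X : ℂ → ℂ}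
    (hX : IsChart A S Om lam t c r ρ C X) :
    ∃ χ : ℂ → ℂ, ContinuousOn χ (ball 0 ρ) ∧
      (∀ w ∈ ball 0 ρ, χ w ∈ ball c r ∧ X (χ w) = w) ∧
      ∀ x ∈ ball c r, X x ∈ ball 0 ρ → χ (X x) = x := by
  choose! χ hχ using fun w (hw : w ∈ ball (0 : ℂ) ρ) => hX.surj hw
  refine ⟨χ, ?_, hχ, fun x hx hXx => hX.injOn (hχ _ hXx).1 hx (hχ _ hXx).2⟩
  have hlip : LipschitzOnWith (Real.toNNReal C) χ (ball 0 ρ) := by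
    refine LipschitzOnWith.of_dist_le_mul fun v hv w hw => ?_
    have := hX.antilipschitz _ (hχ v hv).1 _ (hχ w hw).1
    rw [(hχ v hv).2, (hχ w hw).2] at this
    rw [dist_eq_norm, dist_eq_norm]
    exact this.trans (mul_le_mul_of_nonneg_right (Real.le_coe_toNNReal C) (norm_nonneg _))
  exact hlip.continuousOn

/-- The disc of radius `ρ` of a straightening coordinate, without the negative axis. -/
def slitDisc (c : ℂ) (r ρ : ℝ) (X : ℂ → ℂ) : Set ℂ :=
  {x | x ∈ ball c r ∧ X x ∈ ball 0 ρ ∧ X x ∈ slitPlane}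

theorem norm_exp_lt_iff {ρ : ℝ} (hρ : 0 < ρ) {l : ℂ} :
    exp l ∈ ball (0 : ℂ) ρ ↔ l.re < Real.log ρ := by
  rw [mem_ball_zero_iff, norm_exp, Real.lt_log_iff_exp_lt hρ]

theorem IsChart.isOpen_slitDisc {lam t c : ℂ} {r ρ C : ℝ} {X : ℂ → ℂ}
    (hX : IsChart A S Om lam t c r ρ C X) : IsOpen (slitDisc c r ρ X) := by
  have hc : ContinuousOn X (ball c r) := fun x hx =>
    (hX.diff x hx).continuousAt.continuousWithinAt
  exact hc.isOpen_inter_preimage isOpen_ball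
    (isOpen_ball.inter isOpen_slitPlane)

theorem IsChart.isPreconnected_slitDisc {lam t c : ℂ} {r ρ C : ℝ} {X : ℂ → ℂ}
    (hX : IsChart A S Om lam t c r ρ C X) (hρ : 0 < ρ) : IsPreconnected (slitDisc c r ρ X) := by
  obtain ⟨χ, hχc, hχ, hχX⟩ := hX.exists_inv
  obtain ⟨T, hT⟩ : ∃ T : Set ℂ, T = {l : ℂ | l.re < Real.log ρ} ∩
    ({l : ℂ | -π < l.im} ∩ {l : ℂ | l.im < π}) := ⟨_, rfl⟩
  have hTc : IsPreconnected T := by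
    rw [hT]
    exact ((convex_halfSpace_re_lt _).inter ((convex_halfSpace_im_gt _).inter
      (convex_halfSpace_im_lt _))).isPreconnected
  have himg : slitDisc c r ρ X = (fun l => χ (exp l)) '' T := by
    ext x
    constructor
    · rintro ⟨h1, h2, h3⟩
      have h4 := exp_log (slitPlane_ne_zero h3)
      refine ⟨log (X x), ?_, ?_⟩
      · rw [hT]
        refine ⟨?_, Complex.neg_pi_lt_log_im _, ?_⟩
        · rw [← h4] at h2
          exact (norm_exp_lt_iff hρ).1 h2
        · have := (mem_slitPlane_iff_arg.1 h3).1
          exact lt_of_le_of_ne (Complex.log_im_le_pi _) (by rwa [log_im])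
      · simp only [h4]
        exact hχX x h1 h2
    · rintro ⟨l, hl, rfl⟩
      rw [hT] at hl
      have hlim : l.im < π := hl.2.2
      have h1 := (norm_exp_lt_iff hρ).2 hl.1
      refine ⟨(hχ _ h1).1, ?_, ?_⟩
      · simp only [(hχ _ h1).2]; exact h1
      · simp only [(hχ _ h1).2]
        rw [mem_slitPlane_iff_arg]
        refine ⟨?_, exp_ne_zero _⟩
        rw [Complex.arg_exp, (toIocMod_eq_self Real.two_pi_pos).2 ⟨hl.2.1, by linarith⟩]
        exact hlim.ne
  rw [himg]
  refine hTc.image _ (hχc.comp Complex.continuous_exp.continuousOn fun l hl => ?_)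
  rw [hT] at hl
  exact (norm_exp_lt_iff hρ).2 hl.1

theorem exp_half_sq {w : ℂ} (hw : w ≠ 0) : exp (3 / 2 * log w) ^ 2 = w ^ 3 := by
  rw [← exp_nat_mul, show ((2 : ℕ) : ℂ) * (3 / 2 * log w)
    = ((3 : ℕ) : ℂ) * log w by push_cast; ring, exp_nat_mul, exp_log hw]

/-- Near the turning point the phase equals `± X^{3/2}`, up to its value at the turning point. -/
theorem IsChart.exists_phase_eq {lam t c l : ℂ} {r ρ C : ℝ} {X z H z₀ H₀ : ℂ → ℂ}
    (hX : IsChart A S Om lam t c r ρ C X) (hρ : 0 < ρ)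
    (hz₀ : ∀ x, z₀ x = exp (3 / 2 * log (X x)))
    (h₀ : ∀ x ∈ slitDisc c r ρ X, IsBranchAt A S Om lam z₀ H₀ x)
    (h : ∀ x ∈ slitDisc c r ρ X, IsBranchAt A S Om lam z H x)
    (hl : Tendsto z (𝓝[slitDisc c r ρ X] t) (𝓝 l)) :
    ∃ ς : ℂ, (ς = 1 ∨ ς = -1) ∧ ∀ x ∈ slitDisc c r ρ X,
      H x ^ 2 = ς * H₀ x ^ 2 ∧ z x = l + ς * exp (3 / 2 * log (X x)) := by
  obtain ⟨ς, m, hς, hςm⟩ := exists_sign_of_isBranchAt hX.isOpen_slitDisc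
    (hX.isPreconnected_slitDisc hρ) h h₀
  refine ⟨ς, hς, fun x hx => ⟨(hςm x hx).1, ?_⟩⟩
  obtain ⟨χ, hχc, hχ, hχX⟩ := hX.exists_inv
  have h0ρ : (0 : ℂ) ∈ ball (0 : ℂ) ρ := mem_ball_self hρ
  have hχ0 : χ 0 = t := by
    have := hχX t hX.mem (by rw [hX.zero]; exact h0ρ)
    rwa [hX.zero] at this
  have hNe : (𝓝[slitDisc c r ρ X] t).NeBot := by
    have h1 : Tendsto (fun s : ℝ => χ s) (𝓝[Ioo 0 ρ] 0) (𝓝[slitDisc c r ρ X] t) := by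
      refine tendsto_nhdsWithin_iff.2 ⟨?_, ?_⟩
      · rw [← hχ0]
        have h2 : ContinuousAt (fun s : ℝ => χ s) 0 := by
          refine ContinuousAt.comp (g := χ) (f := fun s : ℝ => (s : ℂ)) ?_
            Complex.continuous_ofReal.continuousAt
          rw [Complex.ofReal_zero]
          exact hχc.continuousAt (isOpen_ball.mem_nhds h0ρ)
        have h3 := h2.tendsto.mono_left (nhdsWithin_le_nhds (s := Ioo 0 ρ))
        simpa using h3
      · filter_upwards [self_mem_nhdsWithin] with s hs
        have h4 : (s : ℂ) ∈ ball (0 : ℂ) ρ := by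
          rw [mem_ball_zero_iff, norm_real, Real.norm_of_nonneg hs.1.le]; exact hs.2
        refine ⟨(hχ _ h4).1, ?_, ?_⟩
        · rw [(hχ _ h4).2]; exact h4
        · rw [(hχ _ h4).2, ofReal_mem_slitPlane]; exact hs.1
    have : (𝓝[Ioo 0 ρ] (0 : ℝ)).NeBot := left_nhdsWithin_Ioo_neBot hρ
    exact h1.neBot
  have hlim : Tendsto z₀ (𝓝[slitDisc c r ρ X] t) (𝓝 0) := by
    have h1 : Tendsto (fun x => ‖X x ^ 3‖) (𝓝[slitDisc c r ρ X] t) (𝓝 0) := by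
      have := ((hX.diff t hX.mem).continuousAt.pow 3).norm.tendsto.mono_left
        (nhdsWithin_le_nhds (s := slitDisc c r ρ X))
      simpa [hX.zero] using this
    have h2 : Tendsto (fun x => ‖z₀ x‖ ^ 2) (𝓝[slitDisc c r ρ X] t) (𝓝 0) := by
      refine h1.congr' ?_
      filter_upwards [self_mem_nhdsWithin] with y hy
      rw [hz₀, ← norm_pow, exp_half_sq (slitPlane_ne_zero hy.2.2)]
    have h3 := h2.sqrt
    rw [Real.sqrt_zero] at h3
    refine tendsto_zero_iff_norm_tendsto_zero.2 (h3.congr fun y => ?_)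
    rw [Real.sqrt_sq (norm_nonneg _)]
  have hm : Tendsto z (𝓝[slitDisc c r ρ X] t) (𝓝 (ς * 0 + m)) := by
    refine ((hlim.const_mul ς).add_const m).congr' ?_
    filter_upwards [self_mem_nhdsWithin] with y hy using (hςm y hy).2.symm
  have := tendsto_nhds_unique hl hm
  rw [mul_zero, zero_add] at this
  rw [(hςm x hx).2, this, hz₀, add_comm]

/-! ### Sectors at a turning point -/

/-- The map `g` parametrizes, by the logarithm of the straightening coordinate, the sector of
opening `4π/3` around the direction `φ`, which is one of the Stokes directions or the direction of
the cut; there the phase is `f₀ + ς X^{3/2}`. -/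
structure IsSectorMap (D : Set ℂ) (f g : ℂ → ℂ) (R₀ φ s ς : ℝ) (f₀ : ℂ) : Prop where
  dir : exp (3 / 2 * (φ * I)) = s * I
  cont : ContinuousOn g {l | l.re < R₀}
  spec : ∀ l : ℂ, l.re < R₀ → |l.im - φ| < 2 * π / 3 →
    g l ∈ D ∧ f (g l) = f₀ + ς * exp (3 / 2 * l)

namespace IsSectorMap

variable {D : Set ℂ} {f g : ℂ → ℂ} {R₀ φ s ς : ℝ} {f₀ : ℂ}

theorem exp_eq (h : IsSectorMap D f g R₀ φ s ς f₀) (l : ℂ) :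
    exp (3 / 2 * l) = s * I * exp (3 / 2 * (l - φ * I)) := by
  rw [← h.dir, ← exp_add]
  congr 1
  ring

theorem re_exp (h : IsSectorMap D f g R₀ φ s ς f₀) (l : ℂ) :
    (exp (3 / 2 * l)).re
      = -s * (Real.exp (3 / 2 * l.re) * Real.sin (3 / 2 * (l.im - φ))) := by
  have e : ∀ w : ℂ, (s * I * w).re = -s * w.im := by intro w; simp
  rw [h.exp_eq, e, Complex.exp_im]
  congr 3
  · simp [mul_re]
  · simp [mul_im]

/-- Two points in the same half of the sector lie in the same Stokes region. -/
theorem mem_stokesRegion (h : IsSectorMap D f g R₀ φ s ς f₀) (hs : s = 1 ∨ s = -1)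
    (hς : ς = 1 ∨ ς = -1) {δ : ℝ} (hδ : δ = 1 ∨ δ = -1) {l₁ l₂ : ℂ} (h₁ : l₁.re < R₀)
    (h₂ : l₂.re < R₀) (h₁' : δ * (l₁.im - φ) ∈ Ioo 0 (2 * π / 3))
    (h₂' : δ * (l₂.im - φ) ∈ Ioo 0 (2 * π / 3)) :
    g l₂ ∈ stokesRegion D f f₀.re (g l₁) := by
  obtain ⟨T, hT⟩ : ∃ T : Set ℂ, T = {l : ℂ | l.re < R₀} ∩
    {l : ℂ | δ * (l.im - φ) ∈ Ioo 0 (2 * π / 3)} := ⟨_, rfl⟩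
  have hTc : IsPreconnected T := by
    rw [hT]
    refine ((convex_halfSpace_re_lt _).inter ?_).isPreconnected
    have : {l : ℂ | δ * (l.im - φ) ∈ Ioo 0 (2 * π / 3)}
        = (fun l : ℂ => δ * l.im) ⁻¹' Ioo (δ * φ) (δ * φ + 2 * π / 3) := by
      ext l
      simp only [mem_ofPred_eq, mem_preimage, mem_Ioo]
      constructor <;> rintro ⟨h1, h2⟩ <;> constructor <;> linarith
    rw [this]
    exact (convex_Ioo _ _).is_linear_preimage
      (f := fun l : ℂ => δ * l.im) ⟨fun a b => by simp [mul_add], fun a b => by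
        simp only [Complex.real_smul, im_ofReal_mul, smul_eq_mul]; ring⟩
  have hsub : g '' T ⊆ {y ∈ D | (f y).re ≠ f₀.re} := by
    rintro _ ⟨l, hl, rfl⟩
    rw [hT] at hl
    obtain ⟨hl1, hl2⟩ := hl
    simp only [mem_ofPred_eq, mem_Ioo] at hl1 hl2
    have habs : |l.im - φ| < 2 * π / 3 := by
      rcases hδ with rfl | rfl <;> rw [abs_lt] <;> constructor <;>
        linarith [Real.pi_pos, hl2.1, hl2.2]
    obtain ⟨hD, hf⟩ := h.spec l hl1 habs
    refine ⟨hD, fun heq => ?_⟩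
    rw [hf, add_re, re_ofReal_mul, h.re_exp] at heq
    have hsin : Real.sin (3 / 2 * (l.im - φ)) ≠ 0 := by
      rcases hδ with rfl | rfl
      · exact (Real.sin_pos_of_pos_of_lt_pi (by linarith [hl2.1]) (by linarith [hl2.2])).ne'
      · exact (Real.sin_neg_of_neg_of_neg_pi_lt (by linarith [hl2.1]) (by linarith [hl2.2])).ne
    have hne : ς * (-s * (Real.exp (3 / 2 * l.re) * Real.sin (3 / 2 * (l.im - φ)))) ≠ 0 := by
      refine mul_ne_zero ?_ (mul_ne_zero ?_ (mul_ne_zero (Real.exp_pos _).ne' hsin))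
      · rcases hς with rfl | rfl <;> norm_num
      · rcases hs with rfl | rfl <;> norm_num
    exact hne (by linarith)
  have hm₁ : l₁ ∈ T := by rw [hT]; exact ⟨h₁, h₁'⟩
  have hm₂ : l₂ ∈ T := by rw [hT]; exact ⟨h₂, h₂'⟩
  exact (hTc.image g (h.cont.mono (by rw [hT]; exact inter_subset_left))).subset_connectedComponentIn
    (mem_image_of_mem g hm₁) hsub (mem_image_of_mem g hm₂)

/-- The Stokes line in the middle of the sector can be crossed along paths with increasing real
part of the phase: in the coordinate `X^{3/2}`, which maps the sector to a slit plane, they consist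
of two segments. -/
theorem inc (h : IsSectorMap D f g R₀ φ s 1 f₀) {l₁ l₂ : ℂ}
    (h₁ : l₁.re < R₀) (h₂ : l₂.re < R₀) (h₁' : |l₁.im - φ| < 2 * π / 3)
    (h₂' : |l₂.im - φ| < 2 * π / 3) (hneg : (exp (3 / 2 * l₁)).re < 0)
    (hpos : 0 < (exp (3 / 2 * l₂)).re) : Inc D f (g l₁) (g l₂) := by
  obtain ⟨lv, hlv⟩ : ∃ lv : ℂ → ℂ, lv = fun v => φ * I + 2 / 3 * log v := ⟨_, rfl⟩
  obtain ⟨R, hR⟩ : ∃ R, R = Real.exp (3 / 2 * R₀) := ⟨_, rfl⟩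
  have hRpos : 0 < R := by rw [hR]; exact Real.exp_pos _
  have hre : ∀ v, (lv v).re = 2 / 3 * Real.log ‖v‖ := by intro v; rw [hlv, ← Complex.log_re]; simp
  have him : ∀ v, (lv v).im - φ = 2 / 3 * arg v := by
    intro v; rw [hlv, ← log_im]; simp
  have hmem : ∀ v ∈ slitPlane, ‖v‖ < R →
      (lv v).re < R₀ ∧ |(lv v).im - φ| < 2 * π / 3 := by
    intro v hv hvR
    have hv0 : 0 < ‖v‖ := norm_pos_iff.2 (slitPlane_ne_zero hv)
    constructor
    · have := Real.log_lt_log hv0 hvR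
      rw [hR, Real.log_exp] at this
      rw [hre]; linarith
    · have h1 := mem_slitPlane_iff_arg.1 hv
      have h2 := lt_of_le_of_ne (Complex.arg_le_pi v) h1.1
      have h3 := Complex.neg_pi_lt_arg v
      rw [him, abs_lt]
      constructor <;> linarith
  have hval : ∀ v ∈ slitPlane, ‖v‖ < R → (f (g (lv v))).re = f₀.re - s * v.im := by
    intro v hv hvR
    obtain ⟨h1, h2⟩ := hmem v hv hvR
    rw [(h.spec _ h1 h2).2, h.exp_eq]
    have : 3 / 2 * (lv v - φ * I) = log v := by rw [hlv]; ring
    rw [this, exp_log (slitPlane_ne_zero hv)]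
    simp
    ring
  have hpath : ∀ v v' : ℂ, (∀ t ∈ Icc (0 : ℝ) 1, v + t * (v' - v) ∈ slitPlane) → ‖v‖ < R →
      ‖v'‖ < R → 0 < -s * (v' - v).im → IncPath D f (g (lv v)) (g (lv v')) := by
    intro v v' hseg hv hv' hlt
    have hn : ∀ t ∈ Icc (0 : ℝ) 1, ‖v + t * (v' - v)‖ < R := by
      intro t ht
      have := (convex_ball (0 : ℂ) R).add_smul_sub_mem (mem_ball_zero_iff.2 hv)
        (mem_ball_zero_iff.2 hv') ht
      rw [Complex.real_smul] at this
      exact mem_ball_zero_iff.1 this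
    refine ⟨0, 1, fun t => g (lv (v + t * (v' - v))), zero_lt_one, ?_, by simp, by simp,
      fun t ht => ?_, ?_⟩
    · refine h.cont.comp ?_ fun t ht => (hmem _ (hseg t ht) (hn t ht)).1
      rw [hlv]
      refine continuousOn_const.add (continuousOn_const.mul (ContinuousOn.clog ?_ hseg))
      fun_prop
    · obtain ⟨h1, h2⟩ := hmem _ (hseg t ht) (hn t ht)
      exact (h.spec _ h1 h2).1
    · intro t ht t' ht' htt
      simp only
      rw [hval _ (hseg t ht) (hn t ht), hval _ (hseg t' ht') (hn t' ht')]
      simp only [add_im, im_ofReal_mul]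
      have := mul_lt_mul_of_pos_left htt hlt
      linarith
  have hinv : ∀ l : ℂ, l.re < R₀ → |l.im - φ| < 2 * π / 3 → ∃ v ∈ slitPlane,
      ‖v‖ < R ∧ lv v = l ∧ (exp (3 / 2 * l)).re = -s * v.im := by
    intro l hl hl'
    rw [abs_lt] at hl'
    have him' : (3 / 2 * (l - φ * I)).im = 3 / 2 * (l.im - φ) := by simp [mul_im]
    have hlog : log (exp (3 / 2 * (l - φ * I)))
        = 3 / 2 * (l - φ * I) :=
      log_exp (by rw [him']; linarith) (by rw [him']; linarith)
    refine ⟨exp (3 / 2 * (l - φ * I)), ?_, ?_, ?_, ?_⟩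
    · rw [mem_slitPlane_iff_arg]
      refine ⟨?_, exp_ne_zero _⟩
      rw [← log_im, hlog, him']
      linarith
    · rw [norm_exp, hR, Real.exp_lt_exp]
      simp [mul_re]
      linarith
    · rw [hlv]; simp only [hlog]; ring
    · rw [h.exp_eq]; simp
  obtain ⟨v₁, hv₁, hv₁R, hv₁l, hv₁e⟩ := hinv l₁ h₁ h₁'
  obtain ⟨v₂, hv₂, hv₂R, hv₂l, hv₂e⟩ := hinv l₂ h₂ h₂'
  rw [hv₁e] at hneg
  rw [hv₂e] at hpos
  rw [← hv₁l, ← hv₂l]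
  have hd0 : ‖((R / 2 : ℝ) : ℂ)‖ < R := by
    rw [norm_real, Real.norm_of_nonneg (by positivity)]; linarith
  have him1 : v₁.im ≠ 0 := by intro h0; rw [h0] at hneg; simp at hneg
  have him2 : v₂.im ≠ 0 := by intro h0; rw [h0] at hpos; simp at hpos
  -- a segment between a non-real point and a positive real point avoids the cut
  refine (Relation.TransGen.single (hpath v₁ ((R / 2 : ℝ) : ℂ) (fun t ht => ?_) hv₁R hd0 ?_)).tail
    (hpath ((R / 2 : ℝ) : ℂ) v₂ (fun t ht => ?_) hd0 hv₂R ?_)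
  · rcases ht.2.lt_or_eq with ht1 | ht1
    · refine Or.inr ?_
      simp only [add_im, im_ofReal_mul, sub_im, ofReal_im]
      rw [show v₁.im + t * (0 - v₁.im) = (1 - t) * v₁.im by ring]
      exact mul_ne_zero (sub_ne_zero.2 ht1.ne') him1
    · rw [ht1, Complex.ofReal_one, one_mul, add_sub_cancel, ofReal_mem_slitPlane]
      positivity
  · rw [sub_im, ofReal_im]; linarith
  · rcases ht.1.eq_or_lt with ht1 | ht1
    · rw [← ht1, Complex.ofReal_zero, zero_mul, add_zero, ofReal_mem_slitPlane]
      positivity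
    · refine Or.inr ?_
      simp only [add_im, im_ofReal_mul, sub_im, ofReal_im]
      rw [zero_add, sub_zero]
      exact mul_ne_zero ht1.ne' him2
  · rw [sub_im, ofReal_im]; linarith

end IsSectorMap

/-! ### Connection at a simple turning point -/

theorem re_exp_three_halves (l : ℂ) : (exp (3 / 2 * l)).re
    = Real.exp (3 / 2 * l.re) * Real.cos (3 / 2 * l.im) := by
  rw [Complex.exp_re]
  congr 2
  · simp [mul_re]
  · simp [mul_im]

theorem im_exp_three_halves (l : ℂ) : (exp (3 / 2 * l)).im
    = Real.exp (3 / 2 * l.re) * Real.sin (3 / 2 * l.im) := by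
  rw [Complex.exp_im]
  congr 2
  · simp [mul_re]
  · simp [mul_im]

/-- The phase `X^{3/2}` has negative real part in the two sectors adjacent to the cut. -/
theorem exists_sector_of_re_neg {l : ℂ} (hl : |l.im| < π)
    (h : (exp (3 / 2 * l)).re < 0) :
    ∃ k : ℝ, (k = 1 ∨ k = -1) ∧ π / 3 < k * l.im ∧ k * l.im < π := by
  rw [re_exp_three_halves] at h
  have hc : Real.cos (3 / 2 * l.im) < 0 := by
    by_contra hc
    push Not at hc
    linarith [mul_nonneg (Real.exp_pos (3 / 2 * l.re)).le hc]
  rw [abs_lt] at hl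
  by_contra hk
  push Not at hk
  have h1 := hk 1 (Or.inl rfl)
  have h2 := hk (-1) (Or.inr rfl)
  have h3 : l.im ≤ π / 3 := by
    by_contra h4
    linarith [h1 (by linarith)]
  have h4 : -(π / 3) ≤ l.im := by
    by_contra h4
    linarith [h2 (by linarith)]
  linarith [Real.cos_nonneg_of_neg_pi_div_two_le_of_le (x := 3 / 2 * l.im) (by linarith)
    (by linarith)]

theorem abs_im_lt_of_re_pos {l : ℂ} (hl : |l.im| < π)
    (h : 0 < (exp (3 / 2 * l)).re) : |l.im| < π / 3 := by
  rw [re_exp_three_halves] at h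
  have hc : 0 < Real.cos (3 / 2 * l.im) := by
    by_contra hc
    push Not at hc
    linarith [mul_nonpos_of_nonneg_of_nonpos (Real.exp_pos (3 / 2 * l.re)).le hc]
  by_contra hk
  push Not at hk
  rw [← Real.cos_abs, abs_mul, abs_of_pos (by norm_num : (0 : ℝ) < 3 / 2)] at hc
  linarith [Real.cos_nonpos_of_pi_div_two_le_of_le (x := 3 / 2 * |l.im|) (by linarith)
    (by linarith)]

theorem exists_ray_of_re_eq_zero {l : ℂ} (hl : |l.im| < π)
    (h : (exp (3 / 2 * l)).re = 0) :
    ∃ k : ℝ, (k = 1 ∨ k = -1) ∧ k * l.im = π / 3 ∧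
      0 < k * (exp (3 / 2 * l)).im := by
  rw [re_exp_three_halves] at h
  have hc : Real.cos (3 / 2 * l.im) = 0 := (mul_eq_zero.1 h).resolve_left (Real.exp_pos _).ne'
  have habs : |l.im| = π / 3 := by
    rw [← Real.cos_abs, abs_mul, abs_of_pos (by norm_num : (0 : ℝ) < 3 / 2)] at hc
    rcases lt_trichotomy |l.im| (π / 3) with h1 | h1 | h1
    · linarith [Real.cos_pos_of_mem_Ioo (x := 3 / 2 * |l.im|)
        ⟨by linarith [abs_nonneg l.im, Real.pi_pos], by linarith⟩]
    · exact h1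
    · linarith [Real.cos_neg_of_pi_div_two_lt_of_lt (x := 3 / 2 * |l.im|) (by linarith)
        (by linarith)]
  rw [im_exp_three_halves]
  rcases abs_choice l.im with h1 | h1
  · refine ⟨1, Or.inl rfl, by linarith, ?_⟩
    rw [show 3 / 2 * l.im = π / 2 by linarith, Real.sin_pi_div_two]
    linarith [Real.exp_pos (3 / 2 * l.re)]
  · refine ⟨-1, Or.inr rfl, by linarith, ?_⟩
    rw [show 3 / 2 * l.im = -(π / 2) by linarith, Real.sin_neg, Real.sin_pi_div_two]
    linarith [Real.exp_pos (3 / 2 * l.re)]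

theorem exp_stokes_direction {k : ℝ} (hk : k = 1 ∨ k = -1) :
    exp (3 / 2 * (((k * (π / 3) : ℝ) : ℂ) * I)) = k * I := by
  have e : ∀ k : ℝ, 3 / 2 * (((k * (π / 3) : ℝ) : ℂ) * I)
      = ((k * (π / 2) : ℝ) : ℂ) * I := by
    intro k; push_cast; ring
  rw [e, Complex.exp_mul_I, ← Complex.ofReal_cos, ← Complex.ofReal_sin]
  rcases hk with rfl | rfl
  · simp
  · simp

theorem exp_cut_direction {o : ℝ} (ho : o = 1 ∨ o = -1) :
    exp (3 / 2 * (((-o * π : ℝ) : ℂ) * I)) = o * I := by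
  have e : ∀ k : ℝ, 3 / 2 * (((-k * π : ℝ) : ℂ) * I)
      = ((-k * (2 * π - π / 2) : ℝ) : ℂ) * I := by
    intro k; push_cast; ring
  rw [e, Complex.exp_mul_I, ← Complex.ofReal_cos, ← Complex.ofReal_sin]
  rcases ho with rfl | rfl
  · rw [neg_one_mul, Real.cos_neg, Real.sin_neg, Real.cos_two_pi_sub, Real.sin_two_pi_sub]; simp
  · simp

theorem log_neg_of_im {o : ℝ} (ho : o = 1 ∨ o = -1) {w : ℂ} (h : o * w.im < 0) :
    log (-w) = log w + o * π * I := by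
  rcases ho with rfl | rfl
  · have : arg (-w) = arg w + π :=
      Complex.arg_neg_eq_arg_add_pi_of_im_neg (by linarith)
    rw [log, log, norm_neg, this]
    push_cast
    ring
  · have : arg (-w) = arg w - π :=
      Complex.arg_neg_eq_arg_sub_pi_of_im_pos (by linarith)
    rw [log, log, norm_neg, this]
    push_cast
    ring

section Local

variable {D : Set ℂ} {f X : ℂ → ℂ} {lam t c f₀ : ℂ} {r ρ C : ℝ}

theorem abs_log_im_lt {w : ℂ} (h : w ∈ slitPlane) : |(log w).im| < π := by
  rw [log_im, abs_lt]
  exact ⟨Complex.neg_pi_lt_arg w,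
    lt_of_le_of_ne (Complex.arg_le_pi w) (mem_slitPlane_iff_arg.1 h).1⟩

theorem slitDisc.log_re_lt (hρ : 0 < ρ) {x : ℂ} (hx : x ∈ slitDisc c r ρ X) :
    (log (X x)).re < Real.log ρ := by
  have := hx.2.1
  rw [← exp_log (slitPlane_ne_zero hx.2.2)] at this
  exact (norm_exp_lt_iff hρ).1 this

/-- The two sectors centred at the Stokes lines of a turning point that differ from the cut. -/
theorem IsChart.exists_isSectorMap (hX : IsChart A S Om lam t c r ρ C X) (hρ : 0 < ρ)
    (hsub : slitDisc c r ρ X ⊆ D) {ς : ℝ}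
    (hf : ∀ x ∈ slitDisc c r ρ X, f x = f₀ + ς * exp (3 / 2 * log (X x))) :
    ∃ g : ℂ → ℂ, (∀ k : ℝ, (k = 1 ∨ k = -1) →
      IsSectorMap D f g (Real.log ρ) (k * (π / 3)) k ς f₀) ∧
      ∀ x ∈ slitDisc c r ρ X, g (log (X x)) = x := by
  obtain ⟨χ, hχc, hχ, hχX⟩ := hX.exists_inv
  refine ⟨fun l => χ (exp l), fun k hk => ⟨exp_stokes_direction hk,
    hχc.comp Complex.continuous_exp.continuousOn fun l hl => (norm_exp_lt_iff hρ).2 hl,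
    fun l hl hl' => ?_⟩, fun x hx => ?_⟩
  · have h1 := (norm_exp_lt_iff hρ).2 hl
    have him : |l.im| < π := by
      rw [abs_lt] at hl' ⊢
      rcases hk with rfl | rfl <;> constructor <;> linarith
    rw [abs_lt] at him
    have hlog := log_exp him.1 him.2.le
    have hmem : χ (exp l) ∈ slitDisc c r ρ X := by
      refine ⟨(hχ _ h1).1, by rw [(hχ _ h1).2]; exact h1, ?_⟩
      rw [(hχ _ h1).2, mem_slitPlane_iff_arg, ← log_im, hlog]
      exact ⟨him.2.ne, exp_ne_zero _⟩
    refine ⟨hsub hmem, ?_⟩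
    rw [hf _ hmem, (hχ _ h1).2, hlog]
  · simp only
    rw [exp_log (slitPlane_ne_zero hx.2.2)]
    exact hχX x hx.1 hx.2.1

theorem stokesRegion_eq {l : ℝ} {x y : ℂ} (h : y ∈ stokesRegion D f l x) :
    stokesRegion D f l x = stokesRegion D f l y :=
  connectedComponentIn_eq h

/-- The sign of `Re f - ℓ` is constant on a Stokes region. -/
theorem re_lt_of_mem_stokesRegion (hf : ContinuousOn f D) {l : ℝ} {x y : ℂ} (hx : x ∈ D)
    (hxl : (f x).re < l) (h : y ∈ stokesRegion D f l x) : y ∈ D ∧ (f y).re < l := by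
  have hsub := connectedComponentIn_subset {y ∈ D | (f y).re ≠ l} x
  have hy := hsub h
  refine ⟨hy.1, lt_of_not_ge fun hge => ?_⟩
  have hpre : IsPreconnected (stokesRegion D f l x) := isPreconnected_connectedComponentIn
  have hc : ContinuousOn (fun y => (f y).re) (stokesRegion D f l x) :=
    continuous_re.comp_continuousOn (hf.mono fun z hz => (hsub hz).1)
  obtain ⟨z, hz, hzl⟩ := hpre.intermediate_value
    (mem_connectedComponentIn (show x ∈ {y ∈ D | (f y).re ≠ l} from ⟨hx, hxl.ne⟩)) h hc
    ⟨hxl.le, hge⟩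
  exact (hsub hz).2 hzl

/-- The position of two points `x`, `y` near a turning point that lie below the level of the
turning point, in different Stokes regions: they lie in the two sectors adjacent to the cut. The
sign `o` is the orientation in which the cut is crossed on the way from `x` to `y`; it can be read
off from the phase on the Stokes lines adjacent to their regions. -/
theorem IsChart.exists_orientation (hX : IsChart A S Om lam t c r ρ C X) (hρ : 0 < ρ)
    (hsub : slitDisc c r ρ X ⊆ D) (hfc : ContinuousOn f D) {ς : ℝ} (hς : ς = 1 ∨ ς = -1)
    (hf : ∀ x ∈ slitDisc c r ρ X, f x = f₀ + ς * exp (3 / 2 * log (X x)))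
    {x y : ℂ} (hx : x ∈ slitDisc c r ρ X) (hy : y ∈ slitDisc c r ρ X) (hxl : (f x).re < f₀.re)
    (hyl : (f y).re < f₀.re) (hxy : y ∉ stokesRegion D f f₀.re x) :
    ς = 1 ∧ ∃ o : ℝ, (o = 1 ∨ o = -1) ∧
      π / 3 < -o * (log (X x)).im ∧ -o * (log (X x)).im < π ∧
      π / 3 < o * (log (X y)).im ∧ o * (log (X y)).im < π ∧
      (∀ p ∈ slitDisc c r ρ X, f₀.re < (f p).re → Inc D f x p ∧ Inc D f y p) ∧
      ∀ p ∈ slitDisc c r ρ X, (f p).re = f₀.re →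
        (p ∈ closure (stokesRegion D f f₀.re y) → 0 < o * (f p - f₀).im) ∧
        (p ∈ closure (stokesRegion D f f₀.re x) → o * (f p - f₀).im < 0) := by
  obtain ⟨g, hg, hgX⟩ := hX.exists_isSectorMap hρ hsub hf
  have hre : ∀ p ∈ slitDisc c r ρ X, (f p).re
      = f₀.re + ς * (exp (3 / 2 * log (X p))).re := by
    intro p hp
    rw [hf p hp, add_re, re_ofReal_mul]
  -- points in the same half of one of the two sectors belong to the same region
  have hsame : ∀ p ∈ slitDisc c r ρ X, ∀ q ∈ slitDisc c r ρ X, ∀ k : ℝ, (k = 1 ∨ k = -1) →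
      ∀ δ : ℝ, (δ = 1 ∨ δ = -1) →
      δ * ((log (X p)).im - k * (π / 3)) ∈ Ioo 0 (2 * π / 3) →
      δ * ((log (X q)).im - k * (π / 3)) ∈ Ioo 0 (2 * π / 3) →
      q ∈ stokesRegion D f f₀.re p := by
    intro p hp q hq k hk δ hδ h1 h2
    have := (hg k hk).mem_stokesRegion hk hς hδ (slitDisc.log_re_lt hρ hp)
      (slitDisc.log_re_lt hρ hq) h1 h2
    rwa [hgX p hp, hgX q hq] at this
  have hς1 : ς = 1 := by
    refine hς.resolve_right fun hς1 => hxy ?_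
    have key : ∀ p ∈ slitDisc c r ρ X, (f p).re < f₀.re →
        (-1 : ℝ) * ((log (X p)).im - 1 * (π / 3)) ∈ Ioo 0 (2 * π / 3) := by
      intro p hp hpl
      rw [hre p hp, hς1] at hpl
      have := abs_im_lt_of_re_pos (abs_log_im_lt hp.2.2) (by linarith)
      rw [abs_lt] at this
      constructor <;> linarith
    exact hsame x hx y hy 1 (Or.inl rfl) (-1) (Or.inr rfl) (key x hx hxl) (key y hy hyl)
  subst hς1
  simp only [one_mul] at hre
  have hsec : ∀ p ∈ slitDisc c r ρ X, (f p).re < f₀.re → ∃ k : ℝ, (k = 1 ∨ k = -1) ∧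
      π / 3 < k * (log (X p)).im ∧ k * (log (X p)).im < π := by
    intro p hp hpl
    rw [hre p hp] at hpl
    exact exists_sector_of_re_neg (abs_log_im_lt hp.2.2) (by linarith)
  have hsame' : ∀ p ∈ slitDisc c r ρ X, ∀ q ∈ slitDisc c r ρ X, ∀ k : ℝ, (k = 1 ∨ k = -1) →
      π / 3 < k * (log (X p)).im → k * (log (X p)).im < π →
      π / 3 < k * (log (X q)).im → k * (log (X q)).im < π →
      q ∈ stokesRegion D f f₀.re p := by
    intro p hp q hq k hk h1 h2 h3 h4
    refine hsame p hp q hq k hk k hk ?_ ?_ <;> rcases hk with rfl | rfl <;> constructor <;> linarith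
  obtain ⟨kx, hkx, hx1, hx2⟩ := hsec x hx hxl
  obtain ⟨o, ho, hy1, hy2⟩ := hsec y hy hyl
  have hkxo : kx = -o := by
    rcases hkx with rfl | rfl <;> rcases ho with rfl | rfl
    · exact absurd (hsame' x hx y hy 1 (Or.inl rfl) hx1 hx2 hy1 hy2) hxy
    · norm_num
    · rfl
    · exact absurd (hsame' x hx y hy (-1) (Or.inr rfl) hx1 hx2 hy1 hy2) hxy
  have ho' : -o = 1 ∨ -o = -1 := by rcases ho with rfl | rfl <;> norm_num
  subst hkxo
  have hinc : ∀ p ∈ slitDisc c r ρ X, (f p).re < f₀.re → ∀ k : ℝ, (k = 1 ∨ k = -1) →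
      π / 3 < k * (log (X p)).im → k * (log (X p)).im < π →
      ∀ q ∈ slitDisc c r ρ X, f₀.re < (f q).re → Inc D f p q := by
    intro p hp hpl k hk h1 h2 q hq hql
    rw [hre p hp] at hpl
    rw [hre q hq] at hql
    have h3 := abs_im_lt_of_re_pos (abs_log_im_lt hq.2.2) (by linarith)
    rw [abs_lt] at h3
    have := (hg k hk).inc (slitDisc.log_re_lt hρ hp) (slitDisc.log_re_lt hρ hq)
      (by rcases hk with rfl | rfl <;> rw [abs_lt] <;> constructor <;> linarith)
      (by rcases hk with rfl | rfl <;> rw [abs_lt] <;> constructor <;> linarith)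
      (by linarith) (by linarith)
    rwa [hgX p hp, hgX q hq] at this
  refine ⟨rfl, o, ho, hx1, hx2, hy1, hy2, fun p hp hpl => ⟨hinc x hx hxl _ ho' hx1 hx2 p hp hpl,
    hinc y hy hyl o ho hy1 hy2 p hp hpl⟩, fun p hp hpl => ?_⟩
  rw [hre p hp, add_eq_left] at hpl
  obtain ⟨k, hk, hkp, hkpos⟩ := exists_ray_of_re_eq_zero (abs_log_im_lt hp.2.2) hpl
  have him : (f p - f₀).im = (exp (3 / 2 * log (X p))).im := by
    rw [hf p hp, Complex.ofReal_one, one_mul, add_sub_cancel_left]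
  -- a region that is adjacent to the Stokes line through `p` contains the sector next to it
  have hadj : ∀ q ∈ slitDisc c r ρ X, (f q).re < f₀.re →
      p ∈ closure (stokesRegion D f f₀.re q) → ∃ q' ∈ slitDisc c r ρ X,
        q' ∈ stokesRegion D f f₀.re q ∧ π / 3 < k * (log (X q')).im ∧
        k * (log (X q')).im < π := by
    intro q hq hql hcl
    have h1 : ∀ᶠ q' in 𝓝 p, q' ∈ slitDisc c r ρ X := hX.isOpen_slitDisc.mem_nhds hp
    have h2 : ∀ᶠ q' in 𝓝 p, 0 < k * (log (X q')).im := by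
      have h3 : ContinuousAt (fun q' => (log (X q')).im) p :=
        continuous_im.continuousAt.comp ((hX.diff p hp.1).continuousAt.clog hp.2.2)
      refine (continuousAt_const.mul h3).eventually_const_lt ?_
      change 0 < k * (log (X p)).im
      rw [hkp]
      positivity
    obtain ⟨q', hq'⟩ := ((mem_closure_iff_frequently.1 hcl).and_eventually (h1.and h2)).exists
    obtain ⟨hq'r, hq's, hq'pos⟩ := hq'
    obtain ⟨-, hq'l⟩ := re_lt_of_mem_stokesRegion hfc (hsub hq) hql hq'r
    obtain ⟨k', hk', h3, h4⟩ := hsec q' hq's hq'l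
    have hkk : k' = k := by
      rcases hk with rfl | rfl <;> rcases hk' with rfl | rfl <;>
        first | rfl | (exfalso; linarith [Real.pi_pos])
    subst hkk
    exact ⟨q', hq's, hq'r, h3, h4⟩
  rw [him]
  constructor
  · intro hcl
    obtain ⟨q', hq', hq'r, h1, h2⟩ := hadj y hy hyl hcl
    by_cases hko : k = o
    · rw [← hko]; exact hkpos
    · have hk' : k = -o := by
        rcases hk with rfl | rfl <;> rcases ho with rfl | rfl <;>
          first | rfl | exact absurd rfl hko | norm_num
      rw [hk'] at h1 h2
      have h3 := hsame' q' hq' x hx (-o) ho' h1 h2 hx1 hx2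
      rw [← stokesRegion_eq hq'r] at h3
      refine absurd ?_ hxy
      rw [← stokesRegion_eq h3]
      exact mem_connectedComponentIn ⟨hsub hy, hyl.ne⟩
  · intro hcl
    obtain ⟨q', hq', hq'r, h1, h2⟩ := hadj x hx hxl hcl
    by_cases hko : k = o
    · rw [hko] at h1 h2
      have h3 := hsame' q' hq' y hy o ho h1 h2 hy1 hy2
      rw [← stokesRegion_eq hq'r] at h3
      exact absurd h3 hxy
    · have hk' : k = -o := by
        rcases hk with rfl | rfl <;> rcases ho with rfl | rfl <;>
          first | rfl | exact absurd rfl hko | norm_num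
      rw [hk'] at hkpos
      linarith

end Local

section Connection

variable {τ : ℂ → ℂ} {D : ℂ → Set ℂ} {r ρ C : ℝ} {X : ℂ → ℂ → ℂ} {σ : ℂ}

/-- The amplitudes `θ`, depending on the spectral parameter, provide branches
`(exp (3 L / 2), exp (σ L / 4) θ)` for every branch `L` of `log X`. -/
def IsAmplitude (A S : ℂ → ℂ) (Om : Set ℂ) (lam₀ c : ℂ) (r : ℝ) (X : ℂ → ℂ → ℂ) (σ : ℂ)
    (θ : ℂ → ℂ → ℂ) : Prop :=
  ∀ᶠ lam in 𝓝 lam₀, ∀ (L : ℂ → ℂ), ∀ x ∈ ball c r,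
    HasDerivAt L (deriv (fun y => X y lam) x / X x lam) x → exp (L x) = X x lam →
      IsBranchAt A S Om lam (fun y => exp (3 / 2 * L y))
        (fun y => exp (σ / 4 * L y) * θ y lam) x

/-- The amplitudes are chosen separately for each `lam`; continuity in `lam` is not needed. -/
theorem IsSlitChart.exists_isAmplitude (hAS : IsPotentialPair A S Om)
    (hX : IsSlitChart A S Om lam₀ τ D r ρ C X)
    (hσ : (σ = 1 ∧ ∀ᶠ lam in 𝓝 lam₀, ∀ x ∈ ball (τ lam₀) r, gPlus A S x lam ≠ 0) ∨
      (σ = -1 ∧ ∀ᶠ lam in 𝓝 lam₀, ∀ x ∈ ball (τ lam₀) r, gMinus A S x lam ≠ 0)) :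
    ∃ θ : ℂ → ℂ → ℂ, IsAmplitude A S Om lam₀ (τ lam₀) r X σ θ := by
  have h : ∀ᶠ lam in 𝓝 lam₀, ∃ θ : ℂ → ℂ, ∀ (L : ℂ → ℂ), ∀ x ∈ ball (τ lam₀) r,
      HasDerivAt L (deriv (fun y => X y lam) x / X x lam) x → exp (L x) = X x lam →
      IsBranchAt A S Om lam (fun y => exp (3 / 2 * L y))
        (fun y => exp (σ / 4 * L y) * θ y) x := by
    rcases hσ with ⟨rfl, h⟩ | ⟨rfl, h⟩
    · filter_upwards [hX.chart, h] with lam h1 h2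
      exact h1.exists_amplitude hAS (Or.inl ⟨rfl, h2⟩)
    · filter_upwards [hX.chart, h] with lam h1 h2
      exact h1.exists_amplitude hAS (Or.inr ⟨rfl, h2⟩)
  have h' : ∀ lam, ∃ θ : ℂ → ℂ, (∃ θ : ℂ → ℂ, ∀ (L : ℂ → ℂ), ∀ x ∈ ball (τ lam₀) r,
      HasDerivAt L (deriv (fun y => X y lam) x / X x lam) x → exp (L x) = X x lam →
      IsBranchAt A S Om lam (fun y => exp (3 / 2 * L y))
        (fun y => exp (σ / 4 * L y) * θ y) x) → ∀ (L : ℂ → ℂ), ∀ x ∈ ball (τ lam₀) r,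
      HasDerivAt L (deriv (fun y => X y lam) x / X x lam) x → exp (L x) = X x lam →
      IsBranchAt A S Om lam (fun y => exp (3 / 2 * L y))
        (fun y => exp (σ / 4 * L y) * θ y) x := by
    intro lam
    by_cases hl : ∃ θ : ℂ → ℂ, ∀ (L : ℂ → ℂ), ∀ x ∈ ball (τ lam₀) r,
      HasDerivAt L (deriv (fun y => X y lam) x / X x lam) x → exp (L x) = X x lam →
      IsBranchAt A S Om lam (fun y => exp (3 / 2 * L y))
        (fun y => exp (σ / 4 * L y) * θ y) x
    · obtain ⟨θ, hθ⟩ := hl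
      exact ⟨θ, fun _ => hθ⟩
    · exact ⟨0, fun h => absurd h hl⟩
  choose θ hθ using h'
  exact ⟨fun x lam => θ lam x, h.mono fun lam hl => hθ lam hl⟩

theorem IsSlitChart.ne_of_ne_zero (hX : IsSlitChart A S Om lam₀ τ D r ρ C X) {x : ℂ}
    (h : X x lam₀ ≠ 0) : x ≠ τ lam₀ := by
  rintro rfl
  exact h hX.chart.self_of_nhds.zero

/-- Branches of the phase and the amplitude near the turning point that are continuous across the
cut: the cut of the logarithm is moved to the opposite direction. -/
noncomputable def crossFamily (hX : IsSlitChart A S Om lam₀ τ D r ρ C X) {θ : ℂ → ℂ → ℂ}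
    (hθ : IsAmplitude A S Om lam₀ (τ lam₀) r X σ θ) {o : ℝ} (ho : o = 1 ∨ o = -1) :
    BranchFamily A S Om lam₀ where
  D lam := slitDisc (τ lam₀) r ρ (fun x => -X x lam)
  Z x lam := exp (3 / 2 * (log (-X x lam) - o * π * I))
  H x lam := exp (σ / 4 * (log (-X x lam) - o * π * I)) * θ x lam
  mem_nhds x hx := by
    have hc := (hX.cont x hx.1 (hX.ne_of_ne_zero
      (neg_ne_zero.1 (slitPlane_ne_zero hx.2.2)))).neg
    exact (continuousAt_fst.eventually_mem (isOpen_ball.mem_nhds hx.1)).and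
      ((hc.eventually_mem (isOpen_ball.mem_nhds hx.2.1)).and
        (hc.eventually_mem (isOpen_slitPlane.mem_nhds hx.2.2)))
  cont x hx := by
    have hc := (hX.cont x hx.1 (hX.ne_of_ne_zero
      (neg_ne_zero.1 (slitPlane_ne_zero hx.2.2)))).neg
    exact (continuousAt_const.mul ((hc.clog hx.2.2).sub continuousAt_const)).cexp
  isOpen := by
    filter_upwards [hX.chart] with lam hl
    have hc : ContinuousOn (fun x => -X x lam) (ball (τ lam₀) r) := fun x hx =>
      (hl.diff x hx).continuousAt.neg.continuousWithinAt
    exact hc.isOpen_inter_preimage isOpen_ball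
      (isOpen_ball.inter isOpen_slitPlane)
  good := by
    filter_upwards [hX.chart, hθ] with lam hl hlθ x hx
    refine hlθ (fun y => log (-X y lam) - o * π * I) x hx.1 ?_ ?_
    · refine (((hl.diff x hx.1).hasDerivAt.neg.clog hx.2.2).sub_const _).congr_deriv ?_
      simp only [Pi.neg_apply]
      rw [neg_div_neg_eq]
    · have : exp (o * π * I) = -1 := by
        rcases ho with rfl | rfl
        · simp
        · simp [exp_neg, Complex.exp_pi_mul_I]
      rw [exp_sub, this, exp_log (slitPlane_ne_zero hx.2.2)]
      ring

theorem eventually_mem_slitDisc (hX : IsSlitChart A S Om lam₀ τ D r ρ C X) {x : ℂ}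
    (hx : x ∈ slitDisc (τ lam₀) r ρ (fun x => X x lam₀)) :
    ContinuousAt (fun lam => X x lam) lam₀ ∧
      ∀ᶠ lam in 𝓝 lam₀, x ∈ slitDisc (τ lam₀) r ρ (fun x => X x lam) := by
  have hc : ContinuousAt (fun lam => X x lam) lam₀ :=
    ContinuousAt.comp (g := fun p : ℂ × ℂ => X p.1 p.2) (f := fun lam => (x, lam))
      (hX.cont x hx.1 (hX.ne_of_ne_zero (slitPlane_ne_zero hx.2.2)))
      (continuous_const.prodMk continuous_id).continuousAt
  exact ⟨hc, (Eventually.of_forall fun _ => hx.1).and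
    ((hc.eventually_mem (isOpen_ball.mem_nhds hx.2.1)).and
      (hc.eventually_mem (isOpen_slitPlane.mem_nhds hx.2.2)))⟩

namespace BranchFamily

variable {B : BranchFamily A S Om lam₀} {θ : ℂ → ℂ → ℂ} {Zτ : ℂ → ℂ}

theorem eventually_phase_eq (hX : IsSlitChart A S Om lam₀ τ B.D r ρ C X)
    (hθ : IsAmplitude A S Om lam₀ (τ lam₀) r X σ θ)
    (hZ : ∀ᶠ lam in 𝓝 lam₀, Tendsto (fun y => B.Z y lam) (𝓝[B.D lam] τ lam) (𝓝 (Zτ lam))) :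
    ∀ᶠ lam in 𝓝 lam₀, ∃ ς : ℂ, (ς = 1 ∨ ς = -1) ∧
      ∀ x ∈ slitDisc (τ lam₀) r ρ (fun x => X x lam),
        B.H x lam ^ 2 = ς * (exp (σ / 4 * log (X x lam)) * θ x lam) ^ 2 ∧
          B.Z x lam = Zτ lam + ς * exp (3 / 2 * log (X x lam)) := by
  filter_upwards [hX.chart, hX.mem, hθ, hZ, B.good] with lam h1 h2 h3 h4 h5
  have hsub : slitDisc (τ lam₀) r ρ (fun x => X x lam) ⊆ B.D lam := fun x hx =>
    h2 x hx.1 hx.2.1 hx.2.2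
  exact h1.exists_phase_eq hX.ρ_pos (z₀ := fun y => exp (3 / 2 * log (X y lam)))
    (H₀ := fun y => exp (σ / 4 * log (X y lam)) * θ y lam) (fun _ => rfl)
    (fun x hx => h3 (fun y => log (X y lam)) x hx.1
      ((h1.diff x hx.1).hasDerivAt.clog hx.2.2)
      (exp_log (slitPlane_ne_zero hx.2.2)))
    (fun x hx => h5 x (hsub hx)) (h4.mono_left (nhdsWithin_mono _ hsub))

/-- If the phase equals `+ X^{3/2}` for `lam₀`, then the same is true for `lam` near `lam₀`. -/
theorem eventually_phase_eq_one (hX : IsSlitChart A S Om lam₀ τ B.D r ρ C X)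
    (hθ : IsAmplitude A S Om lam₀ (τ lam₀) r X σ θ)
    (hZ : ∀ᶠ lam in 𝓝 lam₀, Tendsto (fun y => B.Z y lam) (𝓝[B.D lam] τ lam) (𝓝 (Zτ lam)))
    {p : ℂ} (hp : p ∈ slitDisc (τ lam₀) r ρ (fun x => X x lam₀))
    (h₀ : ∀ x ∈ slitDisc (τ lam₀) r ρ (fun x => X x lam₀),
      B.Z x lam₀ = Zτ lam₀ + exp (3 / 2 * log (X x lam₀))) :
    ∀ᶠ lam in 𝓝 lam₀, ∃ sg : ℂ, (sg = 1 ∨ sg = -1) ∧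
      ∀ x ∈ slitDisc (τ lam₀) r ρ (fun x => X x lam),
        B.H x lam = sg * (exp (σ / 4 * log (X x lam)) * θ x lam) ∧
          B.Z x lam = Zτ lam + exp (3 / 2 * log (X x lam)) := by
  have hbr : ∀ lam, (∀ (L : ℂ → ℂ), ∀ x ∈ ball (τ lam₀) r,
      HasDerivAt L (deriv (fun y => X y lam) x / X x lam) x → exp (L x) = X x lam →
      IsBranchAt A S Om lam (fun y => exp (3 / 2 * L y))
        (fun y => exp (σ / 4 * L y) * θ y lam) x) →
      IsChart A S Om lam (τ lam) (τ lam₀) r ρ C (fun x => X x lam) →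
      ∀ x ∈ slitDisc (τ lam₀) r ρ (fun x => X x lam), IsBranchAt A S Om lam
        (fun y => exp (3 / 2 * log (X y lam)))
        (fun y => exp (σ / 4 * log (X y lam)) * θ y lam) x :=
    fun lam h3 h1 x hx => h3 (fun y => log (X y lam)) x hx.1
      ((h1.diff x hx.1).hasDerivAt.clog hx.2.2)
      (exp_log (slitPlane_ne_zero hx.2.2))
  -- a second point, at which the phase has a different value
  obtain ⟨q, hq, hpq⟩ : ∃ q ∈ slitDisc (τ lam₀) r ρ (fun x => X x lam₀),
      exp (3 / 2 * log (X q lam₀))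
        ≠ exp (3 / 2 * log (X p lam₀)) := by
    have hb := hbr lam₀ (Eventually.self_of_nhds hθ) hX.chart.self_of_nhds p hp
    have h1 := hb.hasDerivAt.eventually_ne hb.deriv_ne
      (c := exp (3 / 2 * log (X p lam₀)))
    have h2 : ∀ᶠ q in 𝓝[≠] p, q ∈ slitDisc (τ lam₀) r ρ (fun x => X x lam₀) :=
      nhdsWithin_le_nhds (hX.chart.self_of_nhds.isOpen_slitDisc.mem_nhds hp)
    obtain ⟨q, hq⟩ := (h2.and h1).exists
    exact ⟨q, hq⟩
  have hcont : ∀ x ∈ slitDisc (τ lam₀) r ρ (fun x => X x lam₀), ContinuousAt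
      (fun lam => B.Z x lam + exp (3 / 2 * log (X x lam))) lam₀ := by
    intro x hx
    have h1 : ContinuousAt (fun lam => B.Z x lam) lam₀ :=
      ContinuousAt.comp (g := fun p : ℂ × ℂ => B.Z p.1 p.2) (f := fun lam => (x, lam))
        (B.cont x (hX.mem.self_of_nhds x hx.1 hx.2.1 hx.2.2))
        (continuous_const.prodMk continuous_id).continuousAt
    exact h1.add (continuousAt_const.mul ((eventually_mem_slitDisc hX hx).1.clog hx.2.2)).cexp
  have hne : ∀ᶠ lam in 𝓝 lam₀, (B.Z q lam + exp (3 / 2 * log (X q lam)))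
      - (B.Z p lam + exp (3 / 2 * log (X p lam))) ≠ 0 := by
    refine ((hcont q hq).sub (hcont p hp)).eventually_ne ?_
    change (B.Z q lam₀ + exp (3 / 2 * log (X q lam₀)))
      - (B.Z p lam₀ + exp (3 / 2 * log (X p lam₀))) ≠ 0
    rw [h₀ q hq, h₀ p hp]
    intro h
    apply hpq
    linear_combination h / 2
  filter_upwards [eventually_phase_eq hX hθ hZ, hne, (eventually_mem_slitDisc hX hq).2,
    (eventually_mem_slitDisc hX hp).2, hX.chart, hθ, hX.mem, B.good]
    with lam ⟨ς, hς, hlam⟩ h2 h3 h4 h5 h6 h7 h8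
  have hς1 : ς = 1 := by
    refine hς.resolve_right fun h => h2 ?_
    rw [(hlam q h3).2, (hlam p h4).2, h]
    ring
  rw [hς1] at hlam
  obtain ⟨sg, hsg, hH⟩ := exists_sign_of_sq_eq (h5.isPreconnected_slitDisc hX.ρ_pos)
    (H := fun x => B.H x lam)
    (H₁ := fun x => exp (σ / 4 * log (X x lam)) * θ x lam)
    (fun x hx => (h8 x (h7 x hx.1 hx.2.1 hx.2.2)).diff.continuousAt.continuousWithinAt)
    (fun x hx => (hbr lam h6 h5 x hx).diff.continuousAt.continuousWithinAt)
    (fun x hx => (hbr lam h6 h5 x hx).ne)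
    (fun x hx => by have := (hlam x hx).1; rwa [one_mul] at this)
  exact ⟨sg, hsg, fun x hx => ⟨hH x hx, by have := (hlam x hx).2; rwa [one_mul] at this⟩⟩

theorem im_sign_of_log {k : ℝ} (hk : k = 1 ∨ k = -1) {w : ℂ} (h0 : 0 < k * (log w).im)
    (h1 : k * (log w).im < π) : 0 < k * w.im := by
  have hw : w ≠ 0 := by rintro rfl; simp at h0
  rw [log_im] at h0 h1
  have e : w.im = ‖w‖ * Real.sin (arg w) := (Complex.norm_mul_sin_arg w).symm
  have hn := norm_pos_iff.2 hw
  rw [e]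
  rcases hk with rfl | rfl
  · rw [one_mul] at *
    exact mul_pos hn (Real.sin_pos_of_pos_of_lt_pi h0 h1)
  · have := Real.sin_neg_of_neg_of_neg_pi_lt (x := arg w) (by linarith) (by linarith)
    nlinarith

/-- Continuation across the cut, from the sector on one side of it to the sector on the other side:
the sign of the phase is reversed and the amplitude is multiplied by `∓ i`. -/
theorem reach_cross (hAS : IsPotentialPair A S Om) (hX : IsSlitChart A S Om lam₀ τ B.D r ρ C X)
    (hθ : IsAmplitude A S Om lam₀ (τ lam₀) r X σ θ) (hσ : σ = 1 ∨ σ = -1)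
    (hZ : ∀ᶠ lam in 𝓝 lam₀, Tendsto (fun y => B.Z y lam) (𝓝[B.D lam] τ lam) (𝓝 (Zτ lam)))
    (h₀ : ∀ x ∈ slitDisc (τ lam₀) r ρ (fun x => X x lam₀),
      B.Z x lam₀ = Zτ lam₀ + exp (3 / 2 * log (X x lam₀)))
    {x y : ℂ} (hx : x ∈ slitDisc (τ lam₀) r ρ (fun x => X x lam₀))
    (hy : y ∈ slitDisc (τ lam₀) r ρ (fun x => X x lam₀)) {o : ℝ} (ho : o = 1 ∨ o = -1)
    (hx1 : π / 3 < -o * (log (X x lam₀)).im)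
    (hx2 : -o * (log (X x lam₀)).im < π)
    (hy1 : π / 3 < o * (log (X y lam₀)).im)
    (hy2 : o * (log (X y lam₀)).im < π)
    (hxl : (exp (3 / 2 * log (X x lam₀))).re < 0)
    (hyl : (exp (3 / 2 * log (X y lam₀))).re < 0) :
    Reach A S Om lam₀ (B.st x) (fun lam =>
      ⟨y, 2 * Zτ lam - B.Z y lam, -(o * σ * I) * B.H y lam⟩) := by
  have ho' : -o = 1 ∨ -o = -1 := by rcases ho with rfl | rfl <;> norm_num
  have hpi := Real.pi_pos
  have hX0 := hX.chart.self_of_nhds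
  have hinc : Inc ((crossFamily hX hθ ho).D lam₀) (fun y => (crossFamily hX hθ ho).Z y lam₀) x y := by
    obtain ⟨χ, hχc, hχ, hχX⟩ := hX0.exists_inv
    have hsec : IsSectorMap ((crossFamily hX hθ ho).D lam₀)
        (fun y => (crossFamily hX hθ ho).Z y lam₀) (fun l => χ (exp l)) (Real.log ρ)
        (-o * π) o 1 0 := by
      refine ⟨exp_cut_direction ho, hχc.comp Complex.continuous_exp.continuousOn fun l hl =>
        (norm_exp_lt_iff hX.ρ_pos).2 hl, fun l hl hl' => ?_⟩
      have h1 := (norm_exp_lt_iff hX.ρ_pos).2 hl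
      have hXl := (hχ _ h1).2
      rw [abs_lt] at hl'
      have heo : exp (o * π * I) = -1 := by
        rcases ho with rfl | rfl
        · simp
        · simp [exp_neg, Complex.exp_pi_mul_I]
      have hneg : -exp l = exp (l + o * π * I) := by
        rw [exp_add, heo]; ring
      have him : (l + o * π * I).im = l.im + o * π := by simp
      have hlog : log (-exp l) = l + o * π * I := by
        rw [hneg]
        exact log_exp (by rw [him]; linarith) (by rw [him]; linarith)
      refine ⟨⟨(hχ _ h1).1, ?_, ?_⟩, ?_⟩
      · change -X (χ (exp l)) lam₀ ∈ ball 0 ρ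
        rw [hXl, mem_ball_zero_iff, norm_neg]
        exact mem_ball_zero_iff.1 h1
      · change -X (χ (exp l)) lam₀ ∈ slitPlane
        rw [hXl, mem_slitPlane_iff_arg, ← log_im, hlog, him]
        exact ⟨by linarith, neg_ne_zero.2 (exp_ne_zero _)⟩
      · simp only [crossFamily, hXl, hlog]
        rw [add_sub_cancel_right, Complex.ofReal_one, one_mul, zero_add]
    have hgx : χ (exp (log (X x lam₀))) = x := by
      rw [exp_log (slitPlane_ne_zero hx.2.2)]
      exact hχX x hx.1 hx.2.1
    have hexpy : exp (log (X y lam₀) - 2 * (o * π) * I) = X y lam₀ := by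
      have : exp (2 * (o * π) * I) = 1 := by
        rcases ho with rfl | rfl
        · simp
        · have h2 := Complex.exp_two_pi_mul_I
          simp [exp_neg, h2]
      rw [exp_sub, this, div_one, exp_log (slitPlane_ne_zero hy.2.2)]
    have hgy : χ (exp (log (X y lam₀) - 2 * (o * π) * I)) = y := by
      rw [hexpy]
      exact hχX y hy.1 hy.2.1
    have hyre : (log (X y lam₀) - 2 * (o * π) * I).re
        = (log (X y lam₀)).re := by simp
    have hyim : (log (X y lam₀) - 2 * (o * π) * I).im
        = (log (X y lam₀)).im - 2 * (o * π) := by simp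
    have := hsec.inc (l₁ := log (X x lam₀))
      (l₂ := log (X y lam₀) - 2 * (o * π) * I)
      (slitDisc.log_re_lt (X := fun x => X x lam₀) hX.ρ_pos hx)
      (by rw [hyre]; exact slitDisc.log_re_lt (X := fun x => X x lam₀) hX.ρ_pos hy)
      (by rcases ho with rfl | rfl <;> rw [abs_lt] <;> constructor <;> linarith)
      (by rw [hyim]; rcases ho with rfl | rfl <;> rw [abs_lt] <;> constructor <;> linarith)
      hxl (by
        have e : exp (3 / 2 * (log (X y lam₀) - 2 * (o * π) * I))
            = -exp (3 / 2 * log (X y lam₀)) := by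
          rw [show 3 / 2 * (log (X y lam₀) - 2 * (o * π) * I)
            = 3 / 2 * log (X y lam₀) - 2 * (o * π) * I
              - o * π * I by ring, exp_sub, exp_sub]
          rcases ho with rfl | rfl
          · have h2 := Complex.exp_two_pi_mul_I
            simp [h2]
            ring
          · have h2 := Complex.exp_two_pi_mul_I
            simp [exp_neg, h2]
            ring
        rw [e, neg_re]
        linarith)
    rwa [hgx, hgy] at this
  refine ((crossFamily hX hθ ho).reach_of_inc hAS hinc).congr ?_
  have hsx := im_sign_of_log ho' (by linarith) hx2
  have hsy := im_sign_of_log ho (by linarith) hy2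
  have hcx := eventually_mem_slitDisc hX hx
  have hcy := eventually_mem_slitDisc hX hy
  have hex : ∀ᶠ lam in 𝓝 lam₀, o * (X x lam).im < 0 :=
    (continuousAt_const.mul (continuous_im.continuousAt.comp hcx.1)).eventually_lt_const
      (show o * (X x lam₀).im < 0 by linarith)
  have hey : ∀ᶠ lam in 𝓝 lam₀, -o * (X y lam).im < 0 :=
    (continuousAt_const.mul (continuous_im.continuousAt.comp hcy.1)).eventually_lt_const
      (show -o * (X y lam₀).im < 0 by linarith)
  filter_upwards [eventually_phase_eq_one hX hθ hZ hx h₀, hcx.2, hcy.2, hex, hey]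
    with lam ⟨sg, hsg, h1⟩ h2 h3 h4 h5
  have hlx := log_neg_of_im ho h4
  have hly := log_neg_of_im ho' h5
  have heo : exp (-(o * π * I)) = -1 := by
    rcases ho with rfl | rfl
    · simp [exp_neg, Complex.exp_pi_mul_I]
    · simp
  have heσ : exp (-(σ * o * (π / 2) * I)) = -(o * σ * I) := by
    have e1 : exp ((π / 2 : ℂ) * I) = I := Complex.exp_pi_div_two_mul_I
    have e2 : exp (-((π / 2 : ℂ) * I)) = -I := by
      rw [exp_neg, e1, Complex.inv_I]
    rcases ho with rfl | rfl <;> rcases hσ with rfl | rfl <;> simp [e1, e2]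
  refine ⟨Zτ lam, sg, hsg, ?_, ?_⟩
  · simp only [BranchFamily.st, crossFamily]
    rw [(h1 x h2).1, (h1 x h2).2, hlx, add_sub_cancel_right, add_comm]
  · simp only [BranchFamily.st, crossFamily]
    have e : log (X y lam) + ((-o : ℝ) : ℂ) * π * I - o * π * I
        = log (X y lam) - 2 * (o * π * I) := by push_cast; ring
    rw [(h1 y h3).1, (h1 y h3).2, hly, e]
    congr 1
    · rw [show 3 / 2 * (log (X y lam) - 2 * (o * π * I))
        = 3 / 2 * log (X y lam) + -(o * π * I) + -(o * π * I)
          + -(o * π * I) by ring, exp_add, exp_add, exp_add,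
        heo]
      ring
    · rw [show σ / 4 * (log (X y lam) - 2 * (o * π * I))
        = σ / 4 * log (X y lam) + -(σ * o * (π / 2) * I) by ring,
        exp_add, heσ]
      ring

/-- Connection at the turning point `t₀`. Let `x`, `y` be points near `t₀` that lie below the
level of `t₀` in different Stokes regions. Then the phase increases along paths from `x` and from
`y` to all points above this level, and exact solutions continue from `x` across the cut to `y`;
the orientation `o` of this continuation is determined by the sign of the phase on the adjacent
Stokes lines. -/
def HasConnection (B : BranchFamily A S Om lam₀) (t₀ : ℂ) (Zτ : ℂ → ℂ) (σ : ℂ) : Prop :=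
  ∃ W ∈ 𝓝 t₀, ∀ x ∈ W ∩ B.D lam₀, ∀ y ∈ W ∩ B.D lam₀,
    (B.Z x lam₀).re < (Zτ lam₀).re → (B.Z y lam₀).re < (Zτ lam₀).re →
    y ∉ stokesRegion (B.D lam₀) (fun p => B.Z p lam₀) (Zτ lam₀).re x →
    ∃ o : ℝ, (o = 1 ∨ o = -1) ∧
      Reach A S Om lam₀ (B.st x) (fun lam =>
        ⟨y, 2 * Zτ lam - B.Z y lam, -(o * σ * I) * B.H y lam⟩) ∧
      (∀ p ∈ W ∩ B.D lam₀, (Zτ lam₀).re < (B.Z p lam₀).re →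
        Inc (B.D lam₀) (fun p => B.Z p lam₀) x p ∧ Inc (B.D lam₀) (fun p => B.Z p lam₀) y p) ∧
      ∀ p ∈ W ∩ B.D lam₀, (B.Z p lam₀).re = (Zτ lam₀).re →
        (p ∈ closure (stokesRegion (B.D lam₀) (fun p => B.Z p lam₀) (Zτ lam₀).re y) →
          0 < o * (B.Z p lam₀ - Zτ lam₀).im) ∧
        (p ∈ closure (stokesRegion (B.D lam₀) (fun p => B.Z p lam₀) (Zτ lam₀).re x) →
          o * (B.Z p lam₀ - Zτ lam₀).im < 0)

theorem hasConnection (hAS : IsPotentialPair A S Om) (hX : IsSlitChart A S Om lam₀ τ B.D r ρ C X)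
    (hσ : (σ = 1 ∧ ∀ᶠ lam in 𝓝 lam₀, ∀ x ∈ ball (τ lam₀) r, gPlus A S x lam ≠ 0) ∨
      (σ = -1 ∧ ∀ᶠ lam in 𝓝 lam₀, ∀ x ∈ ball (τ lam₀) r, gMinus A S x lam ≠ 0))
    (hZ : ∀ᶠ lam in 𝓝 lam₀, Tendsto (fun y => B.Z y lam) (𝓝[B.D lam] τ lam) (𝓝 (Zτ lam))) :
    B.HasConnection (τ lam₀) Zτ σ := by
  obtain ⟨θ, hθ⟩ := hX.exists_isAmplitude hAS hσ
  have hX0 := hX.chart.self_of_nhds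
  have hW : {p | p ∈ ball (τ lam₀) r ∧ X p lam₀ ∈ ball 0 ρ} ∈ 𝓝 (τ lam₀) := by
    have h2 : ∀ᶠ p in 𝓝 (τ lam₀), X p lam₀ ∈ ball 0 ρ := by
      refine (hX0.diff _ hX0.mem).continuousAt.eventually_mem ?_
      rw [hX0.zero]
      exact ball_mem_nhds _ hX.ρ_pos
    have h3 : ∀ᶠ p in 𝓝 (τ lam₀), p ∈ ball (τ lam₀) r :=
      isOpen_ball.mem_nhds hX0.mem
    exact h3.and h2
  have hmem : ∀ p ∈ {p | p ∈ ball (τ lam₀) r ∧ X p lam₀ ∈ ball 0 ρ} ∩ B.D lam₀,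
      p ∈ slitDisc (τ lam₀) r ρ (fun x => X x lam₀) := fun p hp =>
    ⟨hp.1.1, hp.1.2, hX.slit p hp.1.1 hp.1.2 hp.2⟩
  refine ⟨_, hW, fun x hx y hy hxl hyl hxy => ?_⟩
  have hx' := hmem x hx
  have hy' := hmem y hy
  obtain ⟨ς, hς, hph⟩ := (eventually_phase_eq hX hθ hZ).self_of_nhds
  obtain ⟨s, hs, hsς⟩ : ∃ s : ℝ, (s = 1 ∨ s = -1) ∧ (s : ℂ) = ς := by
    rcases hς with rfl | rfl
    · exact ⟨1, Or.inl rfl, by simp⟩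
    · exact ⟨-1, Or.inr rfl, by simp⟩
  rw [← hsς] at hph
  obtain ⟨hs1, o, ho, hx1, hx2, hy1, hy2, hinc, hcl⟩ := hX0.exists_orientation hX.ρ_pos
    (D := B.D lam₀) (f := fun p => B.Z p lam₀)
    (fun p hp => hX.mem.self_of_nhds p hp.1 hp.2.1 hp.2.2)
    (fun p hp => (B.continuousAt_Z₀ hp).continuousWithinAt) hs (fun p hp => (hph p hp).2) hx' hy'
    hxl hyl hxy
  subst hs1
  have h₀ : ∀ x ∈ slitDisc (τ lam₀) r ρ (fun x => X x lam₀),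
      B.Z x lam₀ = Zτ lam₀ + exp (3 / 2 * log (X x lam₀)) := fun p hp => by
    rw [(hph p hp).2]; simp
  have hσ' : σ = 1 ∨ σ = -1 := hσ.imp (fun h => h.1) (fun h => h.1)
  refine ⟨o, ho, reach_cross hAS hX hθ hσ' hZ h₀ hx' hy' ho hx1 hx2 hy1 hy2 ?_ ?_,
    fun p hp hpl => hinc p (hmem p hp) hpl, fun p hp hpl => hcl p (hmem p hp) hpl⟩
  · rw [h₀ x hx', add_re] at hxl; linarith
  · rw [h₀ y hy', add_re] at hyl; linarith

end BranchFamily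

end Connection

/-! ### From base points to turning points -/

section Paths

variable {D W : Set ℂ} {f g : ℂ → ℂ} {x t₀ L : ℂ}

theorem IncreasesTo.exists_near (h : IncreasesTo D f x t₀)
    (hlim : Tendsto f (𝓝[D] t₀) (𝓝 L)) (hW : W ∈ 𝓝 t₀) :
    ∃ y ∈ W ∩ D, (f y).re < L.re ∧ Inc D f x y ∧ y ∈ stokesRegion D f L.re x := by
  obtain ⟨η, hη, rfl, rfl, hD, hmono⟩ := h
  have : (𝓝[Ico (0 : ℝ) 1] 1).NeBot := by
    refine mem_closure_iff_nhdsWithin_neBot.1 ?_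
    rw [closure_Ico zero_ne_one]
    exact ⟨zero_le_one, le_rfl⟩
  have hη1 : Tendsto η (𝓝[Ico (0 : ℝ) 1] 1) (𝓝 (η 1)) :=
    (hη 1 ⟨zero_le_one, le_rfl⟩).mono_left (nhdsWithin_mono _ Ico_subset_Icc_self)
  have hfη : Tendsto (fun t => (f (η t)).re) (𝓝[Ico (0 : ℝ) 1] 1) (𝓝 L.re) :=
    (continuous_re.tendsto L).comp (hlim.comp (tendsto_nhdsWithin_iff.2
      ⟨hη1, by filter_upwards [self_mem_nhdsWithin] with t ht using hD t ht⟩))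
  have hlt : ∀ t ∈ Ico (0 : ℝ) 1, (f (η t)).re < L.re := by
    intro t ht
    have hs : (t + 1) / 2 ∈ Ico (0 : ℝ) 1 := ⟨by linarith [ht.1], by linarith [ht.2]⟩
    refine (hmono ht hs (by linarith [ht.2])).trans_le (ge_of_tendsto hfη ?_)
    filter_upwards [self_mem_nhdsWithin, nhdsWithin_le_nhds (lt_mem_nhds hs.2)] with u hu hu'
    exact hmono.monotoneOn hs hu (le_of_lt hu')
  obtain ⟨t, ⟨htW, htI⟩, ht0⟩ := (((hη1.eventually_mem hW).and self_mem_nhdsWithin).and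
    (nhdsWithin_le_nhds (lt_mem_nhds zero_lt_one))).exists
  have hsub : Icc 0 t ⊆ Ico (0 : ℝ) 1 := fun s hs => ⟨hs.1, hs.2.trans_lt htI.2⟩
  have hηt : ContinuousOn η (Icc 0 t) := hη.mono fun s hs => ⟨hs.1, (hsub hs).2.le⟩
  refine ⟨η t, ⟨htW, hD t htI⟩, hlt t htI, Relation.TransGen.single
    ⟨0, t, η, ht0, hηt, rfl, rfl, fun s hs => hD s (hsub hs), hmono.mono hsub⟩, ?_⟩
  refine (isPreconnected_Icc.image η hηt).subset_connectedComponentIn ⟨0, ⟨le_rfl, ht0.le⟩, rfl⟩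
    ?_ ⟨t, ⟨ht0.le, le_rfl⟩, rfl⟩
  rintro _ ⟨s, hs, rfl⟩
  exact ⟨hD s (hsub hs), (hlt s (hsub hs)).ne⟩

theorem DecreasesTo.neg (h : DecreasesTo D f x t₀) (hg : ∀ y ∈ D, (g y).re = -(f y).re) :
    IncreasesTo D g x t₀ := by
  obtain ⟨η, hη, h0, h1, hD, hmono⟩ := h
  refine ⟨η, hη, h0, h1, hD, fun s hs t ht hst => ?_⟩
  simp only [hg _ (hD s hs), hg _ (hD t ht)]
  exact neg_lt_neg (hmono hs ht hst)

theorem IncreasesTo.neg (h : IncreasesTo D f x t₀) (hg : ∀ y ∈ D, (g y).re = -(f y).re) :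
    DecreasesTo D g x t₀ := by
  obtain ⟨η, hη, h0, h1, hD, hmono⟩ := h
  refine ⟨η, hη, h0, h1, hD, fun s hs t ht hst => ?_⟩
  simp only [hg _ (hD s hs), hg _ (hD t ht)]
  exact neg_lt_neg (hmono hs ht hst)

theorem stokesRegion_neg (hg : ∀ y ∈ D, (g y).re = -(f y).re) (l : ℝ) (x : ℂ) :
    stokesRegion D g (-l) x = stokesRegion D f l x := by
  unfold stokesRegion
  congr 1
  ext y
  constructor
  · rintro ⟨h1, h2⟩
    exact ⟨h1, fun h => h2 (by rw [hg y h1, h])⟩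
  · rintro ⟨h1, h2⟩
    exact ⟨h1, fun h => h2 (by rw [hg y h1] at h; exact neg_injective h)⟩

end Paths

/-- The connection at a turning point for base points `x`, `y`, `m` that are joined to it by
progressive paths. -/
theorem BranchFamily.HasConnection.exists_reach {B : BranchFamily A S Om lam₀} {t₀ : ℂ}
    {Zτ : ℂ → ℂ} {σ : ℂ} (h : B.HasConnection t₀ Zτ σ) (hAS : IsPotentialPair A S Om)
    (hσ : σ = 1 ∨ σ = -1)
    (hlim : Tendsto (fun y => B.Z y lam₀) (𝓝[B.D lam₀] t₀) (𝓝 (Zτ lam₀))) {x y m : ℂ}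
    (hx : IncreasesTo (B.D lam₀) (fun y => B.Z y lam₀) x t₀)
    (hy : IncreasesTo (B.D lam₀) (fun y => B.Z y lam₀) y t₀)
    (hm : DecreasesTo (B.D lam₀) (fun y => B.Z y lam₀) m t₀)
    (hxy : y ∉ stokesRegion (B.D lam₀) (fun p => B.Z p lam₀) (Zτ lam₀).re x) :
    ∃ o : ℝ, (o = 1 ∨ o = -1) ∧ Inc (B.D lam₀) (fun p => B.Z p lam₀) x m ∧
      Inc (B.D lam₀) (fun p => B.Z p lam₀) y m ∧
      Reach A S Om lam₀ (B.st x) (fun lam =>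
        ⟨y, 2 * Zτ lam - B.Z y lam, -(o * σ * I) * B.H y lam⟩) ∧
      ∀ᶠ p in 𝓝 t₀, p ∈ B.D lam₀ → (B.Z p lam₀).re = (Zτ lam₀).re →
        (p ∈ closure (stokesRegion (B.D lam₀) (fun p => B.Z p lam₀) (Zτ lam₀).re y) →
          0 < o * (B.Z p lam₀ - Zτ lam₀).im) ∧
        (p ∈ closure (stokesRegion (B.D lam₀) (fun p => B.Z p lam₀) (Zτ lam₀).re x) →
          o * (B.Z p lam₀ - Zτ lam₀).im < 0) := by
  obtain ⟨W, hW, h⟩ := h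
  obtain ⟨x', hx', hxl, hxi, hxr⟩ := hx.exists_near hlim hW
  obtain ⟨y', hy', hyl, hyi, hyr⟩ := hy.exists_near hlim hW
  obtain ⟨m', hm', hml, hmi, -⟩ := (hm.neg (g := fun y => -B.Z y lam₀)
    fun p _ => by simp).exists_near hlim.neg hW
  have hmi' : Inc (B.D lam₀) (fun p => B.Z p lam₀) m' m := hmi.rev fun p _ => by simp
  rw [neg_re, neg_re, neg_lt_neg_iff] at hml
  have hxy' : y' ∉ stokesRegion (B.D lam₀) (fun p => B.Z p lam₀) (Zτ lam₀).re x' := by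
    intro hmem
    rw [← stokesRegion_eq hxr] at hmem
    apply hxy
    rw [stokesRegion_eq hmem, ← stokesRegion_eq hyr]
    exact mem_connectedComponentIn (connectedComponentIn_nonempty_iff.1 ⟨_, hyr⟩)
  obtain ⟨o, ho, hreach, hinc, hcl⟩ := h x' hx' y' hy' hxl hyl hxy'
  obtain ⟨hix, hiy⟩ := hinc m' hm' hml
  refine ⟨o, ho, (hxi.trans hix).trans hmi', (hyi.trans hiy).trans hmi', ?_, ?_⟩
  · obtain ⟨κ, hκ⟩ : ∃ κ, κ = -(o * σ * I) := ⟨_, rfl⟩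
    have hκ2 : κ ^ 2 = -1 := by
      rw [hκ]
      rcases ho with rfl | rfl <;> rcases hσ with rfl | rfl <;> simp
    have hback : Inc ((B.rot κ (by linear_combination (κ ^ 2 - 1) * hκ2)).D lam₀)
        (fun p => (B.rot κ (by linear_combination (κ ^ 2 - 1) * hκ2)).Z p lam₀) y' y :=
      hyi.rev fun p _ => by simp [BranchFamily.rot, hκ2]
    have h2 := (BranchFamily.reach_of_inc _ hAS hback).congr
      (s' := fun lam => ⟨y', 2 * Zτ lam - B.Z y' lam, κ * B.H y' lam⟩)
      (t' := fun lam => ⟨y, 2 * Zτ lam - B.Z y lam, κ * B.H y lam⟩)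
      (Eventually.of_forall fun lam => ⟨2 * Zτ lam, 1, Or.inl rfl, by
        simp only [BranchFamily.st, BranchFamily.rot, hκ2]; congr 1 <;> ring, by
        simp only [BranchFamily.st, BranchFamily.rot, hκ2]; congr 1 <;> ring⟩)
    rw [← hκ] at hreach ⊢
    exact ((B.reach_of_inc hAS hxi).trans hreach).trans h2
  · filter_upwards [hW] with p hpW hpD hpl
    have := hcl p ⟨hpW, hpD⟩ hpl
    rwa [← stokesRegion_eq hxr, ← stokesRegion_eq hyr] at this

/-! ### The phase along a Stokes line -/

/-- The imaginary part of the phase is strictly monotone along a simple curve on which the real part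
is constant. -/
theorem strictMonoOn_im_or_strictAntiOn_im {D : Set ℂ} {f f' : ℂ → ℂ} {c : ℝ → ℂ} {s t l : ℝ}
    (hD : IsOpen D) (hf : ∀ x ∈ D, HasDerivAt f (f' x) x) (hf0 : ∀ x ∈ D, f' x ≠ 0)
    (hc : Continuous c) (hci : Function.Injective c) (hcD : ∀ u ∈ Ioo s t, c u ∈ D)
    (hl : ∀ u ∈ Ioo s t, (f (c u)).re = l) (hst : s < t) :
    StrictMonoOn (fun u => (f (c u)).im) (Ioo s t) ∨
      StrictAntiOn (fun u => (f (c u)).im) (Ioo s t) := by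
  have hF : ContinuousOn (fun u => (f (c u)).im) (Ioo s t) := fun u hu =>
    (continuous_im.continuousAt.comp
      ((hf _ (hcD u hu)).continuousAt.comp hc.continuousAt)).continuousWithinAt
  have hlocal : ∀ w ∈ Ioo s t, ∃ δ > 0, Icc (w - δ) (w + δ) ⊆ Ioo s t ∧
      InjOn (fun u => (f (c u)).im) (Icc (w - δ) (w + δ)) := by
    intro w hw
    have hstrict : HasStrictDerivAt f (f' (c w)) (c w) := by
      have han : AnalyticAt ℂ f (c w) := (DifferentiableOn.analyticAt (s := D)
        (fun y hy => (hf y hy).differentiableAt.differentiableWithinAt) (hD.mem_nhds (hcD w hw)))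
      have := han.hasStrictDerivAt
      rwa [(hf _ (hcD w hw)).deriv] at this
    obtain ⟨N, hN, hinj⟩ : ∃ N ∈ 𝓝 (c w), InjOn f N := by
      have h1 := hstrict.hasStrictFDerivAt_equiv (hf0 _ (hcD w hw))
      obtain ⟨N, hN, hNo, happ⟩ := h1.approximates_deriv_on_open_nhds
      exact ⟨N, hNo.mem_nhds hN, happ.injOn
        ((ContinuousLinearEquiv.subsingleton_or_nnnorm_symm_pos _).imp id fun h =>
          NNReal.half_lt_self (inv_pos.2 h).ne')⟩
    obtain ⟨δ, hδ, hsub⟩ := nhds_basis_closedBall.mem_iff.1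
      (inter_mem (Ioo_mem_nhds hw.1 hw.2) (hc.continuousAt.preimage_mem_nhds hN))
    rw [Real.closedBall_eq_Icc] at hsub
    refine ⟨δ, hδ, fun u hu => (hsub hu).1, fun u hu v hv huv => hci ?_⟩
    refine hinj (hsub hu).2 (hsub hv).2 (Complex.ext ?_ huv)
    rw [hl u (hsub hu).1, hl v (hsub hv).1]
  have hinj : InjOn (fun u => (f (c u)).im) (Ioo s t) := by
    have key : ∀ u ∈ Ioo s t, ∀ v ∈ Ioo s t, u < v → (f (c u)).im ≠ (f (c v)).im := by
      intro u hu v hv huv heq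
      obtain ⟨w, hw, hext⟩ := exists_isLocalExtr_Ioo huv
        (hF.mono fun p hp => ⟨hu.1.trans_le hp.1, hp.2.trans_lt hv.2⟩) heq
      obtain ⟨δ, hδ, hsub, hi⟩ := hlocal w ⟨hu.1.trans hw.1, hw.2.trans hv.2⟩
      have hwI : w ∈ Icc (w - δ) (w + δ) := ⟨by linarith, by linarith⟩
      have hright : ∃ᶠ p in 𝓝 w, p ∈ Ioo w (w + δ) :=
        (Eventually.frequently (f := 𝓝[>] w) (Ioo_mem_nhdsGT (by linarith))).filter_mono
          nhdsWithin_le_nhds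
      have hleft : ∃ᶠ p in 𝓝 w, p ∈ Ioo (w - δ) w :=
        (Eventually.frequently (f := 𝓝[<] w) (Ioo_mem_nhdsLT (by linarith))).filter_mono
          nhdsWithin_le_nhds
      rcases (hF.mono hsub).strictMonoOn_of_injOn_Icc' (by linarith) hi with hm | hm <;>
        rcases hext with he | he
      · obtain ⟨p, hp, hpe⟩ := (hleft.and_eventually he).exists
        exact absurd hpe (not_le.2 (hm ⟨hp.1.le, hp.2.le.trans hwI.2⟩ hwI hp.2))
      · obtain ⟨p, hp, hpe⟩ := (hright.and_eventually he).exists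
        exact absurd hpe (not_le.2 (hm hwI ⟨hwI.1.trans hp.1.le, hp.2.le⟩ hp.1))
      · obtain ⟨p, hp, hpe⟩ := (hright.and_eventually he).exists
        exact absurd hpe (not_le.2 (hm hwI ⟨hwI.1.trans hp.1.le, hp.2.le⟩ hp.1))
      · obtain ⟨p, hp, hpe⟩ := (hleft.and_eventually he).exists
        exact absurd hpe (not_le.2 (hm ⟨hp.1.le, hp.2.le.trans hwI.2⟩ hwI hp.2))
    intro u hu v hv huv
    rcases lt_trichotomy u v with h | h | h
    · exact absurd huv (key u hu v hv h)
    · exact h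
    · exact absurd huv.symm (key v hv u hu h)
  exact hF.strictMonoOn_of_injOn_Ioo hst hinj

/-- A monotone function lies on different sides of its two limits. -/
theorem mul_neg_of_tendsto {F : ℝ → ℝ} {s t a b o o' : ℝ} (hst : s < t)
    (hF : StrictMonoOn F (Ioo s t) ∨ StrictAntiOn F (Ioo s t)) (ha : Tendsto F (𝓝[>] s) (𝓝 a))
    (hb : Tendsto F (𝓝[<] t) (𝓝 b)) (h : ∀ᶠ u in 𝓝[>] s, 0 < o * (F u - a))
    (h' : ∀ᶠ u in 𝓝[<] t, 0 < o' * (F u - b)) : o * o' < 0 := by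
  obtain ⟨u, hu, huI⟩ := (h.and (Ioo_mem_nhdsGT hst)).exists
  obtain ⟨v, hv, hvI⟩ := (h'.and (Ioo_mem_nhdsLT hst)).exists
  have e1 : ∀ᶠ p in 𝓝[>] s, p ∈ Ioo s u := Ioo_mem_nhdsGT huI.1
  have e2 : ∀ᶠ p in 𝓝[<] t, p ∈ Ioo v t := Ioo_mem_nhdsLT hvI.2
  rcases hF with hF | hF
  · have h1 : a ≤ F u := le_of_tendsto ha (by
      filter_upwards [e1] with p hp
      exact (hF ⟨hp.1, hp.2.trans huI.2⟩ huI hp.2).le)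
    have h2 : F v ≤ b := ge_of_tendsto hb (by
      filter_upwards [e2] with p hp
      exact (hF hvI ⟨hvI.1.trans hp.1, hp.2⟩ hp.1).le)
    have h3 : 0 < o := by
      by_contra hc
      push Not at hc
      linarith [mul_nonpos_of_nonpos_of_nonneg hc (sub_nonneg.2 h1)]
    have h4 : o' < 0 := by
      by_contra hc
      push Not at hc
      linarith [mul_nonpos_of_nonneg_of_nonpos hc (sub_nonpos.2 h2)]
    exact mul_neg_of_pos_of_neg h3 h4
  · have h1 : F u ≤ a := ge_of_tendsto ha (by
      filter_upwards [e1] with p hp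
      exact (hF ⟨hp.1, hp.2.trans huI.2⟩ huI hp.2).le)
    have h2 : b ≤ F v := le_of_tendsto hb (by
      filter_upwards [e2] with p hp
      exact (hF hvI ⟨hvI.1.trans hp.1, hp.2⟩ hp.1).le)
    have h3 : o < 0 := by
      by_contra hc
      push Not at hc
      linarith [mul_nonpos_of_nonneg_of_nonpos hc (sub_nonpos.2 h1)]
    have h4 : 0 < o' := by
      by_contra hc
      push Not at hc
      linarith [mul_nonpos_of_nonpos_of_nonneg hc (sub_nonneg.2 h2)]
    exact mul_neg_of_neg_of_pos h3 h4

/-! ### The connection at the end of a branch cut -/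

theorem exists_ball_of_eventually_nhds_prod {t₀ : ℂ} {p : ℂ × ℂ → Prop}
    (h : ∀ᶠ q in 𝓝 (t₀, lam₀), p q) :
    ∃ R : ℝ, 0 < R ∧ ∀ᶠ lam in 𝓝 lam₀, ∀ x ∈ ball t₀ R, p (x, lam) := by
  rw [nhds_prod_eq, eventually_prod_iff] at h
  obtain ⟨pa, ha, pb, hb, h⟩ := h
  obtain ⟨R, hR, hball⟩ := eventually_nhds_iff_ball.1 ha
  exact ⟨R, hR, hb.mono fun lam hl x hx => h (hball x hx) hl⟩

theorem eventually_notMem_arc {k : ℝ → ℂ → ℂ} {U₀ : Set ℂ} (hU : U₀ ∈ 𝓝 lam₀)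
    (hk : ContinuousOn (fun p : ℝ × ℂ => k p.1 p.2) (Icc 0 1 ×ˢ U₀)) {y : ℂ}
    (hy : y ∉ (fun t => k t lam₀) '' Icc 0 1) :
    ∀ᶠ p in 𝓝 (y, lam₀), p.1 ∉ (fun t => k t p.2) '' Icc 0 1 := by
  obtain ⟨δ, hδ, h⟩ := eventually_forall_le_dist hU hk isCompact_Icc le_rfl (y := y)
    fun t ht he => hy ⟨t, ht, he⟩
  rw [nhds_prod_eq]
  have hb : ∀ᶠ x in 𝓝 y, x ∈ ball y δ := ball_mem_nhds y hδ
  filter_upwards [hb.prod_mk h]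
  rintro ⟨x, lam⟩ ⟨hx, hl⟩ ⟨t, ht, he⟩
  exact absurd (mem_ball.1 hx) (not_lt.2 ((hl t ht).trans_eq (congrArg (dist · y) he)))

/-- The sign `σ` records which one of `g₊`, `g₋` vanishes at the turning point. -/
def TypeSign (A S : ℂ → ℂ) (lam₀ t₀ σ : ℂ) : Prop :=
  (σ = 1 ∧ gMinus A S t₀ lam₀ = 0 ∧ gPlus A S t₀ lam₀ ≠ 0) ∨
    (σ = -1 ∧ gPlus A S t₀ lam₀ = 0 ∧ gMinus A S t₀ lam₀ ≠ 0)

theorem TypeSign.eq {t₀ σ : ℂ} (h : TypeSign A S lam₀ t₀ σ) : σ = 1 ∨ σ = -1 :=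
  h.imp And.left And.left

theorem exists_typeSign (hAS : IsPotentialPair A S Om) {t₀ : ℂ} (ht : t₀ ∈ Om)
    (h0 : V₀ A S t₀ lam₀ = 0) (h1 : deriv (fun x => V₀ A S x lam₀) t₀ ≠ 0) :
    ∃ σ, TypeSign A S lam₀ t₀ σ := by
  have hboth : ¬ (gPlus A S t₀ lam₀ = 0 ∧ gMinus A S t₀ lam₀ = 0) := by
    rintro ⟨hp, hm⟩
    refine h1 ?_
    have h : HasDerivAt (fun x => gPlus A S x lam₀ * gMinus A S x lam₀) _ t₀ :=
      (hasDerivAt_gPlus hAS ht).mul (hasDerivAt_gMinus hAS ht)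
    simp only [V₀_eq]
    rw [h.deriv, hp, hm]
    ring
  rw [V₀_eq, mul_eq_zero] at h0
  rcases h0 with h0 | h0
  · exact ⟨-1, Or.inr ⟨rfl, h0, fun h => hboth ⟨h0, h⟩⟩⟩
  · exact ⟨1, Or.inl ⟨rfl, h0, fun h => hboth ⟨h, h0⟩⟩⟩

/-- Connection at the turning point `τ` for a family of domains that are, near `τ`, the complement of
a Stokes arc from `τ`. -/
theorem BranchFamily.hasConnection_of_arc (B : BranchFamily A S Om lam₀)
    (hAS : IsPotentialPair A S Om) {τ : ℂ → ℂ} {k : ℝ → ℂ → ℂ} {U₀ : Set ℂ} (hU : U₀ ∈ 𝓝 lam₀)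
    (hτ : ContinuousAt τ lam₀) (hτ0 : ∀ lam ∈ U₀, V₀ A S (τ lam) lam = 0) (hOm : τ lam₀ ∈ Om)
    (hsimple : deriv (fun x => V₀ A S x lam₀) (τ lam₀) ≠ 0)
    (hk : ContinuousOn (fun p : ℝ × ℂ => k p.1 p.2) (Icc 0 1 ×ˢ U₀))
    (hk0 : ∀ lam ∈ U₀, k 0 lam = τ lam)
    (harc : ∀ lam ∈ U₀, IsStokesArc A S Om lam (fun t => k t lam))
    (hD : ∀ᶠ p in 𝓝 (τ lam₀, lam₀), p.1 ∈ B.D p.2 ↔ p.1 ∉ (fun t => k t p.2) '' Icc 0 1)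
    {Zτ : ℂ → ℂ}
    (hZ : ∀ᶠ lam in 𝓝 lam₀, Tendsto (fun y => B.Z y lam) (𝓝[B.D lam] τ lam) (𝓝 (Zτ lam)))
    {σ : ℂ} (hσ : TypeSign A S lam₀ (τ lam₀) σ) : B.HasConnection (τ lam₀) Zτ σ := by
  have key : ∃ R > 0, (∀ᶠ lam in 𝓝 lam₀, ∀ x ∈ ball (τ lam₀) R,
        x ∈ B.D lam ↔ x ∉ (fun t => k t lam) '' Icc 0 1) ∧
      ((σ = 1 ∧ ∀ᶠ lam in 𝓝 lam₀, ∀ x ∈ ball (τ lam₀) R, gPlus A S x lam ≠ 0) ∨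
        (σ = -1 ∧ ∀ᶠ lam in 𝓝 lam₀, ∀ x ∈ ball (τ lam₀) R, gMinus A S x lam ≠ 0)) := by
    rcases hσ with ⟨h1, -, h2⟩ | ⟨h1, -, h2⟩
    · obtain ⟨R, hR, h⟩ := exists_ball_of_eventually_nhds_prod
        (hD.and ((continuousAt_gPlus hAS hOm).eventually_ne h2))
      exact ⟨R, hR, h.mono fun _ h x hx => (h x hx).1, Or.inl ⟨h1, h.mono fun _ h x hx => (h x hx).2⟩⟩
    · obtain ⟨R, hR, h⟩ := exists_ball_of_eventually_nhds_prod
        (hD.and ((continuousAt_gMinus hAS hOm).eventually_ne h2))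
      exact ⟨R, hR, h.mono fun _ h x hx => (h x hx).1, Or.inr ⟨h1, h.mono fun _ h x hx => (h x hx).2⟩⟩
  obtain ⟨R, hR, hDR, hg⟩ := key
  obtain ⟨X, r, ρ, C, hrR, hX⟩ := exists_isSlitChart hAS hτ (by
    filter_upwards [hU] with lam hl using hτ0 lam hl) hOm hsimple hR hU hk hk0 harc hDR
  exact BranchFamily.hasConnection hAS hX (hg.imp
    (And.imp_right fun h => h.mono fun _ h x hx => h x (ball_subset_ball hrR hx))
    (And.imp_right fun h => h.mono fun _ h x hx => h x (ball_subset_ball hrR hx))) hZ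

namespace BifurcationData

/-! ### The branch family of a configuration -/

variable (P : BifurcationData A S Om lam₀)

theorem U₀_mem_nhds : P.U₀ ∈ 𝓝 lam₀ := P.isOpen_U₀.mem_nhds P.mem_U₀

theorem eventually_mem_D {x : ℂ} (hx : x ∈ P.D lam₀) : ∀ᶠ p : ℂ × ℂ in 𝓝 (x, lam₀), p.1 ∈ P.D p.2 := by
  have h0 : ∀ᶠ p : ℂ × ℂ in 𝓝 (x, lam₀), p.1 ∈ P.om :=
    continuousAt_fst.eventually_mem (P.isOpen_om.mem_nhds hx.1)
  filter_upwards [h0,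
    eventually_notMem_arc P.U₀_mem_nhds P.continuousOn_kα fun h => hx.2 (Or.inl (Or.inl h)),
    eventually_notMem_arc P.U₀_mem_nhds P.continuousOn_kβ fun h => hx.2 (Or.inl (Or.inr h)),
    eventually_notMem_arc P.U₀_mem_nhds P.continuousOn_kγ fun h => hx.2 (Or.inr h)]
    with p h h1 h2 h3
  exact ⟨h, by rintro ((h | h) | h) <;> contradiction⟩

theorem isOpen_D {lam : ℂ} (hl : lam ∈ P.U₀) : IsOpen (P.D lam) := by
  have h : ∀ {k : ℝ → ℂ → ℂ}, IsStokesArc A S Om lam (fun t => k t lam) →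
      IsClosed ((fun t => k t lam) '' Icc 0 1) := fun hk =>
    (isCompact_Icc.image_of_continuousOn hk.continuousOn).isClosed
  exact P.isOpen_om.sdiff (((h (P.stokes_kα lam hl)).union (h (P.stokes_kβ lam hl))).union
    (h (P.stokes_kγ lam hl)))

theorem isBranchAt {lam : ℂ} (hl : lam ∈ P.U₀) {x : ℂ} (hx : x ∈ P.D lam) :
    IsBranchAt A S Om lam (fun y => P.Z y lam) (fun y => P.H y lam) x := by
  have h0 : (0 : ℝ) ∈ Icc (0 : ℝ) 1 := ⟨le_rfl, zero_le_one⟩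
  have hV : V₀ A S x lam ≠ 0 := by
    intro h
    rcases P.eq_of_V₀ lam hl x hx.1 h with h | h | h
    · exact hx.2 (Or.inl (Or.inl ⟨0, h0, (P.kα_zero lam hl).trans h.symm⟩))
    · exact hx.2 (Or.inl (Or.inr ⟨0, h0, (P.kβ_zero lam hl).trans h.symm⟩))
    · exact hx.2 (Or.inr ⟨0, h0, (P.kγ_zero lam hl).trans h.symm⟩)
  have hsq := P.root_sq lam hl x hx
  have hH := P.H_sq lam hl x hx
  have hr : P.root x lam ≠ 0 := fun h => hV (by rw [← neg_eq_zero, ← hsq, h, zero_pow two_ne_zero])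
  have hne : P.H x lam ^ 2 * gPlus A S x lam ≠ 0 := by
    rw [hH]
    exact mul_ne_zero Complex.I_ne_zero hr
  have hg : gPlus A S x lam ≠ 0 := right_ne_zero_of_mul hne
  refine ⟨P.om_subset hx.1, ?_, (P.differentiableOn_H lam hl).differentiableAt
    ((P.isOpen_D hl).mem_nhds hx), fun h => left_ne_zero_of_mul hne (by simp [h]), hg, ?_⟩
  · rw [hH]
    exact P.hasDerivAt_Z lam hl x hx
  · refine mul_right_cancel₀ hg ?_
    rw [V₀_eq] at hsq
    linear_combination (P.H x lam ^ 2 * gPlus A S x lam + I * P.root x lam) * hH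
      + (P.root x lam ^ 2) * I_sq - hsq

/-- The phase and the amplitude of a configuration as a branch family. -/
def branch : BranchFamily A S Om lam₀ where
  D := P.D
  Z := P.Z
  H := P.H
  mem_nhds _ hx := P.eventually_mem_D hx
  cont x hx := by
    refine P.continuousOn_Z.continuousAt ?_
    filter_upwards [continuousAt_snd.eventually_mem (x := (x, lam₀)) P.U₀_mem_nhds,
      P.eventually_mem_D hx] with p h1 h2 using ⟨h1, h2⟩
  isOpen := by filter_upwards [P.U₀_mem_nhds] with lam hl using P.isOpen_D hl
  good := by filter_upwards [P.U₀_mem_nhds] with lam hl x hx using P.isBranchAt hl hx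

/-- The branch cut from one turning point does not contain any other simple turning point. -/
theorem notMem_arc {k : ℝ → ℂ → ℂ} {t₀ : ℂ} (hk : IsStokesArc A S Om lam₀ (fun t => k t lam₀))
    (h0 : V₀ A S t₀ lam₀ = 0) (hs : deriv (fun x => V₀ A S x lam₀) t₀ ≠ 0) (hne : k 0 lam₀ ≠ t₀) :
    t₀ ∉ (fun t => k t lam₀) '' Icc 0 1 := by
  rintro ⟨t, ht, he⟩
  rcases ht.1.eq_or_lt with rfl | h
  · exact hne he
  · exact hk.ne_of_simple h0 hs ⟨h, ht.2⟩ he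

theorem α_ne_β : P.α lam₀ ≠ P.β lam₀ := by
  rw [← P.c_a, ← P.c_b]
  exact P.injective_c.ne (P.a_lt_g.trans P.g_lt_b).ne

theorem α_ne_γ : P.α lam₀ ≠ P.γ lam₀ := by
  rw [← P.c_a, ← P.c_g]
  exact P.injective_c.ne P.a_lt_g.ne

theorem β_ne_γ : P.β lam₀ ≠ P.γ lam₀ := by
  rw [← P.c_b, ← P.c_g]
  exact P.injective_c.ne P.g_lt_b.ne'

theorem α_mem : P.α lam₀ ∈ P.om := P.c_a ▸ P.c_mem _

theorem β_mem : P.β lam₀ ∈ P.om := P.c_b ▸ P.c_mem _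

theorem γ_mem : P.γ lam₀ ∈ P.om := P.c_g ▸ P.c_mem _

theorem hasConnection_α {σ : ℂ} (hAS : IsPotentialPair A S Om)
    (hσ : TypeSign A S lam₀ (P.α lam₀) σ) : P.branch.HasConnection (P.α lam₀) P.Zα σ := by
  have hU := P.U₀_mem_nhds
  have hl := P.mem_U₀
  refine P.branch.hasConnection_of_arc hAS hU (P.continuousOn_α.continuousAt hU) P.V₀_α
    (P.om_subset P.α_mem) P.simple_α P.continuousOn_kα P.kα_zero P.stokes_kα ?_
    (by filter_upwards [hU] with lam hl using P.tendsto_Zα lam hl) hσ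
  have h0 : ∀ᶠ p : ℂ × ℂ in 𝓝 (P.α lam₀, lam₀), p.1 ∈ P.om :=
    continuousAt_fst.eventually_mem (P.isOpen_om.mem_nhds P.α_mem)
  filter_upwards [h0, eventually_notMem_arc hU P.continuousOn_kβ (notMem_arc (P.stokes_kβ _ hl)
      (P.V₀_α _ hl) P.simple_α (by rw [P.kβ_zero _ hl]; exact P.α_ne_β.symm)),
    eventually_notMem_arc hU P.continuousOn_kγ (notMem_arc (P.stokes_kγ _ hl)
      (P.V₀_α _ hl) P.simple_α (by rw [P.kγ_zero _ hl]; exact P.α_ne_γ.symm))] with p h h1 h2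
  exact ⟨fun h h' => h.2 (Or.inl (Or.inl h')), fun h' => ⟨h, by rintro ((h | h) | h) <;> contradiction⟩⟩

theorem hasConnection_β {σ : ℂ} (hAS : IsPotentialPair A S Om)
    (hσ : TypeSign A S lam₀ (P.β lam₀) σ) : P.branch.HasConnection (P.β lam₀) P.Zβ σ := by
  have hU := P.U₀_mem_nhds
  have hl := P.mem_U₀
  refine P.branch.hasConnection_of_arc hAS hU (P.continuousOn_β.continuousAt hU) P.V₀_β
    (P.om_subset P.β_mem) P.simple_β P.continuousOn_kβ P.kβ_zero P.stokes_kβ ?_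
    (by filter_upwards [hU] with lam hl using P.tendsto_Zβ lam hl) hσ
  have h0 : ∀ᶠ p : ℂ × ℂ in 𝓝 (P.β lam₀, lam₀), p.1 ∈ P.om :=
    continuousAt_fst.eventually_mem (P.isOpen_om.mem_nhds P.β_mem)
  filter_upwards [h0, eventually_notMem_arc hU P.continuousOn_kα (notMem_arc (P.stokes_kα _ hl)
      (P.V₀_β _ hl) P.simple_β (by rw [P.kα_zero _ hl]; exact P.α_ne_β)),
    eventually_notMem_arc hU P.continuousOn_kγ (notMem_arc (P.stokes_kγ _ hl)
      (P.V₀_β _ hl) P.simple_β (by rw [P.kγ_zero _ hl]; exact P.β_ne_γ.symm))] with p h h1 h2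
  exact ⟨fun h h' => h.2 (Or.inl (Or.inr h')), fun h' => ⟨h, by rintro ((h | h) | h) <;> contradiction⟩⟩

/-- The connection at `γ`, for the branch family of the decaying solutions `u⁻`. -/
theorem hasConnection_γ {σ : ℂ} (hAS : IsPotentialPair A S Om)
    (hσ : TypeSign A S lam₀ (P.γ lam₀) σ) :
    (P.branch.rot I Complex.I_pow_four).HasConnection (P.γ lam₀) (fun lam => -P.Zγ lam) σ := by
  have hU := P.U₀_mem_nhds
  have hl := P.mem_U₀
  refine BranchFamily.hasConnection_of_arc _ hAS hU (P.continuousOn_γ.continuousAt hU) P.V₀_γ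
    (P.om_subset P.γ_mem) P.simple_γ P.continuousOn_kγ P.kγ_zero P.stokes_kγ ?_ ?_ hσ
  · have h0 : ∀ᶠ p : ℂ × ℂ in 𝓝 (P.γ lam₀, lam₀), p.1 ∈ P.om :=
      continuousAt_fst.eventually_mem (P.isOpen_om.mem_nhds P.γ_mem)
    filter_upwards [h0, eventually_notMem_arc hU P.continuousOn_kα (notMem_arc (P.stokes_kα _ hl)
        (P.V₀_γ _ hl) P.simple_γ (by rw [P.kα_zero _ hl]; exact P.α_ne_γ)),
      eventually_notMem_arc hU P.continuousOn_kβ (notMem_arc (P.stokes_kβ _ hl)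
        (P.V₀_γ _ hl) P.simple_γ (by rw [P.kβ_zero _ hl]; exact P.β_ne_γ))] with p h h1 h2
    exact ⟨fun h h' => h.2 (Or.inr h'), fun h' => ⟨h, by rintro ((h | h) | h) <;> contradiction⟩⟩
  · filter_upwards [hU] with lam hl
    refine (P.tendsto_Zγ lam hl).neg.congr fun y => ?_
    simp [BranchFamily.rot, branch]

/-! ### The tails of the contour -/

/-- The branch cuts do not reach the far ends of the real line. -/
theorem exists_tail :
    ∃ M : ℝ, P.T ≤ M ∧ ∀ᶠ lam in 𝓝 lam₀, ∀ t : ℝ, M ≤ |t| → (t : ℂ) ∈ P.D lam := by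
  have hU := P.U₀_mem_nhds
  have key : ∀ {k : ℝ → ℂ → ℂ}, ContinuousOn (fun p : ℝ × ℂ => k p.1 p.2) (Icc 0 1 ×ˢ P.U₀) →
      (∀ lam ∈ P.U₀, IsStokesArc A S Om lam (fun t => k t lam)) → ∃ M : ℝ, ∀ᶠ lam in 𝓝 lam₀,
        ∀ t : ℝ, M ≤ |t| → (t : ℂ) ∉ (fun t => k t lam) '' Icc 0 1 := by
    intro k hk harc
    obtain ⟨M, hM⟩ := (isCompact_Icc.image_of_continuousOn
      (harc lam₀ P.mem_U₀).continuousOn).isBounded.subset_ball 0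
    refine ⟨M, ?_⟩
    filter_upwards [eventually_forall_curve_mem hU hk isCompact_Icc le_rfl
      (isOpen_ball (x := (0 : ℂ)) (ε := M)) fun t ht => hM ⟨t, ht, rfl⟩] with lam hl
    rintro t ht ⟨s, hs, he⟩
    have := hl s hs
    rw [show k s lam = t from he, mem_ball_zero_iff, norm_real, Real.norm_eq_abs] at this
    linarith
  obtain ⟨M₁, h₁⟩ := key P.continuousOn_kα P.stokes_kα
  obtain ⟨M₂, h₂⟩ := key P.continuousOn_kβ P.stokes_kβ
  obtain ⟨M₃, h₃⟩ := key P.continuousOn_kγ P.stokes_kγ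
  refine ⟨max (max M₁ M₂) (max M₃ P.T), (le_max_right _ _).trans (le_max_right _ _), ?_⟩
  filter_upwards [h₁, h₂, h₃] with lam h₁ h₂ h₃ t ht
  simp only [max_le_iff] at ht
  refine ⟨P.c_real t ht.2.2 ▸ P.c_mem t, ?_⟩
  rintro ((h | h) | h)
  exacts [h₁ t ht.1.1 h, h₂ t ht.1.2 h, h₃ t ht.2.1 h]

theorem exists_rayBound_left (hAS : IsPotentialPair A S Om) (hlam₀ : lam₀.im ≠ 0) :
    ∃ b' < P.a, P.c b' = ray 1 b' ∧ ∃ M L : ℝ, 0 ≤ M ∧ 0 ≤ L ∧ ∀ᶠ lam in 𝓝 lam₀,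
      RayBound A S Om lam 1 b' (|lam₀.im| / 2) M L (fun x => P.Z x lam) (fun x => P.H x lam)
        (P.D lam) := by
  obtain ⟨M, hMT, hM⟩ := P.exists_tail
  have habs : ∀ t < min P.a (-|M|), M ≤ |t| := fun t ht => by
    rw [abs_of_neg ((ht.trans_le (min_le_right _ _)).trans_le (neg_nonpos.2 (abs_nonneg M)))]
    linarith [ht.trans_le (min_le_right _ _), le_abs_self M]
  have hc : ∀ t < min P.a (-|M|), ray 1 t = P.c t := fun t ht => by
    rw [P.c_real t (hMT.trans (habs t ht)), ray, one_mul]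
  obtain ⟨b', hb', h⟩ := P.branch.exists_rayBound hAS hlam₀ (Or.inl rfl) (b := min P.a (-|M|))
    (hM.mono fun lam hl t ht => by
      rw [ray, one_mul]
      exact hl t (habs t ht)) (by
      intro s hs t ht hst
      simp only [hc s hs, hc t ht]
      exact P.progressive_left.monotoneOn (mem_Iio.2 ((mem_Iio.1 hs).trans_le (min_le_left _ _)))
        (mem_Iio.2 ((mem_Iio.1 ht).trans_le (min_le_left _ _))) hst)
  exact ⟨b', hb'.trans_le (min_le_left _ _), (hc b' hb').symm, h⟩

theorem exists_rayBound_right (hAS : IsPotentialPair A S Om) (hlam₀ : lam₀.im ≠ 0) :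
    ∃ b', P.b < -b' ∧ P.c (-b') = ray (-1) b' ∧ ∃ M L : ℝ, 0 ≤ M ∧ 0 ≤ L ∧ ∀ᶠ lam in 𝓝 lam₀,
      RayBound A S Om lam (-1) b' (|lam₀.im| / 2) M L (fun x => P.Z x lam) (fun x => P.H x lam)
        (P.D lam) := by
  obtain ⟨M, hMT, hM⟩ := P.exists_tail
  have habs : ∀ t < min (-P.b) (-|M|), M ≤ |-t| := fun t ht => by
    rw [abs_neg, abs_of_neg ((ht.trans_le (min_le_right _ _)).trans_le
      (neg_nonpos.2 (abs_nonneg M)))]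
    linarith [ht.trans_le (min_le_right _ _), le_abs_self M]
  have hc : ∀ t < min (-P.b) (-|M|), ray (-1) t = P.c (-t) := fun t ht => by
    rw [P.c_real (-t) (hMT.trans (habs t ht)), ray, neg_one_mul]
  have hlt : ∀ t < min (-P.b) (-|M|), P.b < -t := fun t ht =>
    lt_neg_of_lt_neg (ht.trans_le (min_le_left _ _))
  obtain ⟨b', hb', h⟩ := P.branch.exists_rayBound hAS hlam₀ (Or.inr rfl) (b := min (-P.b) (-|M|))
    (hM.mono fun lam hl t ht => by
      rw [ray, neg_one_mul]
      exact hl (-t) (habs t ht)) (by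
      intro s hs t ht hst
      simp only [hc s hs, hc t ht]
      exact P.progressive_right.antitoneOn (hlt t ht) (hlt s hs) (neg_le_neg hst))
  exact ⟨b', hlt b' hb', (hc b' hb').symm, h⟩

theorem increasesTo_left {s : ℝ} (hs : s < P.a) :
    IncreasesTo (P.D lam₀) (fun y => P.Z y lam₀) (P.c s) (P.α lam₀) := by
  have hlt : ∀ u ∈ Ico (0 : ℝ) 1, s + u * (P.a - s) < P.a := fun u hu => by nlinarith [hu.2]
  refine ⟨fun u => P.c (s + u * (P.a - s)), (P.continuous_c.comp (by fun_prop)).continuousOn,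
    by simp, by simp [P.c_a], fun u hu => ?_, fun u hu v hv huv => ?_⟩
  · have h := hlt u hu
    exact P.c_mem_cutDomain _ h.ne (h.trans P.a_lt_g).ne ((h.trans P.a_lt_g).trans P.g_lt_b).ne
  · exact P.progressive_left (hlt u hu) (hlt v hv) (by nlinarith)

theorem increasesTo_right {s : ℝ} (hs : P.b < s) :
    IncreasesTo (P.D lam₀) (fun y => P.Z y lam₀) (P.c s) (P.β lam₀) := by
  have hlt : ∀ u ∈ Ico (0 : ℝ) 1, P.b < s + u * (P.b - s) := fun u hu => by nlinarith [hu.2]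
  refine ⟨fun u => P.c (s + u * (P.b - s)), (P.continuous_c.comp (by fun_prop)).continuousOn,
    by simp, by simp [P.c_b], fun u hu => ?_, fun u hu v hv huv => ?_⟩
  · have h := hlt u hu
    exact P.c_mem_cutDomain _ (P.a_lt_g.trans (P.g_lt_b.trans h)).ne' (P.g_lt_b.trans h).ne' h.ne'
  · exact P.progressive_right (hlt v hv) (hlt u hu) (by nlinarith)

/-! ### The orientation of the three connections -/

section Orientation

variable {l : Filter ℝ} {s : ℝ} {t₀ L : ℂ}

theorem mem_D_of_Ioo_left {u : ℝ} (hu : u ∈ Ioo P.a P.g) : P.c u ∈ P.D lam₀ :=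
  P.c_mem_cutDomain u hu.1.ne' hu.2.ne (hu.2.trans P.g_lt_b).ne

theorem mem_D_of_Ioo_right {u : ℝ} (hu : u ∈ Ioo P.g P.b) : P.c u ∈ P.D lam₀ :=
  P.c_mem_cutDomain u (P.a_lt_g.trans hu.1).ne' hu.1.ne' hu.2.ne

theorem re_left {u : ℝ} (hu : u ∈ Ioo P.a P.g) : (P.Z (P.c u) lam₀).re = (P.Zγ lam₀).re :=
  P.stokes_middle u ⟨hu.1, hu.2.trans P.g_lt_b⟩ hu.2.ne

theorem re_right {u : ℝ} (hu : u ∈ Ioo P.g P.b) : (P.Z (P.c u) lam₀).re = (P.Zγ lam₀).re :=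
  P.stokes_middle u ⟨P.a_lt_g.trans hu.1, hu.2⟩ hu.1.ne'

theorem tendsto_c (hl : l ≤ 𝓝 s) (hs : P.c s = t₀) : Tendsto P.c l (𝓝 t₀) :=
  hs ▸ (P.continuous_c.tendsto s).mono_left hl

theorem tendsto_Z_c (hl : l ≤ 𝓝 s) (hs : P.c s = t₀) (hD : ∀ᶠ u in l, P.c u ∈ P.D lam₀)
    (hL : Tendsto (fun y => P.Z y lam₀) (𝓝[P.D lam₀] t₀) (𝓝 L)) :
    Tendsto (fun u => P.Z (P.c u) lam₀) l (𝓝 L) :=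
  hL.comp (tendsto_nhdsWithin_iff.2 ⟨P.tendsto_c hl hs, hD⟩)

theorem tendsto_left_α : Tendsto (fun u => P.Z (P.c u) lam₀) (𝓝[>] P.a) (𝓝 (P.Zα lam₀)) :=
  P.tendsto_Z_c nhdsWithin_le_nhds P.c_a (mem_of_superset (Ioo_mem_nhdsGT P.a_lt_g)
    fun _ => P.mem_D_of_Ioo_left) (P.tendsto_Zα _ P.mem_U₀)

theorem tendsto_left_γ : Tendsto (fun u => P.Z (P.c u) lam₀) (𝓝[<] P.g) (𝓝 (P.Zγ lam₀)) :=
  P.tendsto_Z_c nhdsWithin_le_nhds P.c_g (mem_of_superset (Ioo_mem_nhdsLT P.a_lt_g)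
    fun _ => P.mem_D_of_Ioo_left) (P.tendsto_Zγ _ P.mem_U₀)

theorem tendsto_right_γ : Tendsto (fun u => P.Z (P.c u) lam₀) (𝓝[>] P.g) (𝓝 (P.Zγ lam₀)) :=
  P.tendsto_Z_c nhdsWithin_le_nhds P.c_g (mem_of_superset (Ioo_mem_nhdsGT P.g_lt_b)
    fun _ => P.mem_D_of_Ioo_right) (P.tendsto_Zγ _ P.mem_U₀)

theorem tendsto_right_β : Tendsto (fun u => P.Z (P.c u) lam₀) (𝓝[<] P.b) (𝓝 (P.Zβ lam₀)) :=
  P.tendsto_Z_c nhdsWithin_le_nhds P.c_b (mem_of_superset (Ioo_mem_nhdsLT P.g_lt_b)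
    fun _ => P.mem_D_of_Ioo_right) (P.tendsto_Zβ _ P.mem_U₀)

theorem re_Zα : (P.Zα lam₀).re = (P.Zγ lam₀).re :=
  tendsto_nhds_unique ((continuous_re.tendsto _).comp P.tendsto_left_α)
    (tendsto_const_nhds.congr' (mem_of_superset (Ioo_mem_nhdsGT P.a_lt_g)
      fun _ hu => (P.re_left hu).symm))

theorem re_Zβ : (P.Zβ lam₀).re = (P.Zγ lam₀).re :=
  tendsto_nhds_unique ((continuous_re.tendsto _).comp P.tendsto_right_β)
    (tendsto_const_nhds.congr' (mem_of_superset (Ioo_mem_nhdsLT P.g_lt_b)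
      fun _ hu => (P.re_right hu).symm))

theorem im_monotone {s t : ℝ} (hst : s < t) (hD : ∀ u ∈ Ioo s t, P.c u ∈ P.D lam₀)
    (hre : ∀ u ∈ Ioo s t, (P.Z (P.c u) lam₀).re = (P.Zγ lam₀).re) :
    StrictMonoOn (fun u => (P.Z (P.c u) lam₀).im) (Ioo s t) ∨
      StrictAntiOn (fun u => (P.Z (P.c u) lam₀).im) (Ioo s t) :=
  strictMonoOn_im_or_strictAntiOn_im (P.isOpen_D P.mem_U₀)
    (fun _ hx => (P.isBranchAt P.mem_U₀ hx).hasDerivAt)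
    (fun _ hx => (P.isBranchAt P.mem_U₀ hx).deriv_ne) P.continuous_c P.injective_c hD hre hst

theorem notMem_stokesRegion_comm {D : Set ℂ} {f : ℂ → ℂ} {r : ℝ} {x y : ℂ}
    (h : x ∉ stokesRegion D f r y) : y ∉ stokesRegion D f r x := fun hy => h <| by
  rw [← stokesRegion_eq hy]
  exact mem_connectedComponentIn (connectedComponentIn_nonempty_iff.1 ⟨_, hy⟩)

end Orientation

/-- All the transports of WKB asymptotics that enter the quantization condition. The branch cuts at
the three turning points are crossed in directions that are not independent: `Im Z` is monotone
along the Stokes line from `α` to `γ` and along that from `γ` to `β`, so that a single sign `o`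
describes all of them. -/
theorem exists_reach (hAS : IsPotentialPair A S Om) {s s' : ℝ} (hs : s < P.a) (hs' : P.b < s')
    {σα σβ σγ : ℂ} (hα : TypeSign A S lam₀ (P.α lam₀) σα) (hβ : TypeSign A S lam₀ (P.β lam₀) σβ)
    (hγ : TypeSign A S lam₀ (P.γ lam₀) σγ) :
    ∃ o : ℝ, (o = 1 ∨ o = -1) ∧
      Reach A S Om lam₀ (P.branch.st (P.c s)) (P.branch.st P.x₁α) ∧
      Reach A S Om lam₀ (P.branch.st (P.c s)) (fun lam =>
        ⟨P.x₂, 2 * P.Zα lam - P.Z P.x₂ lam, (o * σα * I) * P.H P.x₂ lam⟩) ∧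
      Reach A S Om lam₀ (P.branch.st (P.c s')) (P.branch.st P.x₁β) ∧
      Reach A S Om lam₀ (P.branch.st (P.c s')) (fun lam =>
        ⟨P.x₂, 2 * P.Zβ lam - P.Z P.x₂ lam, -(o * σβ * I) * P.H P.x₂ lam⟩) ∧
      Reach A S Om lam₀ (P.branch.st P.x₂) (P.branch.st P.x₁α) ∧
      Reach A S Om lam₀ (P.branch.st P.x₂) (P.branch.st P.x₁β) ∧
      Reach A S Om lam₀ (fun lam => ⟨P.x₁α, -P.Z P.x₁α lam, I * P.H P.x₁α lam⟩)
        (fun lam => ⟨P.x₁β, P.Z P.x₁β lam - 2 * P.Zγ lam, (o * σγ) * P.H P.x₁β lam⟩) := by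
  have hl := P.mem_U₀
  have hrot : ∀ y, (P.branch.rot I Complex.I_pow_four).Z y lam₀ = -P.Z y lam₀ := fun y => by
    simp [BranchFamily.rot, branch]
  have hregion : ∀ x, stokesRegion (P.D lam₀)
      (fun y => (P.branch.rot I Complex.I_pow_four).Z y lam₀) (-P.Zγ lam₀).re x
      = stokesRegion (P.D lam₀) (fun y => P.Z y lam₀) (P.Zγ lam₀).re x := fun x =>
    stokesRegion_neg (fun y _ => by rw [hrot, neg_re]) _ x
  obtain ⟨oα, hoα, iα, -, rα, cα⟩ := (P.hasConnection_α hAS hα).exists_reach hAS hα.eq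
    (P.tendsto_Zα _ hl) (P.increasesTo_left hs) P.x₂_to_α P.x₁α_to_α (notMem_stokesRegion_comm (by
      rw [P.re_Zα]
      exact P.left_not_up s hs))
  obtain ⟨oβ, hoβ, iβ, -, rβ, cβ⟩ := (P.hasConnection_β hAS hβ).exists_reach hAS hβ.eq
    (P.tendsto_Zβ _ hl) (P.increasesTo_right hs') P.x₂_to_β P.x₁β_to_β (notMem_stokesRegion_comm (by
      rw [P.re_Zβ]
      exact P.right_not_up s' hs'))
  obtain ⟨oγ, hoγ, iγα, iγβ, rγ, cγ⟩ := (P.hasConnection_γ hAS hγ).exists_reach hAS hγ.eq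
    ((P.tendsto_Zγ _ hl).neg.congr fun y => (hrot y).symm)
    (P.x₁α_to_γ.neg fun y _ => by rw [hrot, neg_re])
    (P.x₁β_to_γ.neg fun y _ => by rw [hrot, neg_re])
    (P.x₂_to_γ.neg fun y _ => by rw [hrot, neg_re]) fun h =>
      P.down_ne ((hregion _).le h)
  -- On each of the two Stokes lines, both orientations are read off from the sign of `Im Z` relative
  -- to its limit at the respective end.
  have hα' : oα = -oγ := by
    have hmul : oα * oγ < 0 := by
      refine mul_neg_of_tendsto P.a_lt_g
        (P.im_monotone P.a_lt_g (fun _ => P.mem_D_of_Ioo_left) fun _ => P.re_left)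
        ((continuous_im.tendsto _).comp P.tendsto_left_α)
        ((continuous_im.tendsto _).comp P.tendsto_left_γ) ?_ ?_
      · filter_upwards [(P.tendsto_c nhdsWithin_le_nhds P.c_a).eventually cα,
          Ioo_mem_nhdsGT P.a_lt_g] with u hu huI
        refine (hu (P.mem_D_of_Ioo_left huI) ((P.re_left huI).trans P.re_Zα.symm)).1 ?_
        rw [P.re_Zα]
        exact P.x₂_region ⟨u, ⟨huI.1, huI.2.trans P.g_lt_b⟩, rfl⟩
      · filter_upwards [(P.tendsto_c nhdsWithin_le_nhds P.c_g).eventually cγ,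
          Ioo_mem_nhdsLT P.a_lt_g] with u hu huI
        have := (hu (P.mem_D_of_Ioo_left huI) (by
          simp only [hrot, neg_re, P.re_left huI])).2 (closure_mono (hregion _).ge
            (P.x₁α_region ⟨u, huI, rfl⟩))
        rw [hrot, sub_im, neg_im, neg_im] at this
        linarith
    rcases hoα with rfl | rfl <;> rcases hoγ with rfl | rfl <;> first | (norm_num; done) | norm_num at hmul
  have hβ' : oβ = oγ := by
    have hmul : -oγ * oβ < 0 := by
      refine mul_neg_of_tendsto P.g_lt_b
        (P.im_monotone P.g_lt_b (fun _ => P.mem_D_of_Ioo_right) fun _ => P.re_right)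
        ((continuous_im.tendsto _).comp P.tendsto_right_γ)
        ((continuous_im.tendsto _).comp P.tendsto_right_β) ?_ ?_
      · filter_upwards [(P.tendsto_c nhdsWithin_le_nhds P.c_g).eventually cγ,
          Ioo_mem_nhdsGT P.g_lt_b] with u hu huI
        have := (hu (P.mem_D_of_Ioo_right huI) (by
          simp only [hrot, neg_re, P.re_right huI])).1 (closure_mono (hregion _).ge
            (P.x₁β_region ⟨u, huI, rfl⟩))
        rw [hrot, sub_im, neg_im, neg_im] at this
        linarith
      · filter_upwards [(P.tendsto_c nhdsWithin_le_nhds P.c_b).eventually cβ,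
          Ioo_mem_nhdsLT P.g_lt_b] with u hu huI
        refine (hu (P.mem_D_of_Ioo_right huI) ((P.re_right huI).trans P.re_Zβ.symm)).1 ?_
        rw [P.re_Zβ]
        exact P.x₂_region ⟨u, ⟨P.a_lt_g.trans huI.1, huI.2⟩, rfl⟩
    rcases hoβ with rfl | rfl <;> rcases hoγ with rfl | rfl <;> first | (norm_num; done) | norm_num at hmul
  refine ⟨oγ, hoγ, P.branch.reach_of_inc hAS iα, ?_, P.branch.reach_of_inc hAS iβ, ?_,
    P.branch.reach_of_inc hAS (iγα.rev fun y _ => ?_),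
    P.branch.reach_of_inc hAS (iγβ.rev fun y _ => ?_), ?_⟩
  · rw [hα'] at rα
    refine rα.of_eventuallyEq .rfl (.of_forall fun lam => ?_)
    simp only [branch, Complex.ofReal_neg, neg_mul, neg_neg]
  · rw [hβ'] at rβ
    exact rβ
  iterate 2
    · rw [hrot, neg_re, neg_neg]
      rfl
  · refine rγ.of_eventuallyEq (.of_forall fun lam => ?_) (.of_forall fun lam => ?_)
    · simp [BranchFamily.st, BranchFamily.rot, branch]
    · simp only [BranchFamily.rot, branch, I_sq]
      congr 1
      · ring
      · linear_combination (oγ * σγ * P.H P.x₁β lam) * I_sq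

end BifurcationData

/-! ### Wronskians of exact WKB solutions -/

section Wronskian

variable {eps : ℝ} {lam : ℂ} {D : Set ℂ} {z H : ℂ → ℂ} {f u v : ℂ → Fin 2 → ℂ} {x x₀ : ℂ}

theorem wr_swap (f g : ℂ → Fin 2 → ℂ) (x : ℂ) : wr f g x = -wr g f x := by
  unfold wr; ring

/-- The reduced form of an exact WKB solution at its base point. -/
theorem IsExactWKB.red_eq (hb : ∀ x ∈ D, IsBranchAt A S Om lam z H x) (hx₀ : x₀ ∈ D) {s κ : ℂ}
    (hκ : (s = 1 ∧ κ = 1) ∨ (s = -1 ∧ κ = I))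
    (hu : IsExactWKB A S Om D eps lam s z H (𝓝 x₀) u) :
    redC S eps u x₀ = exp (κ ^ 2 * z x₀ / eps) * (H x₀)⁻¹ ∧
      redD S eps u x₀ = -(exp (κ ^ 2 * z x₀ / eps) * (I * κ ^ 2 * H x₀)) := by
  obtain ⟨hp, hq⟩ := hu.symbol_eq hb hκ
  have hκ0 : κ ≠ 0 := by rcases hκ with ⟨-, rfl⟩ | ⟨-, rfl⟩ <;> simp
  have hH := (hb x₀ hx₀).ne
  obtain ⟨h1, h2⟩ := eq_of_pco_qco (eps := eps) (z := κ ^ 2 * z x₀) (c := redC S eps u x₀)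
    (d := redD S eps u x₀) (mul_ne_zero hκ0 hH)
  rw [hp, hq] at h1 h2
  constructor
  · rw [h1]
    field_simp
    ring
  · rw [h2]
    ring

/-- The Wronskian with an exact WKB solution reads off a coefficient of the symbol at the base
point. -/
theorem IsExactWKB.wr_eq_pco (hb : ∀ x ∈ D, IsBranchAt A S Om lam z H x) (hx₀ : x₀ ∈ D) {s κ κ' : ℂ}
    (hκ' : (s = 1 ∧ κ' = 1) ∨ (s = -1 ∧ κ' = I)) (hκ : κ ^ 2 = -1) {ζ h : ℂ}
    (hζ : κ ^ 2 * ζ = κ' ^ 2 * z x₀) (hh : κ * h = κ' * H x₀)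
    (hv : IsExactWKB A S Om D eps lam s z H (𝓝 x₀) v) :
    wr f v x₀ = -4 * I * κ * κ' * pco eps ζ h (redC S eps f x₀) (redD S eps f x₀) := by
  obtain ⟨h1, h2⟩ := hv.red_eq hb hx₀ hκ'
  have hH := (hb x₀ hx₀).ne
  have hκ0 : κ ≠ 0 := fun h0 => by simp [h0] at hκ
  have hκ'0 : κ' ≠ 0 := by rcases hκ' with ⟨-, rfl⟩ | ⟨-, rfl⟩ <;> simp
  have hHe : H x₀ = κ * h / κ' := by rw [hh]; field_simp
  have hh0 : h ≠ 0 := fun h0 => hH (by rw [hHe, h0]; simp)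
  have he : -ζ = κ' ^ 2 * z x₀ := by linear_combination hζ - ζ * hκ
  rw [wr_eq S eps, h1, h2, pco, he, hHe]
  have hκi : κ⁻¹ = -κ := by
    field_simp
    linear_combination hκ
  rw [show (κ * h / κ')⁻¹ = -κ * κ' / h by rw [← hκi]; field_simp,
    show I * κ' ^ 2 * (κ * h / κ') = I * κ' * κ * h by field_simp]
  field_simp
  linear_combination (4 * redD S eps f x₀) * I_sq

/-- The dependence of an exact WKB solution on the origin of the phase. -/
theorem wr_sub_const (hAS : IsPotentialPair A S Om) (heps : eps ≠ 0) {m m' : ℂ}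
    (hb : ∀ m, ∀ x ∈ D, IsBranchAt A S Om lam (fun x => z x - m) H x) (hx₀ : x₀ ∈ D) {s κ : ℂ}
    (hκ : (s = 1 ∧ κ = 1) ∨ (s = -1 ∧ κ = I))
    (hf : IsDiracSolution A S Om eps lam f)
    (hu : IsExactWKB A S Om D eps lam s (fun x => z x - m) H (𝓝 x₀) u)
    (hv : IsExactWKB A S Om D eps lam s (fun x => z x - m') H (𝓝 x₀) v) (hx : x ∈ Om) :
    wr f v x = exp (κ ^ 2 * (m - m') / eps) * wr f u x := by
  have hm := (hb m x₀ hx₀).mem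
  rw [wr_const hAS heps hf hu.1 hx hm, wr_const hAS heps hf hv.1 hx hm, wr_eq S eps, wr_eq S eps]
  obtain ⟨h1, h2⟩ := hu.red_eq (hb m) hx₀ hκ
  obtain ⟨h3, h4⟩ := hv.red_eq (hb m') hx₀ hκ
  have he : exp (κ ^ 2 * (z x₀ - m') / eps)
      = exp (κ ^ 2 * (m - m') / eps) * exp (κ ^ 2 * (z x₀ - m) / eps) := by
    rw [← exp_add]
    congr 1
    ring
  rw [h1, h2, h3, h4, he]
  ring

end Wronskian

theorem IsBranchAt.sub_const {lam x : ℂ} {z H : ℂ → ℂ} (h : IsBranchAt A S Om lam z H x) (m : ℂ) :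
    IsBranchAt A S Om lam (fun y => z y - m) H x :=
  { h with hasDerivAt := h.hasDerivAt.sub_const m }

theorem RayBound.sub_const {lam : ℂ} {e b c M L : ℝ} {z H : ℂ → ℂ} {D : Set ℂ}
    (h : RayBound A S Om lam e b c M L z H D) (m : ℂ) :
    RayBound A S Om lam e b c M L (fun y => z y - m) H D :=
  { h with branch := fun x hx => (h.branch x hx).sub_const m }

theorem Reach.sub_const {s t : ℂ → WState} (h : Reach A S Om lam₀ s t) (m : ℂ → ℂ) :
    Reach A S Om lam₀ (fun lam => ⟨(s lam).pt, (s lam).ph - m lam, (s lam).am⟩)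
      (fun lam => ⟨(t lam).pt, (t lam).ph - m lam, (t lam).am⟩) :=
  h.congr (.of_forall fun lam => ⟨-m lam, 1, Or.inl rfl, by simp [sub_eq_add_neg],
    by simp [sub_eq_add_neg]⟩)

/-! ### Asymptotics of Wronskians -/

/-- If the asymptotics of the exact WKB solutions `u` can be transported to the base point of the
exact WKB solutions `v`, then the Wronskian of `u` and `v` is constant up to `O(eps)`. -/
theorem exists_wr_estimate (hAS : IsPotentialPair A S Om) (B : BranchFamily A S Om lam₀)
    {s t : ℂ → WState} (hr : Reach A S Om lam₀ s t) {m : ℂ → ℂ} {σ₀ : ℂ} {l : Filter ℂ}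
    {K₀ : ℝ} (hK₀ : 0 ≤ K₀) {k₀ : ℂ} (hk₀ : ‖k₀‖ = 1)
    (hQ : ∀ᶠ p : ℂ × ℝ in 𝓝 lam₀ ×ˢ 𝓝[>] 0, ∀ u,
      IsExactWKB A S Om (B.D p.1) p.2 p.1 σ₀ (fun x => B.Z x p.1 - m p.1) (fun x => B.H x p.1) l u →
      IsDiracSolution A S Om p.2 p.1 u ∧ Near K₀ p.2 k₀ (s p.1) (redC S p.2 u) (redD S p.2 u))
    {x₀ : ℂ} (hx₀ : x₀ ∈ B.D lam₀) {σ κ κ' : ℂ}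
    (hκ' : (σ = 1 ∧ κ' = 1) ∨ (σ = -1 ∧ κ' = I)) (hκ : κ ^ 2 = -1)
    (ht : ∀ lam, (t lam).pt = x₀ ∧ κ ^ 2 * (t lam).ph = κ' ^ 2 * (B.Z x₀ lam - m lam) ∧
      κ * (t lam).am = κ' * B.H x₀ lam) {c : ℂ} (hc : -4 * I * κ * κ' * k₀ = c) :
    ∀ᶠ K : ℝ in atTop, ∀ᶠ p : ℂ × ℝ in 𝓝 lam₀ ×ˢ 𝓝[>] 0, ∀ u v,
      IsExactWKB A S Om (B.D p.1) p.2 p.1 σ₀ (fun x => B.Z x p.1 - m p.1) (fun x => B.H x p.1) l u →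
      IsExactWKB A S Om (B.D p.1) p.2 p.1 σ (fun x => B.Z x p.1 - m p.1) (fun x => B.H x p.1)
        (𝓝 x₀) v → ∀ x ∈ Om, ‖wr u v x - c‖ ≤ K * p.2 := by
  obtain ⟨K, hK, e, he, h⟩ := hr K₀ hK₀
  filter_upwards [eventually_ge_atTop (4 * K)] with K' hK'
  have hD : ∀ᶠ lam in 𝓝 lam₀, x₀ ∈ B.D lam := by
    filter_upwards [eventually_forall_mem (isCompact_singleton (x := x₀))
      (D := B.D) (l := lam₀) (by rintro y rfl; exact B.mem_nhds y hx₀)] with lam hl using hl x₀ rfl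
  filter_upwards [hQ, (h.and (hD.and B.good)).prod_mk
    (Ioo_mem_nhdsGT he : ∀ᶠ x in 𝓝[>] (0 : ℝ), x ∈ Ioo 0 e)]
  rintro ⟨lam, eps⟩ hQ ⟨⟨h, hxD, hg⟩, heps⟩ u v hu hv x hx
  obtain ⟨hus, hn⟩ := hQ u hu
  have hgm : ∀ y ∈ B.D lam, IsBranchAt A S Om lam (fun y => B.Z y lam - m lam)
      (fun y => B.H y lam) y := fun y hy => (hg y hy).sub_const _
  have h1 := (h eps heps.1 heps.2 _ _ (hus.isReduced heps.1.ne' hAS.isOpen hAS.holo_S) k₀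
    (norm_ne_zero_iff.1 (by rw [hk₀]; exact one_ne_zero)) hn).1
  obtain ⟨h2, h3, h4⟩ := ht lam
  rw [h2, hk₀, mul_one] at h1
  rw [wr_const hAS heps.1.ne' hus hv.1 hx (hg x₀ hxD).mem, hv.wr_eq_pco hgm hxD hκ' hκ h3 h4,
    ← hc, ← mul_sub, norm_mul]
  have hκn : ‖κ‖ = 1 := by
    have := congrArg norm hκ
    rw [norm_pow, norm_neg, norm_one] at this
    exact (pow_eq_one_iff_of_nonneg (norm_nonneg _) two_ne_zero).1 this
  have hκ'n : ‖κ'‖ = 1 := by rcases hκ' with ⟨-, rfl⟩ | ⟨-, rfl⟩ <;> simp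
  have : ‖-4 * I * κ * κ'‖ = 4 := by simp [hκn, hκ'n]
  rw [this]
  refine le_trans ?_ (mul_le_mul_of_nonneg_right hK' (le_of_lt heps.1))
  rw [mul_assoc]
  exact mul_le_mul_of_nonneg_left h1 (by norm_num)

/-- Existence and asymptotics of the exact WKB solutions with base point at infinity. -/
theorem eventually_ray_symbol (hAS : IsPotentialPair A S Om) (B : BranchFamily A S Om lam₀)
    {e b c M L : ℝ} (he : e = 1 ∨ e = -1) (hc : 0 < c) (hM : 0 ≤ M) (hL : 0 ≤ L)
    (h : ∀ᶠ lam in 𝓝 lam₀, RayBound A S Om lam e b c M L (fun x => B.Z x lam) (fun x => B.H x lam)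
      (B.D lam)) (m : ℂ → ℂ) :
    ∀ᶠ p : ℂ × ℝ in 𝓝 lam₀ ×ˢ 𝓝[>] 0,
      (∃ u, IsExactWKB A S Om (B.D p.1) p.2 p.1 1 (fun x => B.Z x p.1 - m p.1)
        (fun x => B.H x p.1) (map (ray e) atBot) u) ∧
      ∀ u, IsExactWKB A S Om (B.D p.1) p.2 p.1 1 (fun x => B.Z x p.1 - m p.1) (fun x => B.H x p.1)
        (map (ray e) atBot) u →
      (∀ i, MemLp (fun t => u (ray e t) i) 2 (volume.restrict (Iic b))) ∧
      IsDiracSolution A S Om p.2 p.1 u ∧ Near ((1 + L) * (M / c)) p.2 1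
        ⟨ray e b, B.Z (ray e b) p.1 - m p.1, B.H (ray e b) p.1⟩ (redC S p.2 u) (redD S p.2 u) := by
  have h0 : 0 < c / (M * L + 1) := by positivity
  filter_upwards [h.prod_mk (Ioo_mem_nhdsGT h0 : ∀ᶠ x in 𝓝[>] (0 : ℝ), x ∈ Ioo 0 (c / (M * L + 1)))]
  rintro ⟨lam, eps⟩ ⟨h, heps⟩
  have h' := h.sub_const (m lam)
  refine ⟨h'.exists_isExactWKB hAS he hc heps.1, fun u hu => ?_⟩
  have hsmall : eps * M * L / c ≤ 1 := by
    rw [div_le_one hc]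
    have := (lt_div_iff₀ (by positivity)).1 heps.2
    have h1 : 0 < eps := heps.1
    simp only at this ⊢
    linarith
  obtain ⟨h1, h2⟩ := h'.norm_symbol_le hAS he hc hM heps.1 hsmall hu b le_rfl
  have h3 : 0 ≤ eps * M / c := div_nonneg (mul_nonneg (le_of_lt heps.1) hM) hc.le
  have h4 : (1 + L) * (M / c) * eps * ‖(1 : ℂ)‖ = eps * M / c + L * (eps * M / c) := by
    rw [norm_one]
    ring
  refine ⟨h'.memLp hAS he hc hM heps.1 hsmall hu, hu.1, h2.trans ?_, h1.trans ?_⟩ <;> rw [h4]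
  · linarith
  · linarith [mul_nonneg hL h3]

/-- The symbol at a finite base point is exact, so that `Near` holds with the constant `0`. -/
theorem eventually_nhds_symbol (B : BranchFamily A S Om lam₀) {y₀ : ℂ} (m : ℂ → ℂ) {σ κ : ℂ}
    (hκ : (σ = 1 ∧ κ = 1) ∨ (σ = -1 ∧ κ = I)) :
    ∀ᶠ p : ℂ × ℝ in 𝓝 lam₀ ×ˢ 𝓝[>] 0,
      ∀ u, IsExactWKB A S Om (B.D p.1) p.2 p.1 σ (fun x => B.Z x p.1 - m p.1) (fun x => B.H x p.1)
        (𝓝 y₀) u → IsDiracSolution A S Om p.2 p.1 u ∧ Near 0 p.2 κ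
        ⟨y₀, κ ^ 2 * (B.Z y₀ p.1 - m p.1), κ * B.H y₀ p.1⟩ (redC S p.2 u) (redD S p.2 u) := by
  filter_upwards [B.good.prod_inl _] with p hp u hu
  obtain ⟨h1, h2⟩ := hu.symbol_eq (fun x hx => (hp x hx).sub_const _) hκ
  refine ⟨hu.1, ?_, ?_⟩
  · simp only [h1]
    simp
  · simp only [h2]
    simp

theorem norm_ratio_sub_le {a b c d a' b' c' d' r : ℂ} {δ : ℝ} (hδ : δ ≤ 2) (ha : ‖a - a'‖ ≤ δ)
    (hb : ‖b - b'‖ ≤ δ) (hc : ‖c - c'‖ ≤ δ) (hd : ‖d - d'‖ ≤ δ) (ha' : ‖a'‖ = 4) (hb' : ‖b'‖ = 4)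
    (hc' : ‖c'‖ = 4) (hd' : ‖d'‖ = 4) (hr : ‖r‖ = 1) (h : a' * b' = r * (c' * d')) :
    ‖a * b / (c * d) - r‖ ≤ 5 * δ := by
  have hδ0 : 0 ≤ δ := (norm_nonneg _).trans ha
  have hup : ∀ {w w' : ℂ}, ‖w - w'‖ ≤ δ → ‖w'‖ = 4 → ‖w‖ ≤ 6 := fun {w w'} h1 h2 => by
    linarith [norm_sub_norm_le w w']
  have hlow : ∀ {w w' : ℂ}, ‖w - w'‖ ≤ δ → ‖w'‖ = 4 → 2 ≤ ‖w‖ := fun {w w'} h1 h2 => by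
    linarith [norm_sub_norm_le w' w, norm_sub_rev w w']
  have hprod : ∀ {w w' y y' : ℂ}, ‖w - w'‖ ≤ δ → ‖y - y'‖ ≤ δ → ‖w'‖ = 4 → ‖y'‖ = 4 →
      ‖w * y - w' * y'‖ ≤ 10 * δ := fun {w w' y y'} h1 h2 h3 h4 => by
    rw [show w * y - w' * y' = (w - w') * y + w' * (y - y') by ring]
    refine (norm_add_le _ _).trans ?_
    rw [norm_mul, norm_mul, h3]
    nlinarith [mul_le_mul h1 (hup h2 h4) (norm_nonneg _) hδ0]
  have hcd : 4 ≤ ‖c * d‖ := by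
    rw [norm_mul]
    nlinarith [hlow hc hc', hlow hd hd']
  have hcd0 : c * d ≠ 0 := norm_ne_zero_iff.1 (by linarith)
  rw [show a * b / (c * d) - r = ((a * b - a' * b') - r * (c * d - c' * d')) / (c * d) by
    rw [eq_div_iff hcd0, sub_mul, div_mul_cancel₀ _ hcd0, h]; ring, norm_div, div_le_iff₀ (by linarith)]
  refine (norm_sub_le _ _).trans ?_
  rw [norm_mul, hr, one_mul]
  nlinarith [hprod ha hb ha' hb', hprod hc hd hc' hd']

theorem negInfty_eq : negInfty = map (ray 1) atBot := by
  unfold negInfty ray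
  simp only [one_mul]

theorem posInfty_eq : posInfty = map (ray (-1)) atBot := by
  rw [posInfty, ← map_neg_atBot, map_map]
  congr 1
  ext t
  simp [ray]

/-! ### The quantization condition -/

theorem DecreasesTo.mem {D : Set ℂ} {f : ℂ → ℂ} {x t₀ : ℂ} (h : DecreasesTo D f x t₀) : x ∈ D := by
  obtain ⟨η, -, rfl, -, hD, -⟩ := h
  exact hD 0 ⟨le_rfl, one_pos⟩

theorem IncreasesTo.mem {D : Set ℂ} {f : ℂ → ℂ} {x t₀ : ℂ} (h : IncreasesTo D f x t₀) : x ∈ D := by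
  obtain ⟨η, -, rfl, -, hD, -⟩ := h
  exact hD 0 ⟨le_rfl, one_pos⟩

namespace BifurcationData

variable (P : BifurcationData A S Om lam₀)

theorem eventually_mem_D_fst {x : ℂ} (hx : x ∈ P.D lam₀) : ∀ᶠ lam in 𝓝 lam₀, x ∈ P.D lam := by
  filter_upwards [eventually_forall_mem (isCompact_singleton (x := x)) (D := P.D) (l := lam₀)
    (by rintro y rfl; exact P.eventually_mem_D hx)] with lam hl using hl x rfl

/-- Existence and asymptotics of the exact WKB solutions: the Wronskians of all pairs that enter the
quantization condition, up to `O(eps)`. -/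
theorem exists_wkb_asymptotics (hAS : IsPotentialPair A S Om) (hlam₀ : lam₀.im ≠ 0) {σα σβ σγ : ℂ}
    (hα : TypeSign A S lam₀ (P.α lam₀) σα) (hβ : TypeSign A S lam₀ (P.β lam₀) σβ)
    (hγ : TypeSign A S lam₀ (P.γ lam₀) σγ) :
    ∃ o : ℝ, (o = 1 ∨ o = -1) ∧ ∃ b b' K : ℝ, ∀ᶠ p : ℂ × ℝ in 𝓝 lam₀ ×ˢ 𝓝[>] 0,
      Nonempty (WKBFamily P p.1 p.2) ∧ ∀ F : WKBFamily P p.1 p.2,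
        (∀ i, MemLp (fun t => F.u₀α (ray 1 t) i) 2 (volume.restrict (Iic b))) ∧
        (∀ i, MemLp (fun t => F.u₀β (ray (-1) t) i) 2 (volume.restrict (Iic b'))) ∧
        ∀ x ∈ Om, ‖wr F.u₀α F.u₁α x - 4 * I‖ ≤ K * p.2 ∧
          ‖wr F.u₀β F.u₁β x - 4 * I‖ ≤ K * p.2 ∧
          ‖wr F.u₂γ F.u₁γα x - 4 * I‖ ≤ K * p.2 ∧
          ‖wr F.u₂γ F.u₁γβ x - 4 * I‖ ≤ K * p.2 ∧
          ‖wr F.u₀α F.u₂α x - -4 * (o * σα)‖ ≤ K * p.2 ∧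
          ‖wr F.u₀β F.u₂β x - 4 * (o * σβ)‖ ≤ K * p.2 ∧
          ‖wr F.u₁γα F.u₁γβ x - -4 * (o * σγ)‖ ≤ K * p.2 := by
  obtain ⟨b, hb, hcb, M, L, hM, hL, hray⟩ := P.exists_rayBound_left hAS hlam₀
  obtain ⟨b', hb', hcb', M', L', hM', hL', hray'⟩ := P.exists_rayBound_right hAS hlam₀
  obtain ⟨o, ho, r₁, r₂, r₃, r₄, r₅, r₆, r₇⟩ := P.exists_reach hAS hb hb' hα hβ hγ
  rw [hcb] at r₁ r₂
  rw [hcb'] at r₃ r₄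
  have hc : 0 < |lam₀.im| / 2 := half_pos (abs_pos.2 hlam₀)
  have hoo : (o : ℂ) ^ 2 = 1 := by rcases ho with rfl | rfl <;> simp
  have hsq : ∀ {σ : ℂ}, σ = 1 ∨ σ = -1 → (o * σ) ^ 2 = 1 := fun {σ} h => by
    rw [mul_pow, hoo]
    rcases h with rfl | rfl <;> norm_num
  have hII := I_sq
  have hplus : ((1 : ℂ) = 1 ∧ (1 : ℂ) = 1) ∨ ((1 : ℂ) = -1 ∧ (1 : ℂ) = I) :=
    Or.inl ⟨rfl, rfl⟩
  have hminus : ((-1 : ℂ) = 1 ∧ I = 1) ∨ ((-1 : ℂ) = -1 ∧ I = I) :=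
    Or.inr ⟨rfl, rfl⟩
  have hx₂ := P.x₂_to_γ.mem
  have hx₁α := P.x₁α_to_γ.mem
  have hx₁β := P.x₁β_to_γ.mem
  have q₁ := eventually_ray_symbol hAS P.branch (Or.inl rfl) hc hM hL hray P.Zα
  have q₂ := eventually_ray_symbol hAS P.branch (Or.inr rfl) hc hM' hL' hray' P.Zβ
  have p₁ := q₁.mono fun p h u hu => (h.2 u hu).2
  have p₂ := q₂.mono fun p h u hu => (h.2 u hu).2
  have q₃ := eventually_nhds_symbol P.branch (y₀ := P.x₂) P.Zγ hplus
  have q₄ := eventually_nhds_symbol P.branch (y₀ := P.x₁α) P.Zγ hminus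
  simp only [one_mul, one_pow] at q₃
  have hKL : 0 ≤ (1 + L) * (M / (|lam₀.im| / 2)) := by positivity
  have hKL' : 0 ≤ (1 + L') * (M' / (|lam₀.im| / 2)) := by positivity
  have w₁ := exists_wr_estimate hAS P.branch (r₁.sub_const P.Zα) hKL norm_one
    p₁ hx₁α (m := P.Zα) (κ := I) hminus hII
    (fun lam => ⟨rfl, rfl, rfl⟩) (c := 4 * I)
    (by linear_combination (-4 * I) * hII)
  have w₂ := exists_wr_estimate hAS P.branch (r₃.sub_const P.Zβ) hKL' norm_one
    p₂ hx₁β (m := P.Zβ) (κ := I) hminus hII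
    (fun lam => ⟨rfl, rfl, rfl⟩) (c := 4 * I)
    (by linear_combination (-4 * I) * hII)
  have w₃ := exists_wr_estimate hAS P.branch (r₅.sub_const P.Zγ) le_rfl norm_one q₃ hx₁α
    (m := P.Zγ) (κ := I) hminus hII (fun lam => ⟨rfl, rfl, rfl⟩) (c := 4 * I)
    (by linear_combination (-4 * I) * hII)
  have w₄ := exists_wr_estimate hAS P.branch (r₆.sub_const P.Zγ) le_rfl norm_one q₃ hx₁β
    (m := P.Zγ) (κ := I) hminus hII (fun lam => ⟨rfl, rfl, rfl⟩) (c := 4 * I)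
    (by linear_combination (-4 * I) * hII)
  have w₅ := exists_wr_estimate hAS P.branch (r₂.sub_const P.Zα) hKL norm_one
    p₁ hx₂ (m := P.Zα) (κ := -(o * σα * I)) hplus
    (by linear_combination I ^ 2 * hsq hα.eq + hII)
    (fun lam => ⟨rfl, by
      simp only [branch]
      linear_combination (P.Zα lam - P.Z P.x₂ lam) * (I ^ 2 * hsq hα.eq + hII), by
      simp only [branch]
      linear_combination (-P.H P.x₂ lam) * (I ^ 2 * hsq hα.eq + hII)⟩)
    (c := -4 * (o * σα)) (by linear_combination (4 * o * σα) * hII)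
  have w₆ := exists_wr_estimate hAS P.branch (r₄.sub_const P.Zβ) hKL' norm_one
    p₂ hx₂ (m := P.Zβ) (κ := o * σβ * I) hplus
    (by linear_combination I ^ 2 * hsq hβ.eq + hII)
    (fun lam => ⟨rfl, by
      simp only [branch]
      linear_combination (P.Zβ lam - P.Z P.x₂ lam) * (I ^ 2 * hsq hβ.eq + hII), by
      simp only [branch]
      linear_combination (-P.H P.x₂ lam) * (I ^ 2 * hsq hβ.eq + hII)⟩)
    (c := 4 * (o * σβ)) (by linear_combination (-4 * o * σβ) * hII)
  have w₇ := exists_wr_estimate hAS P.branch (r₇.sub_const fun lam => -P.Zγ lam) le_rfl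
    Complex.norm_I (q₄.mono fun p h u hu => by
      have e : I ^ 2 * (P.branch.Z P.x₁α p.1 - P.Zγ p.1) = -P.Z P.x₁α p.1 - -P.Zγ p.1 := by
        rw [hII]
        simp only [branch]
        ring
      rw [← e]
      exact h u hu) hx₁β (m := P.Zγ) (κ := o * σγ * I) hminus
    (by linear_combination I ^ 2 * hsq hγ.eq + hII)
    (fun lam => ⟨rfl, by
      simp only [branch]
      linear_combination (P.Z P.x₁β lam - P.Zγ lam) * (I ^ 2 * hsq hγ.eq), by
      simp only [branch]
      linear_combination (I * P.H P.x₁β lam) * hsq hγ.eq⟩)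
    (c := -4 * (o * σγ))
    (by linear_combination (-4 * o * σγ * (I ^ 2 - 1)) * hII)
  obtain ⟨K, ⟨⟨⟨⟨⟨⟨w₁, w₂⟩, w₃⟩, w₄⟩, w₅⟩, w₆⟩, w₇⟩⟩ :=
    ((((((w₁.and w₂).and w₃).and w₄).and w₅).and w₆).and w₇).exists
  refine ⟨o, ho, b, b', K, ?_⟩
  filter_upwards [w₁, w₂, w₃, w₄, w₅, w₆, w₇, q₁, q₂, ((P.isOpen_U₀.eventually_mem P.mem_U₀).and
    ((P.eventually_mem_D_fst hx₂).and ((P.eventually_mem_D_fst hx₁α).and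
      (P.eventually_mem_D_fst hx₁β)))).prod_mk (eventually_mem_nhdsWithin : ∀ᶠ e in 𝓝[>] (0 : ℝ), e ∈ Ioi 0)]
  rintro ⟨lam, eps⟩ w₁ w₂ w₃ w₄ w₅ w₆ w₇ ⟨q₁, q₁'⟩ ⟨q₂, q₂'⟩ ⟨⟨hl, m₂, m₁α, m₁β⟩, heps⟩
  refine ⟨?_, fun F => ?_⟩
  · have ex : ∀ (m : ℂ) {s κ x₀ : ℂ}, ((s = 1 ∧ κ = 1) ∨ (s = -1 ∧ κ = I)) →
        x₀ ∈ P.D lam → ∃ u, IsExactWKB A S Om (P.D lam) eps lam s (fun x => P.Z x lam - m)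
          (fun x => P.H x lam) (𝓝 x₀) u := fun m {s κ x₀} hκ hx =>
      exists_isExactWKB_nhds hAS heps (P.isOpen_D hl)
        (fun x hx => (P.isBranchAt hl hx).sub_const m) hx hκ
    obtain ⟨u₀α, h₀α⟩ := q₁
    obtain ⟨u₀β, h₀β⟩ := q₂
    obtain ⟨u₁α, h₁α⟩ := ex (P.Zα lam) hminus m₁α
    obtain ⟨u₂α, h₂α⟩ := ex (P.Zα lam) hplus m₂
    obtain ⟨u₁β, h₁β⟩ := ex (P.Zβ lam) hminus m₁β
    obtain ⟨u₂β, h₂β⟩ := ex (P.Zβ lam) hplus m₂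
    obtain ⟨u₁γα, h₁γα⟩ := ex (P.Zγ lam) hminus m₁α
    obtain ⟨u₁γβ, h₁γβ⟩ := ex (P.Zγ lam) hminus m₁β
    obtain ⟨u₂γ, h₂γ⟩ := ex (P.Zγ lam) hplus m₂
    exact ⟨⟨u₀α, u₁α, u₂α, u₀β, u₁β, u₂β, u₁γα, u₁γβ, u₂γ, negInfty_eq ▸ h₀α, h₁α, h₂α,
      posInfty_eq ▸ h₀β, h₁β, h₂β, h₁γα, h₁γβ, h₂γ⟩⟩
  · have h₀α := F.wkb_u₀α
    have h₀β := F.wkb_u₀β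
    rw [negInfty_eq] at h₀α
    rw [posInfty_eq] at h₀β
    exact ⟨(q₁' _ h₀α).1, (q₂' _ h₀β).1, fun x hx => ⟨w₁ _ _ h₀α F.wkb_u₁α x hx,
      w₂ _ _ h₀β F.wkb_u₁β x hx, w₃ _ _ F.wkb_u₂γ F.wkb_u₁γα x hx,
      w₄ _ _ F.wkb_u₂γ F.wkb_u₁γβ x hx, w₅ _ _ h₀α F.wkb_u₂α x hx, w₆ _ _ h₀β F.wkb_u₂β x hx,
      w₇ _ _ F.wkb_u₁γα F.wkb_u₁γβ x hx⟩⟩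

end BifurcationData

namespace WKBFamily

variable {P : BifurcationData A S Om lam₀} {lam : ℂ} {eps : ℝ}

/-- The algebra of the quantization condition. After all solutions have been expressed through those
with phase `z(·, λ, γ)`, it is the Plücker relation between the Wronskians of the vectors `u₀α`,
`u₀β`, `u₁γα`, `u₁γβ`, `u₂γ` of the plane. -/
theorem wr_eq_zero_iff (F : WKBFamily P lam eps) (hAS : IsPotentialPair A S Om) (heps : eps ≠ 0)
    (hl : lam ∈ P.U₀) (h₁α : P.x₁α ∈ P.D lam) (h₁β : P.x₁β ∈ P.D lam) (h₂ : P.x₂ ∈ P.D lam) {x : ℂ}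
    (hx : x ∈ Om) (hdα : F.denα x ≠ 0) (hdβ : F.denβ x ≠ 0) (hα : wr F.u₂γ F.u₁γα x ≠ 0)
    (hβ : wr F.u₂γ F.u₁γβ x ≠ 0) :
    wr F.u₀α F.u₀β x = 0 ↔ F.mα x * exp (2 * (P.Zγ lam - P.Zα lam) / eps) +
      F.mβ x * exp (2 * (P.Zγ lam - P.Zβ lam) / eps) = 1 := by
  have hb : ∀ m, ∀ x ∈ P.D lam, IsBranchAt A S Om lam (fun x => P.Z x lam - m)
    (fun x => P.H x lam) x := fun m x hx => (P.isBranchAt hl hx).sub_const m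
  have e1 := wr_sub_const hAS heps hb h₁α (Or.inr ⟨rfl, rfl⟩) F.wkb_u₀α.1 F.wkb_u₁α F.wkb_u₁γα hx
  have e2 := wr_sub_const hAS heps hb h₁β (Or.inr ⟨rfl, rfl⟩) F.wkb_u₀β.1 F.wkb_u₁β F.wkb_u₁γβ hx
  have e3 := wr_sub_const hAS heps hb h₂ (Or.inl ⟨rfl, rfl⟩) F.wkb_u₀α.1 F.wkb_u₂γ F.wkb_u₂α hx
  have e4 := wr_sub_const hAS heps hb h₂ (Or.inl ⟨rfl, rfl⟩) F.wkb_u₀β.1 F.wkb_u₂γ F.wkb_u₂β hx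
  rw [I_sq, show -1 * (P.Zα lam - P.Zγ lam) / (eps : ℂ) = (P.Zγ lam - P.Zα lam) / eps by
    ring] at e1
  rw [I_sq, show -1 * (P.Zβ lam - P.Zγ lam) / (eps : ℂ) = (P.Zγ lam - P.Zβ lam) / eps by
    ring] at e2
  rw [one_pow, one_mul] at e3 e4
  have hsq : ∀ w : ℂ, exp (2 * w / eps) = exp (w / eps) ^ 2 := fun w => by
    rw [← exp_nat_mul]
    congr 1
    push_cast
    ring
  have hE := exp_ne_zero ((P.Zγ lam - P.Zα lam) / eps)
  have hG := exp_ne_zero ((P.Zγ lam - P.Zβ lam) / eps)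
  rw [denα, wr_swap F.u₂α, e3] at hdα
  rw [denβ, wr_swap F.u₂β, e4] at hdβ
  rw [mα, mβ, denα, denβ, wr_swap F.u₂α, wr_swap F.u₂β, e3, e4, hsq, hsq]
  set E := exp ((P.Zγ lam - P.Zα lam) / eps)
  set G := exp ((P.Zγ lam - P.Zβ lam) / eps)
  obtain ⟨hαw, hvv⟩ := mul_ne_zero_iff.1 hdα
  have hβw := right_ne_zero_of_mul (neg_ne_zero.1 (left_ne_zero_of_mul hdβ))
  have hαw := right_ne_zero_of_mul (neg_ne_zero.1 hαw)
  have m1 : wr F.u₀α F.u₁α x * wr F.u₁γβ F.u₂γ x / (-(E * wr F.u₀α F.u₂γ x) * wr F.u₁γα F.u₁γβ x)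
      * E ^ 2 = -(wr F.u₀α F.u₁γα x * wr F.u₁γβ F.u₂γ x) /
        (wr F.u₀α F.u₂γ x * wr F.u₁γα F.u₁γβ x) := by
    rw [e1]
    field_simp
  have m2 : wr F.u₀β F.u₁β x * wr F.u₂γ F.u₁γα x / (-(G * wr F.u₀β F.u₂γ x) * wr F.u₁γα F.u₁γβ x)
      * G ^ 2 = -(wr F.u₀β F.u₁γβ x * wr F.u₂γ F.u₁γα x) /
        (wr F.u₀β F.u₂γ x * wr F.u₁γα F.u₁γβ x) := by
    rw [e2]
    field_simp
  have key : -(wr F.u₀α F.u₁γα x * wr F.u₁γβ F.u₂γ x) * wr F.u₀β F.u₂γ x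
      - wr F.u₀β F.u₁γβ x * wr F.u₂γ F.u₁γα x * wr F.u₀α F.u₂γ x
      - wr F.u₀α F.u₂γ x * wr F.u₀β F.u₂γ x * wr F.u₁γα F.u₁γβ x
      = -(wr F.u₂γ F.u₁γα x * wr F.u₂γ F.u₁γβ x * wr F.u₀α F.u₀β x) := by
    unfold wr
    ring
  rw [m1, m2, div_add_div _ _ (mul_ne_zero hαw hvv) (mul_ne_zero hβw hvv),
    div_eq_one_iff_eq (mul_ne_zero (mul_ne_zero hαw hvv) (mul_ne_zero hβw hvv))]
  constructor
  · intro h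
    rw [h, mul_zero, neg_zero] at key
    linear_combination (wr F.u₁γα F.u₁γβ x) * key
  · intro h
    have h1 : wr F.u₁γα F.u₁γβ x * (wr F.u₂γ F.u₁γα x * wr F.u₂γ F.u₁γβ x * wr F.u₀α F.u₀β x) = 0 := by
      linear_combination wr F.u₁γα F.u₁γβ x * key - h
    exact (mul_eq_zero.1 ((mul_eq_zero.1 h1).resolve_left hvv)).resolve_left (mul_ne_zero hα hβ)

end WKBFamily

theorem TypeSign.mul_of_sameType {x y σ σ' : ℂ} (h : SameType A S lam₀ x y)
    (hx : TypeSign A S lam₀ x σ) (hy : TypeSign A S lam₀ y σ') : -(σ * σ') = -1 := by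
  rcases hx with ⟨rfl, h1, h2⟩ | ⟨rfl, h1, h2⟩ <;> rcases hy with ⟨rfl, h3, h4⟩ | ⟨rfl, h3, h4⟩ <;>
    rcases h with ⟨h5, h6⟩ | ⟨h5, h6⟩ <;> first | contradiction | norm_num

theorem TypeSign.mul_of_differentType {x y σ σ' : ℂ} (h : DifferentType A S lam₀ x y)
    (hx : TypeSign A S lam₀ x σ) (hy : TypeSign A S lam₀ y σ') : -(σ * σ') = 1 := by
  rcases hx with ⟨rfl, h1, h2⟩ | ⟨rfl, h1, h2⟩ <;> rcases hy with ⟨rfl, h3, h4⟩ | ⟨rfl, h3, h4⟩ <;>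
    rcases h with ⟨h5, h6⟩ | ⟨h5, h6⟩ <;> first | contradiction | norm_num

theorem exists_ne_zero_of_wr_ne_zero {u v : ℂ → Fin 2 → ℂ}
    (h : ∀ x : ℝ, wr u v x ≠ 0) : ∃ x : ℝ, u x ≠ 0 :=
  ⟨0, fun h0 => h 0 (by unfold wr; rw [h0]; simp)⟩

end DiracWKB
open DiracWKB

theorem mainTheorem2 (A S : ℂ → ℂ) (Om : Set ℂ) (hAS : DiracWKB.IsPotentialPair A S Om)
    (lam₀ : ℂ) (hlam₀ : lam₀.im ≠ 0) (P : DiracWKB.BifurcationData A S Om lam₀) :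
    ∃ U : Set ℂ, IsOpen U ∧ lam₀ ∈ U ∧ U ⊆ P.U₀ ∧ ∃ eps₀ : ℝ, 0 < eps₀ ∧ ∃ K : ℝ,
      ∀ lam ∈ U, ∀ eps ∈ Set.Ioo 0 eps₀,
        Nonempty (DiracWKB.WKBFamily P lam eps) ∧
        ∀ F : DiracWKB.WKBFamily P lam eps, ∀ x ∈ Om,
          F.denα x ≠ 0 ∧ F.denβ x ≠ 0 ∧
          (DiracWKB.IsEigenvalue A S eps lam ↔
            F.mα x * Complex.exp (2 * (P.Zγ lam - P.Zα lam) / eps) +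
              F.mβ x * Complex.exp (2 * (P.Zγ lam - P.Zβ lam) / eps) = 1) ∧
          (DiracWKB.SameType A S lam₀ (P.α lam₀) (P.γ lam₀) → ‖F.mα x - (-1)‖ ≤ K * eps) ∧
          (DiracWKB.DifferentType A S lam₀ (P.α lam₀) (P.γ lam₀) → ‖F.mα x - 1‖ ≤ K * eps) ∧
          (DiracWKB.SameType A S lam₀ (P.β lam₀) (P.γ lam₀) → ‖F.mβ x - (-1)‖ ≤ K * eps) ∧
          (DiracWKB.DifferentType A S lam₀ (P.β lam₀) (P.γ lam₀) → ‖F.mβ x - 1‖ ≤ K * eps) := by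
  obtain ⟨σα, hα⟩ := DiracWKB.exists_typeSign hAS (P.om_subset P.α_mem) (P.V₀_α _ P.mem_U₀) P.simple_α
  obtain ⟨σβ, hβ⟩ := DiracWKB.exists_typeSign hAS (P.om_subset P.β_mem) (P.V₀_β _ P.mem_U₀) P.simple_β
  obtain ⟨σγ, hγ⟩ := DiracWKB.exists_typeSign hAS (P.om_subset P.γ_mem) (P.V₀_γ _ P.mem_U₀) P.simple_γ
  obtain ⟨o, ho, b, b', K, h⟩ := P.exists_wkb_asymptotics hAS hlam₀ hα hβ hγ
  have hK : ∀ᶠ eps in 𝓝[>] (0 : ℝ), K * eps < 2 := by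
    refine nhdsWithin_le_nhds (Filter.Tendsto.eventually_lt_const (v := K * 0) (by simp) ?_)
    exact (continuous_const.mul continuous_id).tendsto 0
  have hev := h.and (((P.isOpen_U₀.eventually_mem P.mem_U₀).and
    ((P.eventually_mem_D_fst P.x₂_to_γ.mem).and ((P.eventually_mem_D_fst P.x₁α_to_γ.mem).and
      (P.eventually_mem_D_fst P.x₁β_to_γ.mem)))).prod_mk hK)
  rw [eventually_prod_iff] at hev
  obtain ⟨pa, ha, pb, hb, hev⟩ := hev
  obtain ⟨U, hU, hUo, hUm⟩ := _root_.eventually_nhds_iff.1 ha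
  obtain ⟨e, he, hbe⟩ := mem_nhdsGT_iff_exists_Ioo_subset.1 hb
  have hun : ∀ {lam}, lam ∈ U → ∀ {eps}, eps ∈ Ioo 0 e → _ := fun {lam} hl {eps} heps =>
    hev (hU lam hl) (hbe heps)
  refine ⟨U, hUo, hUm, fun lam hl => (hun hl ⟨half_pos he, half_lt_self he⟩).2.1.1, e, he, 5 * K,
    fun lam hl eps heps => ?_⟩
  obtain ⟨⟨hne, hF⟩, ⟨hlU, m₂, m₁α, m₁β⟩, hK⟩ := hun hl heps
  refine ⟨hne, fun F x hx => ?_⟩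
  obtain ⟨hα2, hβ2, hw⟩ := hF F
  have hn : ∀ {σ : ℂ}, σ = 1 ∨ σ = -1 → ‖(4 : ℂ) * (o * σ)‖ = 4 := fun {σ} hσ => by
    rcases hσ with rfl | rfl <;> rcases ho with rfl | rfl <;> simp
  have hn' : ∀ {σ : ℂ}, σ = 1 ∨ σ = -1 → ‖(-4 : ℂ) * (o * σ)‖ = 4 := fun {σ} hσ => by
    rw [neg_mul, norm_neg, hn hσ]
  have hI : ‖(4 : ℂ) * Complex.I‖ = 4 := by simp
  -- All Wronskians that occur in denominators are close to numbers of modulus `4`.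
  have hne0 : ∀ {w w' : ℂ}, ‖w - w'‖ ≤ K * eps → ‖w'‖ = 4 → w ≠ 0 := by
    rintro w w' h1 h2 rfl
    rw [zero_sub, norm_neg, h2] at h1
    simp only at hK
    linarith
  have hoo : (o : ℂ) ^ 2 = 1 := by rcases ho with rfl | rfl <;> simp
  have hr : ∀ {σ σ' : ℂ}, σ = 1 ∨ σ = -1 → σ' = 1 ∨ σ' = -1 →
      ‖-(σ * σ')‖ = 1 ∧ (σ * σ') ^ 2 = 1 := by
    rintro σ σ' (rfl | rfl) (rfl | rfl) <;> simp
  obtain ⟨w₁, w₂, w₃, w₄, w₅, w₆, w₇⟩ := hw x hx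
  have n₇ := hne0 w₇ (hn' hγ.eq)
  have hdα : F.denα x ≠ 0 := by
    rw [DiracWKB.WKBFamily.denα, DiracWKB.wr_swap F.u₂α]
    exact mul_ne_zero (neg_ne_zero.2 (hne0 w₅ (hn' hα.eq))) n₇
  have hdβ : F.denβ x ≠ 0 := by
    rw [DiracWKB.WKBFamily.denβ, DiracWKB.wr_swap F.u₂β]
    exact mul_ne_zero (neg_ne_zero.2 (hne0 w₆ (hn hβ.eq))) n₇
  have hmα : ‖F.mα x - -(σα * σγ)‖ ≤ 5 * K * eps := by
    have e : F.mα x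
        = wr F.u₀α F.u₁α x * wr F.u₂γ F.u₁γβ x / (wr F.u₀α F.u₂α x * wr F.u₁γα F.u₁γβ x) := by
      rw [WKBFamily.mα, WKBFamily.denα, wr_swap F.u₂α, wr_swap F.u₁γβ, mul_neg, neg_mul, neg_div_neg_eq]
    obtain ⟨r1, r2⟩ := hr hα.eq hγ.eq
    rw [e, mul_assoc]
    exact norm_ratio_sub_le hK.le w₁ w₄ w₅ w₇ hI hI (hn' hα.eq) (hn' hγ.eq) r1
      (by linear_combination 16 * Complex.I_sq + 16 * (σα * σγ) ^ 2 * hoo + 16 * r2)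
  have hmβ : ‖F.mβ x - -(σβ * σγ)‖ ≤ 5 * K * eps := by
    have e : F.mβ x
        = wr F.u₀β F.u₁β x * wr F.u₂γ F.u₁γα x / (wr F.u₀β F.u₂β x * -wr F.u₁γα F.u₁γβ x) := by
      rw [WKBFamily.mβ, WKBFamily.denβ, wr_swap F.u₂β, neg_mul, mul_neg]
    obtain ⟨r1, r2⟩ := hr hβ.eq hγ.eq
    rw [e, mul_assoc]
    refine norm_ratio_sub_le (d' := 4 * (o * σγ)) hK.le w₂ w₃ w₆ ?_ hI hI (hn hβ.eq) (hn hγ.eq) r1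
      (by linear_combination 16 * Complex.I_sq + 16 * (σβ * σγ) ^ 2 * hoo + 16 * r2)
    rwa [← norm_neg, show -(-wr F.u₁γα F.u₁γβ x - 4 * (o * σγ))
      = wr F.u₁γα F.u₁γβ x - -4 * (o * σγ) by ring]
  refine ⟨hdα, hdβ, ?_, fun h => ?_, fun h => ?_, fun h => ?_, fun h => ?_⟩
  · rw [← F.wr_eq_zero_iff hAS heps.1.ne' hlU m₁α m₁β m₂ hx hdα hdβ (hne0 w₃ hI) (hne0 w₄ hI)]
    exact isEigenvalue_iff hAS heps.1.ne' F.wkb_u₀α.1 F.wkb_u₀β.1 hα2 hβ2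
      (exists_ne_zero_of_wr_ne_zero fun y => hne0 (hw y (hAS.real_mem y)).1 hI)
      (exists_ne_zero_of_wr_ne_zero fun y => hne0 (hw y (hAS.real_mem y)).2.1 hI) hx
  · rwa [hα.mul_of_sameType h hγ] at hmα
  · rwa [hα.mul_of_differentType h hγ] at hmα
  · rwa [hβ.mul_of_sameType h hγ] at hmβ
  · rwa [hβ.mul_of_differentType h hγ] at hmβ
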